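/- Let $Q^+\subset\mathbb R^2$ be the convex hull of the points $P_n=(n,n^2)$, $n\in\mathbb Z$, and let $Q^-=-Q^+$. Let $S_1$ be the translation surface obtained from the disjoint union of $Q^+$ and $Q^-$ by identifying, for every $n\in\mathbb Z$, the edge $[P_n,P_{n+1}]$ of $Q^+$ with the edge $[-P_{n+1},-P_n]$ of $Q^-$ by the translation $z\mapsto z-P_n-P_{n+1}$, and let $\Sigma\subset S_1$ be the (two-point) set of images of the vertices. Write $\mathrm{Area}$ for the area on $S_1$ induced by Lebesgue measure on $Q^\pm$. An affine automorphism of $S_1$ is a homeomorphism $\hat H:S_1\to S_1$ with $\hat H(\Sigma)=\Sigma$ which, in the translation charts of $S_1\setminus\Sigma$, is locally of the form $z\mapsto Hz+b$ with a linear part $H\in GL(2,\mathbb R)$ that is the same everywhere; it is called hyperbolic if $H$ has real eigenvalues $\mu,\nu$ with $|\nu|<1<|\mu|$. A cylinder on $S_1$ is a subset of $S_1\setminus\Sigma$ that is the image of an open Euclidean cylinder of finite circumference and height (the quotient of an open strip of the plane by a translation along the strip) under an injective map that is locally a translation in the charts. Then for every hyperbolic affine automorphism $\hat H$ of $S_1$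 there is a constant $\kappa_H>0$, depending only on $\hat H$, such that for any two cylinders $\mathcal A$ and $\mathcal B$ on $S_1$, $$\lim_{m\to\infty} m^{3/2}\,\mathrm{Area}\big(\hat H^m(\mathcal A)\cap\mathcal B\big)=\kappa_H\,\mathrm{Area}(\mathcal A)\,\mathrm{Area}(\mathcal B).$$ -/

import Mathlib

open Filter Topology MeasureTheory

namespace ParabolaSurface

/-- The plane `ℝ²`; `volume` on it is Lebesgue measure. -/
abbrev Plane : Type := Fin 2 → ℝ

/-- The integer points `(n, n²)` of the parabola. -/
def P (n : ℤ) : Plane := ![(n : ℝ), (n : ℝ) ^ 2]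

/-- The upper polygonal parabola: the convex hull of the points `(n, n²)`. -/
def Qplus : Set Plane := convexHull ℝ (Set.range P)

/-- The lower polygonal parabola: the image of `Qplus` under the rotation by `π`. -/
def Qminus : Set Plane := {z | -z ∈ Qplus}

/-- The edge gluing. The edge `[P n, P (n+1)]` of `Qplus` is identified with its image
`[-P (n+1), -P n]` under the rotation by `π`, by the translation by `-P n - P (n+1)`. -/
def Glue : Qplus ⊕ Qminus → Qplus ⊕ Qminus → Prop
  | Sum.inl x, Sum.inr y =>
      ∃ n : ℤ, (x : Plane) ∈ segment ℝ (P n) (P (n + 1)) ∧ (y : Plane) = x - P n - P (n + 1)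
  | _, _ => False

/-- The surface `S₁`: the quotient of the disjoint union of the two polygons by the equivalence
relation generated by the edge gluing, with the quotient topology. -/
abbrev S1 : Type := Quot Glue

/-- The point of `S₁` represented by a point of `Qplus`. -/
def ptPlus (z : Plane) (h : z ∈ Qplus) : S1 := Quot.mk Glue (Sum.inl ⟨z, h⟩)

/-- The point of `S₁` represented by a point of `Qminus`. -/
def ptMinus (z : Plane) (h : z ∈ Qminus) : S1 := Quot.mk Glue (Sum.inr ⟨z, h⟩)

lemma P_mem (n : ℤ) : P n ∈ Qplus := subset_convexHull ℝ _ ⟨n, rfl⟩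

/-- The set `Σ` of cone singularities: the images of the vertices of the two polygons
(every vertex of `Qminus` is glued to one of `Qplus`). -/
def singular : Set S1 := Set.range fun n : ℤ => ptPlus (P n) (P_mem n)

/-- The domain of the `n`-th chart: the interior of `Qplus`, the open edge from `P n` to
`P (n+1)`, and the interior of the copy of `Qminus` that is attached to `Qplus` along this edge. -/
def chartDomain (n : ℤ) : Set Plane :=
  interior Qplus ∪ openSegment ℝ (P n) (P (n + 1)) ∪
    {z | z - P n - P (n + 1) ∈ interior Qminus}

open Classical in
/-- The `n`-th (inverse) chart, which lays out the two polygons in the plane, glued along their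
`n`-th edge. It is meant on `chartDomain n` only; the value elsewhere plays no role. The images of
the chart domains cover the complement of the singularities, and the changes of charts are
translations. -/
noncomputable def chart (n : ℤ) (z : Plane) : S1 :=
  if h : z ∈ Qplus then ptPlus z h
  else if h : z - P n - P (n + 1) ∈ Qminus then ptMinus (z - P n - P (n + 1)) h
  else ptPlus (P 0) (P_mem 0)

/-- The area of a subset of `S₁`: the sum of the Lebesgue measures of its parts in the two
polygons. -/
noncomputable def area (E : Set S1) : ENNReal :=
  volume {z : Plane | ∃ h : z ∈ Qplus, ptPlus z h ∈ E} +
    volume {z : Plane | ∃ h : z ∈ Qminus, ptMinus z h ∈ E}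

/-- `f` is an affine automorphism of `S₁` with derivative `A`: a homeomorphism which preserves the
set of singularities and which, in the charts of the translation structure, is locally of the form
`z ↦ A z + b`, with the same linear part `A` everywhere. -/
structure IsAffineAutomorphism (f : S1 ≃ₜ S1) (A : GL (Fin 2) ℝ) : Prop where
  singular_iff : ∀ x, f x ∈ singular ↔ x ∈ singular
  locally_affine : ∀ n : ℤ, ∀ z ∈ chartDomain n, ∃ m : ℤ, ∃ w ∈ chartDomain m,
    ∀ᶠ v in 𝓝 (0 : Plane),
      f (chart n (z + v)) = chart m (w + (A : Matrix (Fin 2) (Fin 2) ℝ).mulVec v)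

/-- A matrix is hyperbolic if it has real eigenvalues `μ`, `ν` with `|ν| < 1 < |μ|`. -/
def IsHyperbolic (A : GL (Fin 2) ℝ) : Prop :=
  ∃ μ ν : ℝ, |ν| < 1 ∧ 1 < |μ| ∧
    Module.End.HasEigenvalue (Matrix.toLin' (A : Matrix (Fin 2) (Fin 2) ℝ)) μ ∧
    Module.End.HasEigenvalue (Matrix.toLin' (A : Matrix (Fin 2) (Fin 2) ℝ)) ν

/-- The wedge product `(a,b) ∧ (c,d) = ad - bc`. -/
def wedge (v w : Plane) : ℝ := v 0 * w 1 - v 1 * w 0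

/-- The open strip in the direction `v`, of Euclidean width `h / |v|`. Its quotient by the
translation by `v` is the open Euclidean cylinder of circumference `|v|` and height `h / |v|`. -/
def strip (v : Plane) (h : ℝ) : Set Plane := {z | 0 < wedge v z ∧ wedge v z < h}

/-- A cylinder on `S₁`: a subset of the complement of the singularities which is the image of an
open Euclidean cylinder (the quotient of a strip by the translation by a vector `v ≠ 0` along it)
under an injective map that is locally a translation in the charts. -/
def IsCylinder (C : Set S1) : Prop :=
  ∃ (v : Plane) (h : ℝ) (F : Plane → S1), v ≠ 0 ∧ 0 < h ∧
    (∀ z ∈ strip v h, ∃ n : ℤ, ∃ w ∈ chartDomain n,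
      ∀ᶠ x in 𝓝 (0 : Plane), F (z + x) = chart n (w + x)) ∧
    (∀ z ∈ strip v h, ∀ z' ∈ strip v h, F z = F z' ↔ ∃ k : ℤ, z' = z + (k : ℝ) • v) ∧
    C = F '' strip v h

end ParabolaSurface

/-! ### The polygon `Qplus`, its supporting lines and the chart domains. -/

namespace ParabolaSurface

/-! A cylinder crosses only finitely many edges of `Qplus`. Recording the signed transverse measure
of its crossings with each edge gives a finitely supported function on `ℤ` of total mass zero
(`HasCyl.massF`, `HasCyl.sum_massF`); it plays the role of the homology class of the cylinder,
weighted by its width. By Stokes' formula, the area of the intersection of two cylinders, multiplied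
by the wedge of their holonomies, is a bilinear form in these functions with kernel `sign (n - j)`
(`HasCyl.wedge_mul_area_inter`).

Chebyshev polynomials diagonalise this form. The function sign on the integers is an integral over β
in [0, π/2] of U_{2n-1}(cos β) cos β, up to the factor 2/π (`integral_cheb_mul_cos`). For functions
of total mass zero this writes the form as an integral over k = cos β, with weight sin² β cos β, of
wedge products of vectors `specVec m k` in the plane (`interForm_eq_integral`). At k = 1 the
spectral vector of a cylinder is its area times its holonomy, in another basis
(`HasCyl.specVec_one`).

For each k the affine automorphisms act linearly on the spectral vectors of cylinders. The
reflections of the polygons permute the edges, so their action is read off from the Chebyshev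
recurrence. For the multitwist in the horizontal cylinders no formula on edges is needed: an
automorphism that preserves the direction of slope 0 or 1 preserves the areas of intersections with
the explicit cylinders of that direction, and these areas determine the pairings with symmetric
functions (`HasCyl.pair_image`). The same argument shows that an automorphism with derivative 1 acts
trivially (`acts_of_one`). A Euclidean algorithm on the holonomies of cylinders shows that three
reflections and -1 generate all derivatives (`HolPres.reduces`). Hence every automorphism acts by
the inverse of a word `M k` in these generators, a deformation of its derivative, which appears at k
= 1 (`Aff.exists_word`).

Let the automorphism be hyperbolic. The trace of `M k * M k` drops at least linearly as k decreases
from 1 to 0 (`Word.traceDrop`). Along the even times, and along the odd times, the wedge products of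
spectral vectors satisfy a second order recurrence with this trace as parameter, so after p steps
they behave like L r^p exp(-α p β²), where r is the large eigenvalue at k = 1. Laplace's method with
the weight sin² β ~ β² gives L K r^p p^{-3/2}, where K depends on the trace function only
(`exists_laplace_const`). The wedge of the holonomies, multiplied by both areas, is the same
sequence evaluated at k = 1, so it is asymptotic to L r^p. In the quotient L r^p cancels, and a
constant times the product of the areas remains. The coefficient L is nonzero because wedges of
holonomies are integers and no holonomy is an eigenvector of a hyperbolic derivative
(`HypData.leadCoeff_ne_zero`). -/

/-- The translation vector `P n + P (n + 1)` of the gluing along the `n`-th edge. -/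
def mid (n : ℤ) : Plane := P n + P (n + 1)

/-- The affine function which vanishes on the `n`-th edge and is nonnegative on `Qplus`. -/
def edgeFn (n : ℤ) (z : Plane) : ℝ := z 1 - (2 * n + 1) * z 0 + n ^ 2 + n

@[simp] lemma P_zero (n : ℤ) : P n 0 = n := rfl
@[simp] lemma P_one (n : ℤ) : P n 1 = (n : ℝ) ^ 2 := rfl
@[simp] lemma mid_zero (n : ℤ) : mid n 0 = 2 * n + 1 := by
  simp [mid]; ring
@[simp] lemma mid_one (n : ℤ) : mid n 1 = 2 * n ^ 2 + 2 * n + 1 := by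
  simp [mid]; ring

lemma sub_sub_mid (z : Plane) (n : ℤ) : z - P n - P (n + 1) = z - mid n := by
  rw [mid, sub_sub]

lemma plane_ext {z w : Plane} (h0 : z 0 = w 0) (h1 : z 1 = w 1) : z = w := by
  funext i; fin_cases i <;> assumption

lemma int_mul_pred_nonneg (k : ℤ) : (0 : ℝ) ≤ k * (k - 1) := by
  have h : 0 ≤ k * (k - 1) := by
    rcases le_or_gt k 0 with h | h
    · nlinarith
    · nlinarith
  exact_mod_cast h

lemma edgeFn_P (n k : ℤ) : edgeFn n (P k) = ((k - n : ℤ) : ℝ) * ((k - n : ℤ) - 1) := by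
  simp [edgeFn]; ring

lemma edgeFn_P_nonneg (n k : ℤ) : 0 ≤ edgeFn n (P k) := by
  rw [edgeFn_P]; exact int_mul_pred_nonneg _

lemma edgeFn_eq (n : ℤ) (z : Plane) :
    edgeFn n z = z 1 - z 0 ^ 2 + (z 0 - n) * (z 0 - n - 1) := by
  simp only [edgeFn]; ring

/-- For `k = n` this exchanges the two sides of an edge. For `n = b`, `k = a - 1` the constant
becomes the length of the cylinder `cyl a b`, measured by `edgeFn (a - 1)`. -/
lemma edgeFn_mid_sub (n k : ℤ) (z : Plane) :
    edgeFn k (mid n - z) = 2 * ((n - k : ℤ) : ℝ) ^ 2 - edgeFn k z := by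
  simp [edgeFn]; ring

lemma edgeFn_mid_sub_self (n : ℤ) (z : Plane) : edgeFn n (mid n - z) = - edgeFn n z := by
  rw [edgeFn_mid_sub]; simp

/-- Over the `n`-th unit interval, the `n`-th edge function is the smallest one. -/
lemma edgeFn_le_of_mem {n : ℤ} {z : Plane} (h0 : (n : ℝ) ≤ z 0) (h1 : z 0 ≤ n + 1) (k : ℤ) :
    edgeFn n z ≤ edgeFn k z := by
  have key : edgeFn k z - edgeFn n z = (((n - k : ℤ) : ℝ)) * (2 * (z 0 - n) + ((n - k : ℤ) : ℝ) - 1) := by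
    simp [edgeFn]; ring
  rcases lt_trichotomy (n - k) 0 with h | h | h
  · have h' : ((n - k : ℤ) : ℝ) ≤ -1 := by exact_mod_cast Int.le_sub_one_of_lt h
    nlinarith
  · rw [h] at key; simp at key; linarith
  · have h' : (1 : ℝ) ≤ ((n - k : ℤ) : ℝ) := by exact_mod_cast h
    nlinarith

lemma edgeFn_convex (n : ℤ) : Convex ℝ {z | 0 ≤ edgeFn n z} := by
  intro x hx y hy a b ha hb hab
  simp only [Set.mem_ofPred_eq, edgeFn] at *
  have : a * x 1 + b * y 1 - (2 * n + 1) * (a * x 0 + b * y 0) + n ^ 2 + n =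
      a * (x 1 - (2 * n + 1) * x 0 + n ^ 2 + n) + b * (y 1 - (2 * n + 1) * y 0 + n ^ 2 + n) := by
    have : b = 1 - a := by linarith
    subst this; ring
  simp only [Pi.add_apply, Pi.smul_apply, smul_eq_mul]
  rw [this]; positivity

lemma edgeFn_continuous (n : ℤ) : Continuous (edgeFn n) := by
  unfold edgeFn; fun_prop

lemma mem_segment_edge {n : ℤ} {z : Plane} :
    z ∈ segment ℝ (P n) (P (n + 1)) ↔ edgeFn n z = 0 ∧ (n : ℝ) ≤ z 0 ∧ z 0 ≤ n + 1 := by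
  rw [segment_eq_image]
  constructor
  · rintro ⟨t, ⟨ht0, ht1⟩, rfl⟩
    simp [edgeFn]
    refine ⟨by ring, by nlinarith, by nlinarith⟩
  · rintro ⟨h, h0, h1⟩
    refine ⟨z 0 - n, ⟨by linarith, by linarith⟩, ?_⟩
    apply plane_ext
    · simp; ring
    · simp [edgeFn] at h ⊢; linear_combination -h

lemma mem_openSegment_edge {n : ℤ} {z : Plane} :
    z ∈ openSegment ℝ (P n) (P (n + 1)) ↔ edgeFn n z = 0 ∧ (n : ℝ) < z 0 ∧ z 0 < n + 1 := by
  rw [openSegment_eq_image]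
  constructor
  · rintro ⟨t, ⟨ht0, ht1⟩, rfl⟩
    simp [edgeFn]
    refine ⟨by ring, by nlinarith, by nlinarith⟩
  · rintro ⟨h, h0, h1⟩
    refine ⟨z 0 - n, ⟨by linarith, by linarith⟩, ?_⟩
    apply plane_ext
    · simp; ring
    · simp [edgeFn] at h ⊢; linear_combination -h

/-- Vertical fibres of `Qplus` are convex, and the point lies between a point `p` of the edge below
it and a point `q` of a high chord. So a single edge inequality, the one over the right unit
interval, suffices. -/
lemma mem_Qplus_of_floor {n : ℤ} {z : Plane} (h0 : (n : ℝ) ≤ z 0) (h1 : z 0 ≤ n + 1)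
    (h : 0 ≤ edgeFn n z) : z ∈ Qplus := by
  have hconv : Convex ℝ Qplus := convex_convexHull ℝ _
  set p : Plane := ![z 0, (2 * n + 1) * z 0 - n ^ 2 - n] with hp
  have hp_mem : p ∈ Qplus := by
    apply hconv.segment_subset (P_mem n) (P_mem (n + 1))
    rw [mem_segment_edge]
    refine ⟨by simp [hp, edgeFn]; ring, h0, h1⟩
  obtain ⟨N, hN⟩ : ∃ N : ℕ, |z 0| + |z 1| + 1 ≤ N := exists_nat_ge _
  have hx := abs_le.1 (show |z 0| ≤ N by linarith [abs_nonneg (z 1)])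
  have hN1 : (1 : ℝ) ≤ N := by linarith [abs_nonneg (z 0), abs_nonneg (z 1)]
  -- The chord from `P (-N)` to `P N` is horizontal at height `N²`; the choice of `N` puts it above
  -- `z` and makes it long enough to pass over `z`.
  set q : Plane := ![z 0, (N : ℝ) ^ 2] with hq
  have hq_mem : q ∈ Qplus := by
    apply hconv.segment_subset (P_mem (-N)) (P_mem N)
    rw [segment_eq_image]
    refine ⟨(z 0 + N) / (2 * N), ⟨by apply div_nonneg <;> linarith, ?_⟩, ?_⟩
    · rw [div_le_one (by linarith)]; linarith
    · apply plane_ext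
      · simp [hq]; field_simp; ring
      · simp [hq]; ring
  have hfib : Convex ℝ {y : ℝ | (![z 0, y] : Plane) ∈ Qplus} := by
    intro y₁ h₁ y₂ h₂ a b ha hb hab
    have := hconv h₁ h₂ ha hb hab
    have e : (![z 0, a • y₁ + b • y₂] : Plane) = a • ![z 0, y₁] + b • ![z 0, y₂] := by
      apply plane_ext
      · simp; rw [← add_mul, hab, one_mul]
      · simp
    rw [← e] at this
    exact this
  have := hfib.ordConnected.out (show p 1 ∈ _ from hp_mem) (show q 1 ∈ _ from hq_mem)
    (show z 1 ∈ Set.Icc (p 1) (q 1) from ?_)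
  · have e : (![z 0, z 1] : Plane) = z := plane_ext rfl rfl
    rw [← e]
    exact this
  · simp only [hp, hq, edgeFn] at h ⊢
    refine ⟨by simp; linarith, ?_⟩
    have : z 1 ≤ N := by linarith [le_abs_self (z 1), abs_nonneg (z 0)]
    simp; nlinarith

lemma mem_Qplus {z : Plane} : z ∈ Qplus ↔ ∀ n, 0 ≤ edgeFn n z := by
  constructor
  · intro h n
    exact convexHull_min (t := {z | 0 ≤ edgeFn n z})
      (by rintro _ ⟨k, rfl⟩; exact edgeFn_P_nonneg n k) (edgeFn_convex n) h
  · intro h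
    exact mem_Qplus_of_floor (Int.floor_le (z 0)) (Int.lt_floor_add_one (z 0)).le (h _)

lemma Qplus_convex : Convex ℝ Qplus := convex_convexHull ℝ _

lemma isClosed_Qplus : IsClosed Qplus := by
  have : Qplus = ⋂ n, {z | 0 ≤ edgeFn n z} := by
    ext z; simp [mem_Qplus]
  rw [this]
  exact isClosed_iInter fun n => isClosed_le continuous_const (edgeFn_continuous n)

lemma mem_interior_Qplus {z : Plane} : z ∈ interior Qplus ↔ ∀ n, 0 < edgeFn n z := by
  constructor
  · intro h n
    -- A small downward move lowers every edge function by the same `ε`, which makes the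
    -- inequalities strict.
    have hz : ∀ᶠ ε in 𝓝 (0 : ℝ), z - ε • ![0, 1] ∈ Qplus := by
      have hc : ContinuousAt (fun ε : ℝ => z - ε • (![0, 1] : Plane)) 0 := by fun_prop
      have := hc.eventually_mem (s := Qplus)
      exact this (by simpa using mem_interior_iff_mem_nhds.1 h)
    obtain ⟨ε, hε, h0⟩ := ((hz.filter_mono nhdsWithin_le_nhds).and
      (self_mem_nhdsWithin (a := (0 : ℝ)) (s := Set.Ioi 0))).exists
    have := mem_Qplus.1 hε n
    simp only [edgeFn, Pi.sub_apply, Pi.smul_apply, smul_eq_mul] at this ⊢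
    simp at this h0
    linarith
  · intro h
    -- Near `z` the integer part of the first coordinate changes by at most one, so three edges are
    -- enough.
    have h1 : ∀ᶠ w in 𝓝 z, ∀ n ∈ Finset.Icc (⌊z 0⌋ - 1) (⌊z 0⌋ + 1), 0 < edgeFn n w := by
      rw [Filter.eventually_all_finset]
      intro n _
      exact ((edgeFn_continuous n).tendsto z).eventually_const_lt (h n)
    have h2 : ∀ᶠ w : Plane in 𝓝 z, |w 0 - z 0| < 1 := by
      have : Continuous fun w : Plane => |w 0 - z 0| := by fun_prop
      exact (this.tendsto z).eventually_lt_const (by simp)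
    rw [mem_interior_iff_mem_nhds]
    filter_upwards [h1, h2] with w hw1 hw2
    refine mem_Qplus_of_floor (Int.floor_le (w 0)) (Int.lt_floor_add_one (w 0)).le (hw1 _ ?_).le
    rw [abs_lt] at hw2
    have ha := Int.floor_le (w 0)
    have hb := Int.lt_floor_add_one (w 0)
    have hc := Int.floor_le (z 0)
    have hd := Int.lt_floor_add_one (z 0)
    rw [Finset.mem_Icc]
    constructor
    · have : (⌊z 0⌋ : ℝ) - 1 < ⌊w 0⌋ + 1 := by linarith
      have : ⌊z 0⌋ - 1 < ⌊w 0⌋ + 1 := by exact_mod_cast this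
      lia
    · have : (⌊w 0⌋ : ℝ) < ⌊z 0⌋ + 1 + 1 := by linarith
      have : ⌊w 0⌋ < ⌊z 0⌋ + 1 + 1 := by exact_mod_cast this
      lia

lemma mem_interior_Qplus_of_strip {n : ℤ} {z : Plane} (h0 : (n : ℝ) ≤ z 0) (h1 : z 0 ≤ n + 1) :
    z ∈ interior Qplus ↔ 0 < edgeFn n z := by
  rw [mem_interior_Qplus]
  exact ⟨fun h => h n, fun h k => h.trans_le (edgeFn_le_of_mem h0 h1 k)⟩

/-- Edges rise at most 1/4 above the parabola, since `(x - n) (x - n - 1) ≥ -1/4`. -/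
lemma mem_interior_Qplus_of_lt {z : Plane} (h : z 0 ^ 2 + 1 / 4 < z 1) : z ∈ interior Qplus := by
  rw [mem_interior_Qplus]
  intro n
  rw [edgeFn_eq]
  nlinarith [sq_nonneg (z 0 - n - 1 / 2)]

lemma sq_le_of_mem_Qplus {z : Plane} (h : z ∈ Qplus) : z 0 ^ 2 ≤ z 1 := by
  have := mem_Qplus.1 h ⌊z 0⌋
  rw [edgeFn_eq] at this
  nlinarith [Int.floor_le (z 0), Int.lt_floor_add_one (z 0)]

lemma mem_Qminus {z : Plane} : z ∈ Qminus ↔ -z ∈ Qplus := Iff.rfl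

lemma mem_interior_Qminus {z : Plane} : z ∈ interior Qminus ↔ -z ∈ interior Qplus := by
  have : Qminus = (Homeomorph.neg Plane) ⁻¹' Qplus := rfl
  rw [this, ← (Homeomorph.neg Plane).preimage_interior]; rfl

/-- The open edge may be replaced by the whole open vertical strip over it: a point of the strip
below the edge is carried into the interior of `Qplus` by the rotation about the midpoint. In this
form openness is evident. -/
lemma mem_chartDomain {n : ℤ} {z : Plane} : z ∈ chartDomain n ↔
    z ∈ interior Qplus ∨ ((n : ℝ) < z 0 ∧ z 0 < n + 1) ∨ mid n - z ∈ interior Qplus := by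
  simp only [chartDomain, Set.mem_union, Set.mem_ofPred_eq, sub_sub_mid, mem_interior_Qminus,
    neg_sub, mem_openSegment_edge]
  constructor
  · rintro ((h | h) | h)
    · exact Or.inl h
    · exact Or.inr (Or.inl h.2)
    · exact Or.inr (Or.inr h)
  · rintro (h | h | h)
    · exact Or.inl (Or.inl h)
    · rcases lt_trichotomy (edgeFn n z) 0 with h' | h' | h'
      · right
        rw [mem_interior_Qplus_of_strip (n := n) (by simp; linarith) (by simp; linarith),
          edgeFn_mid_sub_self]
        linarith
      · exact Or.inl (Or.inr ⟨h', h⟩)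
      · exact Or.inl (Or.inl ((mem_interior_Qplus_of_strip h.1.le h.2.le).2 h'))
    · exact Or.inr h

lemma isOpen_chartDomain (n : ℤ) : IsOpen (chartDomain n) := by
  have : chartDomain n = interior Qplus ∪ ({z | (n : ℝ) < z 0} ∩ {z | z 0 < n + 1}) ∪
      (fun z => mid n - z) ⁻¹' interior Qplus := by
    ext z; rw [mem_chartDomain]; simp [or_assoc]
  rw [this]
  refine (isOpen_interior.union (IsOpen.inter ?_ ?_)).union
    (isOpen_interior.preimage (by fun_prop))
  · exact isOpen_lt continuous_const (continuous_apply 0)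
  · exact isOpen_lt (continuous_apply 0) continuous_const

/-- A point of `Qplus` in the domain of the `n`-th chart is interior or lies on the open edge. -/
lemma mem_chartDomain_Qplus {n : ℤ} {z : Plane} (h : z ∈ chartDomain n) (hz : z ∈ Qplus) :
    z ∈ interior Qplus ∨ (edgeFn n z = 0 ∧ (n : ℝ) < z 0 ∧ z 0 < n + 1) := by
  rcases mem_chartDomain.1 h with h | h | h
  · exact Or.inl h
  · rcases (mem_Qplus.1 hz n).eq_or_lt' with h' | h'
    · exact Or.inr ⟨h', h⟩
    · exact Or.inl ((mem_interior_Qplus_of_strip h.1.le h.2.le).2 h')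
  · have h1 := mem_interior_Qplus.1 h n
    rw [edgeFn_mid_sub_self] at h1
    linarith [mem_Qplus.1 hz n]

lemma mem_chartDomain_not_Qplus {n : ℤ} {z : Plane} (h : z ∈ chartDomain n) (hz : z ∉ Qplus) :
    mid n - z ∈ interior Qplus := by
  rcases mem_chartDomain.1 h with h | h | h
  · exact absurd (interior_subset h) hz
  · have h' : edgeFn n z < 0 := by
      by_contra h'
      exact hz (mem_Qplus_of_floor h.1.le h.2.le (not_lt.1 h'))
    rw [mem_interior_Qplus_of_strip (n := n) (by simp; linarith) (by simp; linarith),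
      edgeFn_mid_sub_self]
    linarith
  · exact h

lemma mid_sub_mem_chartDomain {n : ℤ} {z : Plane} (h : z ∈ chartDomain n) :
    mid n - z ∈ chartDomain n := by
  rw [mem_chartDomain] at h ⊢
  rcases h with h | h | h
  · right; right; simpa using h
  · right; left; simp; constructor <;> linarith
  · exact Or.inl h

lemma P_notMem_chartDomain (n k : ℤ) : P k ∉ chartDomain n := by
  intro h
  rcases mem_chartDomain_Qplus h (P_mem k) with h | h
  · have := mem_interior_Qplus.1 h k
    rw [edgeFn_P] at this; simp at this
  · rw [P_zero] at h
    have h1 : n < k := by exact_mod_cast h.2.1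
    have h2 : k < n + 1 := by exact_mod_cast h.2.2
    lia

/-- Two open edges of `Qplus` that meet are equal. -/
lemma edge_unique {n m : ℤ} {z : Plane} (h0 : (n : ℝ) < z 0) (h1 : z 0 < n + 1)
    (h2 : (m : ℝ) < z 0) (h3 : z 0 < m + 1) : n = m := by
  have a : (n : ℝ) < m + 1 := by linarith
  have b : (m : ℝ) < n + 1 := by linarith
  have a' : n < m + 1 := by exact_mod_cast a
  have b' : m < n + 1 := by exact_mod_cast b
  lia

lemma volume_frontier_Qplus : volume (frontier Qplus) = 0 := Qplus_convex.addHaar_frontier _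

end ParabolaSurface

/-! ### Normal forms of points, changes of charts and unique continuation. -/

namespace ParabolaSurface

lemma ptPlus_eq_ptMinus {n : ℤ} {z : Plane} (h : z ∈ Qplus) (h' : z - mid n ∈ Qminus)
    (hs : z ∈ segment ℝ (P n) (P (n + 1))) : ptPlus z h = ptMinus (z - mid n) h' :=
  Quot.sound ⟨n, hs, (sub_sub_mid z n).symm⟩

open Classical in
/-- The preferred representative of a point of `Qplus ⊕ Qminus` up to gluing; `none` for vertices. -/
noncomputable def normalFormAux : Qplus ⊕ Qminus → Option (Plane ⊕ Plane)
  | Sum.inl z => if (z : Plane) ∈ Set.range P then none else some (Sum.inl z)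
  | Sum.inr w => if -(w : Plane) ∈ Set.range P then none
      else if edgeFn ⌊-(w : Plane) 0⌋ (-w) = 0 then some (Sum.inl (w + mid ⌊-(w : Plane) 0⌋))
      else some (Sum.inr w)

lemma mem_segment_cases {n : ℤ} {z : Plane} (h : z ∈ segment ℝ (P n) (P (n + 1))) :
    z = P n ∨ z = P (n + 1) ∨ (edgeFn n z = 0 ∧ (n : ℝ) < z 0 ∧ z 0 < n + 1) := by
  obtain ⟨h, h0, h1⟩ := mem_segment_edge.1 h
  rcases h0.eq_or_lt with h0 | h0
  · left
    simp only [edgeFn, ← h0] at h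
    exact plane_ext h0.symm (by simp; linarith)
  rcases h1.eq_or_lt with h1 | h1
  · right; left
    simp only [edgeFn, h1] at h
    exact plane_ext (by simp [h1]) (by simp; linarith)
  · exact Or.inr (Or.inr ⟨h, h0, h1⟩)

lemma notMem_range_P_of_strip {n : ℤ} {z : Plane} (h0 : (n : ℝ) < z 0) (h1 : z 0 < n + 1) :
    z ∉ Set.range P := by
  rintro ⟨k, rfl⟩
  rw [P_zero] at h0 h1
  have a : n < k := by exact_mod_cast h0
  have b : k < n + 1 := by exact_mod_cast h1
  lia

lemma notMem_range_P_of_interior {z : Plane} (h : z ∈ interior Qplus) : z ∉ Set.range P := by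
  rintro ⟨k, rfl⟩
  have := mem_interior_Qplus.1 h k
  rw [edgeFn_P] at this; simp at this

lemma floor_eq_of_strip {n : ℤ} {x : ℝ} (h0 : (n : ℝ) < x) (h1 : x < n + 1) : ⌊x⌋ = n :=
  Int.floor_eq_iff.2 ⟨h0.le, h1⟩

/-- The preferred representative of a nonsingular point of the surface. -/
noncomputable def normalForm : S1 → Option (Plane ⊕ Plane) :=
  Quot.lift normalFormAux (by
    rintro (⟨x, hx⟩ | x) (y | ⟨y, hy⟩) h
    · exact h.elim
    · obtain ⟨n, hs, rfl⟩ := h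
      simp only [sub_sub_mid] at *
      simp only [normalFormAux, neg_sub]
      rcases mem_segment_cases hs with h | h | ⟨h, h0, h1⟩
      · subst h
        rw [if_pos ⟨n, rfl⟩, if_pos ⟨n + 1, by simp [mid]⟩]
      · subst h
        rw [if_pos ⟨n + 1, rfl⟩, if_pos ⟨n, by simp [mid]⟩]
      · have hf : ⌊-(x - mid n) 0⌋ = n := floor_eq_of_strip (by simp; linarith) (by simp; linarith)
        rw [if_neg (notMem_range_P_of_strip h0 h1), hf, edgeFn_mid_sub_self, h,
          if_neg (notMem_range_P_of_strip (n := n) (by simp; linarith) (by simp; linarith))]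
        simp
    · exact h.elim
    · exact h.elim)

lemma normalForm_ptPlus {z : Plane} (h : z ∈ Qplus) (hz : z ∉ Set.range P) :
    normalForm (ptPlus z h) = some (Sum.inl z) := if_neg hz

lemma normalForm_ptPlus_P (k : ℤ) : normalForm (ptPlus (P k) (P_mem k)) = none := if_pos ⟨k, rfl⟩

lemma normalForm_ptMinus {z : Plane} (h : z ∈ Qminus) (hz : -z ∈ interior Qplus) :
    normalForm (ptMinus z h) = some (Sum.inr z) := by
  exact (if_neg (notMem_range_P_of_interior hz)).trans (if_neg (mem_interior_Qplus.1 hz _).ne')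

lemma normalForm_singular {x : S1} (h : x ∈ singular) : normalForm x = none := by
  obtain ⟨k, rfl⟩ := h
  exact normalForm_ptPlus_P k

lemma chart_of_mem {n : ℤ} {z : Plane} (h : z ∈ Qplus) : chart n z = ptPlus z h := dif_pos h

lemma chart_of_notMem {n : ℤ} {z : Plane} (h : z ∉ Qplus) (h' : z - mid n ∈ Qminus) :
    chart n z = ptMinus (z - mid n) h' := by
  unfold chart
  rw [dif_neg h]
  rw [dif_pos (by rwa [sub_sub_mid])]
  simp only [sub_sub_mid]

lemma notMem_range_P_of_mem_chartDomain {n : ℤ} {z : Plane} (h : z ∈ chartDomain n) :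
    z ∉ Set.range P := by
  rintro ⟨k, rfl⟩
  exact P_notMem_chartDomain n k h

lemma sub_mid_mem_Qminus {n : ℤ} {z : Plane} (h : mid n - z ∈ Qplus) : z - mid n ∈ Qminus := by
  rw [mem_Qminus, neg_sub]; exact h

lemma normalForm_chart_of_mem {n : ℤ} {z : Plane} (h : z ∈ chartDomain n) (hz : z ∈ Qplus) :
    normalForm (chart n z) = some (Sum.inl z) := by
  rw [chart_of_mem hz, normalForm_ptPlus hz (notMem_range_P_of_mem_chartDomain h)]

lemma normalForm_chart_of_notMem {n : ℤ} {z : Plane} (h : z ∈ chartDomain n) (hz : z ∉ Qplus) :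
    normalForm (chart n z) = some (Sum.inr (z - mid n)) := by
  have h' := mem_chartDomain_not_Qplus h hz
  rw [chart_of_notMem hz (sub_mid_mem_Qminus (interior_subset h')),
    normalForm_ptMinus _ (by rwa [neg_sub])]

lemma chart_notMem_singular {n : ℤ} {z : Plane} (h : z ∈ chartDomain n) :
    chart n z ∉ singular := by
  intro hs
  have h1 := normalForm_singular hs
  by_cases hz : z ∈ Qplus
  · simp [normalForm_chart_of_mem h hz] at h1
  · simp [normalForm_chart_of_notMem h hz] at h1

/-- The value of a chart in terms of `Qminus`. -/
lemma chart_eq_ptMinus {n : ℤ} {z : Plane} (h : z ∈ chartDomain n) (hz : mid n - z ∈ Qplus) :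
    chart n z = ptMinus (z - mid n) (sub_mid_mem_Qminus hz) := by
  by_cases hz' : z ∈ Qplus
  · rw [chart_of_mem hz']
    apply ptPlus_eq_ptMinus
    rcases mem_chartDomain_Qplus h hz' with h' | h'
    · have h1 := mem_interior_Qplus.1 h' n
      have h2 := mem_Qplus.1 hz n
      rw [edgeFn_mid_sub_self] at h2
      linarith
    · exact mem_segment_edge.2 ⟨h'.1, h'.2.1.le, h'.2.2.le⟩
  · exact chart_of_notMem hz' _

/-- The normal form is a complete invariant of a nonsingular point, so equality on the quotient
becomes equality of points of `Qplus` or of `Qminus`. All later comparisons of charts go through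
this criterion. -/
lemma chart_eq_iff {n m : ℤ} {z w : Plane} (hz : z ∈ chartDomain n) (hw : w ∈ chartDomain m) :
    chart n z = chart m w ↔
      (z = w ∧ z ∈ Qplus) ∨ (z - mid n = w - mid m ∧ mid n - z ∈ Qplus) := by
  constructor
  · intro h
    have h := congrArg normalForm h
    by_cases h1 : z ∈ Qplus <;> by_cases h2 : w ∈ Qplus
    · rw [normalForm_chart_of_mem hz h1, normalForm_chart_of_mem hw h2] at h
      simp at h
      exact Or.inl ⟨h, h1⟩
    · rw [normalForm_chart_of_mem hz h1, normalForm_chart_of_notMem hw h2] at h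
      simp at h
    · rw [normalForm_chart_of_notMem hz h1, normalForm_chart_of_mem hw h2] at h
      simp at h
    · rw [normalForm_chart_of_notMem hz h1, normalForm_chart_of_notMem hw h2] at h
      simp at h
      exact Or.inr ⟨h, interior_subset (mem_chartDomain_not_Qplus hz h1)⟩
  · rintro (⟨rfl, h⟩ | ⟨h, h'⟩)
    · rw [chart_of_mem h, chart_of_mem h]
    · have h2 : mid m - w ∈ Qplus := by
        rw [← neg_sub, ← h, neg_sub]; exact h'
      rw [chart_eq_ptMinus hz h', chart_eq_ptMinus hw h2]
      congr 1

lemma eventually_add_mem {s : Set Plane} (hs : IsOpen s) {z : Plane} (hz : z ∈ s) :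
    ∀ᶠ x in 𝓝 (0 : Plane), z + x ∈ s := by
  have hc : ContinuousAt (fun x : Plane => z + x) 0 := by fun_prop
  exact hc.eventually_mem (hs.mem_nhds (by simpa using hz))

/-- Changes of charts are translations. -/
lemma chart_transition {n m : ℤ} {z w : Plane} (hz : z ∈ chartDomain n) (hw : w ∈ chartDomain m)
    (h : chart n z = chart m w) :
    ∀ᶠ x in 𝓝 (0 : Plane), chart n (z + x) = chart m (w + x) := by
  have e1 := eventually_add_mem (isOpen_chartDomain n) hz
  have e2 := eventually_add_mem (isOpen_chartDomain m) hw
  rcases (chart_eq_iff hz hw).1 h with ⟨rfl, hq⟩ | ⟨he, hq⟩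
  · rcases mem_chartDomain_Qplus hz hq with h1 | h1
    · filter_upwards [e1, e2, eventually_add_mem isOpen_interior h1] with x hx1 hx2 hx3
      exact (chart_eq_iff hx1 hx2).2 (Or.inl ⟨rfl, interior_subset hx3⟩)
    · rcases mem_chartDomain_Qplus hw hq with h2 | h2
      · have := mem_interior_Qplus.1 h2 n
        linarith [h1.1]
      -- A boundary point lies on only one open edge, so the two charts have the same index.
      · rw [edge_unique h1.2.1 h1.2.2 h2.2.1 h2.2.2]
        exact Eventually.of_forall fun _ => rfl
  · have he' : mid n - z = mid m - w := by rw [← neg_sub, he, neg_sub]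
    rcases mem_chartDomain_Qplus (mid_sub_mem_chartDomain hz) hq with h1 | h1
    · filter_upwards [e1, e2, eventually_add_mem (isOpen_interior.preimage
        (continuous_const.sub continuous_id : Continuous fun z => mid n - z)) h1]
        with x hx1 hx2 hx3
      refine (chart_eq_iff hx1 hx2).2 (Or.inr ⟨?_, interior_subset hx3⟩)
      rw [add_sub_right_comm, he, add_sub_right_comm]
    · have hq2 := hq
      rw [he'] at hq2
      rcases mem_chartDomain_Qplus (mid_sub_mem_chartDomain hw) hq2 with h2 | h2
      · have := mem_interior_Qplus.1 h2 n
        rw [← he'] at this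
        linarith [h1.1]
      · rw [← he'] at h2
        have := edge_unique h1.2.1 h1.2.2 h2.2.1 h2.2.2
        subst this
        have : z = w := by simpa using he
        subst this
        exact Eventually.of_forall fun _ => rfl

lemma exists_chart_of_mem_Qplus {z : Plane} (h : z ∈ Qplus) :
    z ∈ Set.range P ∨ ∃ n, z ∈ chartDomain n := by
  have h0 := Int.floor_le (z 0)
  have h1 := Int.lt_floor_add_one (z 0)
  rcases h0.eq_or_lt with h0' | h0'
  · rcases (mem_Qplus.1 h ⌊z 0⌋).eq_or_lt' with h' | h'
    · left
      refine ⟨⌊z 0⌋, plane_ext h0' ?_⟩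
      simp only [edgeFn] at h'
      rw [← h0'] at h'
      simp at h' ⊢
      linarith
    · exact Or.inr ⟨0, mem_chartDomain.2 (Or.inl ((mem_interior_Qplus_of_strip h0 h1.le).2 h'))⟩
  · exact Or.inr ⟨⌊z 0⌋, mem_chartDomain.2 (Or.inr (Or.inl ⟨h0', h1⟩))⟩

/-- Every nonsingular point lies in the image of a chart. -/
lemma exists_chart {x : S1} (hx : x ∉ singular) : ∃ n, ∃ z ∈ chartDomain n, x = chart n z := by
  induction x using Quot.ind with
  | mk s =>
  rcases s with ⟨z, hz⟩ | ⟨z, hz⟩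
  · rcases exists_chart_of_mem_Qplus hz with ⟨k, rfl⟩ | ⟨n, hn⟩
    · exact absurd ⟨k, rfl⟩ hx
    · exact ⟨n, z, hn, (chart_of_mem hz).symm⟩
  · rcases exists_chart_of_mem_Qplus (mem_Qminus.1 hz) with ⟨k, hk⟩ | ⟨n, hn⟩
    -- Across the edge `k` the vertex `-P k` of `Qminus` is glued to `P (k + 1)`.
    · refine absurd ⟨k + 1, ?_⟩ hx
      have e : P (k + 1) - mid k = z := by
        have : z = - P k := by rw [hk, neg_neg]
        rw [this, mid]; abel
      have h' : P (k + 1) - mid k ∈ Qminus := by rw [e]; exact hz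
      change ptPlus _ _ = ptMinus z hz
      rw [ptPlus_eq_ptMinus (P_mem _) h' (right_mem_segment _ _ _)]
      congr 1
    · refine ⟨n, mid n - -z, mid_sub_mem_chartDomain hn, ?_⟩
      rw [chart_eq_ptMinus (mid_sub_mem_chartDomain hn) (by simpa [mem_Qminus] using hz)]
      change ptMinus z hz = _
      congr 1
      abel

/-- `F` is a translation in the charts, near `z`. -/
def LocTransAt (F : Plane → S1) (z : Plane) : Prop :=
  ∃ n : ℤ, ∃ w ∈ chartDomain n, ∀ᶠ x in 𝓝 (0 : Plane), F (z + x) = chart n (w + x)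

lemma locTransAt_chart {n : ℤ} {z : Plane} (h : z ∈ chartDomain n) : LocTransAt (chart n) z :=
  ⟨n, z, h, Eventually.of_forall fun _ => rfl⟩

lemma LocTransAt.eventually_eq {F G : Plane → S1} {z w : Plane} (hF : LocTransAt F z)
    (hG : LocTransAt G w) (h : F z = G w) : ∀ᶠ x in 𝓝 (0 : Plane), F (z + x) = G (w + x) := by
  obtain ⟨n, a, ha, hFa⟩ := hF
  obtain ⟨m, b, hb, hGb⟩ := hG
  have h1 : F z = chart n a := by simpa using hFa.self_of_nhds
  have h2 : G w = chart m b := by simpa using hGb.self_of_nhds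
  filter_upwards [hFa, hGb, chart_transition ha hb (by rw [← h1, ← h2, h])] with x h1 h2 h3
  rw [h1, h2, h3]

lemma LocTransAt.notMem_singular {F : Plane → S1} {z : Plane} (hF : LocTransAt F z) :
    F z ∉ singular := by
  obtain ⟨n, a, ha, hFa⟩ := hF
  have h1 : F z = chart n a := by simpa using hFa.self_of_nhds
  rw [h1]
  exact chart_notMem_singular ha

/-- Separation of distinct points under a common translation. It provides the closed half of the
open-closed argument in `eq_of_locTransAt`; the open half is `LocTransAt.eventually_eq`. -/
lemma LocTransAt.eventually_ne {F G : Plane → S1} {z w : Plane} (hF : LocTransAt F z)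
    (hG : LocTransAt G w) (h : F z ≠ G w) : ∀ᶠ x in 𝓝 (0 : Plane), F (z + x) ≠ G (w + x) := by
  obtain ⟨n, a, ha, hFa⟩ := hF
  obtain ⟨m, b, hb, hGb⟩ := hG
  have h1 : F z = chart n a := by simpa using hFa.self_of_nhds
  have h2 : G w = chart m b := by simpa using hGb.self_of_nhds
  rw [h1, h2, Ne, chart_eq_iff ha hb, not_or, not_and, not_and] at h
  have e1 : ∀ᶠ x in 𝓝 (0 : Plane), ¬ (a + x = b + x ∧ a + x ∈ Qplus) := by
    by_cases hab : a = b
    · filter_upwards [eventually_add_mem isClosed_Qplus.isOpen_compl (h.1 hab)] with x hx hx'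
      exact hx hx'.2
    · exact Eventually.of_forall fun x hx => hab (by simpa using hx.1)
  have e2 : ∀ᶠ x in 𝓝 (0 : Plane),
      ¬ (a + x - mid n = b + x - mid m ∧ mid n - (a + x) ∈ Qplus) := by
    by_cases hab : a - mid n = b - mid m
    · filter_upwards [eventually_add_mem (isClosed_Qplus.isOpen_compl.preimage
        (continuous_const.sub continuous_id : Continuous fun z => mid n - z)) (h.2 hab)]
        with x hx hx'
      exact hx hx'.2
    · refine Eventually.of_forall fun x hx => hab ?_
      have := hx.1
      rw [add_sub_right_comm, add_sub_right_comm] at this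
      exact add_right_cancel this
  filter_upwards [hFa, hGb, e1, e2, eventually_add_mem (isOpen_chartDomain n) ha,
    eventually_add_mem (isOpen_chartDomain m) hb] with x h1 h2 h3 h4 h5 h6
  rw [h1, h2, Ne, chart_eq_iff h5 h6]
  exact not_or.2 ⟨h3, h4⟩

lemma eventually_line {p : Plane → Prop} (h : ∀ᶠ x in 𝓝 (0 : Plane), p x) (v : Plane) (t : ℝ) :
    ∀ᶠ s in 𝓝 t, p ((s - t) • v) := by
  have : Tendsto (fun s : ℝ => (s - t) • v) (𝓝 t) (𝓝 0) := by
    have : Continuous fun s : ℝ => (s - t) • v := by fun_prop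
    simpa using this.tendsto t
  exact this.eventually h

/-- Unique continuation along lines. -/
lemma eq_of_locTransAt {F G : Plane → S1} {z w v : Plane} {I : Set ℝ} (hI : IsPreconnected I)
    (hF : ∀ t ∈ I, LocTransAt F (z + t • v)) (hG : ∀ t ∈ I, LocTransAt G (w + t • v))
    {t₀ t : ℝ} (ht₀ : t₀ ∈ I) (ht : t ∈ I) (h : F (z + t₀ • v) = G (w + t₀ • v)) :
    F (z + t • v) = G (w + t • v) := by
  classical
  -- Agreement and disagreement are both open conditions on the parameter, so this Boolean is
  -- constant on a connected set.
  set f : ℝ → Bool := fun t => decide (F (z + t • v) = G (w + t • v)) with hf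
  have hc : ContinuousOn f I := by
    intro s hs
    apply ContinuousAt.continuousWithinAt
    apply ContinuousAt.congr (f := fun _ => f s) continuousAt_const
    have e : ∀ (y : Plane) (r : ℝ), y + s • v + (r - s) • v = y + r • v := by
      intro y r; rw [add_assoc, ← add_smul]; simp
    by_cases h : F (z + s • v) = G (w + s • v)
    · filter_upwards [eventually_line ((hF s hs).eventually_eq (hG s hs) h) v s] with r hr
      rw [e, e] at hr
      simp [hf, h, hr]
    · filter_upwards [eventually_line ((hF s hs).eventually_ne (hG s hs) h) v s] with r hr
      rw [e, e] at hr
      simp [hf, h, hr]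
  have := hI.constant hc ht₀ ht
  simp [hf, h] at this
  exact this

end ParabolaSurface

/-! ### Affine maps, the symmetries of the two polygons, and area. -/

namespace ParabolaSurface

/-- `g` permutes the surface and the singularities, and is locally affine with linear part `B` in
the charts. Continuity at the singularities plays no role. -/
structure Aff (g : Equiv.Perm S1) (B : Matrix (Fin 2) (Fin 2) ℝ) : Prop where
  det_ne : B.det ≠ 0
  singular_iff : ∀ x, g x ∈ singular ↔ x ∈ singular
  locally_affine : ∀ n : ℤ, ∀ z ∈ chartDomain n, ∃ m : ℤ, ∃ w ∈ chartDomain m,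
    ∀ᶠ x in 𝓝 (0 : Plane), g (chart n (z + x)) = chart m (w + B.mulVec x)

lemma tendsto_mulVec_zero (B : Matrix (Fin 2) (Fin 2) ℝ) :
    Tendsto (fun x : Plane => B.mulVec x) (𝓝 0) (𝓝 0) := by
  have : Continuous fun x : Plane => B.mulVec x := continuous_const.matrix_mulVec continuous_id
  simpa using this.tendsto 0

lemma Aff.apply_locTransAt {g : Equiv.Perm S1} {B : Matrix (Fin 2) (Fin 2) ℝ} (hg : Aff g B)
    {F : Plane → S1} {z : Plane} (hF : LocTransAt F z) : ∃ m : ℤ, ∃ w ∈ chartDomain m,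
      ∀ᶠ x in 𝓝 (0 : Plane), g (F (z + x)) = chart m (w + B.mulVec x) := by
  obtain ⟨n, a, ha, hFa⟩ := hF
  obtain ⟨m, w, hw, h⟩ := hg.locally_affine n a ha
  refine ⟨m, w, hw, ?_⟩
  filter_upwards [hFa, h] with x h1 h2
  rw [h1, h2]

lemma Aff.comp {g g' : Equiv.Perm S1} {B B' : Matrix (Fin 2) (Fin 2) ℝ} (hg : Aff g B)
    (hg' : Aff g' B') : Aff (g * g') (B * B') where
  det_ne := by rw [Matrix.det_mul]; exact mul_ne_zero hg.det_ne hg'.det_ne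
  singular_iff x := by rw [Equiv.Perm.mul_apply, hg.singular_iff, hg'.singular_iff]
  locally_affine n z hz := by
    obtain ⟨m, w, hw, h⟩ := hg'.locally_affine n z hz
    obtain ⟨k, u, hu, h'⟩ := hg.locally_affine m w hw
    refine ⟨k, u, hu, ?_⟩
    filter_upwards [h, (tendsto_mulVec_zero B').eventually h'] with x h1 h2
    rw [Equiv.Perm.mul_apply, h1, h2, Matrix.mulVec_mulVec]

lemma perm_apply_inv_self (g : Equiv.Perm S1) (x : S1) : g (g⁻¹ x) = x := g.apply_symm_apply x

lemma Aff.inv {g : Equiv.Perm S1} {B : Matrix (Fin 2) (Fin 2) ℝ} (hg : Aff g B) :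
    Aff g⁻¹ B⁻¹ where
  det_ne := by
    rw [Matrix.det_nonsing_inv]
    exact (hg.det_ne.isUnit.ringInverse).ne_zero
  singular_iff x := by
    rw [← hg.singular_iff, perm_apply_inv_self]
  locally_affine n z hz := by
    have hs : g⁻¹ (chart n z) ∉ singular := by
      rw [← hg.singular_iff, perm_apply_inv_self]
      exact chart_notMem_singular hz
    obtain ⟨m, w, hw, h⟩ := exists_chart hs
    obtain ⟨k, u, hu, hu'⟩ := hg.locally_affine m w hw
    refine ⟨m, w, hw, ?_⟩
    have h0 : chart n z = chart k u := by
      have := hu'.self_of_nhds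
      simp only [add_zero, Matrix.mulVec_zero] at this
      rw [← this, ← h, perm_apply_inv_self]
    filter_upwards [chart_transition hz hu h0, (tendsto_mulVec_zero B⁻¹).eventually hu']
      with x h1 h2
    rw [h1, Equiv.Perm.inv_eq_iff_eq, h2, Matrix.mulVec_mulVec, Matrix.mul_nonsing_inv _
      hg.det_ne.isUnit, Matrix.one_mulVec]

lemma aff_of_isAffineAutomorphism {H : S1 ≃ₜ S1} {A : GL (Fin 2) ℝ}
    (h : IsAffineAutomorphism H A) : Aff H.toEquiv A :=
  ⟨(A.isUnit.map Matrix.detMonoidHom).ne_zero, h.singular_iff, h.locally_affine⟩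

/-! ### The rotation by `π` -/

/-- The rotation by `π`, which exchanges the two polygons, as a map. -/
def rotFun : S1 → S1 :=
  Quot.lift (fun s => match s with
    | Sum.inl z => ptMinus (-z) (by rw [mem_Qminus, neg_neg]; exact z.2)
    | Sum.inr z => ptPlus (-z) z.2) (by
    rintro (⟨x, hx⟩ | x) (y | ⟨y, hy⟩) h
    · exact h.elim
    · obtain ⟨n, hs, rfl⟩ := h
      have e : -(x - P n - P (n + 1)) = mid n - x := by rw [sub_sub_mid, neg_sub]
      symm
      apply Quot.sound
      refine ⟨n, ?_, ?_⟩
      · simp only [e]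
        rw [mem_segment_edge] at hs ⊢
        rw [edgeFn_mid_sub_self, hs.1]
        refine ⟨by simp, ?_, ?_⟩ <;> simp <;> linarith [hs.2.1, hs.2.2]
      · simp only [sub_sub_mid]
        abel
    · exact h.elim
    · exact h.elim)

lemma rotFun_involutive : Function.Involutive rotFun := by
  intro x
  induction x using Quot.ind with
  | mk s =>
  rcases s with ⟨z, hz⟩ | ⟨z, hz⟩
  · change ptPlus (- -z) _ = ptPlus z _
    congr 1; exact neg_neg z
  · change ptMinus (- -z) _ = ptMinus z _
    congr 1; exact neg_neg z

/-- The rotation by `π`, which exchanges the two polygons. -/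
def rot : Equiv.Perm S1 := rotFun_involutive.toPerm

lemma rot_rot (x : S1) : rot (rot x) = x := rotFun_involutive x

lemma rot_chart {n : ℤ} {z : Plane} (h : z ∈ chartDomain n) :
    rot (chart n z) = chart n (mid n - z) := by
  by_cases hz : z ∈ Qplus
  · rw [chart_of_mem hz, chart_eq_ptMinus (mid_sub_mem_chartDomain h) (by simpa using hz)]
    change ptMinus (-z) _ = _
    congr 1; abel
  · have h' := interior_subset (mem_chartDomain_not_Qplus h hz)
    rw [chart_eq_ptMinus h h', chart_of_mem h']
    change ptPlus (-(z - mid n)) _ = _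
    congr 1; abel

lemma singular_iff_of_involutive {g : Equiv.Perm S1} (hg : ∀ x, g (g x) = x)
    (h : ∀ n, ∀ z ∈ chartDomain n, g (chart n z) ∉ singular) (x : S1) :
    g x ∈ singular ↔ x ∈ singular := by
  have key : ∀ x, x ∉ singular → g x ∉ singular := by
    intro x hx
    obtain ⟨n, z, hz, rfl⟩ := exists_chart hx
    exact h n z hz
  refine ⟨fun h => by_contra fun h' => key x h' h, fun h => by_contra fun h' => key _ h' ?_⟩
  rwa [hg]

lemma aff_rot : Aff rot (-1) where
  det_ne := by simp [Matrix.det_neg]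
  singular_iff := singular_iff_of_involutive rot_rot fun n z hz => by
    rw [rot_chart hz]; exact chart_notMem_singular (mid_sub_mem_chartDomain hz)
  locally_affine n z hz := by
    refine ⟨n, mid n - z, mid_sub_mem_chartDomain hz, ?_⟩
    filter_upwards [eventually_add_mem (isOpen_chartDomain n) hz] with x hx
    rw [rot_chart hx, Matrix.neg_mulVec, Matrix.one_mulVec]
    congr 1; abel

/-! ### The reflections of the polygons -/

/-- The affine reflection of `Qplus` with `P n ↦ P (c - n)`. -/
def reflMap (c : ℤ) (z : Plane) : Plane := ![c - z 0, z 1 - 2 * c * z 0 + c ^ 2]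

/-- The linear part of `reflMap c`. -/
def reflMat (c : ℤ) : Matrix (Fin 2) (Fin 2) ℝ := !![-1, 0; -2 * c, 1]

@[simp] lemma reflMap_zero (c : ℤ) (z : Plane) : reflMap c z 0 = c - z 0 := rfl
@[simp] lemma reflMap_one (c : ℤ) (z : Plane) :
    reflMap c z 1 = z 1 - 2 * c * z 0 + c ^ 2 := rfl

lemma edgeFn_reflMap (c n : ℤ) (z : Plane) : edgeFn n (reflMap c z) = edgeFn (c - 1 - n) z := by
  simp [edgeFn]; ring

lemma edgeFn_reflMap' (c n : ℤ) (z : Plane) : edgeFn (c - 1 - n) (reflMap c z) = edgeFn n z := by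
  rw [edgeFn_reflMap]; congr 1; ring

lemma reflMap_reflMap (c : ℤ) (z : Plane) : reflMap c (reflMap c z) = z := by
  apply plane_ext <;> simp; ring

lemma reflMap_mem {c : ℤ} {z : Plane} : reflMap c z ∈ Qplus ↔ z ∈ Qplus := by
  rw [mem_Qplus, mem_Qplus]
  exact ⟨fun h n => by rw [← edgeFn_reflMap' c]; exact h _,
    fun h n => by rw [edgeFn_reflMap]; exact h _⟩

lemma reflMap_mem_interior {c : ℤ} {z : Plane} :
    reflMap c z ∈ interior Qplus ↔ z ∈ interior Qplus := by
  rw [mem_interior_Qplus, mem_interior_Qplus]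
  exact ⟨fun h n => by rw [← edgeFn_reflMap' c]; exact h _,
    fun h n => by rw [edgeFn_reflMap]; exact h _⟩

lemma reflMap_mid_sub (c n : ℤ) (z : Plane) :
    reflMap c (mid n - z) = mid (c - 1 - n) - reflMap c z := by
  apply plane_ext <;> simp <;> ring

lemma reflMap_P (c n : ℤ) : reflMap c (P n) = P (c - n) := by
  apply plane_ext <;> simp; ring

lemma reflMap_mem_chartDomain {c n : ℤ} {z : Plane} (h : z ∈ chartDomain n) :
    reflMap c z ∈ chartDomain (c - 1 - n) := by
  rw [mem_chartDomain] at h ⊢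
  rcases h with h | h | h
  · exact Or.inl (reflMap_mem_interior.2 h)
  · right; left; simp; constructor <;> linarith
  · right; right
    rw [← reflMap_mid_sub]
    exact reflMap_mem_interior.2 h

/-- The symmetry of the surface induced by `reflMap c`, as a map. -/
def reflFun (c : ℤ) : S1 → S1 :=
  Quot.map (fun s => match s with
    | Sum.inl z => Sum.inl ⟨reflMap c z, reflMap_mem.2 z.2⟩
    | Sum.inr z => Sum.inr ⟨-reflMap c (-z), by rw [mem_Qminus, neg_neg, reflMap_mem]; exact z.2⟩)
    (by
    rintro (⟨x, hx⟩ | x) (y | ⟨y, hy⟩) h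
    · exact h.elim
    · obtain ⟨n, hs, rfl⟩ := h
      refine ⟨c - 1 - n, ?_, ?_⟩
      · simp only [mem_segment_edge] at hs ⊢
        rw [edgeFn_reflMap', hs.1]
        refine ⟨rfl, ?_, ?_⟩ <;> simp <;> linarith [hs.2.1, hs.2.2]
      · simp only [sub_sub_mid, neg_sub, reflMap_mid_sub]
    · exact h.elim
    · exact h.elim)

lemma reflFun_involutive (c : ℤ) : Function.Involutive (reflFun c) := by
  intro x
  induction x using Quot.ind with
  | mk s =>
  rcases s with ⟨z, hz⟩ | ⟨z, hz⟩
  · change ptPlus (reflMap c (reflMap c z)) _ = ptPlus z _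
    congr 1; exact reflMap_reflMap c z
  · change ptMinus (-reflMap c (- -reflMap c (-z))) _ = ptMinus z _
    congr 1; rw [neg_neg, reflMap_reflMap, neg_neg]

/-- The symmetry of the surface induced by `reflMap c`. -/
def refl (c : ℤ) : Equiv.Perm S1 := (reflFun_involutive c).toPerm

lemma refl_refl (c : ℤ) (x : S1) : refl c (refl c x) = x := reflFun_involutive c x

lemma refl_chart {c n : ℤ} {z : Plane} (h : z ∈ chartDomain n) :
    refl c (chart n z) = chart (c - 1 - n) (reflMap c z) := by
  by_cases hz : z ∈ Qplus
  · rw [chart_of_mem hz, chart_of_mem (reflMap_mem.2 hz)]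
    rfl
  · have h' := interior_subset (mem_chartDomain_not_Qplus h hz)
    rw [chart_eq_ptMinus h h', chart_eq_ptMinus (reflMap_mem_chartDomain h)
      (by rw [← reflMap_mid_sub]; exact reflMap_mem.2 h')]
    change ptMinus (-reflMap c (-(z - mid n))) _ = _
    congr 1
    rw [neg_sub, reflMap_mid_sub, neg_sub]

lemma reflMap_add (c : ℤ) (z x : Plane) :
    reflMap c (z + x) = reflMap c z + (reflMat c).mulVec x := by
  apply plane_ext <;> simp [reflMat, dotProduct, Fin.sum_univ_two] <;> ring

lemma aff_refl (c : ℤ) : Aff (refl c) (reflMat c) where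
  det_ne := by simp [reflMat]
  singular_iff := singular_iff_of_involutive (refl_refl c) fun n z hz => by
    rw [refl_chart hz]; exact chart_notMem_singular (reflMap_mem_chartDomain hz)
  locally_affine n z hz := by
    refine ⟨c - 1 - n, reflMap c z, reflMap_mem_chartDomain hz, ?_⟩
    filter_upwards [eventually_add_mem (isOpen_chartDomain n) hz] with x hx
    rw [refl_chart hx, reflMap_add]

/-! ### Area -/

/-- The part of a subset of the surface in the interior of `Qplus`. -/
def plusPart (E : Set S1) : Set Plane := {z | z ∈ interior Qplus ∧ chart 0 z ∈ E}

lemma mem_chartDomain_of_interior {z : Plane} (h : z ∈ interior Qplus) (n : ℤ) :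
    z ∈ chartDomain n := mem_chartDomain.2 (Or.inl h)

lemma chart_eq_chart_zero {z : Plane} (h : z ∈ interior Qplus) (n : ℤ) :
    chart n z = chart 0 z := by
  rw [chart_of_mem (interior_subset h), chart_of_mem (interior_subset h)]

lemma mem_rot_image {E : Set S1} {x : S1} : x ∈ rot '' E ↔ rot x ∈ E := by
  constructor
  · rintro ⟨y, hy, rfl⟩; rwa [rot_rot]
  · intro h; exact ⟨_, h, rot_rot x⟩

lemma rot_chart_zero {z : Plane} (h : z ∈ interior Qplus) :
    rot (chart 0 z) = ptMinus (-z) (by rw [mem_Qminus, neg_neg]; exact interior_subset h) := by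
  rw [chart_of_mem (interior_subset h)]
  rfl

/-- The boundary of a convex set is null, and `rot` carries the part in `Qminus` into `Qplus`. From
here on all measures are computed in the interior of `Qplus`. -/
lemma area_eq (E : Set S1) : area E = volume (plusPart E) + volume (plusPart (rot '' E)) := by
  have h1 : volume {z : Plane | ∃ h : z ∈ Qplus, ptPlus z h ∈ E} = volume (plusPart E) := by
    apply le_antisymm
    · refine (measure_mono (t := plusPart E ∪ frontier Qplus) ?_).trans
        ((measure_union_le _ _).trans ?_)
      · rintro z ⟨h, hz⟩
        by_cases hi : z ∈ interior Qplus
        · left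
          exact ⟨hi, by rwa [chart_of_mem h]⟩
        · right
          exact ⟨subset_closure h, hi⟩
      · rw [volume_frontier_Qplus, add_zero]
    · apply measure_mono
      rintro z ⟨h, hz⟩
      exact ⟨interior_subset h, by rwa [chart_of_mem (interior_subset h)] at hz⟩
  have h2 : volume {z : Plane | ∃ h : z ∈ Qminus, ptMinus z h ∈ E} =
      volume (plusPart (rot '' E)) := by
    rw [← Measure.measure_preimage_neg volume (plusPart (rot '' E))]
    apply le_antisymm
    · refine (measure_mono (t := -plusPart (rot '' E) ∪ -frontier Qplus) ?_).trans
        ((measure_union_le _ _).trans ?_)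
      · rintro z ⟨h, hz⟩
        by_cases hi : -z ∈ interior Qplus
        · left
          refine ⟨hi, ?_⟩
          rw [mem_rot_image, rot_chart_zero hi]
          convert hz
          rw [neg_neg]
        · right
          exact ⟨subset_closure h, hi⟩
      · rw [Measure.measure_neg, Measure.measure_neg, Measure.measure_preimage_neg,
          volume_frontier_Qplus, add_zero]
    · apply measure_mono
      rintro z ⟨hi, hz⟩
      rw [mem_rot_image, rot_chart_zero hi] at hz
      refine ⟨mem_Qminus.2 (interior_subset hi), ?_⟩
      convert hz
      rw [neg_neg]
  rw [area, h1, h2]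

lemma area_mono {E E' : Set S1} (h : E ⊆ E') : area E ≤ area E' :=
  add_le_add (measure_mono fun _ ⟨hz, hE⟩ => ⟨hz, h hE⟩)
    (measure_mono fun _ ⟨hz, hE⟩ => ⟨hz, h hE⟩)

lemma area_iUnion_le (E : ℕ → Set S1) : area (⋃ i, E i) ≤ ∑' i, area (E i) := by
  simp only [area, ENNReal.summable.tsum_add ENNReal.summable]
  refine add_le_add ((measure_mono ?_).trans (measure_iUnion_le _))
    ((measure_mono ?_).trans (measure_iUnion_le _))
  all_goals
    rintro z ⟨h, hz⟩
    obtain ⟨i, hi⟩ := Set.mem_iUnion.1 hz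
    exact Set.mem_iUnion.2 ⟨i, h, hi⟩

lemma area_union_le (E E' : Set S1) : area (E ∪ E') ≤ area E + area E' := by
  rw [area, area, area, add_add_add_comm]
  refine add_le_add ((measure_mono ?_).trans (measure_union_le _ _))
    ((measure_mono ?_).trans (measure_union_le _ _))
  all_goals
    rintro z ⟨h, hz | hz⟩
    · exact Or.inl ⟨h, hz⟩
    · exact Or.inr ⟨h, hz⟩

lemma volume_preimage_sub_left (c : Plane) (S : Set Plane) :
    volume ((fun z => c - z) ⁻¹' S) = volume S :=
  (Measure.measurePreserving_sub_left volume c).measure_preimage_equiv (f := MeasurableEquiv.subLeft c) S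

/-- The points of `S` in `Qplus` stay in place and the others are rotated about the midpoint of the
edge. An inequality is enough: equality for automorphisms comes from applying it to the inverse as
well. -/
lemma area_chart_image_le {m : ℤ} {S : Set Plane} (hS : S ⊆ chartDomain m) :
    area (chart m '' S) ≤ volume S := by
  rw [area_eq, ← measure_inter_add_sdiff S (isClosed_Qplus.measurableSet)]
  refine add_le_add (measure_mono ?_) ?_
  · rintro z ⟨hz, w, hw, h⟩
    rcases (chart_eq_iff (hS hw) (mem_chartDomain_of_interior hz 0)).1 h with h | h
    · exact ⟨h.1 ▸ hw, interior_subset hz⟩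
    · have h1 := mem_interior_Qplus.1 hz 0
      have h2 := mem_Qplus.1 h.2 0
      have : mid m - w = mid 0 - z := by rw [← neg_sub, h.1, neg_sub]
      rw [this, edgeFn_mid_sub_self] at h2
      linarith
  · have : plusPart (rot '' (chart m '' S)) ⊆ (fun z => mid m - z) ⁻¹' (S \ Qplus) := by
      rintro z ⟨hz, hz'⟩
      rw [mem_rot_image, rot_chart (mem_chartDomain_of_interior hz 0)] at hz'
      obtain ⟨w, hw, h⟩ := hz'
      have hz1 := mem_interior_Qplus.1 hz
      rcases (chart_eq_iff (hS hw) (mid_sub_mem_chartDomain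
        (mem_chartDomain_of_interior hz 0))).1 h with h | h
      · have h2 := mem_Qplus.1 h.2 0
        rw [h.1, edgeFn_mid_sub_self] at h2
        linarith [hz1 0]
      · have e : mid m - z = w := by
          have := h.1
          rw [sub_sub_cancel_left] at this
          rw [sub_eq_add_neg, ← this]; abel
        refine ⟨show mid m - z ∈ S from e ▸ hw, ?_⟩
        intro hq
        have := mem_Qplus.1 hq m
        rw [edgeFn_mid_sub_self] at this
        linarith [hz1 m]
    refine (measure_mono this).trans (le_of_eq ?_)
    exact volume_preimage_sub_left _ _

lemma volume_affine_image {B : Matrix (Fin 2) (Fin 2) ℝ} (hB : |B.det| = 1) (z w : Plane)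
    (S : Set Plane) : volume ((fun y => w + B.mulVec (y - z)) '' S) = volume S := by
  have : (fun y => w + B.mulVec (y - z)) '' S =
      (fun y => (w - B.mulVec z) + y) '' (Matrix.toLin' B '' S) := by
    rw [Set.image_image]
    refine Set.image_congr fun y _ => ?_
    rw [Matrix.toLin'_apply, Matrix.mulVec_sub]; abel
  rw [this, Set.image_add_left, measure_preimage_add, Measure.addHaar_image_linearMap,
    LinearMap.det_toLin', hB]
  simp

/-- The map `g` is a single affine map only near each point. Countably many such neighbourhoods
cover `S`; making them disjoint reduces the claim to affine images inside one chart. -/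
lemma area_image_chart_le {g : Equiv.Perm S1} {B : Matrix (Fin 2) (Fin 2) ℝ} (hg : Aff g B)
    (hB : |B.det| = 1) {n : ℤ} {S : Set Plane} (hS : S ⊆ chartDomain n) (hm : MeasurableSet S) :
    area (g '' (chart n '' S)) ≤ volume S := by
  have key : ∀ z ∈ S, ∃ V : Set Plane, z ∈ V ∧ IsOpen V ∧ ∃ m : ℤ, ∃ w : Plane, ∀ y ∈ V,
      g (chart n y) = chart m (w + B.mulVec (y - z)) ∧
        w + B.mulVec (y - z) ∈ chartDomain m := by
    intro z hz
    obtain ⟨m, w, hw, h⟩ := hg.locally_affine n z (hS hz)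
    have h2 := h.and ((tendsto_mulVec_zero B).eventually
      (eventually_add_mem (isOpen_chartDomain m) hw))
    have h3 : Tendsto (fun y => y - z) (𝓝 z) (𝓝 0) := by
      have : Continuous fun y : Plane => y - z := by fun_prop
      simpa using this.tendsto z
    obtain ⟨V, hV, hVo, hzV⟩ := eventually_nhds_iff.1 (h3.eventually h2)
    exact ⟨V, hzV, hVo, m, w, fun y hy => by simpa using hV y hy⟩
  choose! V hzV hVo m w hV using key
  obtain ⟨t, htS, htc, ht⟩ := TopologicalSpace.countable_cover_nhdsWithin (f := V) (s := S)
    fun z hz => mem_nhdsWithin_of_mem_nhds ((hVo z hz).mem_nhds (hzV z hz))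
  rcases t.eq_empty_or_nonempty with rfl | hne
  · have : S = ∅ := by simpa using ht
    subst this
    simp [area]
  obtain ⟨f, rfl⟩ := htc.exists_eq_range hne
  have hf : ∀ i, f i ∈ S := fun i => htS ⟨i, rfl⟩
  set D : ℕ → Set Plane := fun i => S ∩ disjointed (fun i => V (f i)) i with hD
  have hDm : ∀ i, MeasurableSet (D i) := fun i =>
    hm.inter (MeasurableSet.disjointed (fun i => (hVo _ (hf i)).measurableSet) i)
  have hDU : S = ⋃ i, D i := by
    rw [← Set.inter_iUnion, iUnion_disjointed]
    simpa using ht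
  have hDd : Pairwise (Function.onFun Disjoint D) := fun i j hij =>
    (disjoint_disjointed _ hij).mono Set.inter_subset_right Set.inter_subset_right
  calc area (g '' (chart n '' S)) ≤ area (⋃ i, g '' (chart n '' D i)) := by
        apply area_mono
        conv_lhs => rw [hDU]
        simp only [Set.image_iUnion]; rfl
    _ ≤ ∑' i, area (g '' (chart n '' D i)) := area_iUnion_le _
    _ ≤ ∑' i, volume (D i) := by
        refine ENNReal.tsum_le_tsum fun i => ?_
        have hsub : D i ⊆ V (f i) := Set.inter_subset_right.trans (disjointed_subset _ i)
        have e : g '' (chart n '' D i) = chart (m (f i)) ''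
            ((fun y => w (f i) + B.mulVec (y - f i)) '' D i) := by
          rw [Set.image_image, Set.image_image]
          exact Set.image_congr fun y hy => (hV (f i) (hf i) y (hsub hy)).1
        rw [e, ← volume_affine_image hB (f i) (w (f i)) (D i)]
        apply area_chart_image_le
        rintro _ ⟨y, hy, rfl⟩
        exact (hV (f i) (hf i) y (hsub hy)).2
    _ = volume S := by rw [← measure_iUnion hDd hDm, ← hDU]

lemma edge_subset_frontier (n : ℤ) : openSegment ℝ (P n) (P (n + 1)) ⊆ frontier Qplus := by
  intro z hz
  have h := mem_openSegment_edge.1 hz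
  refine ⟨subset_closure (mem_Qplus_of_floor h.2.1.le h.2.2.le h.1.ge), fun hi => ?_⟩
  linarith [mem_interior_Qplus.1 hi n]

/-- Away from the singularities, a set is covered by its parts in the two open polygons and by
countably many open edges. The edges are null, and so are their images. -/
lemma area_image_le {g : Equiv.Perm S1} {B : Matrix (Fin 2) (Fin 2) ℝ} (hg : Aff g B)
    (hB : |B.det| = 1) {E : Set S1} (hE : Disjoint E singular) (h1 : MeasurableSet (plusPart E))
    (h2 : MeasurableSet (plusPart (rot '' E))) : area (g '' E) ≤ area E := by
  set S₂ : Set Plane := (fun z => mid 0 - z) ⁻¹' plusPart (rot '' E) with hS₂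
  have hS₂d : S₂ ⊆ chartDomain 0 := fun z hz => mem_chartDomain.2 (Or.inr (Or.inr hz.1))
  have hS₂m : MeasurableSet S₂ :=
    measurableSet_preimage (continuous_const.sub continuous_id).measurable h2
  have hcov : E ⊆ (chart 0 '' plusPart E ∪ chart 0 '' S₂) ∪
      ⋃ i : ℕ, chart (Equiv.intEquivNat.symm i) ''
        openSegment ℝ (P (Equiv.intEquivNat.symm i)) (P (Equiv.intEquivNat.symm i + 1)) := by
    intro x hx
    obtain ⟨n, z, hz, rfl⟩ := exists_chart (Set.disjoint_left.1 hE hx)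
    by_cases hq : z ∈ Qplus
    · rcases mem_chartDomain_Qplus hz hq with hi | hi
      · left; left
        rw [chart_eq_chart_zero hi] at hx ⊢
        exact ⟨z, ⟨hi, hx⟩, rfl⟩
      · right
        refine Set.mem_iUnion.2 ⟨Equiv.intEquivNat n, ?_⟩
        rw [Equiv.symm_apply_apply]
        exact ⟨z, mem_openSegment_edge.2 hi, rfl⟩
    · left; right
      have hi := mem_chartDomain_not_Qplus hz hq
      have hc : mid 0 - (mid n - z) ∈ chartDomain 0 :=
        mid_sub_mem_chartDomain (mem_chartDomain_of_interior hi 0)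
      have e : chart n z = chart 0 (mid 0 - (mid n - z)) := by
        rw [chart_eq_iff hz hc]
        right
        exact ⟨by abel, interior_subset hi⟩
      refine ⟨mid 0 - (mid n - z), ⟨by simpa using hi, ?_⟩, e.symm⟩
      rw [mem_rot_image]
      simp only [sub_sub_cancel]
      rw [rot_chart (mem_chartDomain_of_interior hi 0), ← e]
      exact hx
  calc area (g '' E) ≤ area ((g '' (chart 0 '' plusPart E) ∪ g '' (chart 0 '' S₂)) ∪
        ⋃ i : ℕ, g '' (chart (Equiv.intEquivNat.symm i) ''
        openSegment ℝ (P (Equiv.intEquivNat.symm i)) (P (Equiv.intEquivNat.symm i + 1)))) := by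
        apply area_mono
        refine (Set.image_mono hcov).trans ?_
        rw [Set.image_union, Set.image_union, Set.image_iUnion]
    _ ≤ (volume (plusPart E) + volume S₂) + ∑' i : ℕ, 0 := by
        refine (area_union_le _ _).trans (add_le_add ((area_union_le _ _).trans (add_le_add ?_ ?_))
          ((area_iUnion_le _).trans (ENNReal.tsum_le_tsum fun i => ?_)))
        · exact area_image_chart_le hg hB
            (fun z hz => mem_chartDomain_of_interior hz.1 0) h1
        · exact area_image_chart_le hg hB hS₂d hS₂m
        · set n := Equiv.intEquivNat.symm i
          have hm : MeasurableSet (openSegment ℝ (P n) (P (n + 1))) := by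
            have : openSegment ℝ (P n) (P (n + 1)) =
                {z | edgeFn n z = 0} ∩ ({z | (n : ℝ) < z 0} ∩ {z | z 0 < n + 1}) := by
              ext z; rw [mem_openSegment_edge]; rfl
            rw [this]
            exact (isClosed_eq (edgeFn_continuous n) continuous_const).measurableSet.inter
              ((isOpen_lt continuous_const (continuous_apply 0)).measurableSet.inter
              (isOpen_lt (continuous_apply 0) continuous_const).measurableSet)
          refine (area_image_chart_le hg hB ?_ hm).trans ?_
          · intro z hz
            exact mem_chartDomain.2 (Or.inr (Or.inl (mem_openSegment_edge.1 hz).2))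
          · exact (measure_mono (edge_subset_frontier n)).trans volume_frontier_Qplus.le
    _ = area E := by
        rw [area_eq, tsum_zero, add_zero]
        congr 1
        exact volume_preimage_sub_left _ _

end ParabolaSurface

/-! ### Cylinders, their leaves and their transverse levels. -/

namespace ParabolaSurface

lemma wedge_add_smul (v z : Plane) (t : ℝ) : wedge v (z + t • v) = wedge v z := by
  simp [wedge]; ring

lemma wedge_neg_left (v z : Plane) : wedge (-v) z = -wedge v z := by
  simp [wedge]; ring

lemma wedge_sub_right (v z w : Plane) : wedge v (z - w) = wedge v z - wedge v w := by
  simp [wedge]; ring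

lemma wedge_add_right (v z w : Plane) : wedge v (z + w) = wedge v z + wedge v w := by
  simp [wedge]; ring

lemma wedge_mulVec (B : Matrix (Fin 2) (Fin 2) ℝ) (v z : Plane) :
    wedge (B.mulVec v) (B.mulVec z) = B.det * wedge v z := by
  simp [wedge, Matrix.det_fin_two]; ring

lemma continuous_wedge (v : Plane) : Continuous (wedge v) := by
  unfold wedge; fun_prop

lemma exists_eq_add_smul {v z w : Plane} (hv : v ≠ 0) (h : wedge v z = wedge v w) :
    ∃ s : ℝ, w = z + s • v := by
  simp only [wedge] at h
  have hn : v 0 ^ 2 + v 1 ^ 2 ≠ 0 := by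
    intro h0
    apply hv
    apply plane_ext <;> simp <;> nlinarith
  refine ⟨((w 0 - z 0) * v 0 + (w 1 - z 1) * v 1) / (v 0 ^ 2 + v 1 ^ 2), ?_⟩
  apply plane_ext
  · simp; field_simp; linear_combination v 1 * h
  · simp; field_simp; linear_combination -v 0 * h

/-- `C` is a cylinder with core curves of holonomy `v`. -/
def HasCyl (C : Set S1) (v : Plane) : Prop :=
  v ≠ 0 ∧ ∃ (U : Set Plane) (F : Plane → S1), IsOpen U ∧ U.Nonempty ∧
    (∀ z ∈ U, ∀ t : ℝ, z + t • v ∈ U) ∧ (∀ z ∈ U, LocTransAt F z) ∧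
    (∀ z ∈ U, ∀ z' ∈ U, F z = F z' ↔ ∃ k : ℤ, z' = z + (k : ℝ) • v) ∧ C = F '' U

lemma exists_hasCyl {C : Set S1} (h : IsCylinder C) : ∃ v, HasCyl C v := by
  obtain ⟨v, h, F, hv, hh, h1, h2, rfl⟩ := h
  refine ⟨v, hv, strip v h, F, ?_, ?_, ?_, h1, h2, rfl⟩
  · exact (isOpen_lt continuous_const (continuous_wedge v)).inter
      (isOpen_lt (continuous_wedge v) continuous_const)
  · have hn : 0 < v 0 ^ 2 + v 1 ^ 2 := by
      by_contra h0
      apply hv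
      apply plane_ext <;> simp <;> nlinarith [sq_nonneg (v 0), sq_nonneg (v 1)]
    refine ⟨(h / 2 / (v 0 ^ 2 + v 1 ^ 2)) • ![-v 1, v 0], ?_⟩
    have : wedge v ((h / 2 / (v 0 ^ 2 + v 1 ^ 2)) • ![-v 1, v 0]) = h / 2 := by
      simp [wedge]; field_simp
    constructor <;> rw [this] <;> linarith
  · intro z hz t
    simp only [strip, Set.mem_ofPred_eq, wedge_add_smul] at hz ⊢
    exact hz

lemma HasCyl.neg {C : Set S1} {v : Plane} (h : HasCyl C v) : HasCyl C (-v) := by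
  obtain ⟨hv, U, F, h1, h2, h3, h4, h5, h6⟩ := h
  refine ⟨neg_ne_zero.2 hv, U, F, h1, h2, fun z hz t => ?_, h4, fun z hz z' hz' => ?_, h6⟩
  · simpa using h3 z hz (-t)
  · rw [h5 z hz z' hz']
    constructor
    · rintro ⟨k, rfl⟩; exact ⟨-k, by simp⟩
    · rintro ⟨k, rfl⟩; exact ⟨-k, by simp⟩

/-- Since `HasCyl` asks only for an open set invariant under the flow along `v`, and not for a
strip, it passes to images by pulling that set back with `B⁻¹`. -/
lemma HasCyl.image {C : Set S1} {v : Plane} (h : HasCyl C v) {g : Equiv.Perm S1}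
    {B : Matrix (Fin 2) (Fin 2) ℝ} (hg : Aff g B) : HasCyl (g '' C) (B.mulVec v) := by
  obtain ⟨hv, U, F, h1, h2, h3, h4, h5, rfl⟩ := h
  have hi : ∀ x : Plane, B⁻¹.mulVec (B.mulVec x) = x := fun x => by
    rw [Matrix.mulVec_mulVec, Matrix.nonsing_inv_mul _ hg.det_ne.isUnit, Matrix.one_mulVec]
  have hi' : ∀ x : Plane, B.mulVec (B⁻¹.mulVec x) = x := fun x => by
    rw [Matrix.mulVec_mulVec, Matrix.mul_nonsing_inv _ hg.det_ne.isUnit, Matrix.one_mulVec]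
  have hc : Continuous fun x : Plane => B⁻¹.mulVec x :=
    continuous_const.matrix_mulVec continuous_id
  refine ⟨fun h0 => hv ?_, (fun x => B⁻¹.mulVec x) ⁻¹' U, fun x => g (F (B⁻¹.mulVec x)),
    h1.preimage hc, ?_, ?_, ?_, ?_, ?_⟩
  · rw [← hi v, h0, Matrix.mulVec_zero]
  · obtain ⟨z, hz⟩ := h2
    exact ⟨B.mulVec z, by rw [Set.mem_preimage, hi]; exact hz⟩
  · intro z hz t
    rw [Set.mem_preimage, Matrix.mulVec_add, Matrix.mulVec_smul, hi]
    exact h3 _ hz t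
  · intro z hz
    obtain ⟨m, w, hw, h⟩ := hg.apply_locTransAt (h4 _ hz)
    refine ⟨m, w, hw, ?_⟩
    filter_upwards [(tendsto_mulVec_zero B⁻¹).eventually h] with x hx
    rw [Matrix.mulVec_add, hx, hi']
  · intro z hz z' hz'
    rw [g.injective.eq_iff, h5 _ hz _ hz']
    refine exists_congr fun k => ⟨fun h => ?_, fun h => ?_⟩ <;> beta_reduce at h ⊢
    · rw [← hi' z', h, Matrix.mulVec_add, Matrix.mulVec_smul, hi']
    · rw [h, Matrix.mulVec_add, Matrix.mulVec_smul, hi]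
  · ext x
    constructor
    · rintro ⟨_, ⟨z, hz, rfl⟩, rfl⟩
      refine ⟨B.mulVec z, ?_, ?_⟩
      · rw [Set.mem_preimage, hi]; exact hz
      · simp only [hi]
    · rintro ⟨z, hz, rfl⟩
      exact ⟨_, ⟨_, hz, rfl⟩, rfl⟩

lemma HasCyl.rot {C : Set S1} {v : Plane} (h : HasCyl C v) : HasCyl (rot '' C) v := by
  have := (h.image aff_rot).neg
  simpa [Matrix.neg_mulVec] using this

lemma HasCyl.disjoint_singular {C : Set S1} {v : Plane} (h : HasCyl C v) :
    Disjoint C singular := by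
  obtain ⟨_, U, F, _, _, _, h4, _, rfl⟩ := h
  rw [Set.disjoint_left]
  rintro _ ⟨z, hz, rfl⟩
  exact (h4 z hz).notMem_singular

/-- The closed leaf of a cylinder through one of its points. -/
lemma HasCyl.exists_leaf {C : Set S1} {v : Plane} (h : HasCyl C v) {x : S1} (hx : x ∈ C) :
    ∃ (F : Plane → S1) (y : Plane), F y = x ∧ (∀ t : ℝ, LocTransAt F (y + t • v)) ∧
      (∀ᶠ x in 𝓝 (0 : Plane), F (y + x) ∈ C) ∧
      (∀ t : ℝ, F (y + t • v) ∈ C) ∧ ∀ t : ℝ, F (y + t • v) = F y ↔ ∃ k : ℤ, t = k := by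
  obtain ⟨hv, U, F, h1, h2, h3, h4, h5, rfl⟩ := h
  obtain ⟨y, hy, rfl⟩ := hx
  refine ⟨F, y, rfl, fun t => h4 _ (h3 y hy t), ?_, fun t => ⟨_, h3 y hy t, rfl⟩, fun t => ?_⟩
  · filter_upwards [eventually_add_mem h1 hy] with x hx using ⟨_, hx, rfl⟩
  · rw [eq_comm, h5 y hy _ (h3 y hy t)]
    refine exists_congr fun k => ?_
    rw [add_right_inj]
    exact ⟨fun h => smul_left_injective ℝ hv h, fun h => by rw [h]⟩

lemma HasCyl.leaf_eq {v : Plane} {n : ℤ} {z : Plane}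
    {I : Set ℝ} (hI : IsPreconnected I) (h0 : (0 : ℝ) ∈ I)
    (hI' : ∀ t ∈ I, z + t • v ∈ chartDomain n) {F : Plane → S1} {y : Plane}
    (hy : F y = chart n z) (hF : ∀ t : ℝ, LocTransAt F (y + t • v)) {t : ℝ} (ht : t ∈ I) :
    F (y + t • v) = chart n (z + t • v) :=
  eq_of_locTransAt hI (fun t _ => hF t) (fun t ht => locTransAt_chart (hI' t ht)) h0 ht
    (by simpa using hy)

/-- Cylinders are invariant under the flow in their direction. -/
lemma HasCyl.flow {C : Set S1} {v : Plane} (h : HasCyl C v) {n : ℤ} {z : Plane}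
    (hz : chart n z ∈ C) {I : Set ℝ} (hI : IsPreconnected I) (h0 : (0 : ℝ) ∈ I)
    (hI' : ∀ t ∈ I, z + t • v ∈ chartDomain n) {t : ℝ} (ht : t ∈ I) :
    chart n (z + t • v) ∈ C := by
  obtain ⟨F, y, hy, hF, _, hC, _⟩ := h.exists_leaf hz
  rw [← HasCyl.leaf_eq hI h0 hI' hy hF ht]
  exact hC t

/-- A leaf closes up after the displacement `v`, whereas a chart never identifies two of its points
that differ by a nonzero vector. -/
lemma HasCyl.false_of_long {C : Set S1} {v : Plane} (h : HasCyl C v) {n : ℤ} {z : Plane}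
    (hz : chart n z ∈ C) (hI : ∀ t ∈ Set.Icc (0 : ℝ) 1, z + t • v ∈ chartDomain n) : False := by
  obtain ⟨F, y, hy, hF, _, hC, hp⟩ := h.exists_leaf hz
  have h1 := HasCyl.leaf_eq isPreconnected_Icc (by simp) hI hy hF
    (show (1 : ℝ) ∈ Set.Icc 0 1 by simp)
  have h2 := (hp 1).2 ⟨1, by simp⟩
  rw [h1, hy] at h2
  have h3 := hI 0 (by simp)
  rw [zero_smul, add_zero] at h3
  rcases (chart_eq_iff (hI 1 (by simp)) h3).1 h2 with h4 | h4
  · exact h.1 (by simpa using h4.1)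
  · exact h.1 (by simpa using h4.1)

lemma HasCyl.nonempty {C : Set S1} {v : Plane} (h : HasCyl C v) : C.Nonempty := by
  obtain ⟨_, U, F, _, h2, _, _, _, rfl⟩ := h
  exact h2.image F

/-- There are no vertical cylinders. -/
lemma HasCyl.apply_zero_ne {C : Set S1} {v : Plane} (h : HasCyl C v) : v 0 ≠ 0 := by
  intro hv0
  wlog hv1 : 0 < v 1 generalizing v
  · refine this h.neg (by simp [hv0]) ?_
    rcases lt_trichotomy (v 1) 0 with h1 | h1 | h1
    · simpa using h1
    · exact absurd (plane_ext hv0 h1) h.1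
    · exact absurd h1 hv1
  -- A vertical ray going up from a point of `Qplus` never leaves the chart domain, so its leaf
  -- cannot close up.
  have key : ∀ (C : Set S1), HasCyl C v → ∀ n, ∀ z ∈ chartDomain n, z ∈ Qplus →
      chart n z ∈ C → False := by
    intro C h n z hz hq hC
    refine h.false_of_long hC fun t ht => ?_
    rw [mem_chartDomain]
    rcases mem_chartDomain_Qplus hz hq with hi | hi
    · left
      rw [mem_interior_Qplus] at hi ⊢
      intro k
      have := hi k
      simp only [edgeFn, Pi.add_apply, Pi.smul_apply, smul_eq_mul, hv0] at this ⊢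
      nlinarith [mul_nonneg ht.1 hv1.le]
    · right; left
      simpa [hv0] using hi.2
  obtain ⟨x, hx⟩ := h.nonempty
  obtain ⟨n, z, hz, rfl⟩ := exists_chart (Set.disjoint_left.1 h.disjoint_singular hx)
  by_cases hq : z ∈ Qplus
  · exact key C h n z hz hq hx
  · refine key _ h.rot n (mid n - z) (mid_sub_mem_chartDomain hz)
      (interior_subset (mem_chartDomain_not_Qplus hz hq)) ?_
    rw [← rot_chart hz]
    exact ⟨_, hx, rfl⟩

lemma HasCyl.isOpen_plusPart {C : Set S1} {v : Plane} (h : HasCyl C v) : IsOpen (plusPart C) := by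
  rw [isOpen_iff_mem_nhds]
  rintro z ⟨hz, hC⟩
  obtain ⟨F, y, hy, hF, hC', _, _⟩ := h.exists_leaf hC
  have hF0 := hF 0
  rw [zero_smul, add_zero] at hF0
  have h1 := hF0.eventually_eq (locTransAt_chart (mem_chartDomain_of_interior hz 0)) hy
  have h3 : Tendsto (fun y => y - z) (𝓝 z) (𝓝 0) := by
    have : Continuous fun y : Plane => y - z := by fun_prop
    simpa using this.tendsto z
  filter_upwards [isOpen_interior.mem_nhds hz, h3.eventually h1, h3.eventually hC'] with w h4 h5 h6
  refine ⟨h4, ?_⟩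
  rw [add_sub_cancel] at h5
  rw [← h5]
  exact h6

/-- The transverse levels of the leaves of `C` in the interior of `Qplus`. -/
def levels (C : Set S1) (v : Plane) : Set ℝ := wedge v '' plusPart C

lemma add_smul_mem_interior {z v : Plane} {s : ℝ} (h0 : z ∈ Qplus)
    (h1 : z + s • v ∈ interior Qplus) {t : ℝ} (ht : t ∈ Set.uIcc 0 s) :
    z + t • v ∈ interior Qplus ∨ z + t • v = z := by
  rcases eq_or_ne t 0 with rfl | ht0
  · right; simp
  left
  have hs : s ≠ 0 := by
    rintro rfl
    simp at ht
    exact ht0 ht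
  rw [mem_interior_Qplus] at h1 ⊢
  intro k
  have e : edgeFn k (z + t • v) = (1 - t / s) * edgeFn k z + t / s * edgeFn k (z + s • v) := by
    simp [edgeFn]; field_simp; ring
  have hts : 0 < t / s ∧ t / s ≤ 1 := by
    rcases lt_or_gt_of_ne hs with hs | hs
    · rw [Set.uIcc_of_ge hs.le] at ht
      exact ⟨div_pos_of_neg_of_neg (lt_of_le_of_ne ht.2 ht0) hs, (div_le_one_of_neg hs).2 ht.1⟩
    · rw [Set.uIcc_of_le hs.le] at ht
      exact ⟨div_pos (lt_of_le_of_ne ht.1 (Ne.symm ht0)) hs, (div_le_one hs).2 ht.2⟩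
  rw [e]
  have := mem_Qplus.1 h0 k
  have := mul_pos hts.1 (h1 k)
  nlinarith [mul_nonneg (sub_nonneg.2 hts.2) (mem_Qplus.1 h0 k)]

/-- By convexity a line parallel to `v` meets the interior of `Qplus` in one segment, and the flow
carries membership in `C` along it. The part of `C` in `Qplus` is therefore determined by a set of
levels. -/
lemma HasCyl.mem_plusPart_iff {C : Set S1} {v : Plane} (h : HasCyl C v) {z : Plane}
    (hz : z ∈ interior Qplus) : z ∈ plusPart C ↔ wedge v z ∈ levels C v := by
  refine ⟨fun h => ⟨z, h, rfl⟩, ?_⟩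
  rintro ⟨w, ⟨hw, hC⟩, he⟩
  refine ⟨hz, ?_⟩
  obtain ⟨s, rfl⟩ := exists_eq_add_smul h.1 he
  refine h.flow hC isPreconnected_uIcc Set.left_mem_uIcc (fun t ht => ?_) Set.right_mem_uIcc
  rcases add_smul_mem_interior (interior_subset hw) hz ht with h' | h'
  · exact mem_chartDomain_of_interior h' 0
  · rw [h']; exact mem_chartDomain_of_interior hw 0

lemma HasCyl.isOpen_levels {C : Set S1} {v : Plane} (h : HasCyl C v) : IsOpen (levels C v) := by
  have h0 := h.apply_zero_ne
  rw [isOpen_iff_mem_nhds]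
  rintro _ ⟨z, hz, rfl⟩
  have hc : Continuous fun t : ℝ => z + ((t - wedge v z) / v 0) • (![0, 1] : Plane) := by
    fun_prop
  have h1 := hc.continuousAt (x := wedge v z) |>.eventually_mem
    (h.isOpen_plusPart.mem_nhds (x := z + ((wedge v z - wedge v z) / v 0) • ![0, 1])
      (by simpa using hz))
  filter_upwards [h1] with t ht
  refine ⟨_, ht, ?_⟩
  simp [wedge]
  field_simp
  ring

/-- High non-vertical lines have chords in `Qplus` longer than `v`, and `HasCyl.false_of_long`
excludes these. Below, the parabola bounds the level. -/
lemma HasCyl.levels_bounded {C : Set S1} {v : Plane} (h : HasCyl C v) :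
    ∃ M, ∀ t ∈ levels C v, |t| ≤ M := by
  have h0 := h.apply_zero_ne
  -- The first term controls the minimum of the level on the parabola; the others put both `w` and
  -- `w + v` inside `Qplus` when the level is too high.
  set K : ℝ := (v 1 / v 0) ^ 2 + v 0 ^ 2 + |v 1| + 1 with hK
  refine ⟨K * |v 0|, ?_⟩
  rintro t ⟨z, hz, rfl⟩
  rw [← div_le_iff₀ (abs_pos.2 h0), ← abs_div, abs_le]
  have hq := sq_le_of_mem_Qplus (interior_subset hz.1)
  have e : wedge v z / v 0 = z 1 - v 1 / v 0 * z 0 := by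
    simp only [wedge]; field_simp
  constructor
  · rw [e]
    have : 0 ≤ v 0 ^ 2 + |v 1| + 1 := by positivity
    nlinarith [sq_nonneg (z 0 - v 1 / v 0 / 2)]
  · by_contra hlt
    rw [not_le] at hlt
    set w : Plane := ![0, wedge v z / v 0] with hw
    have hw0 : w ∈ interior Qplus := by
      apply mem_interior_Qplus_of_lt
      simp only [hw]
      have : 0 ≤ (v 1 / v 0) ^ 2 + v 0 ^ 2 + |v 1| := by positivity
      simp; linarith
    have hw1 : w + (1 : ℝ) • v ∈ interior Qplus := by
      apply mem_interior_Qplus_of_lt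
      simp only [hw]
      have : 0 ≤ (v 1 / v 0) ^ 2 := by positivity
      simp; linarith [neg_abs_le (v 1)]
    have hwC : w ∈ plusPart C := by
      rw [h.mem_plusPart_iff hw0]
      refine ⟨z, hz, ?_⟩
      simp only [wedge, hw]; simp; field_simp
    refine h.false_of_long hwC.2 fun t ht => ?_
    rcases add_smul_mem_interior (interior_subset hw0) hw1
      (Set.uIcc_of_le (zero_le_one' ℝ) ▸ ht) with h' | h'
    · exact mem_chartDomain_of_interior h' 0
    · rw [h']; exact mem_chartDomain_of_interior hw0 0

/-- A leaf through an open edge, transverse to it, enters the interior of `Qplus`. -/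
lemma HasCyl.mem_levels_edge {C : Set S1} {v : Plane} (h : HasCyl C v) {n : ℤ} {p : Plane}
    (hp : edgeFn n p = 0) (hp0 : (n : ℝ) < p 0) (hp1 : p 0 < n + 1)
    (hv : wedge v (P n) ≠ wedge v (P (n + 1))) :
    wedge v p ∈ levels C v ↔ chart n p ∈ C := by
  have hpq : p ∈ Qplus := mem_Qplus_of_floor hp0.le hp1.le hp.ge
  have hpd : p ∈ chartDomain n := mem_chartDomain.2 (Or.inr (Or.inl ⟨hp0, hp1⟩))
  -- This is the derivative of `edgeFn n` along `v`: transversality to the edge.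
  have hd : v 1 - (2 * n + 1) * v 0 ≠ 0 := by
    intro h0
    apply hv
    simp [wedge]
    linear_combination h0
  constructor
  · rintro ⟨z, ⟨hz, hC⟩, he⟩
    obtain ⟨s, hs⟩ := exists_eq_add_smul h.1 he.symm
    have hs' : p = z + (-s) • v := by rw [hs]; simp
    rw [hs']
    rw [← chart_eq_chart_zero hz n] at hC
    refine h.flow hC (isPreconnected_uIcc (a := 0) (b := -s)) Set.left_mem_uIcc (fun t ht => ?_)
      Set.right_mem_uIcc
    have e : z + t • v = p + (s + t) • v := by rw [hs, add_assoc, ← add_smul]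
    have ht' : s + t ∈ Set.uIcc 0 s := by
      rw [Set.mem_uIcc] at ht ⊢
      rcases ht with ht | ht
      · right; constructor <;> linarith
      · left; constructor <;> linarith
    rw [e]
    rcases add_smul_mem_interior hpq (hs ▸ hz) ht' with h' | h'
    · exact mem_chartDomain_of_interior h' n
    · rw [h']; exact hpd
  · intro hC
    have hcont : ∀ᶠ t in 𝓝 (0 : ℝ), (n : ℝ) < (p + t • v) 0 ∧ (p + t • v) 0 < n + 1 := by
      have hc : Continuous fun t : ℝ => (p + t • v) 0 := by
        simp only [Pi.add_apply, Pi.smul_apply]; fun_prop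
      have := hc.tendsto 0
      exact (this.eventually_const_lt (by simpa using hp0)).and
        (this.eventually_lt_const (by simpa using hp1))
    obtain ⟨δ, hδ, hball⟩ := Metric.eventually_nhds_iff_ball.1 hcont
    -- The sign of `t` is chosen so that the edge function increases, and its size so that the
    -- segment stays over the open edge.
    obtain ⟨t, ht, htd⟩ : ∃ t : ℝ, |t| < δ ∧ 0 < t * (v 1 - (2 * n + 1) * v 0) := by
      rcases lt_or_gt_of_ne hd with hd | hd
      · exact ⟨-(δ / 2), by rw [abs_neg, abs_of_pos] <;> linarith, by nlinarith⟩
      · exact ⟨δ / 2, by rw [abs_of_pos] <;> linarith, by positivity⟩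
    have hstrip : ∀ s ∈ Set.uIcc 0 t, (n : ℝ) < (p + s • v) 0 ∧ (p + s • v) 0 < n + 1 := by
      intro s hs
      apply hball
      rw [mem_ball_zero_iff, Real.norm_eq_abs]
      refine lt_of_le_of_lt ?_ ht
      have := Set.abs_sub_left_of_mem_uIcc hs
      simpa using this
    have hi : p + t • v ∈ interior Qplus := by
      have h1 := hstrip t Set.right_mem_uIcc
      rw [mem_interior_Qplus_of_strip h1.1.le h1.2.le]
      simp [edgeFn] at hp ⊢
      linarith
    refine ⟨p + t • v, ⟨hi, ?_⟩, wedge_add_smul _ _ _⟩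
    rw [← chart_eq_chart_zero hi n]
    exact h.flow hC isPreconnected_uIcc Set.left_mem_uIcc
      (fun s hs => mem_chartDomain.2 (Or.inr (Or.inl (hstrip s hs)))) Set.right_mem_uIcc

/-- A point of an open edge sees the cylinder from both polygons. The rotation about the midpoint of
the edge turns the view from `Qminus` into that of `rot '' C` from `Qplus`. -/
lemma HasCyl.mem_levels_rot {C : Set S1} {v : Plane} (h : HasCyl C v) {n : ℤ} {p : Plane}
    (hp : edgeFn n p = 0) (hp0 : (n : ℝ) < p 0) (hp1 : p 0 < n + 1)
    (hv : wedge v (P n) ≠ wedge v (P (n + 1))) :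
    wedge v p ∈ levels C v ↔ wedge v (mid n) - wedge v p ∈ levels (ParabolaSurface.rot '' C) v := by
  rw [h.mem_levels_edge hp hp0 hp1 hv, ← wedge_sub_right, h.rot.mem_levels_edge
    (by rw [edgeFn_mid_sub_self, hp, neg_zero]) (by simp; linarith) (by simp; linarith) hv,
    ← rot_chart (mem_chartDomain.2 (Or.inr (Or.inl ⟨hp0, hp1⟩))), mem_rot_image, rot_rot]

/-- The point of level `t` on the line through the `n`-th edge. -/
noncomputable def edgePt (v : Plane) (n : ℤ) (t : ℝ) : Plane :=
  P n + ((t - wedge v (P n)) / (wedge v (P (n + 1)) - wedge v (P n))) • (P (n + 1) - P n)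

lemma edgePt_spec {v : Plane} {n : ℤ} {t : ℝ}
    (ht : t ∈ Set.uIoo (wedge v (P n)) (wedge v (P (n + 1)))) :
    edgeFn n (edgePt v n t) = 0 ∧ (n : ℝ) < edgePt v n t 0 ∧ edgePt v n t 0 < n + 1 ∧
      wedge v (edgePt v n t) = t ∧ wedge v (P n) ≠ wedge v (P (n + 1)) := by
  have hne : wedge v (P n) ≠ wedge v (P (n + 1)) := by
    intro h; rw [h] at ht; simp at ht
  have hd : wedge v (P (n + 1)) - wedge v (P n) ≠ 0 := sub_ne_zero.2 hne.symm
  have hr : 0 < (t - wedge v (P n)) / (wedge v (P (n + 1)) - wedge v (P n)) ∧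
      (t - wedge v (P n)) / (wedge v (P (n + 1)) - wedge v (P n)) < 1 := by
    rcases lt_or_gt_of_ne hne with h | h
    · rw [Set.uIoo_of_lt h] at ht
      have := sub_pos.2 h
      exact ⟨div_pos (sub_pos.2 ht.1) this, (div_lt_one this).2 (by linarith [ht.2])⟩
    · rw [Set.uIoo_of_gt h] at ht
      have := sub_neg.2 h
      exact ⟨div_pos_of_neg_of_neg (sub_neg.2 ht.2) this,
        (div_lt_one_of_neg this).2 (by linarith [ht.1])⟩
  have hw : wedge v (edgePt v n t) = t := by
    have : wedge v (edgePt v n t) = wedge v (P n) + (t - wedge v (P n)) /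
        (wedge v (P (n + 1)) - wedge v (P n)) * (wedge v (P (n + 1)) - wedge v (P n)) := by
      simp only [edgePt, wedge, Pi.add_apply, Pi.smul_apply, Pi.sub_apply, smul_eq_mul]; ring
    rw [this, div_mul_cancel₀ _ hd]; ring
  refine ⟨?_, ?_, ?_, hw, hne⟩
  · simp [edgePt, edgeFn]; ring
  · simp [edgePt]; exact hr.1
  · simp [edgePt]; exact hr.2

/-- The transverse measure of `C` on the `n`-th edge, positive where leaves exit `Qplus`. -/
noncomputable def mass (C : Set S1) (v : Plane) (n : ℤ) : ℝ :=
  ∫ t in (wedge v (P n))..(wedge v (P (n + 1))), (levels C v).indicator 1 t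

lemma HasCyl.levels_shift {C : Set S1} {v : Plane} (h : HasCyl C v) {n : ℤ} {t : ℝ}
    (ht : t ∈ Set.uIoo (wedge v (P n)) (wedge v (P (n + 1)))) :
    t ∈ levels C v ↔ wedge v (mid n) - t ∈ levels (ParabolaSurface.rot '' C) v := by
  obtain ⟨h1, h2, h3, h4, h5⟩ := edgePt_spec ht
  have := h.mem_levels_rot h1 h2 h3 h5
  rwa [h4] at this

end ParabolaSurface

/-! ### Integration along lines in `Qplus`. -/

namespace ParabolaSurface

/-- Integration over the part of a unit interval on which an affine function stays below `t`. -/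
lemma integral_slab {f Ψ : ℝ → ℝ} (hf : ∀ a b, IntervalIntegrable f volume a b)
    (hΨ : ∀ a b, ∫ x in a..b, f x = Ψ b - Ψ a) (n q₀ q₁ t : ℝ) :
    ∫ x in n..(n + 1), (if q₀ + (x - n) * (q₁ - q₀) < t then f x else 0) =
      (if q₁ < t then Ψ (n + 1) else 0) - (if q₀ < t then Ψ n else 0) +
      ((if t ∈ Set.Ioc q₀ q₁ then Ψ (n + (t - q₀) / (q₁ - q₀)) else 0) -
        (if t ∈ Set.Ioc q₁ q₀ then Ψ (n + (t - q₀) / (q₁ - q₀)) else 0)) := by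
  have hle : n ≤ n + 1 := by linarith
  set G : ℝ → ℝ := fun x => if q₀ + (x - n) * (q₁ - q₀) < t then f x else 0 with hG
  -- The affine function takes the value `t` inside the interval, at the abscissa `c`, only when `t`
  -- separates its end values; in the other two cases the integrand is `f` or zero throughout.
  rcases lt_or_ge q₀ t with h0 | h0 <;> rcases lt_or_ge q₁ t with h1 | h1
  · have : ∫ x in n..(n + 1), G x = ∫ x in n..(n + 1), f x := by
      apply intervalIntegral.integral_congr
      intro x hx
      rw [Set.uIcc_of_le hle] at hx
      refine if_pos ?_
      nlinarith [mul_nonneg (sub_nonneg.2 hx.1) (sub_nonneg.2 h1.le),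
        mul_nonneg (sub_nonneg.2 hx.2) (sub_nonneg.2 h0.le), hx.1, hx.2]
    rw [this, hΨ]
    simp [h0, h1, h0.not_ge, h1.not_ge]
  · have hd : 0 < q₁ - q₀ := by linarith
    set c := n + (t - q₀) / (q₁ - q₀) with hc
    have hcn : n ≤ c := by
      have : 0 ≤ (t - q₀) / (q₁ - q₀) := div_nonneg (by linarith) hd.le
      linarith
    have hcn1 : c ≤ n + 1 := by
      have : (t - q₀) / (q₁ - q₀) ≤ 1 := (div_le_one hd).2 (by linarith)
      linarith
    have hct : (c - n) * (q₁ - q₀) = t - q₀ := by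
      rw [hc, add_sub_cancel_left, div_mul_cancel₀ _ hd.ne']
    have e1 : Set.EqOn G f (Set.uIoo n c) := by
      intro x hx
      rw [Set.uIoo_of_le hcn] at hx
      refine if_pos ?_
      nlinarith [mul_pos (sub_pos.2 hx.2) hd]
    have e2 : Set.EqOn G (fun _ => 0) (Set.uIoo c (n + 1)) := by
      intro x hx
      rw [Set.uIoo_of_le hcn1] at hx
      refine if_neg ?_
      nlinarith [mul_pos (sub_pos.2 hx.1) hd]
    have i1 : IntervalIntegrable G volume n c := (hf n c).congr_uIoo e1.symm
    have i2 : IntervalIntegrable G volume c (n + 1) :=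
      intervalIntegrable_const.congr_uIoo e2.symm
    rw [← intervalIntegral.integral_add_adjacent_intervals i1 i2,
      intervalIntegral.integral_congr_uIoo e1, intervalIntegral.integral_congr_uIoo e2, hΨ]
    simp [h0, h1, h0.not_ge, h1.not_gt]
    ring
  · have hd : 0 < q₀ - q₁ := by linarith
    set c := n + (t - q₀) / (q₁ - q₀) with hc
    have hq : (t - q₀) / (q₁ - q₀) = (q₀ - t) / (q₀ - q₁) := by
      rw [← neg_sub q₀ t, ← neg_sub q₀ q₁, neg_div_neg_eq]
    have hcn : n ≤ c := by
      have : 0 ≤ (q₀ - t) / (q₀ - q₁) := div_nonneg (by linarith) hd.le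
      linarith
    have hcn1 : c ≤ n + 1 := by
      have : (q₀ - t) / (q₀ - q₁) ≤ 1 := (div_le_one hd).2 (by linarith)
      linarith
    have hct : (c - n) * (q₁ - q₀) = t - q₀ := by
      rw [hc, add_sub_cancel_left, div_mul_cancel₀ _ (by linarith)]
    have e1 : Set.EqOn G (fun _ => 0) (Set.uIoo n c) := by
      intro x hx
      rw [Set.uIoo_of_le hcn] at hx
      refine if_neg ?_
      nlinarith [mul_pos (sub_pos.2 hx.2) hd]
    have e2 : Set.EqOn G f (Set.uIoo c (n + 1)) := by
      intro x hx
      rw [Set.uIoo_of_le hcn1] at hx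
      refine if_pos ?_
      nlinarith [mul_pos (sub_pos.2 hx.1) hd]
    have i1 : IntervalIntegrable G volume n c :=
      intervalIntegrable_const.congr_uIoo e1.symm
    have i2 : IntervalIntegrable G volume c (n + 1) := (hf c (n + 1)).congr_uIoo e2.symm
    rw [← intervalIntegral.integral_add_adjacent_intervals i1 i2,
      intervalIntegral.integral_congr_uIoo e1, intervalIntegral.integral_congr_uIoo e2, hΨ]
    simp [h0, h1, h0.not_gt, h1.not_ge]
    ring
  · have : ∫ x in n..(n + 1), G x = ∫ x in n..(n + 1), 0 := by
      apply intervalIntegral.integral_congr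
      intro x hx
      rw [Set.uIcc_of_le hle] at hx
      refine if_neg ?_
      nlinarith [mul_nonneg (sub_nonneg.2 hx.1) (sub_nonneg.2 h1),
        mul_nonneg (sub_nonneg.2 hx.2) (sub_nonneg.2 h0), hx.1, hx.2]
    rw [this]
    simp [h0.not_gt, h1.not_gt]

/-- The point with first coordinate `x` on the line of level `t`. -/
noncomputable def linePt (v : Plane) (t x : ℝ) : Plane := ![x, (t + v 1 * x) / v 0]

lemma linePt_mem_interior {v : Plane} (hv : 0 < v 0) {n : ℤ} {t x : ℝ} (h0 : (n : ℝ) ≤ x)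
    (h1 : x ≤ n + 1) : linePt v t x ∈ interior Qplus ↔
      wedge v (P n) + (x - n) * (wedge v (P (n + 1)) - wedge v (P n)) < t := by
  rw [mem_interior_Qplus_of_strip (n := n) (by simpa [linePt] using h0)
    (by simpa [linePt] using h1)]
  have e : t - (wedge v (P n) + (x - n) * (wedge v (P (n + 1)) - wedge v (P n))) =
      v 0 * edgeFn n (linePt v t x) := by
    simp [edgeFn, linePt, wedge]; field_simp; ring
  rw [← sub_pos (b := wedge v (P n) + _), e, mul_pos_iff_of_pos_left hv]

lemma wedge_linePt {v : Plane} (hv : v 0 ≠ 0) (t x : ℝ) : wedge v (linePt v t x) = t := by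
  simp [wedge, linePt]; field_simp; ring

lemma wedge_linePt' {v : Plane} (hv : v 0 ≠ 0) (w : Plane) (t x : ℝ) :
    wedge w (linePt v t x) = wedge w v / v 0 * x + w 0 * t / v 0 := by
  simp [wedge, linePt]; field_simp; ring

lemma linePt_edge {v : Plane} (hv : v 0 ≠ 0) {n : ℤ} {t : ℝ}
    (h : wedge v (P n) ≠ wedge v (P (n + 1))) :
    linePt v t (n + (t - wedge v (P n)) / (wedge v (P (n + 1)) - wedge v (P n))) =
      edgePt v n t := by
  have hd : wedge v (P (n + 1)) - wedge v (P n) ≠ 0 := sub_ne_zero.2 h.symm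
  apply plane_ext
  · simp [linePt, edgePt]
  · simp [linePt, edgePt]
    generalize hr : (t - wedge v (P n)) / (wedge v (P (n + 1)) - wedge v (P n)) = r
    rw [div_eq_iff hd] at hr
    simp [wedge] at hr
    field_simp
    linear_combination hr

/-- Levels tend to infinity along `Qplus`. -/
lemma exists_level_bound {v : Plane} (hv : 0 < v 0) (M : ℝ) :
    ∃ N : ℕ, ∀ x : ℝ, (N : ℝ) ≤ |x| → M < v 0 * x ^ 2 - v 1 * x := by
  obtain ⟨N, hN⟩ := exists_nat_ge ((|v 1| + |M| + 1) / v 0 + 1)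
  refine ⟨N, fun x hx => ?_⟩
  have hx' : (|v 1| + |M| + 1) / v 0 + 1 ≤ |x| := hN.trans hx
  have h1 : |v 1| + |M| + 1 ≤ v 0 * |x| := by
    rw [← div_le_iff₀' hv]; linarith
  have h2 : 1 ≤ |x| := by
    have : 0 ≤ (|v 1| + |M| + 1) / v 0 := by positivity
    linarith
  have h3 : v 1 * x ≤ |v 1| * |x| := by rw [← abs_mul]; exact le_abs_self _
  have h4 : v 0 * x ^ 2 = v 0 * |x| * |x| := by rw [← sq_abs]; ring
  rw [h4]
  nlinarith [le_abs_self M, abs_nonneg M]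

lemma wedge_ge_of_mem_Qplus {v z : Plane} (hv : 0 < v 0) (hz : z ∈ Qplus) :
    v 0 * z 0 ^ 2 - v 1 * z 0 ≤ wedge v z := by
  have := sq_le_of_mem_Qplus hz
  simp only [wedge]
  nlinarith

lemma sum_range_eq_sum_Ico (f : ℤ → ℝ) (N : ℕ) :
    ∑ k ∈ Finset.range (2 * N), f (k - N) = ∑ n ∈ Finset.Ico (-N : ℤ) N, f n := by
  apply Finset.sum_bij' (fun (k : ℕ) _ => (k : ℤ) - N) (fun (n : ℤ) _ => (n + N).toNat)
  · intro k hk; simp at hk ⊢; lia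
  · intro n hn; simp at hn ⊢; lia
  · intro k hk; simp
  · intro n hn; simp at hn ⊢; lia
  · intro k hk; rfl

/-- Integration along a line of level `t`, in terms of the edges it crosses. -/
lemma integral_line {v : Plane} (hv : 0 < v 0) {f Ψ : ℝ → ℝ}
    (hf : ∀ a b, IntervalIntegrable f volume a b)
    (hΨ : ∀ a b, ∫ x in a..b, f x = Ψ b - Ψ a) {t : ℝ} {N : ℕ}
    (hN : ∀ x : ℝ, (N : ℝ) ≤ |x| → t < v 0 * x ^ 2 - v 1 * x) :
    ∫ x, (interior Qplus).indicator (fun z => f (z 0)) (linePt v t x) =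
      ∑ n ∈ Finset.Ico (-N : ℤ) N,
        ((Set.Ioc (wedge v (P n)) (wedge v (P (n + 1)))).indicator
          (fun t => Ψ (edgePt v n t 0)) t -
        (Set.Ioc (wedge v (P (n + 1))) (wedge v (P n))).indicator
          (fun t => Ψ (edgePt v n t 0)) t) := by
  classical
  set G : ℝ → ℝ := fun x => (interior Qplus).indicator (fun z => f (z 0)) (linePt v t x) with hG
  -- The vertex contributions telescope over the unit slabs and vanish at both ends, so only the
  -- edge crossings `W` survive.
  set V : ℤ → ℝ := fun n => if wedge v (P n) < t then Ψ n else 0 with hV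
  set W : ℤ → ℝ := fun n => (Set.Ioc (wedge v (P n)) (wedge v (P (n + 1)))).indicator
      (fun t => Ψ (edgePt v n t 0)) t - (Set.Ioc (wedge v (P (n + 1))) (wedge v (P n))).indicator
      (fun t => Ψ (edgePt v n t 0)) t with hW
  have hGle : ∀ x, linePt v t x ∈ interior Qplus → v 0 * x ^ 2 - v 1 * x ≤ t := by
    intro x hx
    have := wedge_ge_of_mem_Qplus hv (interior_subset hx)
    rw [wedge_linePt hv.ne'] at this
    simpa [linePt] using this
  have hsupp : Function.support G ⊆ Set.Ioc (-(N : ℝ)) N := by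
    intro x hx
    have h1 : linePt v t x ∈ interior Qplus := by
      by_contra h
      exact hx (Set.indicator_of_notMem h _)
    have h2 : |x| < N := by
      by_contra h
      exact absurd (hN x (not_lt.1 h)) (not_lt.2 (hGle x h1))
    rw [abs_lt] at h2
    exact ⟨h2.1, h2.2.le⟩
  have hGm : ∀ n : ℤ, Set.EqOn G (fun x => if wedge v (P n) +
      (x - n) * (wedge v (P (n + 1)) - wedge v (P n)) < t then f x else 0)
      (Set.uIcc n (n + 1)) := by
    intro n x hx
    rw [Set.uIcc_of_le (by linarith)] at hx
    simp only [hG, Set.indicator_apply, linePt_mem_interior hv hx.1 hx.2]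
    simp [linePt]
  have hslab : ∀ n : ℤ, ∫ x in (n : ℝ)..(n + 1), G x = V (n + 1) - V n + W n := by
    intro n
    rw [intervalIntegral.integral_congr (hGm n), integral_slab hf hΨ]
    simp only [hV, hW, Set.indicator_apply, Int.cast_add, Int.cast_one]
    simp [edgePt]
  have hmeas : MeasurableSet {x | linePt v t x ∈ interior Qplus} := by
    apply (isOpen_interior.preimage _).measurableSet
    apply continuous_pi
    intro i
    fin_cases i
    · exact continuous_id
    · simp only [linePt]; fun_prop
  have hint : ∀ a b, IntervalIntegrable G volume a b := by
    intro a b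
    have : G = {x | linePt v t x ∈ interior Qplus}.indicator f := by
      funext x
      simp only [hG, Set.indicator_apply, Set.mem_ofPred_eq]
      simp [linePt]
    rw [this, intervalIntegrable_iff]
    exact ((intervalIntegrable_iff.1 (hf a b)).indicator hmeas)
  rw [← intervalIntegral.integral_eq_integral_of_support_subset hsupp]
  have hsum := intervalIntegral.sum_integral_adjacent_intervals (f := G) (μ := volume)
    (a := fun k : ℕ => (k : ℝ) - N) (n := 2 * N) (fun k _ => hint _ _)
  have e1 : ((0 : ℕ) : ℝ) - N = -N := by simp
  have e2 : ((2 * N : ℕ) : ℝ) - N = N := by push_cast; ring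
  rw [e1, e2] at hsum
  rw [← hsum]
  have hterm : ∀ k ∈ Finset.range (2 * N), ∫ x in ((k : ℝ) - N)..(((k + 1 : ℕ) : ℝ) - N), G x =
      (V ((k + 1 : ℕ) - N) - V (k - N)) +
      W ((k : ℤ) - N) := by
    intro k _
    have := hslab ((k : ℤ) - N)
    push_cast at this ⊢
    rw [show (k : ℝ) - N + 1 = k + 1 - N by ring, show (k : ℤ) - N + 1 = k + 1 - N by ring] at this
    exact this
  rw [Finset.sum_congr rfl hterm, Finset.sum_add_distrib, sum_range_eq_sum_Ico W N,
    Finset.sum_range_sub (fun k : ℕ => V ((k : ℤ) - N))]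
  have hV0 : ∀ n : ℤ, (N : ℝ) ≤ |(n : ℝ)| → V n = 0 := by
    intro n hn
    refine if_neg (not_lt.2 ?_)
    have := hN n hn
    simp [wedge]; linarith
  rw [hV0 _ (by push_cast; rw [show (2 : ℝ) * N - N = N by ring]; exact le_abs_self _),
    hV0 _ (by simp)]
  simp

end ParabolaSurface

/-! ### Fubini's theorem and Stokes' formula on `Qplus`. -/

namespace ParabolaSurface

/-- Fubini along the lines parallel to `v`. -/
lemma integral_plane {v : Plane} (hv : 0 < v 0) {g : Plane → ℝ} (hg : Integrable g) :
    v 0 * ∫ z, g z = ∫ t, ∫ x, g (linePt v t x) := by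
  -- This linear map sends `(x, t)` to `linePt v t x`; its determinant `1 / v 0` accounts for the
  -- factor in the statement.
  set f : Plane →ₗ[ℝ] Plane := Matrix.toLin' !![1, 0; v 1 / v 0, 1 / v 0] with hf
  have hdet : LinearMap.det f = 1 / v 0 := by
    rw [hf, LinearMap.det_toLin']; simp
  have hfc : Continuous f := f.continuous_of_finiteDimensional
  have hmap : Measure.map f volume = ENNReal.ofReal (v 0) • (volume : Measure Plane) := by
    rw [Measure.map_linearMap_addHaar_eq_smul_addHaar _ (by rw [hdet]; positivity), hdet]
    congr 2
    simp [abs_of_pos hv]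
  have hgm : AEStronglyMeasurable g (Measure.map f volume) := by
    rw [hmap]; exact hg.aestronglyMeasurable.smul_measure _
  have h1 : ∫ z, g (f z) = v 0 * ∫ z, g z := by
    rw [← integral_map hfc.measurable.aemeasurable hgm, hmap, integral_smul_measure,
      ENNReal.toReal_ofReal hv.le, smul_eq_mul]
  have h2 : Integrable fun z => g (f z) := by
    refine (integrable_map_measure hgm hfc.measurable.aemeasurable).1 ?_
    rw [hmap]; exact hg.smul_measure ENNReal.ofReal_ne_top
  have hp := (volume_preserving_finTwoArrow ℝ).symm
  have h3 : Integrable (fun p : ℝ × ℝ => g (f (MeasurableEquiv.finTwoArrow.symm p)))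
      (volume.prod volume) := hp.integrable_comp_of_integrable h2
  have h4 := hp.integral_comp (MeasurableEquiv.measurableEmbedding _) fun z => g (f z)
  rw [← h1, ← h4]
  change ∫ p, g (f (MeasurableEquiv.finTwoArrow.symm p)) ∂(volume.prod volume) = _
  rw [integral_prod_symm _ h3]
  congr 1; funext t
  congr 1; funext x
  congr 1
  apply plane_ext
  · simp [hf, linePt]
  · simp [hf, linePt]; field_simp; ring

/-- A non-vertical line cuts off a bounded piece below it, because the parabola grows quadratically.
-/
lemma volume_levels_lt_top {v : Plane} (hv : 0 < v 0) {M : ℝ} {N : ℕ}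
    (hN : ∀ x : ℝ, (N : ℝ) ≤ |x| → M < v 0 * x ^ 2 - v 1 * x) :
    volume {z : Plane | z ∈ Qplus ∧ wedge v z ≤ M} < ⊤ := by
  set K : ℝ := (|M| + |v 1| * N) / v 0 with hK
  refine (measure_mono (t := Set.Icc ![-(N : ℝ), 0] ![(N : ℝ), K]) ?_).trans_lt
    measure_Icc_lt_top
  rintro z ⟨hz, hzM⟩
  have h1 : |z 0| < N := by
    by_contra h
    have := hN _ (not_lt.1 h)
    linarith [wedge_ge_of_mem_Qplus hv hz]
  have h2 := sq_le_of_mem_Qplus hz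
  have h3 : z 1 ≤ K := by
    rw [hK, le_div_iff₀ hv]
    simp only [wedge] at hzM
    have : v 1 * z 0 ≤ |v 1| * N := (le_abs_self _).trans (by rw [abs_mul]; gcongr)
    nlinarith [le_abs_self M]
  rw [abs_lt] at h1
  constructor
  · intro i; fin_cases i
    · exact h1.1.le
    · exact (sq_nonneg _).trans h2
  · intro i; fin_cases i
    · exact h1.2.le
    · exact h3

lemma integrable_levels {v : Plane} (hv : 0 < v 0) {T : Set ℝ} (hT : MeasurableSet T) {M : ℝ}
    (hM : ∀ t ∈ T, t ≤ M) {N : ℕ} (hN : ∀ x : ℝ, (N : ℝ) ≤ |x| → M < v 0 * x ^ 2 - v 1 * x)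
    (w : Plane) {φ : ℝ → ℝ} (hφ : Measurable φ) (hφ1 : ∀ r, |φ r| ≤ 1) :
    Integrable ((interior Qplus).indicator fun z =>
      T.indicator 1 (wedge v z) * φ (wedge w z)) := by
  apply IntegrableOn.integrable_of_forall_notMem_eq_zero
    (s := {z : Plane | z ∈ Qplus ∧ wedge v z ≤ M})
  · refine IntegrableOn.of_bound (volume_levels_lt_top hv hN) ?_ 1 (Eventually.of_forall fun z => ?_)
    · refine (Measurable.indicator ?_ isOpen_interior.measurableSet).aestronglyMeasurable
      exact ((measurable_one.indicator hT).comp (continuous_wedge v).measurable).mul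
        (hφ.comp (continuous_wedge w).measurable)
    · rw [Real.norm_eq_abs]
      by_cases hz : z ∈ interior Qplus
      · rw [Set.indicator_of_mem hz, abs_mul]
        have : |T.indicator (1 : ℝ → ℝ) (wedge v z)| ≤ 1 := by
          by_cases h : wedge v z ∈ T <;> simp [h]
        calc _ ≤ (1 : ℝ) * 1 := by gcongr; exact hφ1 _
          _ = 1 := by ring
      · rw [Set.indicator_of_notMem hz]; simp
  · intro z hz
    by_cases hzi : z ∈ interior Qplus
    · have : wedge v z ∉ T := fun h => hz ⟨interior_subset hzi, hM _ h⟩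
      simp [hzi, this]
    · exact Set.indicator_of_notMem hzi _

lemma continuous_edgePt (v : Plane) (n : ℤ) : Continuous (edgePt v n) := by
  unfold edgePt; fun_prop

/-- Stokes' formula on `Qplus`, for a set of leaves parallel to `v` and a function whose derivative
along `v` is `wedge w v * φ (wedge w z)`. -/
lemma stokes_plus {v : Plane} (hv : 0 < v 0) (w : Plane) {T : Set ℝ} (hT : MeasurableSet T) {M : ℝ}
    (hM : ∀ t ∈ T, t ≤ M) {N : ℕ} (hN : ∀ x : ℝ, (N : ℝ) ≤ |x| → M < v 0 * x ^ 2 - v 1 * x)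
    {φ Φ : ℝ → ℝ} (hφ : Measurable φ) (hφ1 : ∀ r, |φ r| ≤ 1)
    (hΦ : ∀ a b, ∫ x in a..b, φ x = Φ b - Φ a) :
    wedge w v * ∫ z, (interior Qplus).indicator (fun z =>
      T.indicator 1 (wedge v z) * φ (wedge w z)) z =
    ∑ n ∈ Finset.Ico (-N : ℤ) N, ∫ t in (wedge v (P n))..(wedge v (P (n + 1))),
      T.indicator 1 t * Φ (wedge w (edgePt v n t)) := by
  have hii : ∀ (c d : ℝ) (a b : ℝ), IntervalIntegrable (fun x => φ (c * x + d)) volume a b := by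
    intro c d a b
    rw [intervalIntegrable_iff]
    refine IntegrableOn.of_bound measure_Ioc_lt_top ?_ 1 (Eventually.of_forall fun x => hφ1 _)
    exact (hφ.comp (by fun_prop)).aestronglyMeasurable
  have hΦc : Continuous Φ := by
    have h1 : Φ = fun b => (∫ x in (0 : ℝ)..b, φ x) + Φ 0 := by
      funext b; rw [hΦ]; ring
    rw [h1]
    refine (intervalIntegral.continuous_primitive (fun a b => ?_) 0).add continuous_const
    simpa using hii 1 0 a b
  set κ := wedge w v with hκ
  have hpl := integral_plane hv (integrable_levels hv hT hM hN w hφ hφ1)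
  -- Along the line of level `t` the function `wedge w` is affine in the first coordinate with slope
  -- `κ / v 0`, so the fundamental theorem of calculus reduces the integral to `Φ` at the edge
  -- crossings.
  have hline : ∀ t, κ / v 0 * ∫ x, (interior Qplus).indicator (fun z =>
      T.indicator 1 (wedge v z) * φ (wedge w z)) (linePt v t x) =
      ∑ n ∈ Finset.Ico (-N : ℤ) N,
        ((Set.Ioc (wedge v (P n)) (wedge v (P (n + 1)))).indicator
          (fun t => T.indicator 1 t * Φ (wedge w (edgePt v n t))) t -
        (Set.Ioc (wedge v (P (n + 1))) (wedge v (P n))).indicator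
          (fun t => T.indicator 1 t * Φ (wedge w (edgePt v n t))) t) := by
    intro t
    by_cases ht : t ∈ T
    · have h := integral_line hv (f := fun x => κ / v 0 * φ (κ / v 0 * x + w 0 * t / v 0))
        (Ψ := fun x => Φ (κ / v 0 * x + w 0 * t / v 0))
        (fun a b => (hii _ _ a b).const_mul _)
        (fun a b => by
          rw [intervalIntegral.integral_const_mul, intervalIntegral.mul_integral_comp_mul_add, hΦ])
        (t := t) (N := N) (fun x hx => (hM t ht).trans_lt (hN x hx))
      rw [← integral_const_mul]
      refine (integral_congr_ae (Eventually.of_forall fun x => ?_)).trans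
        (h.trans (Finset.sum_congr rfl fun n _ => ?_))
      · by_cases hx : linePt v t x ∈ interior Qplus
        · rw [Set.indicator_of_mem hx, Set.indicator_of_mem hx, wedge_linePt hv.ne',
            wedge_linePt' hv.ne', Set.indicator_of_mem ht]
          simp [linePt, hκ]
        · rw [Set.indicator_of_notMem hx, Set.indicator_of_notMem hx, mul_zero]
      · have key : ∀ (h : wedge v (P n) ≠ wedge v (P (n + 1))),
            wedge w (edgePt v n t) = κ / v 0 * edgePt v n t 0 + w 0 * t / v 0 := by
          intro h
          rw [← linePt_edge hv.ne' h, wedge_linePt' hv.ne']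
          simp [linePt, hκ]
        by_cases h1 : t ∈ Set.Ioc (wedge v (P n)) (wedge v (P (n + 1)))
        · have h2 : t ∉ Set.Ioc (wedge v (P (n + 1))) (wedge v (P n)) := fun h => by
            linarith [h.1, h1.2]
          simp only [Set.indicator_of_mem h1, Set.indicator_of_notMem h2, Set.indicator_of_mem ht,
            key (h1.1.trans_le h1.2).ne, Pi.one_apply, one_mul]
        by_cases h2 : t ∈ Set.Ioc (wedge v (P (n + 1))) (wedge v (P n))
        · simp only [Set.indicator_of_mem h2, Set.indicator_of_notMem h1, Set.indicator_of_mem ht,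
            key (h2.1.trans_le h2.2).ne', Pi.one_apply, one_mul]
        · rw [Set.indicator_of_notMem h1, Set.indicator_of_notMem h1, Set.indicator_of_notMem h2,
            Set.indicator_of_notMem h2]
    · have h1 : ∀ x, (interior Qplus).indicator (fun z =>
          T.indicator 1 (wedge v z) * φ (wedge w z)) (linePt v t x) = 0 := by
        intro x
        simp [wedge_linePt hv.ne', ht]
      simp only [h1]
      rw [Finset.sum_eq_zero]
      · simp
      · intro n _
        simp [Set.indicator_apply, ht]
  have hInt : ∀ (n : ℤ) (a b : ℝ), IntegrableOn
      (fun t => T.indicator 1 t * Φ (wedge w (edgePt v n t))) (Set.Ioc a b) := by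
    intro n a b
    have hc : Continuous fun t => Φ (wedge w (edgePt v n t)) :=
      hΦc.comp ((continuous_wedge w).comp (continuous_edgePt v n))
    have h1 : (fun t => T.indicator 1 t * Φ (wedge w (edgePt v n t))) =
        T.indicator fun t => Φ (wedge w (edgePt v n t)) := by
      funext t; by_cases h : t ∈ T <;> simp [h]
    rw [h1]
    exact (hc.integrableOn_Ioc).indicator hT
  have hInt' : ∀ (n : ℤ) (a b : ℝ), Integrable ((Set.Ioc a b).indicator
      (fun t => T.indicator 1 t * Φ (wedge w (edgePt v n t)))) := fun n a b =>
    (integrable_indicator_iff measurableSet_Ioc).2 (hInt n a b)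
  calc _ = κ / v 0 * (v 0 * ∫ z, (interior Qplus).indicator (fun z =>
        T.indicator 1 (wedge v z) * φ (wedge w z)) z) := by field_simp
    _ = ∫ t, κ / v 0 * ∫ x, (interior Qplus).indicator (fun z =>
        T.indicator 1 (wedge v z) * φ (wedge w z)) (linePt v t x) := by
        rw [hpl, integral_const_mul]
    _ = _ := by
        simp only [hline]
        refine (integral_finsetSum _ fun n _ => (hInt' n _ _).sub (hInt' n _ _)).trans
          (Finset.sum_congr rfl fun n _ => ?_)
        rw [integral_sub' (hInt' n _ _) (hInt' n _ _), integral_indicator measurableSet_Ioc,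
          integral_indicator measurableSet_Ioc]
        rfl

end ParabolaSurface

/-! ### Stokes' formula on the surface. -/

namespace ParabolaSurface

lemma wedge_mid (v : Plane) (n : ℤ) : wedge v (mid n) = wedge v (P n) + wedge v (P (n + 1)) := by
  rw [← wedge_add_right]; rfl

lemma integral_reflect (f : ℝ → ℝ) (a b : ℝ) :
    ∫ t in a..b, f (a + b - t) = ∫ t in a..b, f t := by
  rw [intervalIntegral.integral_comp_sub_left]
  congr 1 <;> ring

lemma integral_congr_uIoo {f g : ℝ → ℝ} {a b : ℝ} (h : ∀ t ∈ Set.uIoo a b, f t = g t) :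
    ∫ t in a..b, f t = ∫ t in a..b, g t := by
  apply intervalIntegral.integral_congr_ae
  have h1 : ∀ᵐ t : ℝ, t ≠ max a b := by
    simp [ae_iff, measure_singleton]
  filter_upwards [h1] with t ht htm
  refine h t ⟨htm.1, lt_of_le_of_ne htm.2 ht⟩

lemma edgePt_mid_sub {v : Plane} {n : ℤ} (t : ℝ) (hv : wedge v (P n) ≠ wedge v (P (n + 1))) :
    edgePt v n (wedge v (P n) + wedge v (P (n + 1)) - t) = mid n - edgePt v n t := by
  have hd : wedge v (P (n + 1)) - wedge v (P n) ≠ 0 := sub_ne_zero.2 hv.symm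
  have e : (wedge v (P n) + wedge v (P (n + 1)) - t - wedge v (P n)) /
      (wedge v (P (n + 1)) - wedge v (P n)) =
      1 - (t - wedge v (P n)) / (wedge v (P (n + 1)) - wedge v (P n)) := by
    field_simp; ring
  unfold edgePt
  rw [e]
  have : mid n = P n + P (n + 1) := rfl
  rw [this, sub_smul, one_smul]
  abel

lemma levels_neg (C : Set S1) (v : Plane) (t : ℝ) : t ∈ levels C (-v) ↔ -t ∈ levels C v := by
  constructor
  · rintro ⟨z, hz, rfl⟩; exact ⟨z, hz, by rw [wedge_neg_left]; ring⟩
  · rintro ⟨z, hz, h⟩; exact ⟨z, hz, by rw [wedge_neg_left, h]; ring⟩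

lemma mass_neg (C : Set S1) (v : Plane) (n : ℤ) : mass C (-v) n = -mass C v n := by
  unfold mass
  have h : ∀ t, (levels C (-v)).indicator (1 : ℝ → ℝ) t = (levels C v).indicator 1 (-t) := by
    intro t
    by_cases ht : t ∈ levels C (-v)
    · rw [Set.indicator_of_mem ht, Set.indicator_of_mem ((levels_neg C v t).1 ht)]; rfl
    · rw [Set.indicator_of_notMem ht, Set.indicator_of_notMem (fun h => ht ((levels_neg C v t).2 h))]
  simp only [h, intervalIntegral.integral_comp_neg, wedge_neg_left, neg_neg]
  rw [intervalIntegral.integral_symm]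

lemma intervalIntegrable_indicator {T : Set ℝ} (hT : MeasurableSet T) (a b : ℝ) :
    IntervalIntegrable (T.indicator (1 : ℝ → ℝ)) volume a b := by
  rw [intervalIntegrable_iff]
  exact (integrableOn_const (by simp) (C := (1 : ℝ))).indicator hT

lemma HasCyl.measurableSet_levels {C : Set S1} {v : Plane} (h : HasCyl C v) :
    MeasurableSet (levels C v) := h.isOpen_levels.measurableSet

lemma HasCyl.indicator_reflect {C : Set S1} {v : Plane} (h : HasCyl C v) {n : ℤ} {t : ℝ}
    (ht : t ∈ Set.uIoo (wedge v (P n)) (wedge v (P (n + 1)))) :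
    (levels (ParabolaSurface.rot '' C) v).indicator (1 : ℝ → ℝ)
      (wedge v (P n) + wedge v (P (n + 1)) - t) = (levels C v).indicator 1 t := by
  have := h.levels_shift ht
  rw [wedge_mid] at this
  by_cases h1 : t ∈ levels C v
  · rw [Set.indicator_of_mem h1, Set.indicator_of_mem (this.1 h1)]; rfl
  · rw [Set.indicator_of_notMem h1, Set.indicator_of_notMem (fun h => h1 (this.2 h))]

/-- The two polygons see the same part of an edge: the reflection of the level interval, whose ends
are the levels of the end points of the edge, matches the two indicator functions. -/
lemma HasCyl.mass_rot {C : Set S1} {v : Plane} (h : HasCyl C v) (n : ℤ) :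
    mass (ParabolaSurface.rot '' C) v n = mass C v n := by
  unfold mass
  rw [← integral_reflect]
  exact integral_congr_uIoo fun t ht => h.indicator_reflect ht

lemma HasCyl.exists_bound {C : Set S1} {v : Plane} (h : HasCyl C v) (hv : 0 < v 0) :
    ∃ M, ∃ N : ℕ, (∀ t ∈ levels C v, t ≤ M) ∧ (∀ t ∈ levels (ParabolaSurface.rot '' C) v, t ≤ M) ∧
      ∀ x : ℝ, (N : ℝ) ≤ |x| → M < v 0 * x ^ 2 - v 1 * x := by
  obtain ⟨M, hM⟩ := h.levels_bounded
  obtain ⟨M', hM'⟩ := h.rot.levels_bounded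
  obtain ⟨N, hN⟩ := exists_level_bound hv (max M M')
  exact ⟨max M M', N, fun t ht => (le_abs_self t).trans ((hM t ht).trans (le_max_left _ _)),
    fun t ht => (le_abs_self t).trans ((hM' t ht).trans (le_max_right _ _)), hN⟩

/-- Far from the origin both end points of an edge lie above all the levels of the cylinder, so it
does not cross that edge. -/
lemma mass_eq_zero {C : Set S1} {v : Plane} {M : ℝ} {N : ℕ}
    (hM : ∀ t ∈ levels C v, t ≤ M) (hN : ∀ x : ℝ, (N : ℝ) ≤ |x| → M < v 0 * x ^ 2 - v 1 * x)
    {n : ℤ} (hn : n ∉ Finset.Ico (-N : ℤ) N) : mass C v n = 0 := by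
  have h1 : ∀ k : ℤ, (N : ℤ) ≤ |k| → M < wedge v (P k) := by
    intro k hk
    have := hN k (by exact_mod_cast hk)
    simpa [wedge] using this
  simp only [Finset.mem_Ico, not_and_or, not_le, not_lt] at hn
  have ha : M < wedge v (P n) := h1 n (by rcases hn with hn | hn <;> [rw [abs_of_neg]; rw [abs_of_nonneg]] <;> lia)
  have hb : M < wedge v (P (n + 1)) :=
    h1 (n + 1) (by rcases hn with hn | hn <;> [rw [abs_of_nonpos]; rw [abs_of_nonneg]] <;> lia)
  unfold mass
  rw [integral_congr_uIoo (g := fun _ => 0), intervalIntegral.integral_zero]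
  intro t ht
  refine Set.indicator_of_notMem (fun h => ?_) _
  have : M < t := (lt_min ha hb).trans ht.1
  linarith [hM t h]

/-- Stokes' formula for a cylinder and a pair of functions on the two polygons whose primitives
differ by constants along the edges. -/
lemma HasCyl.stokes {C : Set S1} {v : Plane} (h : HasCyl C v) (hv : 0 < v 0) {M : ℝ} {N : ℕ}
    (hM : ∀ t ∈ levels C v, t ≤ M) (hM' : ∀ t ∈ levels (ParabolaSurface.rot '' C) v, t ≤ M)
    (hN : ∀ x : ℝ, (N : ℝ) ≤ |x| → M < v 0 * x ^ 2 - v 1 * x) (w : Plane)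
    {φ Φ ψ Ψ : ℝ → ℝ} (hφ : Measurable φ) (hφ1 : ∀ r, |φ r| ≤ 1)
    (hΦ : ∀ a b, ∫ x in a..b, φ x = Φ b - Φ a) (hψ : Measurable ψ) (hψ1 : ∀ r, |ψ r| ≤ 1)
    (hΨ : ∀ a b, ∫ x in a..b, ψ x = Ψ b - Ψ a) {c : ℤ → ℝ}
    (hc : ∀ (n : ℤ) (p : Plane), edgeFn n p = 0 → (n : ℝ) < p 0 → p 0 < n + 1 →
      Φ (wedge w p) + Ψ (wedge w (mid n) - wedge w p) = c n) :
    wedge w v * ((∫ z, (interior Qplus).indicator (fun z =>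
        (levels C v).indicator 1 (wedge v z) * φ (wedge w z)) z) +
      ∫ z, (interior Qplus).indicator (fun z =>
        (levels (ParabolaSurface.rot '' C) v).indicator 1 (wedge v z) * ψ (wedge w z)) z) =
    ∑ n ∈ Finset.Ico (-N : ℤ) N, mass C v n * c n := by
  have hprim : ∀ {φ Φ : ℝ → ℝ}, Measurable φ → (∀ r, |φ r| ≤ 1) →
      (∀ a b, ∫ x in a..b, φ x = Φ b - Φ a) → Continuous Φ := by
    intro φ Φ hφ hφ1 hΦ
    have h1 : Φ = fun b => (∫ x in (0 : ℝ)..b, φ x) + Φ 0 := by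
      funext b; rw [hΦ]; ring
    rw [h1]
    refine (intervalIntegral.continuous_primitive (fun a b => ?_) 0).add continuous_const
    rw [intervalIntegrable_iff]
    exact IntegrableOn.of_bound measure_Ioc_lt_top hφ.aestronglyMeasurable 1
      (Eventually.of_forall fun x => hφ1 _)
  have hΦc := hprim hφ hφ1 hΦ
  have hΨc := hprim hψ hψ1 hΨ
  rw [mul_add, stokes_plus hv w h.measurableSet_levels hM hN hφ hφ1 hΦ,
    stokes_plus hv w h.rot.measurableSet_levels hM' hN hψ hψ1 hΨ, ← Finset.sum_add_distrib]
  refine Finset.sum_congr rfl fun n _ => ?_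
  by_cases hne : wedge v (P n) = wedge v (P (n + 1))
  · simp [mass, hne]
  -- Reflecting the interval rewrites the contribution of the second polygon over the levels of the
  -- first. The two primitives then add up to the constant `c n` along the edge.
  rw [← integral_reflect (fun t => (levels (ParabolaSurface.rot '' C) v).indicator 1 t *
    Ψ (wedge w (edgePt v n t))), mass, ← intervalIntegral.integral_mul_const,
    integral_congr_uIoo (f := fun t => (levels (ParabolaSurface.rot '' C) v).indicator 1
      (wedge v (P n) + wedge v (P (n + 1)) - t) * _)
    (g := fun t => (levels C v).indicator 1 t * Ψ (wedge w (mid n) - wedge w (edgePt v n t)))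
    (fun t ht => by rw [h.indicator_reflect ht, edgePt_mid_sub t hne, wedge_sub_right]),
    ← intervalIntegral.integral_add]
  · refine integral_congr_uIoo fun t ht => ?_
    obtain ⟨h1, h2, h3, -, -⟩ := edgePt_spec ht
    rw [← mul_add, hc n _ h1 h2 h3]
  · exact (intervalIntegrable_indicator h.measurableSet_levels _ _).mul_continuousOn
      (hΦc.comp ((continuous_wedge w).comp (continuous_edgePt v n))).continuousOn
  · exact (intervalIntegrable_indicator h.measurableSet_levels _ _).mul_continuousOn
      (hΨc.comp (continuous_const.sub
        ((continuous_wedge w).comp (continuous_edgePt v n)))).continuousOn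

end ParabolaSurface

/-! ### Edge measures and the intersection form. -/

namespace ParabolaSurface

lemma HasCyl.mass_support_finite {C : Set S1} {v : Plane} (h : HasCyl C v) :
    (Function.support (mass C v)).Finite := by
  wlog hv : 0 < v 0 generalizing v
  · have hv' : 0 < (-v) 0 := by
      have := h.apply_zero_ne
      simp only [Pi.neg_apply, Left.neg_pos_iff]
      exact lt_of_le_of_ne (not_lt.1 hv) this
    have := this h.neg hv'
    refine this.subset fun n hn => ?_
    rw [Function.mem_support, mass_neg]
    exact neg_ne_zero.2 hn
  obtain ⟨M, N, hM, hM', hN⟩ := h.exists_bound hv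
  refine (Finset.Ico (-N : ℤ) N).finite_toSet.subset fun n hn => ?_
  by_contra h'
  exact hn (mass_eq_zero hM hN h')

/-- The finitely supported function of transverse measures of the edges. -/
noncomputable def HasCyl.massF {C : Set S1} {v : Plane} (h : HasCyl C v) : ℤ →₀ ℝ :=
  Finsupp.ofSupportFinite (mass C v) h.mass_support_finite

lemma HasCyl.massF_apply {C : Set S1} {v : Plane} (h : HasCyl C v) (n : ℤ) :
    h.massF n = mass C v n := rfl

lemma HasCyl.massF_neg {C : Set S1} {v : Plane} (h : HasCyl C v) :
    h.neg.massF = -h.massF := by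
  ext n; simp [massF_apply, mass_neg]

/-- The intersection form on finitely supported functions on the edges. -/
noncomputable def interForm (m m' : ℤ →₀ ℝ) : ℝ :=
  m.sum fun n x => m'.sum fun j y => x * y * ((n - j).sign : ℝ)

lemma sum_eq_sum_Ico {m : ℤ →₀ ℝ} {N : ℕ} (h : ∀ n, n ∉ Finset.Ico (-N : ℤ) N → m n = 0)
    (f : ℤ → ℝ) : m.sum (fun n x => x * f n) = ∑ n ∈ Finset.Ico (-N : ℤ) N, m n * f n := by
  refine Finsupp.sum_of_support_subset _ (fun n hn => ?_) _ (by simp)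
  by_contra h'
  exact Finsupp.mem_support_iff.1 hn (h n h')

lemma HasCyl.stokes_massF {C : Set S1} {v : Plane} (h : HasCyl C v) (hv : 0 < v 0) (w : Plane)
    {φ Φ ψ Ψ : ℝ → ℝ} (hφ : Measurable φ) (hφ1 : ∀ r, |φ r| ≤ 1)
    (hΦ : ∀ a b, ∫ x in a..b, φ x = Φ b - Φ a) (hψ : Measurable ψ) (hψ1 : ∀ r, |ψ r| ≤ 1)
    (hΨ : ∀ a b, ∫ x in a..b, ψ x = Ψ b - Ψ a) {c : ℤ → ℝ}
    (hc : ∀ (n : ℤ) (p : Plane), edgeFn n p = 0 → (n : ℝ) < p 0 → p 0 < n + 1 →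
      Φ (wedge w p) + Ψ (wedge w (mid n) - wedge w p) = c n) :
    wedge w v * ((∫ z, (interior Qplus).indicator (fun z =>
        (levels C v).indicator 1 (wedge v z) * φ (wedge w z)) z) +
      ∫ z, (interior Qplus).indicator (fun z =>
        (levels (ParabolaSurface.rot '' C) v).indicator 1 (wedge v z) * ψ (wedge w z)) z) =
    h.massF.sum fun n x => x * c n := by
  obtain ⟨M, N, hM, hM', hN⟩ := h.exists_bound hv
  rw [h.stokes hv hM hM' hN w hφ hφ1 hΦ hψ hψ1 hΨ hc,
    sum_eq_sum_Ico (fun n hn => mass_eq_zero hM hN hn)]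
  rfl

/-- What enters `Qplus` also leaves it: this is Stokes' formula for the constants 1 on `Qplus` and 0
on `Qminus`, which jump by 1 across every edge. -/
lemma HasCyl.sum_massF {C : Set S1} {v : Plane} (h : HasCyl C v) :
    h.massF.sum (fun _ x => x) = 0 := by
  wlog hv : 0 < v 0 generalizing v
  · have hv' : 0 < (-v) 0 := by
      have := h.apply_zero_ne
      simp only [Pi.neg_apply, Left.neg_pos_iff]
      exact lt_of_le_of_ne (not_lt.1 hv) this
    have := this h.neg hv'
    rw [h.massF_neg, Finsupp.sum_neg_index (by simp)] at this
    simpa [Finsupp.sum] using this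
  have := h.stokes_massF hv 0 (φ := fun _ => 0) (Φ := fun _ => 1) (ψ := fun _ => 0)
    (Ψ := fun _ => 0) (c := fun _ => 1) measurable_const (by simp) (by simp) measurable_const
    (by simp) (by simp) (by simp)
  simpa [wedge] using this.symm

lemma plusPart_inter (C D : Set S1) : plusPart (C ∩ D) = plusPart C ∩ plusPart D := by
  ext z; simp only [plusPart, Set.mem_inter_iff, Set.mem_ofPred_eq]; tauto

lemma rot_image_inter (C D : Set S1) : rot '' (C ∩ D) = rot '' C ∩ rot '' D :=
  Set.image_inter rot.injective

lemma HasCyl.plusPart_eq {C : Set S1} {v : Plane} (h : HasCyl C v) :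
    plusPart C = interior Qplus ∩ wedge v ⁻¹' levels C v := by
  ext z
  constructor
  · intro hz; exact ⟨hz.1, (h.mem_plusPart_iff hz.1).1 hz⟩
  · rintro ⟨hz, hz'⟩; exact (h.mem_plusPart_iff hz).2 hz'

lemma HasCyl.volume_plusPart_lt_top {C : Set S1} {v : Plane} (h : HasCyl C v) :
    volume (plusPart C) < ⊤ := by
  wlog hv : 0 < v 0 generalizing v
  · have hv' : 0 < (-v) 0 := by
      have := h.apply_zero_ne
      simp only [Pi.neg_apply, Left.neg_pos_iff]
      exact lt_of_le_of_ne (not_lt.1 hv) this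
    exact this h.neg hv'
  obtain ⟨M, N, hM, hM', hN⟩ := h.exists_bound hv
  refine (measure_mono ?_).trans_lt (volume_levels_lt_top hv hN)
  intro z hz
  exact ⟨interior_subset hz.1, hM _ ⟨z, hz, rfl⟩⟩

lemma HasCyl.area_lt_top {C : Set S1} {v : Plane} (h : HasCyl C v) : area C < ⊤ := by
  rw [area_eq]
  exact ENNReal.add_lt_top.2 ⟨h.volume_plusPart_lt_top, h.rot.volume_plusPart_lt_top⟩

lemma integral_indicator_levels {A T : Set ℝ} {v w : Plane} (hA : MeasurableSet A)
    (hT : MeasurableSet T) :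
    ∫ z, (interior Qplus).indicator (fun z =>
        A.indicator 1 (wedge v z) * T.indicator (1 : ℝ → ℝ) (wedge w z)) z =
      (volume ((interior Qplus ∩ wedge v ⁻¹' A) ∩ wedge w ⁻¹' T)).toReal := by
  have hm : MeasurableSet ((interior Qplus ∩ wedge v ⁻¹' A) ∩ wedge w ⁻¹' T) :=
    (isOpen_interior.measurableSet.inter ((continuous_wedge v).measurable hA)).inter
      ((continuous_wedge w).measurable hT)
  have := integral_indicator_one (μ := volume) hm
  rw [Measure.real] at this
  rw [← this]
  congr 1; funext z
  by_cases h1 : z ∈ interior Qplus <;> by_cases h2 : wedge v z ∈ A <;>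
    by_cases h3 : wedge w z ∈ T <;> simp [h1, h2, h3, Set.indicator]

lemma HasCyl.area_inter_toReal {C D : Set S1} {v w : Plane} (h : HasCyl C v) (h' : HasCyl D w) :
    (area (C ∩ D)).toReal = (∫ z, (interior Qplus).indicator (fun z =>
        (levels C v).indicator 1 (wedge v z) *
          (levels D w).indicator (1 : ℝ → ℝ) (wedge w z)) z) +
      ∫ z, (interior Qplus).indicator (fun z =>
        (levels (ParabolaSurface.rot '' C) v).indicator 1 (wedge v z) *
          (levels (ParabolaSurface.rot '' D) w).indicator (1 : ℝ → ℝ) (wedge w z)) z := by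
  rw [integral_indicator_levels h.measurableSet_levels h'.measurableSet_levels,
    integral_indicator_levels h.rot.measurableSet_levels h'.rot.measurableSet_levels, area_eq,
    rot_image_inter, plusPart_inter, plusPart_inter, h.plusPart_eq, h'.plusPart_eq,
    h.rot.plusPart_eq, h'.rot.plusPart_eq]
  have e : ∀ {A B D : Set Plane}, (A ∩ B) ∩ (A ∩ D) = A ∩ B ∩ D := by
    intro A B D; ext; simp only [Set.mem_inter_iff]; tauto
  rw [e, e]
  refine ENNReal.toReal_add ?_ ?_
  · refine ((measure_mono Set.inter_subset_left).trans_lt ?_).ne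
    rw [← h.plusPart_eq]; exact h.volume_plusPart_lt_top
  · refine ((measure_mono Set.inter_subset_left).trans_lt ?_).ne
    rw [← h.rot.plusPart_eq]; exact h.rot.volume_plusPart_lt_top

/-- Stokes' formula for the linear function `wedge w` on both polygons. It recovers area times
holonomy from the edge measures, and later identifies the spectral vector at 1. -/
lemma HasCyl.wedge_mul_area {C : Set S1} {v : Plane} (h : HasCyl C v) (w : Plane) :
    wedge w v * (area C).toReal = h.massF.sum fun n x => x * wedge w (mid n) := by
  wlog hv : 0 < v 0 generalizing v
  · have hv' : 0 < (-v) 0 := by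
      have := h.apply_zero_ne
      simp only [Pi.neg_apply, Left.neg_pos_iff]
      exact lt_of_le_of_ne (not_lt.1 hv) this
    have := this h.neg hv'
    rw [h.massF_neg, Finsupp.sum_neg_index (by simp)] at this
    have e : wedge w (-v) = -wedge w v := by simp [wedge]; ring
    rw [e] at this
    simp only [Finsupp.sum, neg_mul, Finset.sum_neg_distrib, neg_inj] at this ⊢
    exact this
  have := h.stokes_massF hv w (φ := Set.univ.indicator 1) (Φ := fun r => r)
    (ψ := Set.univ.indicator 1) (Ψ := fun r => r) (c := fun n => wedge w (mid n))
    (by simp [measurable_one]) (by simp) (by simp) (by simp [measurable_one]) (by simp) (by simp)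
    (by simp)
  rw [← this, integral_indicator_levels h.measurableSet_levels MeasurableSet.univ,
    integral_indicator_levels h.rot.measurableSet_levels MeasurableSet.univ, area_eq,
    ← h.plusPart_eq, ← h.rot.plusPart_eq, ENNReal.toReal_add h.volume_plusPart_lt_top.ne
      h.rot.volume_plusPart_lt_top.ne]
  simp

/-- The areas of intersections of cylinders are given by the intersection form. -/
lemma HasCyl.wedge_mul_area_inter {C D : Set S1} {v w : Plane} (h : HasCyl C v)
    (h' : HasCyl D w) :
    wedge w v * (area (C ∩ D)).toReal = interForm h.massF h'.massF := by
  wlog hv : 0 < v 0 generalizing v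
  · have hv' : 0 < (-v) 0 := by
      have := h.apply_zero_ne
      simp only [Pi.neg_apply, Left.neg_pos_iff]
      exact lt_of_le_of_ne (not_lt.1 hv) this
    have := this h.neg hv'
    rw [h.massF_neg, interForm, Finsupp.sum_neg_index (by simp)] at this
    have e : wedge w (-v) = -wedge w v := by simp [wedge]; ring
    rw [e] at this
    simp only [Finsupp.sum, neg_mul, Finset.sum_neg_distrib, neg_inj] at this ⊢
    exact this
  -- Primitives of the transverse indicator of `D` on the two polygons. Their derivative along `v`
  -- is `wedge w v` times that indicator, so Stokes' formula for `C` computes the intersection.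
  set G : ℝ → ℝ := fun r => ∫ x in (0 : ℝ)..r, (levels D w).indicator 1 x with hG
  set G' : ℝ → ℝ := fun r => ∫ x in (0 : ℝ)..r,
    (levels (ParabolaSurface.rot '' D) w).indicator 1 x with hG'
  have iG := intervalIntegrable_indicator h'.measurableSet_levels
  have iG' := intervalIntegrable_indicator h'.rot.measurableSet_levels
  have dG : ∀ a b, ∫ x in a..b, (levels D w).indicator (1 : ℝ → ℝ) x = G b - G a := fun a b =>
    (intervalIntegral.integral_interval_sub_left (iG 0 b) (iG 0 a)).symm
  have dG' : ∀ a b, ∫ x in a..b, (levels (ParabolaSurface.rot '' D) w).indicator (1 : ℝ → ℝ) x =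
      G' b - G' a := fun a b =>
    (intervalIntegral.integral_interval_sub_left (iG' 0 b) (iG' 0 a)).symm
  set c : ℤ → ℝ := fun n => G (wedge w (P n)) + G' (wedge w (P (n + 1))) with hc
  -- `D` has the same trace on an edge from both sides, so the sum of the two primitives is constant
  -- along the edge.
  have hedge : ∀ n, ∀ t ∈ Set.uIcc (wedge w (P n)) (wedge w (P (n + 1))),
      G t + G' (wedge w (P n) + wedge w (P (n + 1)) - t) = c n := by
    intro n t ht
    have h1 : ∫ x in (wedge w (P n))..t, (levels D w).indicator (1 : ℝ → ℝ) x =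
        ∫ x in (wedge w (P n))..t, (levels (ParabolaSurface.rot '' D) w).indicator 1
          (wedge w (P n) + wedge w (P (n + 1)) - x) := by
      refine integral_congr_uIoo fun x hx => (h'.indicator_reflect (n := n) ?_).symm
      have h1 := ht.1
      have h2 := ht.2
      exact ⟨(le_min (min_le_left _ _) h1).trans_lt hx.1,
        hx.2.trans_le (max_le (le_max_left _ _) h2)⟩
    rw [dG, intervalIntegral.integral_comp_sub_left, dG', add_sub_cancel_left] at h1
    rw [hc]; linarith
  -- The edges `n - 1` and `n` share a vertex, so the constants are compared by integrating over
  -- these two edges only.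
  have hdiff : ∀ n, c n - c (n - 1) = mass D w n + mass D w (n - 1) := by
    intro n
    have h1 := hedge (n - 1) (wedge w (P (n - 1 + 1))) Set.right_mem_uIcc
    rw [← h'.mass_rot, ← h'.mass_rot, mass, mass, dG', dG', ← h1, hc]
    simp only [sub_add_cancel, add_sub_cancel_right]
    ring
  have hbd : ∀ (T : Set ℝ) (r : ℝ), |T.indicator (1 : ℝ → ℝ) r| ≤ 1 := by
    intro T r; by_cases h : r ∈ T <;> simp [h]
  have := h.stokes_massF hv w (φ := (levels D w).indicator 1) (Φ := G)
    (ψ := (levels (ParabolaSurface.rot '' D) w).indicator 1) (Ψ := G') (c := c)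
    (measurable_one.indicator h'.measurableSet_levels) (hbd _) dG
    (measurable_one.indicator h'.rot.measurableSet_levels) (hbd _) dG'
    (fun n p hp h0 h1 => by
      rw [wedge_mid]
      apply hedge
      have e : wedge w p = wedge w (P n) + (p 0 - n) * (wedge w (P (n + 1)) - wedge w (P n)) := by
        simp [edgeFn] at hp
        simp [wedge]; linear_combination w 0 * hp
      rw [e]
      rcases le_total (wedge w (P n)) (wedge w (P (n + 1))) with hl | hl
      · rw [Set.uIcc_of_le hl]; constructor <;> nlinarith
      · rw [Set.uIcc_of_ge hl]; constructor <;> nlinarith)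
  rw [h.area_inter_toReal h', this]
  -- The sign kernel has the same increments as `c`, because sign jumps by 1 on entering 0 and by 1
  -- on leaving it.
  set s : ℤ → ℝ := fun n => h'.massF.sum fun j y => y * ((n - j).sign : ℝ) with hs
  have hsd : ∀ n, s n - s (n - 1) = mass D w n + mass D w (n - 1) := by
    intro n
    have h1 : ∀ j : ℤ, (((n - j).sign : ℤ) : ℝ) - (((n - 1 - j).sign : ℤ) : ℝ) =
        (if j = n then 1 else 0) + (if j = n - 1 then 1 else 0) := by
      intro j
      rcases lt_trichotomy j (n - 1) with hj | rfl | hj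
      · rw [Int.sign_eq_one_of_pos (by lia), Int.sign_eq_one_of_pos (by lia), if_neg (by lia),
          if_neg (by lia)]; simp
      · simp
      · rcases eq_or_ne j n with rfl | hj'
        · rw [if_neg (show ¬j = j - 1 by lia)]; simp
        · rw [Int.sign_eq_neg_one_of_neg (by lia), Int.sign_eq_neg_one_of_neg (by lia),
            if_neg (by lia), if_neg (by lia)]; simp
    simp only [hs, Finsupp.sum, ← Finset.sum_sub_distrib, ← mul_sub, h1, mul_add,
      Finset.sum_add_distrib, mul_ite, mul_one, mul_zero, Finset.sum_ite_eq']
    rw [← h'.massF_apply, ← h'.massF_apply]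
    congr 1 <;> simp +contextual [eq_comm]
  have hconst : ∀ n, c n = s n + (c 0 - s 0) := by
    intro n
    induction n using Int.induction_on with
    | zero => ring
    | succ i ih =>
      have h1 := hdiff (i + 1); have h2 := hsd (i + 1)
      rw [add_sub_cancel_right] at h1 h2
      linarith
    | pred i ih =>
      have h1 := hdiff (-i); have h2 := hsd (-i)
      linarith
  rw [Finsupp.sum, Finset.sum_congr rfl (fun n _ => by rw [hconst n, mul_add]),
    Finset.sum_add_distrib, ← Finset.sum_mul]
  -- The undetermined additive constant `c 0 - s 0` pairs to zero with a function of total mass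
  -- zero.
  have h0 := h.sum_massF
  simp only [Finsupp.sum] at h0
  rw [h0, zero_mul, add_zero, interForm]
  simp only [Finsupp.sum, hs, Finset.mul_sum, mul_assoc]

end ParabolaSurface

/-! ### Reflected edge measures, invariance of area, and the lattice of periods. -/

namespace ParabolaSurface

lemma mem_refl_image {c : ℤ} {E : Set S1} {x : S1} : x ∈ refl c '' E ↔ refl c x ∈ E := by
  constructor
  · rintro ⟨y, hy, rfl⟩; rwa [refl_refl]
  · intro h; exact ⟨_, h, refl_refl c x⟩

lemma mem_plusPart_refl {c : ℤ} {E : Set S1} {z : Plane} :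
    z ∈ plusPart (refl c '' E) ↔ reflMap c z ∈ plusPart E := by
  simp only [plusPart, Set.mem_ofPred_eq, mem_refl_image, reflMap_mem_interior]
  refine and_congr_right fun hz => ?_
  rw [refl_chart (mem_chartDomain_of_interior hz 0),
    chart_eq_chart_zero (reflMap_mem_interior.2 hz)]

lemma wedge_reflMat (c : ℤ) (v z : Plane) : wedge ((reflMat c).mulVec v) z =
    wedge ((reflMat c).mulVec v) (reflMap c 0) - wedge v (reflMap c z) := by
  simp [wedge, reflMat, reflMap, Matrix.mulVec, dotProduct, Fin.sum_univ_two]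
  ring

lemma mem_levels_refl {c : ℤ} {C : Set S1} {v : Plane} {t : ℝ} :
    t ∈ levels (refl c '' C) ((reflMat c).mulVec v) ↔
      wedge ((reflMat c).mulVec v) (reflMap c 0) - t ∈ levels C v := by
  constructor
  · rintro ⟨z, hz, rfl⟩
    exact ⟨reflMap c z, mem_plusPart_refl.1 hz, by rw [wedge_reflMat c v z]; ring⟩
  · rintro ⟨z, hz, h⟩
    refine ⟨reflMap c z, mem_plusPart_refl.2 (by rwa [reflMap_reflMap]), ?_⟩
    rw [wedge_reflMat c v (reflMap c z), reflMap_reflMap]; linarith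

/-- The reflection reverses both the order of the vertices and the levels; the two reversals cancel,
so the edges are permuted without a sign. -/
lemma mass_refl (c : ℤ) (C : Set S1) (v : Plane) (n : ℤ) :
    mass (refl c '' C) ((reflMat c).mulVec v) n = mass C v (c - 1 - n) := by
  unfold mass
  have h : ∀ t, (levels (refl c '' C) ((reflMat c).mulVec v)).indicator (1 : ℝ → ℝ) t =
      (levels C v).indicator 1 (wedge ((reflMat c).mulVec v) (reflMap c 0) - t) := by
    intro t
    by_cases ht : t ∈ levels (refl c '' C) ((reflMat c).mulVec v)
    · rw [Set.indicator_of_mem ht, Set.indicator_of_mem (mem_levels_refl.1 ht)]; rfl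
    · rw [Set.indicator_of_notMem ht, Set.indicator_of_notMem (fun h => ht (mem_levels_refl.2 h))]
  simp only [h, intervalIntegral.integral_comp_sub_left]
  have e1 : c - (n + 1) = c - 1 - n := by ring
  have e2 : c - n = c - 1 - n + 1 := by ring
  rw [wedge_reflMat c v (P n), wedge_reflMat c v (P (n + 1)), reflMap_P, reflMap_P, sub_sub_cancel,
    sub_sub_cancel, e1, e2]

lemma HasCyl.isOpen_plusPart_inter {C D : Set S1} {v w : Plane} (h : HasCyl C v)
    (h' : HasCyl D w) : IsOpen (plusPart (C ∩ D)) := by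
  rw [plusPart_inter]; exact h.isOpen_plusPart.inter h'.isOpen_plusPart

lemma HasCyl.area_image_inter_le {C D : Set S1} {v w : Plane} (h : HasCyl C v)
    (h' : HasCyl D w) {g : Equiv.Perm S1} {B : Matrix (Fin 2) (Fin 2) ℝ} (hg : Aff g B)
    (hB : |B.det| = 1) : area (g '' C ∩ g '' D) ≤ area (C ∩ D) := by
  rw [← Set.image_inter g.injective]
  refine area_image_le hg hB (h.disjoint_singular.mono_left Set.inter_subset_left)
    (h.isOpen_plusPart_inter h').measurableSet ?_
  rw [rot_image_inter]
  exact (h.rot.isOpen_plusPart_inter h'.rot).measurableSet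

lemma inv_image_image (g : Equiv.Perm S1) (C : Set S1) :
    (g⁻¹ : Equiv.Perm S1) '' (g '' C) = C := by
  rw [← Set.image_comp]
  convert Set.image_id C
  exact g.symm_apply_apply _

lemma abs_det_inv {B : Matrix (Fin 2) (Fin 2) ℝ} (hB : |B.det| = 1) : |B⁻¹.det| = 1 := by
  rw [Matrix.det_nonsing_inv, Ring.inverse_eq_inv', abs_inv, hB, inv_one]

/-- Affine automorphisms of determinant `±1` preserve the areas of intersections of cylinders. -/
lemma HasCyl.area_image_inter {C D : Set S1} {v w : Plane} (h : HasCyl C v)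
    (h' : HasCyl D w) {g : Equiv.Perm S1} {B : Matrix (Fin 2) (Fin 2) ℝ} (hg : Aff g B)
    (hB : |B.det| = 1) : area (g '' C ∩ g '' D) = area (C ∩ D) := by
  refine le_antisymm (h.area_image_inter_le h' hg hB) ?_
  -- The inequality for the inverse automorphism gives the converse.
  have := (h.image hg).area_image_inter_le (h'.image hg) hg.inv (abs_det_inv hB)
  rwa [inv_image_image, inv_image_image] at this

/-- The lattice `2ℤ × 4ℤ` of periods. -/
def periodLattice : AddSubgroup Plane where
  carrier := {z | ∃ a b : ℤ, z 0 = 2 * a ∧ z 1 = 4 * b}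
  zero_mem' := ⟨0, 0, by simp⟩
  add_mem' := by
    rintro z w ⟨a, b, h0, h1⟩ ⟨a', b', h0', h1'⟩
    exact ⟨a + a', b + b', by simp [h0, h0']; ring, by simp [h1, h1']; ring⟩
  neg_mem' := by
    rintro z ⟨a, b, h0, h1⟩
    exact ⟨-a, -b, by simp [h0], by simp [h1]⟩

/-- A developing map to the plane, defined modulo `periodLattice`. -/
noncomputable def devel (x : S1) : Plane :=
  match normalForm x with
  | some (Sum.inl z) => z
  | some (Sum.inr z) => z + ![1, 1]
  | none => 0

/-- All gluing translations are congruent to `(1, 1)` modulo the lattice: the second coordinate of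
`mid n` is `2 n (n + 1) + 1`, and `n (n + 1)` is even. -/
lemma devel_chart {n : ℤ} {z : Plane} (h : z ∈ chartDomain n) :
    devel (chart n z) - z ∈ periodLattice := by
  by_cases hz : z ∈ Qplus
  · rw [devel, normalForm_chart_of_mem h hz]
    simp [periodLattice.zero_mem]
  · rw [devel, normalForm_chart_of_notMem h hz]
    obtain ⟨k, hk⟩ := Int.even_mul_succ_self n
    refine ⟨-n, -k, ?_, ?_⟩
    · change z 0 - mid n 0 + 1 - z 0 = _
      simp; ring
    · have : (n : ℝ) * (n + 1) = k + k := by exact_mod_cast hk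
      change z 1 - mid n 1 + 1 - z 1 = _
      simp; linear_combination -2 * this

/-- Along a leaf, the developing map minus the position is locally constant modulo the lattice.
After one period the developed point is the same while the position has moved by `v`. -/
lemma HasCyl.mem_periodLattice {C : Set S1} {v : Plane} (h : HasCyl C v) : v ∈ periodLattice := by
  obtain ⟨x, hx⟩ := h.nonempty
  obtain ⟨F, y, -, hF, -, -, hp⟩ := h.exists_leaf hx
  set p : ℝ → Prop := fun t => devel (F (y + t • v)) - (y + t • v) - (devel (F y) - y) ∈
    periodLattice with hpdef
  have hloc : IsLocallyConstant p := by
    rw [IsLocallyConstant.iff_eventually_eq]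
    intro t
    obtain ⟨n, w, hw, he⟩ := hF t
    have h1 := eventually_line (he.and (eventually_add_mem (isOpen_chartDomain n) hw)) v t
    filter_upwards [h1] with s hs
    have e : y + t • v + (s - t) • v = y + s • v := by rw [sub_smul]; abel
    rw [e] at hs
    have h2 := devel_chart hs.2
    rw [← hs.1] at h2
    have h3 := devel_chart hw
    have h4 := he.self_of_nhds
    rw [add_zero, add_zero] at h4
    rw [← h4] at h3
    apply propext
    have h5 := periodLattice.sub_mem h2 h3
    have e2 : devel (F (y + s • v)) - (y + s • v) - (devel (F y) - y) =
        devel (F (y + t • v)) - (y + t • v) - (devel (F y) - y) +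
        (devel (F (y + s • v)) - (w + (s - t) • v) - (devel (F (y + t • v)) - w)) := by
      rw [sub_smul]; abel
    simp only [hpdef]
    rw [e2]
    exact periodLattice.add_mem_cancel_right h5
  have h0 : p 0 := by simp [hpdef, periodLattice.zero_mem]
  have h1 : p 1 := by rw [hloc.apply_eq_of_preconnectedSpace 1 0]; exact h0
  simp only [hpdef] at h1
  rw [(hp 1).2 ⟨1, by simp⟩] at h1
  simpa using h1

end ParabolaSurface

/-! ### An explicit family of cylinders. -/

namespace ParabolaSurface

/-- The holonomy of the cylinder between the edges `a - 1` and `b`. -/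
def cylVec (a b : ℤ) : Plane := ![2 * (b - a + 1), 2 * (b - a + 1) * (a + b)]

/-- The level of a point in the strip that covers the cylinder between the edges `a - 1`, `b`. -/
def lev (a b : ℤ) (z : Plane) : ℝ := z 1 - (a + b) * z 0 + a * b

/-- The strip that covers the cylinder between the edges `a - 1` and `b`. -/
def cylStrip (a b : ℤ) : Set Plane := {z | 0 < lev a b z ∧ lev a b z < b - a + 1}

/-- The covering map of the cylinder between the edges `a - 1` and `b`. -/
noncomputable def cylMap (a b : ℤ) (z : Plane) : S1 :=
  chart b (z - (⌊edgeFn (a - 1) z / (2 * (b - a + 1) ^ 2)⌋ : ℝ) • cylVec a b)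

/-- The cylinder between the edges `a - 1` and `b`. -/
noncomputable def cyl (a b : ℤ) : Set S1 := cylMap a b '' cylStrip a b

lemma lev_add_smul (a b : ℤ) (z : Plane) (t : ℝ) : lev a b (z + t • cylVec a b) = lev a b z := by
  simp [lev, cylVec]; ring

/-- `edgeFn (a - 1)` is the coordinate along the cylinder. It vanishes on the edge through which
leaves enter `Qplus` and gains `2 (b - a + 1)²` in one turn; the floor in `cylMap` selects the turn.
-/
lemma edgeFn_add_smul (a b : ℤ) (z : Plane) (t : ℝ) :
    edgeFn (a - 1) (z + t • cylVec a b) = edgeFn (a - 1) z + t * (2 * (b - a + 1) ^ 2) := by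
  simp [edgeFn, cylVec]; ring

lemma edgeFn_left (a b : ℤ) (z : Plane) :
    edgeFn (a - 1) z = lev a b z + (b - a + 1) * (z 0 - a) := by
  simp [edgeFn, lev]; ring

lemma edgeFn_right (a b : ℤ) (z : Plane) :
    edgeFn b z = lev a b z - (b - a + 1) * (z 0 - b) := by
  simp [edgeFn, lev]; ring

lemma lev_mid_sub (a b : ℤ) (z : Plane) : lev a b (mid b - z) = b - a + 1 - lev a b z := by
  simp [lev]; ring

lemma edgeFn_left_mid_sub (a b : ℤ) (z : Plane) :
    edgeFn (a - 1) (mid b - z) = 2 * (b - a + 1) ^ 2 - edgeFn (a - 1) z := by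
  rw [edgeFn_mid_sub]; push_cast; ring

/-- A turn leaves `Qplus` through the edge `b` and comes back through the edge `a - 1`, so the
holonomy is the difference of the two gluing translations. -/
lemma mid_sub_mid (a b : ℤ) : mid b - mid (a - 1) = cylVec a b := by
  apply plane_ext <;> simp [cylVec] <;> ring

lemma continuous_lev (a b : ℤ) : Continuous (lev a b) := by
  unfold lev; fun_prop

lemma isOpen_cylStrip (a b : ℤ) : IsOpen (cylStrip a b) :=
  (isOpen_lt continuous_const (continuous_lev a b)).inter
    (isOpen_lt (continuous_lev a b) continuous_const)

lemma mid_sub_mem_cylStrip {a b : ℤ} {z : Plane} (h : z ∈ cylStrip a b) :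
    mid b - z ∈ cylStrip a b := by
  constructor <;> rw [lev_mid_sub] <;> linarith [h.1, h.2]

lemma add_smul_mem_cylStrip {a b : ℤ} {z : Plane} (h : z ∈ cylStrip a b) (t : ℝ) :
    z + t • cylVec a b ∈ cylStrip a b := by
  constructor <;> rw [lev_add_smul] <;> [exact h.1; exact h.2]

lemma height_pos {a b : ℤ} (hab : a ≤ b) : (1 : ℝ) ≤ b - a + 1 := by
  have : (a : ℝ) ≤ b := by exact_mod_cast hab
  linarith

lemma cylVec_ne_zero {a b : ℤ} (hab : a ≤ b) : cylVec a b ≠ 0 := by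
  intro h
  have := congrFun h 0
  simp [cylVec] at this
  linarith [height_pos hab]

/-- The part of the strip between the lines through the two edges lies in the interior. -/
lemma mem_interior_of_cylStrip {a b : ℤ} (hab : a ≤ b) {z : Plane} (hz : z ∈ cylStrip a b)
    (ha : 0 < edgeFn (a - 1) z) (hb : 0 < edgeFn b z) : z ∈ interior Qplus := by
  have hj := height_pos hab
  have h1 : z 0 < b + 1 := by
    by_contra h; rw [edgeFn_right a] at hb; nlinarith [hz.2]
  have h2 : (a : ℝ) - 1 < z 0 := by
    by_contra h; rw [edgeFn_left a b] at ha; nlinarith [hz.2]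
  have f1 := Int.floor_le (z 0)
  have f2 := (Int.lt_floor_add_one (z 0)).le
  set n := ⌊z 0⌋ with hn
  rw [mem_interior_Qplus_of_strip f1 f2]
  have hnb : n ≤ b := by
    have : (n : ℝ) < b + 1 := f1.trans_lt h1
    exact Int.lt_add_one_iff.1 (by exact_mod_cast this)
  have hna : a - 1 ≤ n := by
    have : ((a - 1 : ℤ) : ℝ) < n + 1 := by push_cast; linarith
    exact Int.lt_add_one_iff.1 (by exact_mod_cast this)
  -- Over the two extreme unit intervals the hypotheses are the needed inequalities. In between, the
  -- edge lies on or below the chord from `P a` to `P b`, the lower side of the strip.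
  rcases eq_or_lt_of_le hnb with rfl | hnb
  · exact hb
  rcases eq_or_lt_of_le hna with hna | hna
  · rw [← hna]; exact ha
  have e : edgeFn n z = lev a b z + ((z 0 - a) * (b - z 0) - (z 0 - n) * (n + 1 - z 0)) := by
    rw [edgeFn_eq]; simp [lev]; ring
  have h3 : (a : ℝ) ≤ n := by exact_mod_cast (by lia : a ≤ n)
  have h4 : (n : ℝ) + 1 ≤ b := by exact_mod_cast (by lia : n + 1 ≤ b)
  have h5 : (z 0 - n) * (n + 1 - z 0) ≤ (z 0 - a) * (b - z 0) := by
    apply mul_le_mul <;> linarith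
  rw [e]; linarith [hz.1]

/-- The first half of a turn is in `Qplus` and the second half in the copy of `Qminus` attached
along the edge `b`; the rotation about the midpoint of that edge exchanges them. -/
lemma mem_chartDomain_of_cylStrip {a b : ℤ} (hab : a ≤ b) {z : Plane} (hz : z ∈ cylStrip a b)
    (h0 : 0 < edgeFn (a - 1) z) (h1 : edgeFn (a - 1) z < 2 * (b - a + 1) ^ 2) :
    z ∈ chartDomain b := by
  have hj := height_pos hab
  rw [mem_chartDomain]
  rcases lt_trichotomy (edgeFn b z) 0 with hb | hb | hb
  · refine Or.inr (Or.inr (mem_interior_of_cylStrip hab (mid_sub_mem_cylStrip hz) ?_ ?_))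
    · rw [edgeFn_left_mid_sub]; linarith
    · rw [edgeFn_mid_sub_self]; linarith
  · rw [edgeFn_right a] at hb
    refine Or.inr (Or.inl ⟨?_, ?_⟩) <;> by_contra h <;> nlinarith [hz.1, hz.2]
  · exact Or.inl (mem_interior_of_cylStrip hab hz h0 hb)

lemma edgeFn_left_lt {a b : ℤ} (hab : a ≤ b) {z : Plane} (hz : z ∈ cylStrip a b)
    (hb : 0 ≤ edgeFn b z) : edgeFn (a - 1) z < 2 * (b - a + 1) ^ 2 := by
  have hj := height_pos hab
  rw [edgeFn_right a] at hb
  rw [edgeFn_left a b]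
  nlinarith [hz.2]

lemma mem_strip_of_seam {a b : ℤ} (hab : a ≤ b) {z : Plane} (hz : z ∈ cylStrip a b)
    (h0 : edgeFn (a - 1) z = 0) : ((a - 1 : ℤ) : ℝ) < z 0 ∧ z 0 < (a - 1 : ℤ) + 1 := by
  have hj := height_pos hab
  rw [edgeFn_left a b] at h0
  push_cast
  constructor <;> by_contra h <;> nlinarith [hz.1, hz.2]

lemma cylMap_eq {a b : ℤ} {z : Plane}
    (h0 : 0 ≤ edgeFn (a - 1) z) (h1 : edgeFn (a - 1) z < 2 * (b - a + 1) ^ 2) :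
    cylMap a b z = chart b z := by
  have h2 : 0 < 2 * ((b : ℝ) - a + 1) ^ 2 := h0.trans_lt h1
  have : ⌊edgeFn (a - 1) z / (2 * ((b : ℝ) - a + 1) ^ 2)⌋ = 0 := by
    rw [Int.floor_eq_zero_iff]
    exact ⟨div_nonneg h0 h2.le, (div_lt_one h2).2 h1⟩
  rw [cylMap, this]; simp

lemma cylMap_add {a b : ℤ} (hab : a ≤ b) (z : Plane) (k : ℤ) :
    cylMap a b (z + (k : ℝ) • cylVec a b) = cylMap a b z := by
  have hj := height_pos hab
  have h2 : 2 * ((b : ℝ) - a + 1) ^ 2 ≠ 0 := by positivity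
  rw [cylMap, cylMap, edgeFn_add_smul, add_div, mul_div_cancel_right₀ _ h2, Int.floor_add_intCast]
  congr 1
  push_cast
  rw [add_smul]; abel

/-- Every point is a translate of one in the fundamental domain. -/
lemma exists_fund {a b : ℤ} (hab : a ≤ b) (z : Plane) : ∃ k : ℤ,
    0 ≤ edgeFn (a - 1) (z + (k : ℝ) • cylVec a b) ∧
      edgeFn (a - 1) (z + (k : ℝ) • cylVec a b) < 2 * (b - a + 1) ^ 2 := by
  have hj := height_pos hab
  have h2 : 0 < 2 * ((b : ℝ) - a + 1) ^ 2 := by positivity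
  refine ⟨-⌊edgeFn (a - 1) z / (2 * ((b : ℝ) - a + 1) ^ 2)⌋, ?_⟩
  rw [edgeFn_add_smul]
  have f1 := Int.floor_le (edgeFn (a - 1) z / (2 * ((b : ℝ) - a + 1) ^ 2))
  have f2 := Int.lt_floor_add_one (edgeFn (a - 1) z / (2 * ((b : ℝ) - a + 1) ^ 2))
  rw [le_div_iff₀ h2] at f1
  rw [div_lt_iff₀ h2] at f2
  push_cast
  constructor <;> nlinarith

/-- Only the seam `edgeFn (a - 1) = 0`, where the fundamental domain begins, needs an argument. The
chart `a - 1` covers both sides of it: by `mid_sub_mid`, the copy of `Qminus` attached along the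
edge `b`, moved back by one period, is the copy attached along the edge `a - 1`. -/
lemma locTransAt_cylMap {a b : ℤ} (hab : a ≤ b) {z : Plane} (hz : z ∈ cylStrip a b) :
    LocTransAt (cylMap a b) z := by
  have hj := height_pos hab
  have h2 : 0 < 2 * ((b : ℝ) - a + 1) ^ 2 := by positivity
  obtain ⟨k, hk0, hk1⟩ := exists_fund hab z
  suffices h : LocTransAt (cylMap a b) (z + (k : ℝ) • cylVec a b) by
    obtain ⟨n, w, hw, he⟩ := h
    refine ⟨n, w, hw, ?_⟩
    filter_upwards [he] with x hx
    rw [← hx, add_right_comm, cylMap_add hab]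
  replace hz := add_smul_mem_cylStrip hz k
  set z' := z + (k : ℝ) • cylVec a b
  have hc : Continuous fun x : Plane => edgeFn (a - 1) (z' + x) :=
    (edgeFn_continuous _).comp (continuous_const.add continuous_id)
  have hc0 := hc.tendsto 0
  rw [add_zero] at hc0
  rcases eq_or_lt_of_le hk0 with h0 | h0
  · have hs := mem_strip_of_seam hab hz h0.symm
    refine ⟨a - 1, z', mem_chartDomain.2 (Or.inr (Or.inl hs)), ?_⟩
    have hcx : Continuous fun x : Plane => (z' + x) 0 := by
      simp only [Pi.add_apply]; fun_prop
    have hcx0 := hcx.tendsto 0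
    rw [add_zero] at hcx0
    filter_upwards [hc0.eventually_const_lt (show -(2 * ((b : ℝ) - a + 1) ^ 2) < _ by linarith),
      hc0.eventually_lt_const hk1, hcx0.eventually_const_lt hs.1, hcx0.eventually_lt_const hs.2,
      eventually_add_mem (isOpen_cylStrip a b) hz] with x h3 h4 h5 h6 h7
    rcases le_or_gt 0 (edgeFn (a - 1) (z' + x)) with h8 | h8
    · have hq : z' + x ∈ Qplus := mem_Qplus_of_floor h5.le h6.le h8
      rw [cylMap_eq h8 h4, chart_of_mem hq, chart_of_mem hq]
    · have e1 : edgeFn (a - 1) (z' + x + ((1 : ℤ) : ℝ) • cylVec a b) =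
          edgeFn (a - 1) (z' + x) + 2 * ((b : ℝ) - a + 1) ^ 2 := by
        rw [edgeFn_add_smul]; push_cast; ring
      rw [← cylMap_add hab _ 1, cylMap_eq (by rw [e1]; linarith) (by rw [e1]; linarith)]
      have hm : mid b - (z' + x + ((1 : ℤ) : ℝ) • cylVec a b) = mid (a - 1) - (z' + x) := by
        rw [← mid_sub_mid, Int.cast_one, one_smul]; abel
      rw [chart_eq_iff (mem_chartDomain_of_cylStrip hab (add_smul_mem_cylStrip h7 _)
        (by rw [e1]; linarith) (by rw [e1]; linarith))
        (mem_chartDomain.2 (Or.inr (Or.inl ⟨h5, h6⟩)))]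
      refine Or.inr ⟨by rw [← neg_inj, neg_sub, neg_sub, hm], ?_⟩
      rw [hm]
      refine mem_Qplus_of_floor (n := a - 1) ?_ ?_ ?_
      · rw [Pi.sub_apply, mid_zero]; linarith
      · rw [Pi.sub_apply, mid_zero]; linarith
      · rw [edgeFn_mid_sub_self]; linarith
  · refine ⟨b, z', mem_chartDomain_of_cylStrip hab hz h0 hk1, ?_⟩
    filter_upwards [hc0.eventually_const_lt h0, hc0.eventually_lt_const hk1] with x h3 h4
    exact cylMap_eq h3.le h4

/-- Seam points lie on the edge `a - 1`, outside `chartDomain b`, and are read in the chart `a - 1`.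
An identification between the two charts through `Qminus` would be a shift by a full turn, which
does not fit into the fundamental domain. -/
lemma chart_inj_fund {a b : ℤ} (hab : a ≤ b) {z w : Plane} (hz : z ∈ cylStrip a b)
    (hw : w ∈ cylStrip a b) (hz0 : 0 ≤ edgeFn (a - 1) z)
    (hz1 : edgeFn (a - 1) z < 2 * (b - a + 1) ^ 2) (hw0 : 0 ≤ edgeFn (a - 1) w)
    (hw1 : edgeFn (a - 1) w < 2 * (b - a + 1) ^ 2) (h : chart b z = chart b w) : z = w := by
  have hrep : ∀ {z : Plane}, z ∈ cylStrip a b → 0 ≤ edgeFn (a - 1) z →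
      edgeFn (a - 1) z < 2 * (b - a + 1) ^ 2 → ∃ n : ℤ, (n = b ∨ n = a - 1) ∧
        z ∈ chartDomain n ∧ chart b z = chart n z := by
    intro z hz h0 h1
    rcases eq_or_lt_of_le h0 with h0 | h0
    · have hs := mem_strip_of_seam hab hz h0.symm
      refine ⟨a - 1, Or.inr rfl, mem_chartDomain.2 (Or.inr (Or.inl hs)), ?_⟩
      have hq : z ∈ Qplus := mem_Qplus_of_floor hs.1.le hs.2.le h0.le
      rw [chart_of_mem hq, chart_of_mem hq]
    · exact ⟨b, Or.inl rfl, mem_chartDomain_of_cylStrip hab hz h0 h1, rfl⟩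
  obtain ⟨n, hn, hzn, ezn⟩ := hrep hz hz0 hz1
  obtain ⟨m, hm, hwm, ewm⟩ := hrep hw hw0 hw1
  rw [ezn, ewm, chart_eq_iff hzn hwm] at h
  have key : ∀ {z w : Plane}, 0 ≤ edgeFn (a - 1) w → edgeFn (a - 1) z < 2 * (b - a + 1) ^ 2 →
      z - mid b = w - mid (a - 1) → False := by
    intro z w hw hz h
    have e : z = w + (1 : ℝ) • cylVec a b := by
      rw [one_smul, ← mid_sub_mid, add_sub_left_comm, ← h]
      abel
    rw [e, edgeFn_add_smul] at hz
    linarith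
  rcases h with h | h
  · exact h.1
  · rcases hn with rfl | rfl <;> rcases hm with rfl | rfl
    · simpa using h.1
    · exact (key hw0 hz1 h.1).elim
    · exact (key hz0 hw1 h.1.symm).elim
    · simpa using h.1

lemma cylMap_eq_iff {a b : ℤ} (hab : a ≤ b) {z w : Plane} (hz : z ∈ cylStrip a b)
    (hw : w ∈ cylStrip a b) :
    cylMap a b z = cylMap a b w ↔ ∃ k : ℤ, w = z + (k : ℝ) • cylVec a b := by
  constructor
  · intro h
    obtain ⟨k, hk0, hk1⟩ := exists_fund hab z
    obtain ⟨l, hl0, hl1⟩ := exists_fund hab w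
    rw [← cylMap_add hab z k, ← cylMap_add hab w l, cylMap_eq hk0 hk1, cylMap_eq hl0 hl1] at h
    have := chart_inj_fund hab (add_smul_mem_cylStrip hz k) (add_smul_mem_cylStrip hw l)
      hk0 hk1 hl0 hl1 h
    refine ⟨k - l, ?_⟩
    push_cast
    rw [sub_smul, ← add_sub_assoc, this]; abel
  · rintro ⟨k, rfl⟩
    exact (cylMap_add hab z k).symm

lemma cylStrip_nonempty {a b : ℤ} (hab : a ≤ b) : (cylStrip a b).Nonempty := by
  have hj := height_pos hab
  refine ⟨![0, (b - a + 1) / 2 - a * b], ?_, ?_⟩ <;> simp [lev] <;> linarith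

lemma hasCyl_cyl {a b : ℤ} (hab : a ≤ b) : HasCyl (cyl a b) (cylVec a b) :=
  ⟨cylVec_ne_zero hab, cylStrip a b, cylMap a b, isOpen_cylStrip a b, cylStrip_nonempty hab,
    fun _ hz t => add_smul_mem_cylStrip hz t, fun _ hz => locTransAt_cylMap hab hz,
    fun _ hz _ hw => cylMap_eq_iff hab hz hw, rfl⟩

lemma cylMap_of_interior {a b : ℤ} (hab : a ≤ b) {z : Plane} (hz : z ∈ cylStrip a b)
    (hi : z ∈ interior Qplus) : cylMap a b z = chart 0 z := by
  rw [cylMap_eq (mem_interior_Qplus.1 hi _).le (edgeFn_left_lt hab hz (mem_interior_Qplus.1 hi _).le),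
    chart_eq_chart_zero hi]

lemma plusPart_cyl {a b : ℤ} (hab : a ≤ b) : plusPart (cyl a b) = interior Qplus ∩ cylStrip a b := by
  ext z
  constructor
  · rintro ⟨hi, w, hw, h⟩
    refine ⟨hi, ?_⟩
    obtain ⟨k, hk0, hk1⟩ := exists_fund hab w
    rw [← cylMap_add hab w k, cylMap_eq hk0 hk1] at h
    replace hw := add_smul_mem_cylStrip hw k
    set w' := w + (k : ℝ) • cylVec a b
    rcases eq_or_lt_of_le hk0 with h0 | h0
    · exfalso
      have hs := mem_strip_of_seam hab hw h0.symm
      have hq : w' ∈ Qplus := mem_Qplus_of_floor hs.1.le hs.2.le hk0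
      rw [chart_of_mem hq, ← chart_of_mem (n := a - 1) hq,
        chart_eq_iff (mem_chartDomain.2 (Or.inr (Or.inl hs))) (mem_chartDomain_of_interior hi 0)] at h
      rcases h with h | h
      · rw [h.1] at h0
        exact (mem_interior_Qplus.1 hi (a - 1)).ne h0
      · have h1 := mem_Qplus.1 h.2 0
        have h2 : mid (a - 1) - w' = mid 0 - z := by rw [← neg_sub, h.1, neg_sub]
        rw [h2, edgeFn_mid_sub_self] at h1
        linarith [mem_interior_Qplus.1 hi 0]
    · rw [chart_eq_iff (mem_chartDomain_of_cylStrip hab hw h0 hk1)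
        (mem_chartDomain_of_interior hi 0)] at h
      rcases h with h | h
      · rw [← h.1]; exact hw
      · have h1 := mem_Qplus.1 h.2 0
        have h2 : mid b - w' = mid 0 - z := by rw [← neg_sub, h.1, neg_sub]
        rw [h2, edgeFn_mid_sub_self] at h1
        linarith [mem_interior_Qplus.1 hi 0]
  · rintro ⟨hi, hz⟩
    exact ⟨hi, z, hz, cylMap_of_interior hab hz hi⟩

/-- The rotation about the midpoint of the edge `b` preserves the strip. This inclusion lets
maximality in `Qplus` control the other polygon too. -/
lemma plusPart_cyl_subset_rot {a b : ℤ} (hab : a ≤ b) :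
    plusPart (cyl a b) ⊆ plusPart (rot '' cyl a b) := by
  rw [plusPart_cyl hab]
  rintro z ⟨hi, hz⟩
  refine ⟨hi, ?_⟩
  have h0 := mem_interior_Qplus.1 hi (a - 1)
  have h1 := edgeFn_left_lt hab hz (mem_interior_Qplus.1 hi b).le
  rw [mem_rot_image, ← chart_eq_chart_zero hi b, rot_chart (mem_chartDomain_of_interior hi b)]
  refine ⟨mid b - z, mid_sub_mem_cylStrip hz, cylMap_eq ?_ ?_⟩ <;> rw [edgeFn_left_mid_sub] <;>
    linarith

end ParabolaSurface

/-! ### Edge measures of the explicit cylinders; rigidity in the slopes 0 and 1. -/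

namespace ParabolaSurface

lemma wedge_cylVec (a b : ℤ) (z : Plane) :
    wedge (cylVec a b) z = 2 * (b - a + 1) * (lev a b z - a * b) := by
  simp [wedge, cylVec, lev]; ring

lemma levels_cyl {a b : ℤ} (hab : a ≤ b) : levels (cyl a b) (cylVec a b) =
    Set.Ioo (2 * ((b : ℝ) - a + 1) * (-(a * b))) (2 * (b - a + 1) * (b - a + 1 - a * b)) := by
  have hj := height_pos hab
  have hab' : (a : ℝ) ≤ b := by exact_mod_cast hab
  ext t
  constructor
  · rintro ⟨z, hz, rfl⟩
    rw [plusPart_cyl hab] at hz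
    have h1 := hz.2.1
    have h2 := hz.2.2
    rw [wedge_cylVec]
    constructor <;> apply mul_lt_mul_of_pos_left <;> linarith
  · intro ht
    set q := t / (2 * ((b : ℝ) - a + 1)) with hq
    have htq : t = 2 * ((b : ℝ) - a + 1) * q := by rw [hq]; field_simp
    rw [htq] at ht
    have h1 := lt_of_mul_lt_mul_left ht.1 (by linarith)
    have h2 := lt_of_mul_lt_mul_left ht.2 (by linarith)
    set z : Plane := ![(a + b) / 2, q + (a + b) * ((a + b) / 2)] with hz
    have hl : lev a b z = q + a * b := by simp [lev, hz]
    have hs : z ∈ cylStrip a b := ⟨by rw [hl]; linarith, by rw [hl]; linarith⟩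
    have hz0 : z 0 = (a + b) / 2 := rfl
    refine ⟨z, ?_, ?_⟩
    · rw [plusPart_cyl hab]
      refine ⟨mem_interior_of_cylStrip hab hs ?_ ?_, hs⟩
      · rw [edgeFn_left a b, hl, hz0]; nlinarith
      · rw [edgeFn_right a b, hl, hz0]; nlinarith
    · rw [wedge_cylVec, hl, htq]; ring

lemma lev_P (a b n : ℤ) : lev a b (P n) = (((n - a) * (n - b) : ℤ) : ℝ) := by
  simp [lev]; ring

/-- The leaves enter `Qplus` through the whole edge `a - 1` and leave it through the whole edge `b`.
Each of these edges spans all the levels of the cylinder, and no other edge meets them. -/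
lemma mass_cyl {a b : ℤ} (hab : a ≤ b) (n : ℤ) : mass (cyl a b) (cylVec a b) n =
    (Finsupp.single b (2 * ((b : ℝ) - a + 1) ^ 2) -
      Finsupp.single (a - 1) (2 * ((b : ℝ) - a + 1) ^ 2) : ℤ →₀ ℝ) n := by
  have hj := height_pos hab
  unfold mass
  rw [levels_cyl hab, wedge_cylVec, wedge_cylVec, lev_P, lev_P]
  set α : ℝ := 2 * ((b : ℝ) - a + 1) * (-(a * b))
  set β : ℝ := 2 * ((b : ℝ) - a + 1) * (b - a + 1 - a * b)
  rcases eq_or_ne n b with rfl | hnb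
  · rw [integral_congr_uIoo (g := fun _ => 1)]
    · have : n ≠ a - 1 := by lia
      simp [this]; ring
    · intro t ht
      refine Set.indicator_of_mem ?_ _
      have e1 : 2 * ((n : ℝ) - a + 1) * ((((n - a) * (n - n) : ℤ) : ℝ) - a * n) = α := by
        push_cast; ring
      have e2 : 2 * ((n : ℝ) - a + 1) * ((((n + 1 - a) * (n + 1 - n) : ℤ) : ℝ) - a * n) = β := by
        push_cast; ring
      rw [e1, e2, Set.uIoo_of_lt] at ht
      · exact ht
      · apply mul_lt_mul_of_pos_left <;> linarith
  rcases eq_or_ne n (a - 1) with rfl | hna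
  · rw [integral_congr_uIoo (g := fun _ => 1)]
    · have : a - 1 ≠ b := by lia
      simp [this]; ring
    · intro t ht
      refine Set.indicator_of_mem ?_ _
      have e1 : 2 * ((b : ℝ) - a + 1) * ((((a - 1 - a) * (a - 1 - b) : ℤ) : ℝ) - a * b) = β := by
        push_cast; ring
      have e2 : 2 * ((b : ℝ) - a + 1) * ((((a - 1 + 1 - a) * (a - 1 + 1 - b) : ℤ) : ℝ) - a * b)
          = α := by
        push_cast; ring
      rw [e1, e2, Set.uIoo_of_gt] at ht
      · exact ht
      · apply mul_lt_mul_of_pos_left <;> linarith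
  rw [integral_congr_uIoo (g := fun _ => 0)]
  · simp [hnb, hna]
  · intro t ht
    refine Set.indicator_of_notMem (fun h => ?_) _
    -- Vertices with index from `a` to `b` are at or below the lowest level, and all the others are
    -- at or above the highest.
    by_cases hm : a ≤ n ∧ n < b
    · have h1 : ((((n - a) * (n - b) : ℤ)) : ℝ) ≤ 0 := by
        exact_mod_cast mul_nonpos_of_nonneg_of_nonpos (by lia) (by lia)
      have h2 : ((((n + 1 - a) * (n + 1 - b) : ℤ)) : ℝ) ≤ 0 := by
        exact_mod_cast mul_nonpos_of_nonneg_of_nonpos (by lia) (by lia)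
      have h3 : t < α := by
        refine ht.2.trans_le (max_le ?_ ?_) <;> apply mul_le_mul_of_nonneg_left <;> linarith
      linarith [h.1]
    · have key : ∀ k : ℤ, k ≤ a - 1 ∨ b + 1 ≤ k → b - a + 1 ≤ (k - a) * (k - b) := by
        rintro k (hk | hk) <;> nlinarith
      have h1 : (b : ℝ) - a + 1 ≤ (((n - a) * (n - b) : ℤ)) := by
        exact_mod_cast key n (by lia)
      have h2 : (b : ℝ) - a + 1 ≤ (((n + 1 - a) * (n + 1 - b) : ℤ)) := by
        exact_mod_cast key (n + 1) (by lia)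
      have h3 : β < t := by
        refine (le_min ?_ ?_).trans_lt ht.1 <;> apply mul_le_mul_of_nonneg_left <;> linarith
      linarith [h.2]

lemma massF_cyl {a b : ℤ} (hab : a ≤ b) : (hasCyl_cyl hab).massF =
    Finsupp.single b (2 * ((b : ℝ) - a + 1) ^ 2) -
      Finsupp.single (a - 1) (2 * ((b : ℝ) - a + 1) ^ 2) := by
  ext n
  rw [HasCyl.massF_apply, mass_cyl hab]

/-- A cylinder in the direction of `cyl a b` that meets it has the same circumference. -/
lemma HasCyl.abs_eq_one {C : Set S1} {a b : ℤ} (hab : a ≤ b) {r : ℝ}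
    (h : HasCyl C (r • cylVec a b)) {z : Plane} (hz : z ∈ cylStrip a b)
    (hC : cylMap a b z ∈ C) : |r| = 1 := by
  obtain ⟨F, y, hy, hF, _, _, hp⟩ := h.exists_leaf hC
  have hr : r ≠ 0 := by rintro rfl; exact h.1 (by simp)
  have h1 : ∀ t : ℝ, F (y + t • r • cylVec a b) = cylMap a b (z + t • r • cylVec a b) := by
    intro t
    refine eq_of_locTransAt isPreconnected_univ (fun t _ => hF t) (fun t _ => ?_)
      (Set.mem_univ 0) (Set.mem_univ t) (by simpa using hy)
    rw [smul_smul]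
    exact locTransAt_cylMap hab (add_smul_mem_cylStrip hz _)
  -- Both sides describe the returns of the same leaf, once in units of `r • cylVec a b` and once in
  -- units of `cylVec a b`; hence `r` and `1 / r` are integers.
  have h2 : ∀ t : ℝ, (∃ k : ℤ, t = k) ↔ ∃ k : ℤ, t * r = k := by
    intro t
    rw [← hp t, h1, hy, eq_comm, smul_smul, cylMap_eq_iff hab hz (add_smul_mem_cylStrip hz _)]
    refine exists_congr fun k => ?_
    rw [add_right_inj]
    exact ⟨fun h => smul_left_injective ℝ (cylVec_ne_zero hab) h, fun h => by rw [h]⟩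
  obtain ⟨k, hk⟩ := (h2 1).1 ⟨1, by simp⟩
  obtain ⟨l, hl⟩ := (h2 (1 / r)).2 ⟨1, by field_simp; simp⟩
  rw [one_mul] at hk
  have h3 : (l * k : ℤ) = 1 := by
    have : (l : ℝ) * k = 1 := by rw [← hl, ← hk]; field_simp
    exact_mod_cast this
  rw [hk]
  rcases Int.isUnit_iff.1 (IsUnit.of_mul_eq_one _ ((mul_comm _ _).trans h3)) with rfl | rfl <;> simp

lemma HasCyl.plusPart_nonempty {C : Set S1} {v : Plane} (h : HasCyl C v) :
    (plusPart C).Nonempty ∨ (plusPart (ParabolaSurface.rot '' C)).Nonempty := by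
  obtain ⟨x, hx⟩ := h.nonempty
  have hxs : x ∉ singular := Set.disjoint_left.1 h.disjoint_singular hx
  obtain ⟨n, z, hz, rfl⟩ := exists_chart hxs
  rcases mem_chartDomain.1 hz with hi | hi | hi
  · left
    exact ⟨z, hi, by rwa [← chart_eq_chart_zero hi n]⟩
  · obtain ⟨F, y, hy, hF, hC, -, -⟩ := h.exists_leaf hx
    have hF0 := hF 0
    rw [zero_smul, add_zero] at hF0
    have hev := hF0.eventually_eq (locTransAt_chart hz) hy
    rcases lt_or_ge (edgeFn n z) 0 with he | he
    · right
      have hi' : mid n - z ∈ interior Qplus := by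
        rw [mem_interior_Qplus_of_strip (n := n), edgeFn_mid_sub_self]
        · linarith
        · simp; linarith
        · simp; linarith
      exact ⟨_, hi', by rw [mem_rot_image, ← chart_eq_chart_zero hi' n,
        rot_chart (mem_chartDomain_of_interior hi' n), sub_sub_cancel]; exact hx⟩
    · left
      have h1 : Tendsto (fun ε : ℝ => ε • (![0, 1] : Plane)) (𝓝[>] 0) (𝓝 0) := by
        refine (Continuous.tendsto' (by fun_prop) 0 0 (by simp)).mono_left nhdsWithin_le_nhds
      obtain ⟨ε, ⟨h2, h3⟩, hε⟩ :=
        ((h1.eventually (hC.and hev)).and self_mem_nhdsWithin).exists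
      have hi' : z + ε • (![0, 1] : Plane) ∈ interior Qplus := by
        rw [mem_interior_Qplus_of_strip (n := n)]
        · have : edgeFn n (z + ε • (![0, 1] : Plane)) = edgeFn n z + ε := by
            simp [edgeFn]; ring
          rw [this]
          have : 0 < ε := hε
          linarith
        · simpa using hi.1.le
        · simpa using hi.2.le
      exact ⟨_, hi', by rw [← chart_eq_chart_zero hi' n, ← h3]; exact h2⟩
  · right
    exact ⟨_, hi, by rw [mem_rot_image, ← chart_eq_chart_zero hi n,
      rot_chart (mem_chartDomain_of_interior hi n), sub_sub_cancel]; exact hx⟩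

/-- The numbers `n (n - s)` with `n ≥ s` increase from 0 to infinity, and the gap after the `n`-th
one is the range of heights of `cyl (s - n) n`. -/
lemma exists_between {s : ℤ} (hs : s = 0 ∨ s = 1) {q : ℝ} (hq : 0 < q)
    (hq' : ∀ n : ℤ, q ≠ n * (n - s)) :
    ∃ n : ℤ, s ≤ n ∧ (n : ℝ) * (n - s) < q ∧ q < (n + 1) * (n + 1 - s) := by
  classical
  have hs0 : (0 : ℝ) ≤ s := by rcases hs with rfl | rfl <;> simp
  have hex : ∃ k : ℕ, q < (s + k + 1) * (k + 1) := by
    obtain ⟨k, hk⟩ := exists_nat_gt q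
    refine ⟨k, hk.trans_le ?_⟩
    have : (0 : ℝ) ≤ k := Nat.cast_nonneg k
    nlinarith
  refine ⟨s + Nat.find hex, by lia, ?_, ?_⟩
  · push_cast
    rcases Nat.eq_zero_or_pos (Nat.find hex) with h0 | h0
    · rw [h0]; simpa using hq
    · obtain ⟨k, hk⟩ := Nat.exists_eq_succ_of_ne_zero h0.ne'
      have h1 := Nat.find_min hex (m := k) (by lia)
      have h2 := hq' (s + (k + 1))
      push_cast at h2
      rw [hk]
      push_cast
      rw [not_lt] at h1
      refine lt_of_le_of_ne ?_ (fun h => h2 (by linarith))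
      linarith
  · have := Nat.find_spec hex
    push_cast
    linarith

/-- The leaves of slope `s ∈ {0, 1}` belong to the cylinders `cyl (s - n) n`. -/
lemma HasCyl.period_of_slope {C : Set S1} {s : ℤ} (hs : s = 0 ∨ s = 1) {r : ℝ}
    (h : HasCyl C (r • ![1, (s : ℝ)])) {z : Plane} (hz : z ∈ plusPart C)
    (hq : ∀ n : ℤ, z 1 - s * z 0 ≠ n * (n - s)) :
    ∃ n : ℤ, s ≤ n ∧ z ∈ cylStrip (s - n) n ∧ |r| = 2 * (2 * n - s + 1) := by
  have hq0 : 0 < z 1 - s * z 0 := by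
    have h0 := mem_interior_Qplus.1 hz.1 0
    have h1 := mem_interior_Qplus.1 hz.1 (-1)
    simp [edgeFn] at h0 h1
    rcases hs with rfl | rfl
    · simp; linarith
    · simp; linarith
  obtain ⟨n, hn, h1, h2⟩ := exists_between hs hq0 hq
  have hstrip : z ∈ cylStrip (s - n) n := by
    constructor <;> simp only [lev] <;> push_cast <;> linarith
  refine ⟨n, hn, hstrip, ?_⟩
  have hn0 : 0 ≤ n := by lia
  have hab : s - n ≤ n := by lia
  have hj := height_pos hab
  push_cast at hj
  set j : ℝ := 2 * (2 * n - s + 1) with hjd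
  have hj0 : 0 < j := by rw [hjd]; linarith
  have e : r • (![1, (s : ℝ)] : Plane) = (r / j) • cylVec (s - n) n := by
    apply plane_ext
    · simp [cylVec]; field_simp; ring
    · simp [cylVec]; field_simp; ring
  rw [e] at h
  have := h.abs_eq_one hab hstrip (by rw [cylMap_of_interior hab hstrip hz.1]; exact hz.2)
  rw [abs_div, abs_of_pos hj0] at this
  field_simp at this
  exact this

/-- The excluded heights are those of the vertices. They form a countable set, and the levels of a
cylinder are open. -/
lemma HasCyl.exists_generic {C : Set S1} {s : ℤ} {r : ℝ}
    (h : HasCyl C (r • ![1, (s : ℝ)])) {T : Set ℝ} (hT : IsOpen T)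
    (hne : (levels C (r • ![1, (s : ℝ)]) ∩ T).Nonempty) :
    ∃ z ∈ plusPart C, wedge (r • ![1, (s : ℝ)]) z ∈ T ∧
      ∀ n : ℤ, z 1 - s * z 0 ≠ n * (n - s) := by
  have hr : r ≠ 0 := by rintro rfl; exact h.1 (by simp)
  have hd := (Set.countable_range fun n : ℤ => r * (n * (n - s) : ℝ)).dense_compl ℝ
  obtain ⟨t, ⟨⟨z, hz, rfl⟩, ht⟩, ht'⟩ := hd.inter_open_nonempty _ (h.isOpen_levels.inter hT) hne
  refine ⟨z, hz, ht, fun n hn => ht' ⟨n, ?_⟩⟩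
  simp only [← hn]
  simp [wedge]; ring

/-- The circumferences of the cylinders of slope `s ∈ {0, 1}`. -/
lemma HasCyl.exists_period {C : Set S1} {s : ℤ} (hs : s = 0 ∨ s = 1) {r : ℝ}
    (h : HasCyl C (r • ![1, (s : ℝ)])) : ∃ n : ℤ, s ≤ n ∧ |r| = 2 * (2 * n - s + 1) := by
  wlog hne : (plusPart C).Nonempty generalizing C
  · exact this h.rot (h.plusPart_nonempty.resolve_left hne)
  obtain ⟨z, hz, -, hq⟩ := h.exists_generic isOpen_univ (by simpa [levels] using hne)
  obtain ⟨n, hn, -, h'⟩ := h.period_of_slope hs hz hq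
  exact ⟨n, hn, h'⟩

lemma cylVec_slope (s n : ℤ) :
    cylVec (s - n) n = (2 * (2 * n - s + 1) : ℝ) • ![1, (s : ℝ)] := by
  apply plane_ext
  · simp [cylVec]; ring
  · change 2 * ((n : ℝ) - (s - n : ℤ) + 1) * ((s - n : ℤ) + n) = 2 * (2 * n - s + 1) * s
    push_cast; ring

/-- The cylinders `cyl (s - n) n` are maximal. -/
lemma HasCyl.plusPart_subset {C : Set S1} {s n : ℤ} (hs : s = 0 ∨ s = 1) (hn : s ≤ n)
    (h : HasCyl C (cylVec (s - n) n)) : plusPart C ⊆ plusPart (cyl (s - n) n) := by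
  have hn0 : 0 ≤ n := by lia
  have hab : s - n ≤ n := by lia
  have hj := height_pos hab
  have key : levels C (cylVec (s - n) n) ⊆ levels (cyl (s - n) n) (cylVec (s - n) n) := by
    rw [levels_cyl hab]
    set α := 2 * ((n : ℝ) - (s - n : ℤ) + 1) * (-((s - n : ℤ) * n))
    set β := 2 * ((n : ℝ) - (s - n : ℤ) + 1) * (n - (s - n : ℤ) + 1 - (s - n : ℤ) * n)
    -- The levels are open, so containment in the closed interval is enough. A generic leaf outside
    -- it would belong to some `cyl (s - m) m`, and comparing circumferences forces `m = n`.
    rw [← interior_Icc]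
    refine interior_maximal ?_ h.isOpen_levels
    by_contra hcon
    obtain ⟨t, ht, ht'⟩ := Set.not_subset.1 hcon
    have h' := h
    rw [cylVec_slope] at h'
    obtain ⟨z, hz, hzt, hq⟩ := h'.exists_generic (T := (Set.Icc α β)ᶜ) isClosed_Icc.isOpen_compl
      ⟨t, by rwa [← cylVec_slope], ht'⟩
    obtain ⟨m, hm, hzm, he⟩ := h'.period_of_slope hs hz hq
    have hmn : m = n := by
      push_cast at hj
      rw [abs_of_pos (by linarith)] at he
      have : (m : ℝ) = n := by linarith
      exact_mod_cast this
    subst hmn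
    apply hzt
    rw [← cylVec_slope, wedge_cylVec]
    have h1 := hzm.1
    have h2 := hzm.2
    constructor <;> apply mul_le_mul_of_nonneg_left <;> linarith
  intro z hz
  rw [(hasCyl_cyl hab).mem_plusPart_iff hz.1]
  exact key ⟨z, hz, rfl⟩

lemma HasCyl.area_inter_le {C : Set S1} {s n : ℤ} (hs : s = 0 ∨ s = 1) (hn : s ≤ n)
    (h : HasCyl C (cylVec (s - n) n)) (E : Set S1) :
    area (E ∩ C) ≤ area (E ∩ cyl (s - n) n) := by
  have hn0 : 0 ≤ n := by lia
  have hab : s - n ≤ n := by lia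
  rw [area_eq, area_eq, rot_image_inter, rot_image_inter, plusPart_inter, plusPart_inter,
    plusPart_inter, plusPart_inter]
  gcongr
  · exact h.plusPart_subset hs hn
  · exact (h.rot.plusPart_subset hs hn).trans (plusPart_cyl_subset_rot hab)

/-- An affine automorphism that preserves the holonomy of `cyl (s - n) n` preserves the areas of
intersections with it. -/
lemma HasCyl.area_image_inter_cyl {C : Set S1} {v : Plane} (h : HasCyl C v) {s n : ℤ}
    (hs : s = 0 ∨ s = 1) (hn : s ≤ n) {g : Equiv.Perm S1} {B : Matrix (Fin 2) (Fin 2) ℝ}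
    (hg : Aff g B) (hB : |B.det| = 1) {ε : ℝ} (hε : ε = 1 ∨ ε = -1)
    (hv : B.mulVec (cylVec (s - n) n) = ε • cylVec (s - n) n) :
    area (g '' C ∩ cyl (s - n) n) = area (C ∩ cyl (s - n) n) := by
  have hn0 : 0 ≤ n := by lia
  have hab : s - n ≤ n := by lia
  set D := cyl (s - n) n
  have hD : HasCyl D (cylVec (s - n) n) := hasCyl_cyl hab
  have h1 : HasCyl (g '' D) (cylVec (s - n) n) := by
    have := hD.image hg
    rw [hv] at this
    rcases hε with rfl | rfl
    · simpa using this
    · simpa using this.neg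
  have h2 : HasCyl ((g⁻¹ : Equiv.Perm S1) '' D) (cylVec (s - n) n) := by
    have h3 : (B⁻¹).mulVec (cylVec (s - n) n) = ε • cylVec (s - n) n := by
      have hu : IsUnit B.det := isUnit_iff_ne_zero.2 hg.det_ne
      have e : cylVec (s - n) n = ε • B.mulVec (cylVec (s - n) n) := by
        rw [hv, smul_smul]; rcases hε with rfl | rfl <;> simp
      conv_lhs => rw [e]
      rw [Matrix.mulVec_smul, Matrix.mulVec_mulVec, Matrix.nonsing_inv_mul _ hu, Matrix.one_mulVec]
    have := hD.image hg.inv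
    rw [h3] at this
    rcases hε with rfl | rfl
    · simpa using this
    · simpa using this.neg
  -- Both `g` and its inverse map the cylinder to one with the same holonomy, contained in it up to
  -- null sets by maximality; each of the two gives one inequality.
  apply le_antisymm
  · have h4 := (h.image hg).area_image_inter_le hD hg.inv (abs_det_inv hB)
    have h5 := h.image hg |>.area_image_inter hD hg.inv (abs_det_inv hB)
    rw [← h5, inv_image_image]
    exact h2.area_inter_le hs hn C
  · rw [← h.area_image_inter hD hg hB]
    exact h1.area_inter_le hs hn _

end ParabolaSurface

/-! ### The multitwist in the horizontal cylinders. -/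

namespace ParabolaSurface

/-- The horizontal cylinder at heights between `n²` and `(n+1)²` in `Qplus`. -/
noncomputable abbrev horCyl (n : ℕ) : Set S1 := cyl (-n) n

/-- The power `σ` of the shear that fixes the line at height `n²`. -/
def shear (σ : ℝ) (n : ℕ) (z : Plane) : Plane := ![z 0 + σ * (2 * (z 1 - n ^ 2)), z 1]

/-- The derivative of the multitwist. -/
def twistMat : Matrix (Fin 2) (Fin 2) ℝ := !![1, 2; 0, 1]

lemma neg_le_nat (n : ℕ) : -(n : ℤ) ≤ n := by lia

lemma mem_horStrip {n : ℕ} {z : Plane} :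
    z ∈ cylStrip (-n) n ↔ (n : ℝ) ^ 2 < z 1 ∧ z 1 < (n + 1) ^ 2 := by
  simp only [cylStrip, lev, Set.mem_ofPred_eq]
  push_cast
  constructor <;> rintro ⟨h1, h2⟩ <;> constructor <;> nlinarith

@[simp] lemma horVec_zero (n : ℕ) : cylVec (-n) n 0 = 2 * (2 * (n : ℝ) + 1) := by
  simp [cylVec]; ring

@[simp] lemma horVec_one (n : ℕ) : cylVec (-n) n 1 = 0 := by
  simp [cylVec]

@[simp] lemma shear_apply_zero (σ : ℝ) (n : ℕ) (z : Plane) :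
    shear σ n z 0 = z 0 + σ * (2 * (z 1 - n ^ 2)) := rfl

@[simp] lemma shear_apply_one (σ : ℝ) (n : ℕ) (z : Plane) : shear σ n z 1 = z 1 := rfl

@[simp] lemma twistMat_mulVec_zero (y : Plane) : twistMat.mulVec y 0 = y 0 + 2 * y 1 := by
  simp [twistMat, Matrix.mulVec, dotProduct, Fin.sum_univ_two]

@[simp] lemma twistMat_mulVec_one (y : Plane) : twistMat.mulVec y 1 = y 1 := by
  simp [twistMat, Matrix.mulVec, dotProduct, Fin.sum_univ_two]

lemma shear_mem {σ : ℝ} {n : ℕ} {z : Plane} (h : z ∈ cylStrip (-n) n) :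
    shear σ n z ∈ cylStrip (-n) n := by
  rw [mem_horStrip] at h ⊢; exact h

lemma shear_add (σ : ℝ) (n : ℕ) (z : Plane) (t : ℝ) :
    shear σ n (z + t • cylVec (-n) n) = shear σ n z + t • cylVec (-n) n := by
  apply plane_ext <;> simp; ring

lemma shear_shear (σ τ : ℝ) (n : ℕ) (z : Plane) : shear σ n (shear τ n z) = shear (σ + τ) n z := by
  apply plane_ext <;> simp; ring

lemma shear_zero (n : ℕ) (z : Plane) : shear 0 n z = z := by
  apply plane_ext <;> simp

/-- A point determines the length of its closed horizontal leaf, which is `2 (2 n + 1)` in `horCyl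
n`. -/
lemma horCyl_disjoint {n m : ℕ} {z : Plane} (hz : z ∈ cylStrip (-n) n)
    (h : cylMap (-n) n z ∈ horCyl m) : n = m := by
  have h1 := hasCyl_cyl (neg_le_nat m)
  have e : cylVec (-m) m = ((2 * m + 1 : ℝ) / (2 * n + 1)) • cylVec (-n) n := by
    apply plane_ext
    · simp; field_simp
    · simp
  rw [e] at h1
  have h2 := h1.abs_eq_one (neg_le_nat n) hz h
  rw [abs_of_pos (by positivity)] at h2
  field_simp at h2
  have : (m : ℝ) = n := by linarith
  exact_mod_cast this.symm

open Classical in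
/-- The powers of the multitwist in the horizontal cylinders, as maps. -/
noncomputable def twistFun (σ : ℝ) (x : S1) : S1 :=
  if h : ∃ p : ℕ × Plane, p.2 ∈ cylStrip (-p.1) p.1 ∧ cylMap (-p.1) p.1 p.2 = x then
    cylMap (-h.choose.1) h.choose.1 (shear σ h.choose.1 h.choose.2)
  else x

/-- The value does not depend on the chosen preimage: `n` is unique by `horCyl_disjoint`, the strip
coordinate is unique up to periods, and the shear commutes with the periods. -/
lemma twistFun_cylMap (σ : ℝ) {n : ℕ} {z : Plane} (hz : z ∈ cylStrip (-n) n) :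
    twistFun σ (cylMap (-n) n z) = cylMap (-n) n (shear σ n z) := by
  have h : ∃ p : ℕ × Plane, p.2 ∈ cylStrip (-p.1) p.1 ∧
      cylMap (-p.1) p.1 p.2 = cylMap (-n) n z := ⟨(n, z), hz, rfl⟩
  rw [twistFun, dif_pos h]
  obtain ⟨h1, h2⟩ := h.choose_spec
  generalize h.choose = p at h1 h2
  obtain ⟨m, w⟩ := p
  dsimp only at h1 h2 ⊢
  obtain rfl : n = m := horCyl_disjoint hz ⟨w, h1, h2⟩
  obtain ⟨k, rfl⟩ := (cylMap_eq_iff (neg_le_nat n) h1 hz).1 h2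
  rw [shear_add, cylMap_add (neg_le_nat n)]

lemma twistFun_of_notMem (σ : ℝ) {x : S1} (h : ∀ n, x ∉ horCyl n) : twistFun σ x = x := by
  rw [twistFun, dif_neg]
  rintro ⟨⟨n, z⟩, h1, h2⟩
  exact h n ⟨z, h1, h2⟩

lemma twistFun_inverse (σ : ℝ) (x : S1) : twistFun (-σ) (twistFun σ x) = x := by
  by_cases h : ∃ n, x ∈ horCyl n
  · obtain ⟨n, z, hz, rfl⟩ := h
    rw [twistFun_cylMap σ hz, twistFun_cylMap _ (shear_mem hz), shear_shear, neg_add_cancel,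
      shear_zero]
  · push Not at h
    rw [twistFun_of_notMem _ h, twistFun_of_notMem _ h]

/-- The multitwist in the horizontal cylinders. -/
noncomputable def twist : Equiv.Perm S1 where
  toFun := twistFun 1
  invFun := twistFun (-1)
  left_inv := twistFun_inverse 1
  right_inv x := by simpa using twistFun_inverse (-1) x

lemma twist_cylMap {n : ℕ} {z : Plane} (hz : z ∈ cylStrip (-n) n) :
    twist (cylMap (-n) n z) = cylMap (-n) n (shear 1 n z) := twistFun_cylMap 1 hz

lemma twist_of_notMem {x : S1} (h : ∀ n, x ∉ horCyl n) : twist x = x := twistFun_of_notMem 1 h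

lemma rot_cylMap {a b : ℤ} (hab : a ≤ b) {z : Plane} (hz : z ∈ cylStrip a b) :
    rot (cylMap a b z) = cylMap a b (mid b - z) := by
  obtain ⟨k, hk0, hk1⟩ := exists_fund hab z
  have e : mid b - z = mid b - (z + (k : ℝ) • cylVec a b) + (k : ℝ) • cylVec a b := by abel
  rw [e, cylMap_add hab _ k, ← cylMap_add hab z k]
  replace hz := add_smul_mem_cylStrip hz k
  set w := z + (k : ℝ) • cylVec a b
  rcases eq_or_lt_of_le hk0 with h0 | h0
  · have hs := mem_strip_of_seam hab hz h0.symm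
    have hq : w ∈ Qplus := mem_Qplus_of_floor hs.1.le hs.2.le hk0
    have e0 : edgeFn (a - 1) (mid (a - 1) - w) = 0 := by rw [edgeFn_mid_sub_self, ← h0, neg_zero]
    have hq' : mid (a - 1) - w ∈ Qplus := by
      refine mem_Qplus_of_floor (n := a - 1) ?_ ?_ e0.ge
      · rw [Pi.sub_apply, mid_zero]; linarith [hs.2]
      · rw [Pi.sub_apply, mid_zero]; linarith [hs.1]
    have e1 : mid b - w = mid (a - 1) - w + ((1 : ℤ) : ℝ) • cylVec a b := by
      rw [← mid_sub_mid, Int.cast_one, one_smul]; abel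
    rw [e1, cylMap_add hab (mid (a - 1) - w) 1, cylMap_eq hk0 hk1, cylMap_eq e0.ge (by rw [e0]; linarith),
      chart_of_mem hq, ← chart_of_mem (n := a - 1) hq,
      rot_chart (mem_chartDomain.2 (Or.inr (Or.inl hs))), chart_of_mem hq', chart_of_mem hq']
  · rw [cylMap_eq hk0 hk1, rot_chart (mem_chartDomain_of_cylStrip hab hz h0 hk1), cylMap_eq] <;>
      rw [edgeFn_left_mid_sub] <;> linarith

lemma mem_horCyl_rot {x : S1} {n : ℕ} (h : x ∈ horCyl n) : rot x ∈ horCyl n := by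
  obtain ⟨z, hz, rfl⟩ := h
  exact ⟨_, mid_sub_mem_cylStrip hz, (rot_cylMap (neg_le_nat n) hz).symm⟩

lemma twist_rot (x : S1) : twist (rot x) = rot (twist x) := by
  by_cases h : ∃ n, x ∈ horCyl n
  · obtain ⟨n, z, hz, rfl⟩ := h
    -- The rotation exchanges the two boundaries of the cylinder, so shear and rotation commute only
    -- up to one period, the full turn of the twist.
    rw [rot_cylMap (neg_le_nat n) hz, twist_cylMap (mid_sub_mem_cylStrip hz), twist_cylMap hz,
      rot_cylMap (neg_le_nat n) (shear_mem hz), ← cylMap_add (neg_le_nat n) (_ - _) 1]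
    congr 1
    apply plane_ext <;> simp; ring
  · push Not at h
    rw [twist_of_notMem h, twist_of_notMem fun n hn => h n (by simpa [rot_rot] using mem_horCyl_rot hn)]

lemma cylMap_of_mem {a b : ℤ} (hab : a ≤ b) {z : Plane} (hz : z ∈ cylStrip a b)
    (hq : z ∈ Qplus) (n : ℤ) : cylMap a b z = chart n z := by
  rw [cylMap_eq (mem_Qplus.1 hq _) (edgeFn_left_lt hab hz (mem_Qplus.1 hq _)),
    chart_of_mem hq, chart_of_mem hq]

lemma shear_add_mulVec (n : ℕ) (z y : Plane) :
    shear 1 n (z + y) = shear 1 n z + twistMat.mulVec y := by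
  apply plane_ext <;> simp only [Pi.add_apply, shear_apply_zero, shear_apply_one,
    twistMat_mulVec_zero, twistMat_mulVec_one]
  ring

lemma exists_sq_of_notMem {z : Plane} (hz : z ∈ interior Qplus)
    (h : ∀ n, chart 0 z ∉ horCyl n) : ∃ k : ℕ, z 1 = (k + 1) ^ 2 := by
  have h0 : 0 < z 1 := by
    have h0 := mem_interior_Qplus.1 hz 0
    have h1 := mem_interior_Qplus.1 hz (-1)
    simp [edgeFn] at h0 h1
    linarith
  by_contra hcon
  push Not at hcon
  obtain ⟨n, hn, h1, h2⟩ := exists_between (s := 0) (Or.inl rfl) h0 (fun n hn => by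
    have hn' : z 1 = ((n.natAbs : ℕ) : ℝ) ^ 2 := by
      rw [hn, Nat.cast_natAbs]; push_cast; rw [sq_abs]; ring
    rcases Nat.eq_zero_or_pos n.natAbs with h' | h'
    · rw [h'] at hn'; simp at hn'; linarith
    · obtain ⟨k, hk⟩ := Nat.exists_eq_succ_of_ne_zero h'.ne'
      apply hcon k
      rw [hn', hk]; push_cast; ring)
  lift n to ℕ using hn
  push_cast at h1 h2
  have hs : z ∈ cylStrip (-n) n := mem_horStrip.2 ⟨by nlinarith, by nlinarith⟩
  exact h n ⟨z, hs, cylMap_of_interior (neg_le_nat n) hs hz⟩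

/-- The multitwist near the lines at heights `k²`. -/
lemma twist_near_saddle {z : Plane} (hz : z ∈ interior Qplus) {k : ℕ} (hk : z 1 = (k + 1) ^ 2) :
    ∀ᶠ y in 𝓝 (0 : Plane), twist (chart 0 (z + y)) = chart 0 (z + twistMat.mulVec y) := by
  have hc : Tendsto (fun y : Plane => y 1) (𝓝 0) (𝓝 0) := by
    have : Continuous fun y : Plane => y 1 := by fun_prop
    exact this.tendsto' 0 0 rfl
  filter_upwards [eventually_add_mem isOpen_interior hz,
    (tendsto_mulVec_zero twistMat).eventually (eventually_add_mem isOpen_interior hz),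
    hc.eventually_const_lt (show (-1 : ℝ) < 0 by norm_num),
    hc.eventually_lt_const (show (0 : ℝ) < 1 by norm_num)] with y h1 h2 h3 h4
  have hk0 : (0 : ℝ) ≤ k := Nat.cast_nonneg k
  rcases lt_trichotomy (y 1) 0 with hy | hy | hy
  -- Just below the line is the top of `horCyl k`, where the shear has completed one full turn; a
  -- period compensates it.
  · have hs : z + y ∈ cylStrip (-k) k :=
      mem_horStrip.2 ⟨by simp only [Pi.add_apply, hk]; push_cast; nlinarith, by simp only [Pi.add_apply, hk]; push_cast; linarith⟩
    have hs' : z + twistMat.mulVec y ∈ cylStrip (-k) k := by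
          exact mem_horStrip.2 ⟨by simp only [Pi.add_apply, hk, twistMat_mulVec_one]; push_cast; nlinarith, by simp only [Pi.add_apply, hk, twistMat_mulVec_one]; push_cast; linarith⟩
    rw [← cylMap_of_interior (neg_le_nat k) hs h1, twist_cylMap hs,
      ← cylMap_of_interior (neg_le_nat k) hs' h2, ← cylMap_add (neg_le_nat k) (z + _) 1]
    congr 1
    apply plane_ext
    · simp only [Pi.add_apply, Pi.smul_apply, smul_eq_mul, shear_apply_zero,
        twistMat_mulVec_zero, horVec_zero, hk]
      push_cast; ring
    · simp only [Pi.add_apply, Pi.smul_apply, smul_eq_mul, shear_apply_one,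
        twistMat_mulVec_one, horVec_one]
      ring
  -- On the line itself the point lies in no horizontal cylinder, so the twist fixes it, and the
  -- matrix fixes horizontal vectors.
  · have e : twistMat.mulVec y = y := by
      apply plane_ext <;> simp only [twistMat_mulVec_zero, twistMat_mulVec_one, hy] <;> ring
    rw [e]
    refine twist_of_notMem fun n hn => ?_
    have hp : z + y ∈ plusPart (horCyl n) := ⟨h1, hn⟩
    rw [plusPart_cyl (neg_le_nat n)] at hp
    have h5 := mem_horStrip.1 hp.2
    simp only [Pi.add_apply, hy, add_zero, hk] at h5
    have h6 : n < k + 1 := by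
      have := lt_of_pow_lt_pow_left₀ 2 (by positivity) h5.1
      exact_mod_cast this
    have h7 : k + 1 < n + 1 := by
      have := lt_of_pow_lt_pow_left₀ 2 (by positivity) h5.2
      exact_mod_cast this
    lia
  -- Just above the line is the bottom of `horCyl (k + 1)`, where the shear starts from the
  -- identity.
  · have hs : z + y ∈ cylStrip (-(k + 1 : ℕ)) (k + 1 : ℕ) :=
      mem_horStrip.2 ⟨by simp only [Pi.add_apply, hk]; push_cast; linarith, by simp only [Pi.add_apply, hk]; push_cast; nlinarith⟩
    have hs' : z + twistMat.mulVec y ∈ cylStrip (-(k + 1 : ℕ)) (k + 1 : ℕ) := by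
          exact mem_horStrip.2 ⟨by simp only [Pi.add_apply, hk, twistMat_mulVec_one]; push_cast; linarith, by simp only [Pi.add_apply, hk, twistMat_mulVec_one]; push_cast; nlinarith⟩
    rw [← cylMap_of_interior (neg_le_nat _) hs h1, twist_cylMap hs,
      ← cylMap_of_interior (neg_le_nat _) hs' h2]
    congr 1
    apply plane_ext
    · simp only [Pi.add_apply, shear_apply_zero, twistMat_mulVec_zero, hk]
      push_cast; ring
    · simp only [Pi.add_apply, shear_apply_one, twistMat_mulVec_one]

/-- An open edge lies strictly between the heights of two consecutive squares, so the critical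
horizontal lines meet no open edge. -/
lemma edge_mem_horCyl {n : ℤ} {z : Plane} (he : edgeFn n z = 0) (h0 : (n : ℝ) < z 0)
    (h1 : z 0 < n + 1) : ∃ m, chart n z ∈ horCyl m := by
  have hq : z ∈ Qplus := mem_Qplus_of_floor h0.le h1.le he.ge
  simp only [edgeFn] at he
  rcases le_or_gt 0 n with hn | hn
  · lift n to ℕ using hn
    push_cast at he h0 h1
    have hn0 : (0 : ℝ) ≤ n := Nat.cast_nonneg n
    have hs : z ∈ cylStrip (-n) n := mem_horStrip.2 ⟨by nlinarith, by nlinarith⟩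
    exact ⟨n, z, hs, cylMap_of_mem (neg_le_nat n) hs hq n⟩
  · obtain ⟨m, hm⟩ := Int.eq_ofNat_of_zero_le (show 0 ≤ -n - 1 by lia)
    have hn' : (n : ℝ) = -m - 1 := by
      have : n = -(m : ℤ) - 1 := by lia
      exact_mod_cast this
    have hm0 : (0 : ℝ) ≤ m := Nat.cast_nonneg m
    rw [hn'] at he h0 h1
    have hs : z ∈ cylStrip (-m) m := mem_horStrip.2 ⟨by nlinarith, by nlinarith⟩
    exact ⟨m, z, hs, cylMap_of_mem (neg_le_nat m) hs hq n⟩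

/-- Every horizontal cylinder has circumference `2 (2 n + 1)` and height `2 n + 1`. The ratio is
always 2, so the shear by `twistMat` makes exactly one turn across each cylinder and the pieces fit
along the boundaries. -/
lemma aff_twist : Aff twist twistMat where
  det_ne := by simp [twistMat]
  singular_iff x := by
    by_cases h : ∃ n, x ∈ horCyl n
    · obtain ⟨n, z, hz, rfl⟩ := h
      rw [twist_cylMap hz]
      have h1 := Set.disjoint_left.1 (hasCyl_cyl (neg_le_nat n)).disjoint_singular
      exact iff_of_false (h1 ⟨_, shear_mem hz, rfl⟩) (h1 ⟨z, hz, rfl⟩)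
    · push Not at h
      rw [twist_of_notMem h]
  locally_affine n z hz := by
    by_cases h : ∃ m, chart n z ∈ horCyl m
    · obtain ⟨m, w, hw, he⟩ := h
      have h1 := (locTransAt_cylMap (neg_le_nat m) hw).eventually_eq (locTransAt_chart hz) he
      obtain ⟨l, u, hu, h2⟩ := locTransAt_cylMap (neg_le_nat m) (shear_mem (σ := 1) hw)
      refine ⟨l, u, hu, ?_⟩
      filter_upwards [h1, (tendsto_mulVec_zero twistMat).eventually h2,
        eventually_add_mem (isOpen_cylStrip _ _) hw] with x h3 h4 h5
      rw [← h3, twist_cylMap h5, shear_add_mulVec, h4]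
    push Not at h
    have hint : ∀ {z : Plane}, z ∈ chartDomain n → (∀ m, chart n z ∉ horCyl m) → z ∈ Qplus →
        z ∈ interior Qplus := by
      intro z hz h hq
      rcases mem_chartDomain_Qplus hz hq with hi | hi
      · exact hi
      · obtain ⟨m, hm⟩ := edge_mem_horCyl hi.1 hi.2.1 hi.2.2
        exact (h m hm).elim
    by_cases hq : z ∈ Qplus
    · have hi := hint hz h hq
      obtain ⟨k, hk⟩ := exists_sq_of_notMem hi (by simpa only [chart_eq_chart_zero hi] using h)
      refine ⟨0, z, mem_chartDomain_of_interior hi 0, ?_⟩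
      filter_upwards [twist_near_saddle hi hk, eventually_add_mem isOpen_interior hi] with x h1 h2
      rw [chart_eq_chart_zero h2, h1]
    -- Critical points in `Qminus` are moved to `Qplus` by `rot`, which commutes with the twist.
    · have hi := mem_chartDomain_not_Qplus hz hq
      have hr : chart 0 (mid n - z) = rot (chart n z) := by
        rw [rot_chart hz, chart_eq_chart_zero hi n]
      obtain ⟨k, hk⟩ := exists_sq_of_notMem hi (fun m hm => h m (by
        rw [hr] at hm; simpa [rot_rot] using mem_horCyl_rot hm))
      refine ⟨n, z, hz, ?_⟩
      have hneg : Tendsto (fun x : Plane => -x) (𝓝 0) (𝓝 0) := by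
        simpa using (continuous_neg (G := Plane)).tendsto 0
      filter_upwards [hneg.eventually (twist_near_saddle hi hk),
        hneg.eventually (eventually_add_mem isOpen_interior hi),
        eventually_add_mem (isOpen_chartDomain n) hz,
        (tendsto_mulVec_zero twistMat).eventually (eventually_add_mem (isOpen_chartDomain n) hz),
        (tendsto_mulVec_zero twistMat).eventually
          (hneg.eventually (eventually_add_mem isOpen_interior hi))] with x h1 h2 h3 h4 h5
      have e1 : mid n - z + -x = mid n - (z + x) := by abel
      have e2 : mid n - z + -twistMat.mulVec x = mid n - (z + twistMat.mulVec x) := by abel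
      rw [Matrix.mulVec_neg, e1, e2, ← chart_eq_chart_zero (e1 ▸ h2) n, ← rot_chart h3, twist_rot,
        ← chart_eq_chart_zero (e2 ▸ h5) n, ← rot_chart h4] at h1
      exact rot.injective h1

end ParabolaSurface

/-! ### Chebyshev polynomials and the spectral form of the intersection form. -/

namespace ParabolaSurface

/-- The Chebyshev polynomials of the second kind, indexed so that `sin β * cheb n (cos β)` is
`sin (n β)`. -/
noncomputable def cheb (n : ℤ) (k : ℝ) : ℝ := (Polynomial.Chebyshev.U ℝ (n - 1)).eval k

lemma cheb_zero (k : ℝ) : cheb 0 k = 0 := by simp [cheb]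

lemma cheb_one (k : ℝ) : cheb 1 k = 1 := by simp [cheb]

lemma cheb_add_one (n : ℤ) (k : ℝ) : cheb (n + 1) k = 2 * k * cheb n k - cheb (n - 1) k := by
  have h := Polynomial.Chebyshev.U_add_one ℝ (n - 1)
  simp only [cheb, add_sub_cancel_right]
  rw [sub_add_cancel] at h
  rw [h]; simp

lemma cheb_neg (n : ℤ) (k : ℝ) : cheb (-n) k = -cheb n k := by
  simp only [cheb]
  rw [Polynomial.Chebyshev.U_neg_sub_one]; simp

lemma cheb_at_one (n : ℤ) : cheb n 1 = n := by
  simp only [cheb, Polynomial.Chebyshev.U_eval_one]; push_cast; ring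

lemma cheb_cos_mul_sin (n : ℤ) (β : ℝ) : cheb n (Real.cos β) * Real.sin β = Real.sin (n * β) := by
  simp only [cheb, Polynomial.Chebyshev.U_real_cos]
  congr 1; push_cast; ring

lemma continuous_cheb (n : ℤ) : Continuous (cheb n) := Polynomial.continuous _

/-- The quadratic form `x² - 2 k x y + y²` is invariant under the Chebyshev recurrence. The constant
1 will disappear against functions of total mass zero. -/
lemma cheb_sq_add (n : ℤ) (k : ℝ) :
    cheb (n + 1) k ^ 2 + cheb n k ^ 2 = 2 * k * (cheb n k * cheb (n + 1) k) + 1 := by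
  induction n using Int.induction_on with
  | zero => simp [cheb_zero, cheb_one]
  | succ i ih =>
    have h := cheb_add_one (i + 1) k
    rw [add_sub_cancel_right] at h
    rw [h]; linear_combination ih
  | pred i ih =>
    have h := cheb_add_one (-i) k
    rw [sub_add_cancel]
    rw [h] at ih
    linear_combination ih

/-- Integration of a function on the edges against a finitely supported one. -/
noncomputable def pair (m : ℤ →₀ ℝ) (F : ℤ → ℝ) : ℝ := m.sum fun n x => x * F n

lemma pair_add_right (m : ℤ →₀ ℝ) (F G : ℤ → ℝ) :
    pair m (fun n => F n + G n) = pair m F + pair m G := by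
  simp [pair, Finsupp.sum, mul_add, Finset.sum_add_distrib]

lemma pair_sub_right (m : ℤ →₀ ℝ) (F G : ℤ → ℝ) :
    pair m (fun n => F n - G n) = pair m F - pair m G := by
  simp [pair, Finsupp.sum, mul_sub, Finset.sum_sub_distrib]

lemma pair_mul_right (m : ℤ →₀ ℝ) (c : ℝ) (F : ℤ → ℝ) :
    pair m (fun n => c * F n) = c * pair m F := by
  simp only [pair, Finsupp.sum, Finset.mul_sum]
  exact Finset.sum_congr rfl fun n _ => by ring

lemma pair_const (m : ℤ →₀ ℝ) (c : ℝ) : pair m (fun _ => c) = m.sum (fun _ x => x) * c := by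
  simp [pair, Finsupp.sum, Finset.sum_mul]

lemma pair_add_left (m m' : ℤ →₀ ℝ) (F : ℤ → ℝ) : pair (m + m') F = pair m F + pair m' F := by
  simp only [pair]
  exact Finsupp.sum_add_index' (by simp) (by intros; ring)

lemma pair_smul_left (c : ℝ) (m : ℤ →₀ ℝ) (F : ℤ → ℝ) : pair (c • m) F = c * pair m F := by
  simp only [pair]
  rw [Finsupp.sum_smul_index (by simp)]
  simp only [Finsupp.sum, Finset.mul_sum, mul_assoc]

lemma pair_neg_left (m : ℤ →₀ ℝ) (F : ℤ → ℝ) : pair (-m) F = -pair m F := by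
  have := pair_smul_left (-1) m F
  simpa using this

lemma pair_sub_left (m m' : ℤ →₀ ℝ) (F : ℤ → ℝ) : pair (m - m') F = pair m F - pair m' F := by
  rw [sub_eq_add_neg, pair_add_left, pair_neg_left]; ring

lemma pair_single (j : ℤ) (c : ℝ) (F : ℤ → ℝ) : pair (Finsupp.single j c) F = c * F j := by
  simp [pair]

lemma pair_equiv {m m' : ℤ →₀ ℝ} (σ : ℤ ≃ ℤ) (h : ∀ n, m' n = m (σ n)) (F : ℤ → ℝ) :
    pair m' F = pair m (fun n => F (σ.symm n)) := by
  have e : m' = m.equivMapDomain σ.symm := by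
    ext n; rw [Finsupp.equivMapDomain_apply, h]; simp
  rw [e, pair, Finsupp.sum_equivMapDomain]; rfl

lemma interForm_eq_pair (m m' : ℤ →₀ ℝ) :
    interForm m m' = pair m fun n => pair m' fun j => ((n - j).sign : ℝ) := by
  simp [interForm, pair, Finsupp.sum, Finset.mul_sum, mul_assoc]

lemma interForm_sub_left (m m' d : ℤ →₀ ℝ) :
    interForm (m - m') d = interForm m d - interForm m' d := by
  simp only [interForm_eq_pair, pair_sub_left]

lemma interForm_smul_left (c : ℝ) (m d : ℤ →₀ ℝ) : interForm (c • m) d = c * interForm m d := by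
  simp only [interForm_eq_pair, pair_smul_left]

/-- The spectral vector of a finitely supported function on the edges. -/
noncomputable def specVec (m : ℤ →₀ ℝ) (k : ℝ) : Plane :=
  ![2 * pair m (fun n => cheb n k * cheb (n + 1) k), -2 * pair m (fun n => cheb n k ^ 2)]

lemma continuous_specVec (m : ℤ →₀ ℝ) : Continuous (specVec m) := by
  have h1 : ∀ F : ℤ → ℝ → ℝ, (∀ n, Continuous (F n)) →
      Continuous fun k => pair m fun n => F n k := by
    intro F hF
    unfold pair Finsupp.sum
    exact continuous_finsetSum _ fun n _ => continuous_const.mul (hF n)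
  refine continuous_pi fun i => ?_
  fin_cases i
  · exact continuous_const.mul (h1 _ fun n => (continuous_cheb n).mul (continuous_cheb (n + 1)))
  · exact continuous_const.mul (h1 _ fun n => (continuous_cheb n).pow 2)

/-- This turns the wedge of two spectral vectors into a kernel in the difference `x - y`, up to
terms in one variable only, and those are invisible to functions of total mass zero. -/
lemma sin_mul_sin_mul_sin (x y β : ℝ) :
    4 * (Real.sin x * Real.sin y * (Real.sin x * Real.sin (y + β) - Real.sin (x + β) * Real.sin y)) =
      Real.sin β * (Real.sin (2 * (x - y)) - Real.sin (2 * x) + Real.sin (2 * y)) := by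
  rw [Real.sin_add, Real.sin_add, Real.sin_two_mul, Real.sin_two_mul, Real.sin_two_mul,
    Real.sin_sub, Real.cos_sub]
  have hx := Real.sin_sq_add_cos_sq x
  have hy := Real.sin_sq_add_cos_sq y
  have ex : Real.cos x ^ 2 = 1 - Real.sin x ^ 2 := by linarith
  have ey : Real.cos y ^ 2 = 1 - Real.sin y ^ 2 := by linarith
  ring_nf
  rw [ex, ey]
  ring

/-- The wedge product of two spectral vectors, for functions of total mass zero. -/
lemma wedge_specVec {m m' : ℤ →₀ ℝ} (hm : m.sum (fun _ x => x) = 0)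
    (hm' : m'.sum (fun _ x => x) = 0) {β : ℝ} (hβ : Real.sin β ≠ 0) :
    wedge (specVec m (Real.cos β)) (specVec m' (Real.cos β)) * Real.sin β ^ 2 =
      pair m fun n => pair m' fun j => cheb (2 * (n - j)) (Real.cos β) := by
  have h1 : ∀ (m : ℤ →₀ ℝ), pair m (fun n => cheb n (Real.cos β) * cheb (n + 1) (Real.cos β)) *
      Real.sin β ^ 2 = pair m fun n => Real.sin (n * β) * Real.sin (n * β + β) := by
    intro m
    rw [mul_comm, ← pair_mul_right]
    congr 1; funext n
    rw [← cheb_cos_mul_sin, show (n : ℝ) * β + β = ((n + 1 : ℤ) : ℝ) * β by push_cast; ring,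
      ← cheb_cos_mul_sin]
    ring
  have h2 : ∀ (m : ℤ →₀ ℝ), pair m (fun n => cheb n (Real.cos β) ^ 2) * Real.sin β ^ 2 =
      pair m fun n => Real.sin (n * β) ^ 2 := by
    intro m
    rw [mul_comm, ← pair_mul_right]
    congr 1; funext n
    rw [← cheb_cos_mul_sin]; ring
  have h3 : wedge (specVec m (Real.cos β)) (specVec m' (Real.cos β)) * Real.sin β ^ 4 =
      pair m fun n => pair m' fun j => Real.sin β * (Real.sin (2 * (n * β - j * β)) -
        Real.sin (2 * (n * β)) + Real.sin (2 * (j * β))) := by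
    have : wedge (specVec m (Real.cos β)) (specVec m' (Real.cos β)) * Real.sin β ^ 4 =
        4 * ((pair m (fun n => cheb n (Real.cos β) ^ 2) * Real.sin β ^ 2) *
          (pair m' (fun n => cheb n (Real.cos β) * cheb (n + 1) (Real.cos β)) * Real.sin β ^ 2) -
        (pair m (fun n => cheb n (Real.cos β) * cheb (n + 1) (Real.cos β)) * Real.sin β ^ 2) *
          (pair m' (fun n => cheb n (Real.cos β) ^ 2) * Real.sin β ^ 2)) := by
      simp [wedge, specVec]; ring
    rw [this, h1, h1, h2, h2]
    simp only [← sin_mul_sin_mul_sin]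
    simp only [pair, Finsupp.sum]
    rw [Finset.sum_mul_sum, Finset.sum_mul_sum, ← Finset.sum_sub_distrib, Finset.mul_sum]
    refine Finset.sum_congr rfl fun n _ => ?_
    rw [← Finset.sum_sub_distrib, Finset.mul_sum, Finset.mul_sum]
    refine Finset.sum_congr rfl fun j _ => ?_
    ring
  -- The terms in `n` alone and in `j` alone are annihilated by the zero mass of `m'` and of `m`.
  have h4 : (pair m fun n => pair m' fun j => Real.sin β * (Real.sin (2 * (n * β - j * β)) -
        Real.sin (2 * (n * β)) + Real.sin (2 * (j * β)))) =
      Real.sin β ^ 2 * pair m fun n => pair m' fun j => cheb (2 * (n - j)) (Real.cos β) := by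
    have e : ∀ n : ℤ, (pair m' fun j => Real.sin β * (Real.sin (2 * (n * β - j * β)) -
        Real.sin (2 * (n * β)) + Real.sin (2 * (j * β)))) =
        Real.sin β ^ 2 * (pair m' fun j => cheb (2 * (n - j)) (Real.cos β)) +
          Real.sin β * pair m' fun j => Real.sin (2 * (j * β)) := by
      intro n
      rw [pair_mul_right, pair_add_right, pair_sub_right, pair_const, hm', zero_mul, sub_zero,
        mul_add, pow_two, mul_assoc, ← pair_mul_right (c := Real.sin β)
          (F := fun j => cheb (2 * (n - j)) (Real.cos β))]
      congr 3; funext j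
      rw [mul_comm (Real.sin β) (cheb _ _), cheb_cos_mul_sin]
      congr 1; push_cast; ring
    simp only [e]
    rw [pair_add_right, pair_const, hm, zero_mul, add_zero, pair_mul_right]
  rw [h4] at h3
  have h5 : Real.sin β ^ 2 ≠ 0 := pow_ne_zero 2 hβ
  apply mul_left_cancel₀ h5
  rw [← h3]; ring

lemma integral_cos_odd_mul_cos (n : ℤ) :
    ∫ β in (0 : ℝ)..(Real.pi / 2), 2 * Real.cos ((2 * n + 1) * β) * Real.cos β =
      (Real.pi / 2) * (((n + 1).sign : ℝ) - (n.sign : ℝ)) := by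
  have hJ : ∀ l : ℤ, ∫ β in (0 : ℝ)..(Real.pi / 2), Real.cos ((2 * l : ℝ) * β) =
      if l = 0 then Real.pi / 2 else 0 := by
    intro l
    split_ifs with h
    · simp [h]
    · have hl : (2 * l : ℝ) ≠ 0 := by simpa using h
      rw [intervalIntegral.integral_comp_mul_left _ hl, integral_cos]
      have e : (2 * l : ℝ) * (Real.pi / 2) = l * Real.pi := by ring
      rw [e, Real.sin_int_mul_pi]; simp
  have e : ∀ β : ℝ, 2 * Real.cos ((2 * n + 1) * β) * Real.cos β =
      Real.cos ((2 * (n + 1 : ℤ) : ℝ) * β) + Real.cos ((2 * n : ℝ) * β) := by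
    intro β
    rw [show (2 * (n + 1 : ℤ) : ℝ) * β = (2 * n + 1) * β + β by push_cast; ring,
      show (2 * n : ℝ) * β = (2 * n + 1) * β - β by ring, Real.cos_add, Real.cos_sub]
    ring
  simp only [e]
  rw [intervalIntegral.integral_add ((by fun_prop : Continuous _).intervalIntegrable _ _)
    ((by fun_prop : Continuous _).intervalIntegrable _ _), hJ, hJ]
  rcases lt_trichotomy n (-1) with h | rfl | h
  · rw [if_neg (by lia), if_neg (by lia), Int.sign_eq_neg_one_of_neg (by lia),
      Int.sign_eq_neg_one_of_neg (by lia)]; simp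
  · simp
  · rcases eq_or_ne n 0 with rfl | h0
    · simp
    · rw [if_neg (by lia), if_neg h0, Int.sign_eq_one_of_pos (by lia),
        Int.sign_eq_one_of_pos (by lia)]; simp

lemma cheb_sub_two (n : ℤ) {β : ℝ} (hβ : Real.sin β ≠ 0) :
    cheb (2 * (n + 1)) (Real.cos β) - cheb (2 * n) (Real.cos β) =
      2 * Real.cos ((2 * n + 1) * β) := by
  apply mul_right_cancel₀ hβ
  rw [sub_mul, cheb_cos_mul_sin, cheb_cos_mul_sin]
  have e1 : ((2 * (n + 1) : ℤ) : ℝ) * β = (2 * n + 1) * β + β := by push_cast; ring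
  have e2 : ((2 * n : ℤ) : ℝ) * β = (2 * n + 1) * β - β := by push_cast; ring
  rw [e1, e2, Real.sin_add, Real.sin_sub]; ring

lemma intervalIntegrable_cheb_mul_cos (n : ℤ) (a b : ℝ) :
    IntervalIntegrable (fun β => cheb n (Real.cos β) * Real.cos β) volume a b :=
  (((continuous_cheb n).comp Real.continuous_cos).mul Real.continuous_cos).intervalIntegrable _ _

/-- Both sides vanish at 0. Their increments agree because a difference of Chebyshev polynomials
with consecutive even indices is twice the cosine of an odd multiple, and orthogonality leaves only
two nonzero integrals. -/
lemma integral_cheb_mul_cos (n : ℤ) :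
    ∫ β in (0 : ℝ)..(Real.pi / 2), cheb (2 * n) (Real.cos β) * Real.cos β =
      (Real.pi / 2) * (n.sign : ℝ) := by
  have hstep : ∀ n : ℤ, (∫ β in (0 : ℝ)..(Real.pi / 2), cheb (2 * (n + 1)) (Real.cos β) * Real.cos β)
      - ∫ β in (0 : ℝ)..(Real.pi / 2), cheb (2 * n) (Real.cos β) * Real.cos β =
      (Real.pi / 2) * (((n + 1).sign : ℝ) - (n.sign : ℝ)) := by
    intro n
    rw [← intervalIntegral.integral_sub (intervalIntegrable_cheb_mul_cos _ _ _)
      (intervalIntegrable_cheb_mul_cos _ _ _), ← integral_cos_odd_mul_cos]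
    refine integral_congr_uIoo fun β hβ => ?_
    rw [Set.uIoo_of_lt (by positivity)] at hβ
    have hs : Real.sin β ≠ 0 := (Real.sin_pos_of_pos_of_lt_pi hβ.1 (by linarith [hβ.2, Real.pi_pos])).ne'
    rw [← cheb_sub_two n hs]; ring
  induction n using Int.induction_on with
  | zero => simp [cheb_zero]
  | succ i ih => have := hstep i; linarith
  | pred i ih =>
    have := hstep (-i - 1)
    rw [sub_add_cancel] at this
    linarith

/-- The intersection form as an integral of wedge products of spectral vectors. -/
lemma interForm_eq_integral {m m' : ℤ →₀ ℝ} (hm : m.sum (fun _ x => x) = 0)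
    (hm' : m'.sum (fun _ x => x) = 0) :
    interForm m m' = (2 / Real.pi) * ∫ β in (0 : ℝ)..(Real.pi / 2),
      wedge (specVec m (Real.cos β)) (specVec m' (Real.cos β)) * Real.sin β ^ 2 * Real.cos β := by
  have h1 : ∫ β in (0 : ℝ)..(Real.pi / 2),
      wedge (specVec m (Real.cos β)) (specVec m' (Real.cos β)) * Real.sin β ^ 2 * Real.cos β =
      ∫ β in (0 : ℝ)..(Real.pi / 2), ∑ n ∈ m.support, ∑ j ∈ m'.support,
        m n * m' j * (cheb (2 * (n - j)) (Real.cos β) * Real.cos β) := by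
    refine integral_congr_uIoo fun β hβ => ?_
    rw [Set.uIoo_of_lt (by positivity)] at hβ
    have hs : Real.sin β ≠ 0 := (Real.sin_pos_of_pos_of_lt_pi hβ.1 (by linarith [hβ.2, Real.pi_pos])).ne'
    rw [wedge_specVec hm hm' hs]
    simp only [pair, Finsupp.sum, Finset.mul_sum, Finset.sum_mul]
    refine Finset.sum_congr rfl fun n _ => Finset.sum_congr rfl fun j _ => ?_
    ring
  have hI : ∀ n ∈ m.support, IntervalIntegrable (fun β => ∑ j ∈ m'.support,
      m n * m' j * (cheb (2 * (n - j)) (Real.cos β) * Real.cos β)) volume 0 (Real.pi / 2) :=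
    fun n _ => (continuous_finsetSum _ fun j _ => continuous_const.mul
      (((continuous_cheb (2 * (n - j))).comp Real.continuous_cos).mul
        Real.continuous_cos)).intervalIntegrable _ _
  rw [h1, intervalIntegral.integral_finsetSum hI]
  have h2 : ∀ n ∈ m.support, ∫ β in (0 : ℝ)..(Real.pi / 2), ∑ j ∈ m'.support,
        m n * m' j * (cheb (2 * (n - j)) (Real.cos β) * Real.cos β) =
      ∑ j ∈ m'.support, m n * m' j * ((Real.pi / 2) * ((n - j).sign : ℝ)) := by
    intro n _
    rw [intervalIntegral.integral_finsetSum
      (fun j _ => (intervalIntegrable_cheb_mul_cos _ _ _).const_mul _)]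
    refine Finset.sum_congr rfl fun j _ => ?_
    rw [intervalIntegral.integral_const_mul, integral_cheb_mul_cos]
  rw [Finset.sum_congr rfl h2]
  simp only [interForm, Finsupp.sum, Finset.mul_sum]
  refine Finset.sum_congr rfl fun n _ => Finset.sum_congr rfl fun j _ => ?_
  field_simp

end ParabolaSurface

/-! ### The action of affine automorphisms on spectral vectors. -/

namespace ParabolaSurface

lemma sign_sub_sign_pred (x : ℤ) : (x.sign : ℝ) - ((x - 1).sign : ℝ) =
    (if x = 0 then 1 else 0) + (if x = 1 then 1 else 0) := by
  rcases lt_trichotomy x 0 with h | rfl | h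
  · rw [Int.sign_eq_neg_one_of_neg h, Int.sign_eq_neg_one_of_neg (by lia), if_neg (by lia),
      if_neg (by lia)]; simp
  · simp
  · rcases eq_or_ne x 1 with rfl | h1
    · simp
    · rw [Int.sign_eq_one_of_pos h, Int.sign_eq_one_of_pos (by lia), if_neg (by lia),
        if_neg (by lia)]; simp

lemma pair_ite (m : ℤ →₀ ℝ) (n : ℤ) : pair m (fun i => if i = n then 1 else 0) = m n := by
  simp only [pair, Finsupp.sum, mul_ite, mul_one, mul_zero, Finset.sum_ite_eq']
  simp +contextual [eq_comm]

/-- A function whose intersection numbers with the cylinders of slope `s` vanish is orthogonal to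
the functions with the symmetry of this slope. -/
lemma pair_eq_zero {s : ℤ} (hs : s = 0 ∨ s = 1) {μ : ℤ →₀ ℝ}
    (h : ∀ n : ℤ, s ≤ n →
      pair μ (fun i => ((i - n).sign : ℝ) - ((i - (s - 1 - n)).sign : ℝ)) = 0)
    {F : ℤ → ℝ} (hF : ∀ n, F (s - 1 - n) = F n) : pair μ F = 0 := by
  have hA : ∀ n : ℤ, 0 ≤ n →
      pair μ (fun i => ((i - n).sign : ℝ) - ((i - (s - 1 - n)).sign : ℝ)) = 0 := by
    intro n hn
    by_cases hsn : s ≤ n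
    · exact h n hsn
    · obtain ⟨rfl, rfl⟩ : s = 1 ∧ n = 0 := by lia
      simp [pair]
  -- The hypotheses for `n` and `n + 1` differ by `S n + S (n + 1)`, so `S` alternates in sign with
  -- constant modulus, and finite support makes it zero.
  set S : ℤ → ℝ := fun n => μ n + μ (s - 1 - n) with hS
  have hstep : ∀ n : ℤ, 0 ≤ n → S (n + 1) = -S n := by
    intro n hn
    have h1 := hA n hn
    have h2 := hA (n + 1) (by lia)
    have h3 : pair μ (fun i => (((i - n).sign : ℝ) - ((i - (s - 1 - n)).sign : ℝ)) -
        (((i - (n + 1)).sign : ℝ) - ((i - (s - 1 - (n + 1))).sign : ℝ))) = 0 := by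
      rw [pair_sub_right, h1, h2, sub_zero]
    have h4 : ∀ i : ℤ, (((i - n).sign : ℝ) - ((i - (s - 1 - n)).sign : ℝ)) -
        (((i - (n + 1)).sign : ℝ) - ((i - (s - 1 - (n + 1))).sign : ℝ)) =
        ((if i = n then 1 else 0) + (if i = n + 1 then 1 else 0)) +
        ((if i = s - 1 - (n + 1) then 1 else 0) + (if i = s - 1 - n then 1 else 0)) := by
      intro i
      have e1 := sign_sub_sign_pred (i - n)
      have e2 := sign_sub_sign_pred (i - (s - 1 - (n + 1)))
      rw [show i - n - 1 = i - (n + 1) by ring] at e1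
      rw [show i - (s - 1 - (n + 1)) - 1 = i - (s - 1 - n) by ring] at e2
      have c1 : (i - n = 0) = (i = n) := propext (by lia)
      have c2 : (i - n = 1) = (i = n + 1) := propext (by lia)
      have c3 : (i - (s - 1 - (n + 1)) = 0) = (i = s - 1 - (n + 1)) := propext (by lia)
      have c4 : (i - (s - 1 - (n + 1)) = 1) = (i = s - 1 - n) := propext (by lia)
      simp only [c1, c2, c3, c4] at e1 e2
      linarith
    simp only [h4, pair_add_right, pair_ite] at h3
    simp only [hS]
    linarith
  have hnat : ∀ n : ℕ, |S n| = |S 0| := by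
    intro n
    induction n with
    | zero => simp
    | succ i ih => push_cast; rw [hstep i (by lia), abs_neg, ih]
  obtain ⟨N, hN⟩ : ∃ N : ℕ, ∀ n ∈ μ.support, n.natAbs ≤ N :=
    ⟨μ.support.sup Int.natAbs, fun n hn => Finset.le_sup (f := Int.natAbs) hn⟩
  have hbig : S (N + 2 : ℕ) = 0 := by
    have h1 : μ ((N + 2 : ℕ) : ℤ) = 0 := by
      by_contra hne
      have := hN _ (Finsupp.mem_support_iff.2 hne)
      lia
    have h2 : μ (s - 1 - ((N + 2 : ℕ) : ℤ)) = 0 := by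
      by_contra hne
      have := hN _ (Finsupp.mem_support_iff.2 hne)
      lia
    simp only [hS, h1, h2, add_zero]
  have hS0 : |S 0| = 0 := by rw [← hnat (N + 2), hbig, abs_zero]
  have hSn : ∀ n : ℤ, S n = 0 := by
    have hpos : ∀ n : ℤ, 0 ≤ n → S n = 0 := by
      intro n hn
      lift n to ℕ using hn
      exact abs_eq_zero.1 ((hnat n).trans hS0)
    intro n
    rcases le_or_gt 0 n with hn | hn
    · exact hpos n hn
    · have := hpos (s - 1 - n) (by lia)
      simp only [hS, sub_sub_cancel] at this ⊢
      linarith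
  -- `μ` is odd and `F` even under this reflection of the edges, so the pairing equals its own
  -- negative.
  set σ : ℤ ≃ ℤ := Equiv.subLeft (s - 1) with hσ
  set μ' : ℤ →₀ ℝ := μ.equivMapDomain σ with hμ'
  have e1 : ∀ n, μ' n = μ (s - 1 - n) := by
    intro n; rw [hμ', Finsupp.equivMapDomain_apply]; congr 1
    simp [hσ, Equiv.subLeft]; ring
  have e2 : pair μ' F = pair μ F := by
    rw [pair, hμ', Finsupp.sum_equivMapDomain, pair]
    simp only [hσ, Equiv.subLeft_apply, hF]
  have e3 : μ + μ' = 0 := by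
    ext n; simp only [Finsupp.add_apply, e1]; exact hSn n
  have e4 := pair_add_left μ μ' F
  rw [e3, e2] at e4
  simp [pair] at e4 ⊢
  linarith

lemma HasCyl.massF_congr {C C' : Set S1} {v v' : Plane} (h : HasCyl C v) (h' : HasCyl C' v')
    (hC : C = C') (hv : v = v') : h.massF = h'.massF := by
  subst hC hv; rfl

lemma interForm_cyl (m : ℤ →₀ ℝ) {a b : ℤ} (hab : a ≤ b) :
    interForm m (hasCyl_cyl hab).massF = 2 * ((b : ℝ) - a + 1) ^ 2 *
      pair m (fun i => ((i - b).sign : ℝ) - ((i - (a - 1)).sign : ℝ)) := by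
  rw [interForm_eq_pair, ← pair_mul_right, massF_cyl hab]
  congr 1; funext i
  rw [pair_sub_left, pair_single, pair_single]; ring

/-- The action on symmetric functions of an affine automorphism that fixes the direction of
slope `s`. -/
lemma HasCyl.pair_image {C : Set S1} {v : Plane} (h : HasCyl C v) {s : ℤ}
    (hs : s = 0 ∨ s = 1) {g : Equiv.Perm S1} {B : Matrix (Fin 2) (Fin 2) ℝ}
    (hg : Aff g B) (hB : |B.det| = 1) {ε : ℝ} (hε : ε = 1 ∨ ε = -1)
    (hv : B.mulVec ![1, (s : ℝ)] = ε • ![1, (s : ℝ)]) {F : ℤ → ℝ} (hF : ∀ n, F (s - 1 - n) = F n) :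
    pair (h.image hg).massF F = ε * B.det * pair h.massF F := by
  rw [← sub_eq_zero, ← pair_smul_left, ← pair_sub_left]
  refine pair_eq_zero hs (fun n hn => ?_) hF
  have hn0 : 0 ≤ n := by lia
  have hab : s - n ≤ n := by lia
  have hcv : B.mulVec (cylVec (s - n) n) = ε • cylVec (s - n) n := by
    rw [cylVec_slope, Matrix.mulVec_smul, hv, smul_comm]
  have h1 := (h.image hg).wedge_mul_area_inter (hasCyl_cyl hab)
  have h2 := h.wedge_mul_area_inter (hasCyl_cyl hab)
  -- The areas stay multiplied by the wedge of the holonomies, so nothing is divided out and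
  -- cylinders parallel to the test cylinder need no separate treatment.
  rw [h.area_image_inter_cyl hs hn hg hB hε hcv] at h1
  have h3 : wedge (cylVec (s - n) n) (B.mulVec v) = ε * B.det * wedge (cylVec (s - n) n) v := by
    have h4 := wedge_mulVec B (cylVec (s - n) n) v
    rw [hcv] at h4
    have h5 : wedge (ε • cylVec (s - n) n) (B.mulVec v) =
        ε * wedge (cylVec (s - n) n) (B.mulVec v) := by
      simp only [wedge, Pi.smul_apply, smul_eq_mul]; ring
    rw [h5] at h4
    rcases hε with rfl | rfl <;> linarith
  rw [h3, mul_assoc, h2, ← interForm_smul_left, ← sub_eq_zero, ← interForm_sub_left,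
    interForm_cyl _ hab, mul_eq_zero, sub_right_comm s n 1] at h1
  have hj := height_pos hab
  rcases h1 with h1 | h1
  · nlinarith
  · rw [pair_sub_left] at h1 ⊢
    linarith

/-- The passage to coordinates with respect to the basis `(1, 1)`, `(1, 0)`. -/
def coordMat : Matrix (Fin 2) (Fin 2) ℝ := !![0, 1; 1, -1]

/-- `g` is an affine automorphism with derivative `B` that acts on the spectral vectors of
cylinders by the matrices `M k`. -/
structure Acts (g : Equiv.Perm S1) (B : Matrix (Fin 2) (Fin 2) ℝ)
    (M : ℝ → Matrix (Fin 2) (Fin 2) ℝ) : Prop where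
  aff : Aff g B
  det : |B.det| = 1
  coord : coordMat * B = M 1 * coordMat
  spec : ∀ (C : Set S1) (v : Plane) (h : HasCyl C v) (k : ℝ),
    specVec (h.image aff).massF k = (M k).mulVec (specVec h.massF k)

lemma Acts.comp {g g' : Equiv.Perm S1} {B B' : Matrix (Fin 2) (Fin 2) ℝ}
    {M M' : ℝ → Matrix (Fin 2) (Fin 2) ℝ} (h : Acts g B M) (h' : Acts g' B' M') :
    Acts (g * g') (B * B') (fun k => M k * M' k) where
  aff := h.aff.comp h'.aff
  det := by rw [Matrix.det_mul, abs_mul, h.det, h'.det, one_mul]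
  coord := by rw [← Matrix.mul_assoc, h.coord, Matrix.mul_assoc, h'.coord, Matrix.mul_assoc]
  spec C v hC k := by
    have h2 := h.spec _ _ (hC.image h'.aff) k
    rw [h'.spec C v hC k] at h2
    refine Eq.trans ?_ (h2.trans (Matrix.mulVec_mulVec _ _ _))
    congr 1
    refine HasCyl.massF_congr _ _ ?_ ?_
    · rw [← Set.image_comp]; rfl
    · rw [Matrix.mulVec_mulVec]

/-- One component of the spectral vector pairs with a function symmetric for slope 0, the other with
one symmetric for slope 1, and a trivial derivative preserves both directions. It is not necessary
to know that the automorphism is the identity. -/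
lemma acts_of_one {g : Equiv.Perm S1} (hg : Aff g 1) : Acts g 1 (fun _ => 1) where
  aff := hg
  det := by simp
  coord := by simp
  spec C v h k := by
    refine Eq.trans ?_ (Matrix.one_mulVec _).symm
    have h0 := h.pair_image (s := 0) (Or.inl rfl) hg (by simp) (Or.inl rfl)
      (by simp) (F := fun n => cheb n k * cheb (n + 1) k) (fun n => by
        rw [show (0 : ℤ) - 1 - n = -(n + 1) by ring, show -(n + 1) + 1 = -n by ring, cheb_neg,
          cheb_neg]; ring)
    have h1 := h.pair_image (s := 1) (Or.inr rfl) hg (by simp) (Or.inl rfl)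
      (by simp) (F := fun n => cheb n k ^ 2) (fun n => by
        rw [show (1 : ℤ) - 1 - n = -n by ring, cheb_neg]; ring)
    rw [specVec, specVec, h0, h1]
    simp

lemma acts_rot : Acts rot (-1) (fun _ => -1) where
  aff := aff_rot
  det := by simp [Matrix.det_neg]
  coord := by simp
  spec C v h k := by
    have e : (h.image aff_rot).massF = -h.massF := by
      ext n
      rw [Finsupp.neg_apply, HasCyl.massF_apply, HasCyl.massF_apply, Matrix.neg_mulVec,
        Matrix.one_mulVec, mass_neg, h.mass_rot]
    rw [e, specVec, specVec, pair_neg_left, pair_neg_left]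
    apply plane_ext <;> simp [Matrix.neg_mulVec]

/-- The first generating reflection. -/
def genOne (k : ℝ) : Matrix (Fin 2) (Fin 2) ℝ := !![1, 2 * k; 0, -1]

/-- The second generating reflection. -/
def genTwo (k : ℝ) : Matrix (Fin 2) (Fin 2) ℝ := !![-1, 0; 2 * k, 1]

/-- The third generating reflection. -/
def genThree : Matrix (Fin 2) (Fin 2) ℝ := !![1, 0; 0, -1]

lemma pair_refl {C : Set S1} {v : Plane} (h : HasCyl C v) (c : ℤ) (F : ℤ → ℝ) :
    pair (h.image (aff_refl c)).massF F = pair h.massF fun n => F (c - 1 - n) := by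
  rw [pair_equiv (m := h.massF) (Equiv.subLeft (c - 1)) (fun n => by
    rw [HasCyl.massF_apply, HasCyl.massF_apply, mass_refl]; rfl)]
  congr 1; funext n
  congr 1
  simp [Equiv.subLeft]; ring

lemma det_reflMat (c : ℤ) : (reflMat c).det = -1 := by simp [reflMat]

lemma acts_refl_one : Acts (refl 1) (reflMat 1) (fun k => -genOne k) where
  aff := aff_refl 1
  det := by rw [det_reflMat]; simp
  coord := by
    ext i j; fin_cases i <;> fin_cases j <;> simp [coordMat, reflMat, genOne, Matrix.mul_apply,
      Fin.sum_univ_two] <;> norm_num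
  spec C v h k := by
    rw [specVec, specVec, pair_refl h, pair_refl h]
    have e1 : (pair h.massF fun n => cheb (1 - 1 - n) k * cheb (1 - 1 - n + 1) k) =
        2 * k * pair h.massF (fun n => cheb n k ^ 2) -
          pair h.massF (fun n => cheb n k * cheb (n + 1) k) := by
      rw [← pair_mul_right, ← pair_sub_right]
      congr 1; funext n
      rw [show (1 : ℤ) - 1 - n = -n by ring, show -n + 1 = -(n - 1) by ring, cheb_neg, cheb_neg,
        cheb_add_one]
      ring
    have e2 : (pair h.massF fun n => cheb (1 - 1 - n) k ^ 2) =
        pair h.massF (fun n => cheb n k ^ 2) := by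
      congr 1; funext n
      rw [show (1 : ℤ) - 1 - n = -n by ring, cheb_neg]; ring
    rw [e1, e2]
    apply plane_ext <;> simp [genOne, Matrix.neg_mulVec, Matrix.mulVec, dotProduct,
      Fin.sum_univ_two]
    ring

/-- The edges are permuted by `n ↦ -1 - n`, which replaces the square at `n` by the square at `n +
1`. `cheb_sq_add` brings it back, and its constant term vanishes by `HasCyl.sum_massF`. -/
lemma acts_refl_zero : Acts (refl 0) (reflMat 0) (fun k => -genTwo k) where
  aff := aff_refl 0
  det := by rw [det_reflMat]; simp
  coord := by
    ext i j; fin_cases i <;> fin_cases j <;> simp [coordMat, reflMat, genTwo, Matrix.mul_apply,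
      Fin.sum_univ_two] <;> norm_num
  spec C v h k := by
    rw [specVec, specVec, pair_refl h, pair_refl h]
    have e1 : (pair h.massF fun n => cheb (0 - 1 - n) k * cheb (0 - 1 - n + 1) k) =
        pair h.massF (fun n => cheb n k * cheb (n + 1) k) := by
      congr 1; funext n
      rw [show (0 : ℤ) - 1 - n = -(n + 1) by ring, show -(n + 1) + 1 = -n by ring, cheb_neg,
        cheb_neg]
      ring
    have e2 : (pair h.massF fun n => cheb (0 - 1 - n) k ^ 2) =
        2 * k * pair h.massF (fun n => cheb n k * cheb (n + 1) k) -
        pair h.massF (fun n => cheb n k ^ 2) := by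
      have h0 := pair_const h.massF 1
      rw [h.sum_massF, zero_mul] at h0
      rw [← pair_mul_right, ← pair_sub_right, ← add_zero (pair h.massF fun n => _ - _), ← h0,
        ← pair_add_right]
      congr 1; funext n
      rw [show (0 : ℤ) - 1 - n = -(n + 1) by ring, cheb_neg]
      linear_combination cheb_sq_add n k
    rw [e1, e2]
    apply plane_ext <;> simp [genTwo, Matrix.neg_mulVec, Matrix.mulVec, dotProduct,
      Fin.sum_univ_two]
    ring

/-- The derivative reverses the slope 0, fixes the slope 1 and has determinant -1. Hence
`HasCyl.pair_image` multiplies the first component by 1 and the second by -1, for every `k`. -/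
lemma acts_twist_refl : Acts (twist * refl 0) (twistMat * reflMat 0) (fun _ => genThree) := by
  have hd : (twistMat * reflMat 0).det = -1 := by
    rw [Matrix.det_mul, det_reflMat]; simp [twistMat]
  have hg : Aff (twist * refl 0) (twistMat * reflMat 0) := aff_twist.comp (aff_refl 0)
  refine ⟨hg, by rw [hd]; simp, ?_, fun C v h k => ?_⟩
  · ext i j; fin_cases i <;> fin_cases j <;> simp [coordMat, reflMat, genThree, twistMat,
      Matrix.mul_apply, Fin.sum_univ_two] <;> norm_num
  · have h0 := h.pair_image (s := 0) (Or.inl rfl) hg (by rw [hd]; simp) (Or.inr rfl)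
      (by apply plane_ext <;> simp [twistMat, reflMat, Matrix.mulVec, dotProduct,
            Matrix.mul_apply, Fin.sum_univ_two])
      (F := fun n => cheb n k * cheb (n + 1) k) (fun n => by
        rw [show (0 : ℤ) - 1 - n = -(n + 1) by ring, show -(n + 1) + 1 = -n by ring, cheb_neg,
          cheb_neg]; ring)
    have h1 := h.pair_image (s := 1) (Or.inr rfl) hg (by rw [hd]; simp) (Or.inl rfl)
      (by apply plane_ext <;> simp [twistMat, reflMat, Matrix.mulVec, dotProduct,
            Matrix.mul_apply, Fin.sum_univ_two]; norm_num)
      (F := fun n => cheb n k ^ 2) (fun n => by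
        rw [show (1 : ℤ) - 1 - n = -n by ring, cheb_neg]; ring)
    rw [specVec, specVec, h0, h1, hd]
    apply plane_ext <;> simp [genThree, Matrix.mulVec, dotProduct, Fin.sum_univ_two]

/-- The spectral vector at `1` is the holonomy, in the coordinates of `coordMat`. -/
lemma HasCyl.specVec_one {C : Set S1} {v : Plane} (h : HasCyl C v) :
    specVec h.massF 1 = (area C).toReal • coordMat.mulVec v := by
  have h0 := h.wedge_mul_area ![0, 1]
  have h1 := h.wedge_mul_area ![1, 0]
  change _ = pair h.massF _ at h0
  change _ = pair h.massF _ at h1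
  -- Zero total mass discards the additive constants of `wedge` at the midpoints.
  have hc := pair_const h.massF 1
  rw [h.sum_massF, zero_mul] at hc
  have e0 : (fun n => wedge ![0, 1] (mid n)) = fun n : ℤ => (-2) * (n : ℝ) - 1 := by
    funext n; simp [wedge]; ring
  have e1 : (fun n => wedge ![1, 0] (mid n)) =
      fun n : ℤ => (2 * ((n : ℝ) * (n + 1))) + 1 := by
    funext n; simp [wedge]; ring
  rw [e0, pair_sub_right, pair_mul_right, hc] at h0
  rw [e1, pair_add_right, pair_mul_right, hc] at h1
  have e2 : (pair h.massF fun n => (n : ℝ) * (n + 1)) =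
      pair h.massF (fun n => (n : ℝ) ^ 2) + pair h.massF (fun n => (n : ℝ)) := by
    rw [← pair_add_right]; congr 1; funext n; ring
  simp only [wedge, Matrix.cons_val_zero, Matrix.cons_val_one] at h0 h1
  simp only [specVec, cheb_at_one]
  apply plane_ext
  · simp [coordMat, Matrix.mulVec, dotProduct, Fin.sum_univ_two]
    linarith
  · simp [coordMat, Matrix.mulVec, dotProduct, Fin.sum_univ_two]
    linarith

end ParabolaSurface

/-! ### Holonomies of cylinders and the group of derivatives. -/

namespace ParabolaSurface

/-- Words in the generating reflections, as functions of the spectral parameter. -/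
inductive Word : (ℝ → Matrix (Fin 2) (Fin 2) ℝ) → Prop
  | one : Word fun _ => 1
  | genOne {M : ℝ → Matrix (Fin 2) (Fin 2) ℝ} : Word M → Word fun k => genOne k * M k
  | genTwo {M : ℝ → Matrix (Fin 2) (Fin 2) ℝ} : Word M → Word fun k => genTwo k * M k
  | genThree {M : ℝ → Matrix (Fin 2) (Fin 2) ℝ} : Word M → Word fun k => genThree * M k
  | neg {M : ℝ → Matrix (Fin 2) (Fin 2) ℝ} : Word M → Word fun k => -M k

lemma acts_one : Acts 1 1 (fun _ => 1) :=
  acts_of_one ⟨by simp, fun _ => Iff.rfl, fun n z hz =>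
    ⟨n, z, hz, Eventually.of_forall fun x => by simp⟩⟩

lemma acts_genOne : Acts (rot * refl 1) (-1 * reflMat 1) (fun k => genOne k) := by
  simpa using acts_rot.comp acts_refl_one

lemma acts_genTwo : Acts (rot * refl 0) (-1 * reflMat 0) (fun k => genTwo k) := by
  simpa using acts_rot.comp acts_refl_zero

lemma Word.exists_acts {M : ℝ → Matrix (Fin 2) (Fin 2) ℝ} (h : Word M) :
    ∃ g B, Acts g B M := by
  induction h with
  | one => exact ⟨_, _, acts_one⟩
  | genOne _ ih => obtain ⟨g, B, hg⟩ := ih; exact ⟨_, _, acts_genOne.comp hg⟩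
  | genTwo _ ih => obtain ⟨g, B, hg⟩ := ih; exact ⟨_, _, acts_genTwo.comp hg⟩
  | genThree _ ih => obtain ⟨g, B, hg⟩ := ih; exact ⟨_, _, acts_twist_refl.comp hg⟩
  | neg _ ih => obtain ⟨g, B, hg⟩ := ih; exact ⟨_, _, by simpa using acts_rot.comp hg⟩

lemma Word.mul {M N : ℝ → Matrix (Fin 2) (Fin 2) ℝ} (h : Word M) (h' : Word N) :
    Word fun k => M k * N k := by
  induction h with
  | one => simpa using h'
  | genOne _ ih => simpa only [Matrix.mul_assoc] using ih.genOne
  | genTwo _ ih => simpa only [Matrix.mul_assoc] using ih.genTwo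
  | genThree _ ih => simpa only [Matrix.mul_assoc] using ih.genThree
  | neg _ ih => simpa only [Matrix.neg_mul] using ih.neg

/-- `(x, y)` are the coordinates with respect to `(1, 1)`, `(1, 0)` of the holonomy of a
cylinder. -/
def Hol (x y : ℝ) : Prop := ∃ C, HasCyl C ![x + y, x]

lemma Hol.mem {x y : ℝ} (h : Hol x y) : ∃ a b : ℤ, x = 4 * a ∧ y = 2 * b := by
  obtain ⟨C, hC⟩ := h
  obtain ⟨a, b, h0, h1⟩ := hC.mem_periodLattice
  simp only [Matrix.cons_val_zero, Matrix.cons_val_one] at h0 h1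
  exact ⟨b, a - 2 * b, h1, by push_cast; linarith⟩

lemma Hol.add_ne_zero {x y : ℝ} (h : Hol x y) : x + y ≠ 0 := by
  obtain ⟨C, hC⟩ := h
  simpa using hC.apply_zero_ne

lemma Hol.period_right {r : ℝ} (h : Hol 0 r) : ∃ n : ℤ, 0 ≤ n ∧ |r| = 2 * (2 * n + 1) := by
  obtain ⟨C, hC⟩ := h
  have e : ![0 + r, 0] = r • ![1, ((0 : ℤ) : ℝ)] := by apply plane_ext <;> simp
  rw [e] at hC
  obtain ⟨n, hn, h1⟩ := hC.exists_period (Or.inl rfl)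
  exact ⟨n, hn, by rw [h1]; simp⟩

lemma Hol.period_left {r : ℝ} (h : Hol r 0) : ∃ n : ℤ, 1 ≤ n ∧ |r| = 4 * n := by
  obtain ⟨C, hC⟩ := h
  have e : ![r + 0, r] = r • ![1, ((1 : ℤ) : ℝ)] := by apply plane_ext <;> simp
  rw [e] at hC
  obtain ⟨n, hn, h1⟩ := hC.exists_period (Or.inr rfl)
  exact ⟨n, hn, by rw [h1]; push_cast; ring⟩

lemma hol_right : Hol 0 2 := by
  refine ⟨cyl 0 0, ?_⟩
  have h := hasCyl_cyl (a := 0) (b := 0) le_rfl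
  convert h using 1
  apply plane_ext <;> simp [cylVec]

lemma hol_left {n : ℤ} (hn : 1 ≤ n) : Hol (4 * n) 0 := by
  refine ⟨cyl (1 - n) n, ?_⟩
  have h := hasCyl_cyl (a := 1 - n) (b := n) (by lia)
  convert h using 1
  rw [cylVec_slope]
  apply plane_ext <;> simp <;> ring

/-- Linear maps, in coordinates, that preserve the set of holonomies, with their inverses. -/
structure HolPres (A A' : Matrix (Fin 2) (Fin 2) ℝ) : Prop where
  mul_inv : A * A' = 1
  inv_mul : A' * A = 1
  map : ∀ x y, Hol x y → Hol (A 0 0 * x + A 0 1 * y) (A 1 0 * x + A 1 1 * y)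
  map_inv : ∀ x y, Hol x y → Hol (A' 0 0 * x + A' 0 1 * y) (A' 1 0 * x + A' 1 1 * y)

lemma HolPres.mul {A A' B B' : Matrix (Fin 2) (Fin 2) ℝ} (h : HolPres A A') (h' : HolPres B B') :
    HolPres (A * B) (B' * A') where
  mul_inv := by rw [Matrix.mul_assoc, ← Matrix.mul_assoc B, h'.mul_inv, Matrix.one_mul, h.mul_inv]
  inv_mul := by rw [Matrix.mul_assoc, ← Matrix.mul_assoc A', h.inv_mul, Matrix.one_mul, h'.inv_mul]
  map x y hxy := by
    have := h.map _ _ (h'.map x y hxy)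
    simp only [Matrix.mul_apply, Fin.sum_univ_two]
    convert this using 1 <;> ring
  map_inv x y hxy := by
    have := h'.map_inv _ _ (h.map_inv x y hxy)
    simp only [Matrix.mul_apply, Fin.sum_univ_two]
    convert this using 1 <;> ring

/-- The inverse of `coordMat`. -/
def coordInv : Matrix (Fin 2) (Fin 2) ℝ := !![1, 1; 1, 0]

lemma coordMat_mul_coordInv : coordMat * coordInv = 1 := by
  ext i j; fin_cases i <;> fin_cases j <;> simp [coordMat, coordInv]

lemma coordInv_mul_coordMat : coordInv * coordMat = 1 := by
  ext i j; fin_cases i <;> fin_cases j <;> simp [coordMat, coordInv]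

lemma Aff.hol_map {g : Equiv.Perm S1} {B N : Matrix (Fin 2) (Fin 2) ℝ} (hg : Aff g B)
    (hN : coordMat * B = N * coordMat) {x y : ℝ} (h : Hol x y) :
    Hol (N 0 0 * x + N 0 1 * y) (N 1 0 * x + N 1 1 * y) := by
  obtain ⟨C, hC⟩ := h
  refine ⟨g '' C, ?_⟩
  convert hC.image hg using 1
  have hB : B = coordInv * N * coordMat := by
    rw [Matrix.mul_assoc, ← hN, ← Matrix.mul_assoc, coordInv_mul_coordMat, Matrix.one_mul]
  rw [hB]
  apply plane_ext <;>
  simp [coordMat, coordInv, Matrix.mul_apply, Matrix.mulVec, Matrix.vecMul, dotProduct,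
    Fin.sum_univ_two] <;> ring

lemma Aff.holPres {g : Equiv.Perm S1} {B N : Matrix (Fin 2) (Fin 2) ℝ} (hg : Aff g B)
    (hN : coordMat * B = N * coordMat) : HolPres N (coordMat * B⁻¹ * coordInv) := by
  have hN' : N = coordMat * B * coordInv := by
    rw [hN, Matrix.mul_assoc, coordMat_mul_coordInv, Matrix.mul_one]
  have h1 : B * B⁻¹ = 1 := Matrix.mul_nonsing_inv _ hg.det_ne.isUnit
  have h2 : B⁻¹ * B = 1 := Matrix.nonsing_inv_mul _ hg.det_ne.isUnit
  refine ⟨?_, ?_, fun x y h => hg.hol_map hN h, fun x y h => hg.inv.hol_map ?_ h⟩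
  · calc N * (coordMat * B⁻¹ * coordInv)
        = coordMat * (B * (coordInv * coordMat) * B⁻¹) * coordInv := by
          rw [hN']; simp only [Matrix.mul_assoc]
      _ = 1 := by rw [coordInv_mul_coordMat, Matrix.mul_one, h1, Matrix.mul_one,
          coordMat_mul_coordInv]
  · calc (coordMat * B⁻¹ * coordInv) * N
        = coordMat * (B⁻¹ * (coordInv * coordMat) * B) * coordInv := by
          rw [hN']; simp only [Matrix.mul_assoc]
      _ = 1 := by rw [coordInv_mul_coordMat, Matrix.mul_one, h2, Matrix.mul_one,
          coordMat_mul_coordInv]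
  · rw [Matrix.mul_assoc _ coordInv, coordInv_mul_coordMat, Matrix.mul_one]

lemma Word.holPres {M : ℝ → Matrix (Fin 2) (Fin 2) ℝ} (h : Word M) : ∃ N, HolPres (M 1) N := by
  obtain ⟨g, B, hg⟩ := h.exists_acts
  exact ⟨_, hg.aff.holPres hg.coord⟩

lemma Hol.genOne {x y : ℝ} (h : Hol x y) : Hol (x + 2 * y) (-y) := by
  simpa [ParabolaSurface.genOne] using acts_genOne.aff.hol_map acts_genOne.coord h

lemma Hol.genTwo {x y : ℝ} (h : Hol x y) : Hol (-x) (2 * x + y) := by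
  simpa [ParabolaSurface.genTwo] using acts_genTwo.aff.hol_map acts_genTwo.coord h

lemma Hol.genThree {x y : ℝ} (h : Hol x y) : Hol x (-y) := by
  simpa [ParabolaSurface.genThree] using acts_twist_refl.aff.hol_map acts_twist_refl.coord h

/-- The Euclidean algorithm on holonomies. -/
lemma Hol.exists_word {x y : ℝ} (h : Hol x y) : ∃ M, Word M ∧
    (M 1 0 0 * x + M 1 0 1 * y = 0 ∨ M 1 1 0 * x + M 1 1 1 * y = 0) := by
  obtain ⟨a, b, hx, hy⟩ := h.mem
  induction hn : (4 * a).natAbs + (2 * b).natAbs using Nat.strong_induction_on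
    generalizing a b x y with
  | _ n ih =>
  have step : ∀ (N : ℝ → Matrix (Fin 2) (Fin 2) ℝ) (a' b' : ℤ), Word N →
      Hol (4 * a') (2 * b') → N 1 0 0 * x + N 1 0 1 * y = 4 * a' →
      N 1 1 0 * x + N 1 1 1 * y = 2 * b' →
      (4 * a').natAbs + (2 * b').natAbs < n → ∃ M, Word M ∧
      (M 1 0 0 * x + M 1 0 1 * y = 0 ∨ M 1 1 0 * x + M 1 1 1 * y = 0) := by
    intro N a' b' hN hh h0 h1 hlt
    obtain ⟨M, hM, h2⟩ := ih _ hlt hh a' b' rfl rfl rfl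
    refine ⟨_, hM.mul hN, ?_⟩
    simp only [Matrix.mul_apply, Fin.sum_univ_two]
    rw [← h0, ← h1] at h2
    rcases h2 with h2 | h2
    · left; linarith
    · right; linarith
  by_cases ha : a = 0
  · exact ⟨_, Word.one, Or.inl (by simp [hx, ha])⟩
  by_cases hb : b = 0
  · exact ⟨_, Word.one, Or.inr (by simp [hy, hb])⟩
  -- No cylinder is vertical, nor is its image under the third reflection. So the two coordinates
  -- differ in modulus and each step of the algorithm decreases strictly.
  have n1 : 4 * a + 2 * b ≠ 0 := by
    have := h.add_ne_zero; rw [hx, hy] at this; exact_mod_cast this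
  have n2 : 4 * a - 2 * b ≠ 0 := by
    have := h.genThree.add_ne_zero; rw [hx, hy, ← sub_eq_add_neg] at this; exact_mod_cast this
  have w1 := Word.one.genOne
  have w2 := Word.one.genTwo
  have w31 := Word.one.genThree.genOne
  have w32 := Word.one.genThree.genTwo
  by_cases hlt : (2 * b).natAbs < (4 * a).natAbs
  · by_cases hs : 0 < a ↔ 0 < b
    · refine step _ (a - b) b w31 ?_ ?_ ?_ (by lia)
      · have := h.genThree.genOne
        rw [hx, hy] at this; push_cast; convert this using 1 <;> ring
      · simp [ParabolaSurface.genOne, ParabolaSurface.genThree, hx, hy]; ring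
      · simp [ParabolaSurface.genOne, ParabolaSurface.genThree, hx, hy]
    · refine step _ (a + b) (-b) w1 ?_ ?_ ?_ (by lia)
      · have := h.genOne
        rw [hx, hy] at this; push_cast; convert this using 1 <;> ring
      · simp [ParabolaSurface.genOne, hx, hy]; ring
      · simp [ParabolaSurface.genOne, hx, hy]
  · by_cases hs : 0 < a ↔ 0 < b
    · refine step _ (-a) (4 * a - b) w32 ?_ ?_ ?_ (by lia)
      · have := h.genThree.genTwo
        rw [hx, hy] at this; push_cast; convert this using 1 <;> ring
      · simp [ParabolaSurface.genTwo, ParabolaSurface.genThree, hx, hy]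
      · simp [ParabolaSurface.genTwo, ParabolaSurface.genThree, hx, hy]; ring
    · refine step _ (-a) (4 * a + b) w2 ?_ ?_ ?_ (by lia)
      · have := h.genTwo
        rw [hx, hy] at this; push_cast; convert this using 1 <;> ring
      · simp [ParabolaSurface.genTwo, hx, hy]
      · simp [ParabolaSurface.genTwo, hx, hy]; ring

/-- `A` is inverse to a word. -/
def Reduces (A : Matrix (Fin 2) (Fin 2) ℝ) : Prop := ∃ M, Word M ∧ M 1 * A = 1

lemma Word.reduces {M : ℝ → Matrix (Fin 2) (Fin 2) ℝ} (h : Word M)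
    {A : Matrix (Fin 2) (Fin 2) ℝ} (hA : Reduces (M 1 * A)) : Reduces A := by
  obtain ⟨N, hN, h1⟩ := hA
  exact ⟨_, hN.mul h, by rw [Matrix.mul_assoc]; exact h1⟩

lemma HolPres.entries {A A' : Matrix (Fin 2) (Fin 2) ℝ} (h : HolPres A A') :
    (A 0 0 * A' 0 0 + A 0 1 * A' 1 0 = 1 ∧ A 0 0 * A' 0 1 + A 0 1 * A' 1 1 = 0 ∧
    A 1 0 * A' 0 0 + A 1 1 * A' 1 0 = 0 ∧ A 1 0 * A' 0 1 + A 1 1 * A' 1 1 = 1) ∧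
    (A' 0 0 * A 0 0 + A' 0 1 * A 1 0 = 1 ∧ A' 0 0 * A 0 1 + A' 0 1 * A 1 1 = 0 ∧
    A' 1 0 * A 0 0 + A' 1 1 * A 1 0 = 0 ∧ A' 1 0 * A 0 1 + A' 1 1 * A 1 1 = 1) := by
  have h1 := h.mul_inv
  have h2 := h.inv_mul
  simp only [← Matrix.ext_iff, Fin.forall_fin_two, Matrix.mul_apply, Fin.sum_univ_two,
    Matrix.one_apply] at h1 h2
  simp at h1 h2
  tauto

/-- Words change `n` by 4, so only `|n| ≤ 2` remains. For `n = ±2` the holonomy `(4, 0)` would go to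
`(4, ±4)`, vertical up to the third reflection. For `n = ±1` the holonomy `(8, 0)` would go to `(8,
±4)`, which reduces to `(0, 4)`, while horizontal circumferences are twice odd numbers. -/
lemma HolPres.reduces_unipotent {A A' : Matrix (Fin 2) (Fin 2) ℝ} (h : HolPres A A')
    (h00 : A 0 0 = 1) (h01 : A 0 1 = 0) (h11 : A 1 1 = 1) (n : ℤ) (hn : 2 * A 1 0 = n) :
    Reduces A := by
  induction hm : n.natAbs using Nat.strong_induction_on generalizing n A A' with
  | _ m ih =>
  have a1 := h.map _ _ (hol_left (n := 1) le_rfl)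
  have a2 := h.map _ _ (hol_left (n := 2) (by norm_num))
  simp only [h00, h01, h11] at a1 a2
  push_cast at a1 a2
  have e1 : A 1 0 * (4 * 1) + 1 * 0 = 2 * (n : ℝ) := by linarith
  have e2 : A 1 0 * (4 * 2) + 1 * 0 = 4 * (n : ℝ) := by linarith
  rw [e1] at a1
  rw [e2] at a2
  have no4 : ¬ Hol 0 4 := by
    intro hh
    obtain ⟨j, -, hj⟩ := hh.period_right
    rw [abs_of_pos (by norm_num)] at hj
    have : (2 : ℤ) = 2 * j + 1 := by exact_mod_cast (by linarith : (2 : ℝ) = 2 * j + 1)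
    lia
  rcases le_or_gt 3 n with hn3 | hn3
  · have w := Word.one.genThree.neg.genTwo
    obtain ⟨N, hN⟩ := w.holPres
    refine w.reduces (ih (n - 4).natAbs (by lia) (hN.mul h) ?_ ?_ ?_ (n - 4) ?_ rfl)
    all_goals simp [Matrix.mul_apply, Fin.sum_univ_two, genTwo, genThree, h00, h01, h11]
    linarith
  rcases le_or_gt n (-3) with hn3' | hn3'
  · have w := Word.one.genTwo.genThree.neg
    obtain ⟨N, hN⟩ := w.holPres
    refine w.reduces (ih (n + 4).natAbs (by lia) (hN.mul h) ?_ ?_ ?_ (n + 4) ?_ rfl)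
    all_goals simp [Matrix.mul_apply, Fin.sum_univ_two, genTwo, genThree, h00, h01, h11]
    linarith
  have hcases : n = -2 ∨ n = -1 ∨ n = 0 ∨ n = 1 ∨ n = 2 := by lia
  rcases hcases with rfl | rfl | rfl | rfl | rfl
  · exact absurd (by norm_num) a1.add_ne_zero
  · refine absurd ?_ no4
    convert a2.genOne using 1 <;> norm_num
  · refine ⟨_, Word.one, ?_⟩
    rw [Matrix.one_mul]
    have : A 1 0 = 0 := by simpa using hn
    ext i j; fin_cases i <;> fin_cases j <;> simp [h00, h01, h11, this]
  · refine absurd ?_ no4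
    convert a2.genThree.genOne using 1 <;> norm_num
  · exact absurd (by norm_num) a1.genThree.add_ne_zero

/-- Holonomies have first coordinate in `4ℤ`, so the upper left entry and its inverse are integers.
It is therefore ±1, and a reflection makes the matrix unipotent. -/
lemma HolPres.reduces_of_fixed {A A' : Matrix (Fin 2) (Fin 2) ℝ} (h : HolPres A A')
    (h01 : A 0 1 = 0) (h11 : A 1 1 = 1) : Reduces A := by
  obtain ⟨⟨-, e2, -, e4⟩, ⟨e5, -, -, -⟩⟩ := h.entries
  have a1 := h.map _ _ (hol_left (n := 1) le_rfl)
  have a2 := h.map_inv _ _ (hol_left (n := 1) le_rfl)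
  obtain ⟨a, b, ha, hb⟩ := a1.mem
  obtain ⟨a', -, ha', -⟩ := a2.mem
  have hA : A 0 0 = a := by push_cast at ha; linarith
  have hA' : A' 0 0 = a' := by push_cast at ha'; linarith
  have hb' : 2 * A 1 0 = b := by push_cast at hb; linarith
  have h00 : A 0 0 ≠ 0 := by
    intro h0
    have := h.entries.1.1
    rw [h0, h01] at this; simp at this
  have h01' : A' 0 1 = 0 := by
    rw [h01, zero_mul, add_zero] at e2
    exact (mul_eq_zero.1 e2).resolve_left h00
  rw [h01', zero_mul, add_zero, hA, hA'] at e5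
  have e5' : a' * a = 1 := by exact_mod_cast e5
  rcases Int.eq_one_or_neg_one_of_mul_eq_one' e5' with ⟨-, rfl⟩ | ⟨-, rfl⟩
  · exact h.reduces_unipotent (by simpa using hA) h01 h11 b hb'
  · have w := Word.one.genThree.neg
    obtain ⟨N, hN⟩ := w.holPres
    refine w.reduces ((hN.mul h).reduces_unipotent ?_ ?_ ?_ b ?_)
    all_goals simp [Matrix.mul_apply, Fin.sum_univ_two, genThree, h01, h11, hA, hb']

/-- The linear maps that preserve the holonomies are inverse to words. -/
lemma HolPres.reduces {A A' : Matrix (Fin 2) (Fin 2) ℝ} (h : HolPres A A') : Reduces A := by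
  -- The Euclidean algorithm moves the image of the shortest horizontal holonomy onto a coordinate
  -- axis.
  obtain ⟨M, hM, hz⟩ := (h.map _ _ hol_right).exists_word
  refine hM.reduces ?_
  obtain ⟨N, hN⟩ := hM.holPres
  have hP := hN.mul h
  set B := M 1 * A with hB
  set B' := A' * N with hB'
  have e1 : M 1 0 0 * (A 0 0 * 0 + A 0 1 * 2) + M 1 0 1 * (A 1 0 * 0 + A 1 1 * 2) = 2 * B 0 1 := by
    simp [hB, Matrix.mul_apply, Fin.sum_univ_two]; ring
  have e2 : M 1 1 0 * (A 0 0 * 0 + A 0 1 * 2) + M 1 1 1 * (A 1 0 * 0 + A 1 1 * 2) = 2 * B 1 1 := by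
    simp [hB, Matrix.mul_apply, Fin.sum_univ_two]; ring
  rw [e1, e2] at hz
  have a1 := hP.map _ _ hol_right
  have a2 := hP.map_inv _ _ hol_right
  obtain ⟨⟨-, -, -, -⟩, ⟨-, f2, -, f4⟩⟩ := hP.entries
  clear_value B B'
  -- If the image is horizontal, the scaling factor and its inverse are odd integers in modulus,
  -- hence ±1.
  rcases hz with hz | hz
  · have h01 : B 0 1 = 0 := by linarith
    rw [h01, mul_zero, zero_add] at f2 f4
    have h11 : B 1 1 ≠ 0 := by rintro h0; simp [h0] at f4
    have h01' : B' 0 1 = 0 := (mul_eq_zero.1 f2).resolve_right h11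
    simp only [h01, h01', mul_zero, zero_add, zero_mul] at a1 a2
    obtain ⟨n, hn, hn1⟩ := a1.period_right
    obtain ⟨n', hn', hn1'⟩ := a2.period_right
    rw [abs_mul, abs_two] at hn1 hn1'
    have h3 : |B 1 1| = 2 * n + 1 := by linarith
    have h3' : |B' 1 1| = 2 * n' + 1 := by linarith
    have h4 : (2 * n' + 1) * (2 * n + 1) = (1 : ℤ) := by
      have : |B' 1 1| * |B 1 1| = 1 := by rw [← abs_mul, f4, abs_one]
      rw [h3, h3'] at this
      exact_mod_cast this
    have h5 : n = 0 := by nlinarith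
    rw [h5] at h3
    norm_num at h3
    rcases eq_or_eq_neg_of_abs_eq h3 with h6 | h6
    · exact hP.reduces_of_fixed h01 h6
    · have w := Word.one.neg
      obtain ⟨N', hN'⟩ := w.holPres
      refine w.reduces ((hN'.mul hP).reduces_of_fixed ?_ ?_)
      all_goals simp [h01, h6]
  -- If the image has slope 1, the inverse sends the slope 1 holonomies `(4, 0)` and `(8, 0)` to
  -- horizontal ones with ratio 2, and two numbers that are twice odd never have this ratio.
  · exfalso
    have h11 : B 1 1 = 0 := by linarith
    rw [h11, mul_zero, add_zero] at f2 f4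
    have h01 : B 0 1 ≠ 0 := by rintro h0; simp [h0] at f4
    have h00' : B' 0 0 = 0 := (mul_eq_zero.1 f2).resolve_right h01
    have a3 := hP.map_inv _ _ (hol_left (n := 1) le_rfl)
    have a4 := hP.map_inv _ _ (hol_left (n := 2) (by norm_num))
    simp only [h11, h00', mul_zero, add_zero, zero_add, zero_mul] at a1 a3 a4
    obtain ⟨n, hn, hn1⟩ := a1.period_left
    obtain ⟨n', hn', hn1'⟩ := a3.period_right
    obtain ⟨n'', hn'', hn1''⟩ := a4.period_right
    rw [abs_mul] at hn1 hn1' hn1''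
    push_cast at hn1' hn1''
    norm_num at hn1 hn1' hn1''
    have h3 : (2 * (2 * n' + 1) : ℝ) = 2 * n'' + 1 := by linarith
    have h4 : 2 * (2 * n' + 1) = 2 * n'' + 1 := by exact_mod_cast h3
    lia

/-- The spectral vectors of the images under an affine automorphism are governed by a word. -/
lemma Aff.exists_word {g : Equiv.Perm S1} {A : Matrix (Fin 2) (Fin 2) ℝ} (hg : Aff g A) :
    |A.det| = 1 ∧ ∃ M, Word M ∧ M 1 * (coordMat * A * coordInv) = 1 ∧
    ∀ (C : Set S1) (v : Plane) (h : HasCyl C v) (k : ℝ),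
      (M k).mulVec (specVec (h.image hg).massF k) = specVec h.massF k := by
  have hc : coordMat * A = coordMat * A * coordInv * coordMat := by
    rw [Matrix.mul_assoc _ coordInv, coordInv_mul_coordMat, Matrix.mul_one]
  obtain ⟨M, hM, h1⟩ := (hg.holPres hc).reduces
  obtain ⟨g', B, hB⟩ := hM.exists_acts
  have hBA : B * A = 1 := by
    have h2 : coordMat * (B * A) = coordMat := by
      rw [← Matrix.mul_assoc, hB.coord, Matrix.mul_assoc, hc, ← Matrix.mul_assoc, h1,
        Matrix.one_mul]
    calc B * A = coordInv * (coordMat * (B * A)) := by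
          rw [← Matrix.mul_assoc, coordInv_mul_coordMat, Matrix.one_mul]
      _ = 1 := by rw [h2, coordInv_mul_coordMat]
  refine ⟨?_, M, hM, h1, fun C v h k => ?_⟩
  · have h2 := hB.det
    have h3 : |B.det * A.det| = 1 := by rw [← Matrix.det_mul, hBA]; simp
    rwa [abs_mul, h2, one_mul] at h3
  -- The word and `g` cancel up to an automorphism with trivial derivative, which does not affect
  -- spectral vectors.
  · have hga : Aff (g' * g) 1 := by rw [← hBA]; exact hB.aff.comp hg
    have h2 := (acts_of_one hga).spec C v h k
    have h3 := hB.spec _ _ (h.image hg) k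
    rw [← h3]
    refine Eq.trans ?_ (h2.trans (Matrix.one_mulVec _))
    congr 1
    refine HasCyl.massF_congr _ _ ?_ ?_
    · rw [← Set.image_comp]; rfl
    · rw [Matrix.mulVec_mulVec, hBA]

end ParabolaSurface

/-! ### Decrease of the trace away from `k = 1`. -/

namespace ParabolaSurface

lemma det_genOne (k : ℝ) : (genOne k).det = -1 := by simp [genOne]

lemma det_genTwo (k : ℝ) : (genTwo k).det = -1 := by simp [genTwo]

lemma det_genThree : genThree.det = -1 := by simp [genThree]

lemma Word.det {M : ℝ → Matrix (Fin 2) (Fin 2) ℝ} (h : Word M) :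
    ∃ δ : ℝ, (δ = 1 ∨ δ = -1) ∧ ∀ k, (M k).det = δ := by
  induction h with
  | one => exact ⟨1, Or.inl rfl, by simp⟩
  | genOne _ ih | genTwo _ ih | genThree _ ih =>
    obtain ⟨δ, h1, h2⟩ := ih
    refine ⟨-δ, ?_, fun k => ?_⟩
    · rcases h1 with rfl | rfl <;> simp
    · simp [Matrix.det_mul, det_genOne, det_genTwo, det_genThree, h2]
  | neg _ ih =>
    obtain ⟨δ, h1, h2⟩ := ih
    exact ⟨δ, h1, fun k => by simp [Matrix.det_neg, h2]⟩

lemma trace_mul_self (M : Matrix (Fin 2) (Fin 2) ℝ) :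
    (M * M).trace = M.trace ^ 2 - 2 * M.det := by
  rw [Matrix.det_fin_two]
  simp only [Matrix.trace, Matrix.diag, Matrix.mul_apply, Fin.sum_univ_two]
  ring

/-- The elements of the dihedral group generated by the first two reflections. -/
noncomputable def dihedral (n : ℤ) (k : ℝ) : Matrix (Fin 2) (Fin 2) ℝ :=
  if Even n then !![cheb (n + 1) k, cheb n k; -cheb n k, -cheb (n - 1) k]
  else !![cheb n k, cheb (n + 1) k; -cheb (n - 1) k, -cheb n k]

lemma dihedral_zero (k : ℝ) : dihedral 0 k = 1 := by
  have h : cheb (-1) k = -1 := by rw [cheb_neg, cheb_one]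
  ext i j
  fin_cases i <;> fin_cases j <;> simp [dihedral, cheb_zero, cheb_one, h]

lemma genOne_mul_dihedral (n : ℤ) (k : ℝ) : genOne k * dihedral n k = dihedral (1 - n) k := by
  have h1 := cheb_add_one n k
  have h2 := cheb_add_one (n - 1) k
  rw [sub_add_cancel] at h2
  have e1 : cheb (1 - n) k = -cheb (n - 1) k := by rw [← cheb_neg]; congr 1; ring
  have e2 : cheb (1 - n + 1) k = -cheb (n - 1 - 1) k := by rw [← cheb_neg]; congr 1; ring
  have e3 : cheb (1 - n - 1) k = -cheb n k := by rw [← cheb_neg]; congr 1; ring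
  by_cases hn : Even n
  · have hn' : ¬ Even (1 - n) := by simpa [Int.even_sub] using hn
    rw [dihedral, dihedral, if_pos hn, if_neg hn', e1, e2, e3]
    ext i j
    fin_cases i <;> fin_cases j <;> simp [genOne, Matrix.mul_apply, Fin.sum_univ_two] <;> linarith
  · have hn' : Even (1 - n) := by simpa [Int.even_sub] using hn
    rw [dihedral, dihedral, if_neg hn, if_pos hn', e1, e2, e3]
    ext i j
    fin_cases i <;> fin_cases j <;> simp [genOne, Matrix.mul_apply, Fin.sum_univ_two] <;> linarith

lemma genTwo_mul_dihedral (n : ℤ) (k : ℝ) : genTwo k * dihedral n k = dihedral (-1 - n) k := by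
  have h1 := cheb_add_one n k
  have h2 := cheb_add_one (n + 1) k
  rw [add_sub_cancel_right] at h2
  have e1 : cheb (-1 - n) k = -cheb (n + 1) k := by rw [← cheb_neg]; congr 1; ring
  have e2 : cheb (-1 - n + 1) k = -cheb n k := by rw [← cheb_neg]; congr 1; ring
  have e3 : cheb (-1 - n - 1) k = -cheb (n + 1 + 1) k := by rw [← cheb_neg]; congr 1; ring
  by_cases hn : Even n
  · have hn' : ¬ Even (-1 - n) := by simpa [Int.even_sub] using hn
    rw [dihedral, dihedral, if_pos hn, if_neg hn', e1, e2, e3]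
    ext i j
    fin_cases i <;> fin_cases j <;> simp [genTwo, Matrix.mul_apply, Fin.sum_univ_two] <;> linarith
  · have hn' : Even (-1 - n) := by simpa [Int.even_sub] using hn
    rw [dihedral, dihedral, if_neg hn, if_pos hn', e1, e2, e3]
    ext i j
    fin_cases i <;> fin_cases j <;> simp [genTwo, Matrix.mul_apply, Fin.sum_univ_two] <;> linarith

/-- The generators act on the indices by reflections that do not depend on `k`, so the product index
is the same for all `k`. -/
lemma exists_dihedral_mul (a : ℤ) : ∀ b, ∃ c, ∀ k, dihedral a k * dihedral b k = dihedral c k := by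
  have h1 : ∀ a : ℤ, (∀ b, ∃ c, ∀ k, dihedral a k * dihedral b k = dihedral c k) →
      ∀ b, ∃ c, ∀ k, dihedral (1 - a) k * dihedral b k = dihedral c k := by
    intro a h b
    obtain ⟨c, hc⟩ := h b
    exact ⟨1 - c, fun k => by
      rw [← genOne_mul_dihedral, Matrix.mul_assoc, hc, genOne_mul_dihedral]⟩
  have h2 : ∀ a : ℤ, (∀ b, ∃ c, ∀ k, dihedral a k * dihedral b k = dihedral c k) →
      ∀ b, ∃ c, ∀ k, dihedral (-1 - a) k * dihedral b k = dihedral c k := by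
    intro a h b
    obtain ⟨c, hc⟩ := h b
    exact ⟨-1 - c, fun k => by
      rw [← genTwo_mul_dihedral, Matrix.mul_assoc, hc, genTwo_mul_dihedral]⟩
  have h3 : ∀ j : ℤ, ∀ b, ∃ c, ∀ k, dihedral (2 * j) k * dihedral b k = dihedral c k := by
    intro j
    induction j using Int.induction_on with
    | zero => exact fun b => ⟨b, fun k => by rw [mul_zero, dihedral_zero, Matrix.one_mul]⟩
    | succ i ih =>
      have := h1 _ (h2 _ ih)
      rwa [show 1 - (-1 - 2 * (i : ℤ)) = 2 * (i + 1) by ring] at this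
    | pred i ih =>
      have := h2 _ (h1 _ ih)
      rwa [show -1 - (1 - 2 * (-i : ℤ)) = 2 * (-i - 1) by ring] at this
  rcases Int.even_or_odd' a with ⟨j, rfl | rfl⟩
  · exact h3 j
  · have := h1 _ (h3 (-j))
    rwa [show 1 - 2 * -j = 2 * j + 1 by ring] at this

lemma trace_dihedral_sq (n : ℤ) : (dihedral n 1 * dihedral n 1).trace = 2 := by
  rw [trace_mul_self, Matrix.det_fin_two]
  by_cases hn : Even n
  · simp [dihedral, hn, cheb_at_one, Matrix.trace, Fin.sum_univ_two]; ring
  · simp [dihedral, hn, cheb_at_one, Matrix.trace, Fin.sum_univ_two]; ring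

lemma det_dihedral (n : ℤ) : |(dihedral n 1).det| = 1 := by
  rw [Matrix.det_fin_two]
  by_cases hn : Even n
  · rw [abs_eq zero_le_one]; left
    simp [dihedral, hn, cheb_at_one]; ring
  · rw [abs_eq zero_le_one]; right
    simp [dihedral, hn, cheb_at_one]; ring

/-- The product of the elements `genThree * dihedral n k`, for `n` in a list. -/
noncomputable def listProd (l : List ℤ) (k : ℝ) : Matrix (Fin 2) (Fin 2) ℝ :=
  (l.map fun n => genThree * dihedral n k).prod

lemma listProd_nil (k : ℝ) : listProd [] k = 1 := rfl

lemma listProd_cons (n : ℤ) (l : List ℤ) (k : ℝ) :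
    listProd (n :: l) k = genThree * dihedral n k * listProd l k := by simp [listProd]

lemma listProd_append (l l' : List ℤ) (k : ℝ) :
    listProd (l ++ l') k = listProd l k * listProd l' k := by simp [listProd]

lemma abs_det_listProd (l : List ℤ) : |(listProd l 1).det| = 1 := by
  induction l with
  | nil => simp [listProd_nil]
  | cons n l ih =>
    rw [listProd_cons, Matrix.det_mul, Matrix.det_mul, abs_mul, abs_mul, ih, det_dihedral,
      det_genThree]
    simp

/-- The first two reflections generate the dihedral family, so the occurrences of `genThree` cut a
word into dihedral pieces. -/
lemma Word.normal_form {M : ℝ → Matrix (Fin 2) (Fin 2) ℝ} (h : Word M) :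
    ∃ (σ : ℝ) (n : ℤ) (l : List ℤ), (σ = 1 ∨ σ = -1) ∧
      ∀ k, M k = σ • (dihedral n k * listProd l k) := by
  induction h with
  | one => exact ⟨1, 0, [], Or.inl rfl, fun k => by simp [listProd_nil, dihedral_zero]⟩
  | genOne _ ih =>
    obtain ⟨σ, n, l, hσ, h⟩ := ih
    exact ⟨σ, 1 - n, l, hσ, fun k => by
      beta_reduce
      rw [h, Matrix.mul_smul, ← Matrix.mul_assoc, genOne_mul_dihedral]⟩
  | genTwo _ ih =>
    obtain ⟨σ, n, l, hσ, h⟩ := ih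
    exact ⟨σ, -1 - n, l, hσ, fun k => by
      beta_reduce
      rw [h, Matrix.mul_smul, ← Matrix.mul_assoc, genTwo_mul_dihedral]⟩
  | genThree _ ih =>
    obtain ⟨σ, n, l, hσ, h⟩ := ih
    exact ⟨σ, 0, n :: l, hσ, fun k => by
      beta_reduce
      rw [h, Matrix.mul_smul, ← Matrix.mul_assoc, dihedral_zero, Matrix.one_mul, listProd_cons]⟩
  | neg _ ih =>
    obtain ⟨σ, n, l, hσ, h⟩ := ih
    exact ⟨-σ, n, l, by rcases hσ with rfl | rfl <;> simp, fun k => by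
      beta_reduce
      rw [h, neg_smul]⟩

/-- Completing the square in `cheb_sq_add` gives `(U_{n+1} - k U_n)² = 1 - (1 - k²) U_n² ≤ 1`. -/
lemma abs_cheb_add_one (n : ℤ) {k : ℝ} (h0 : 0 ≤ k) (h1 : k ≤ 1) :
    |cheb (n + 1) k| ≤ k * |cheb n k| + 1 := by
  have h := cheb_sq_add n k
  have h2 : |cheb (n + 1) k - k * cheb n k| ≤ 1 := by
    refine abs_le_of_sq_le_sq ?_ zero_le_one
    nlinarith [mul_nonneg (mul_nonneg (sub_nonneg.2 h1) (by linarith : 0 ≤ 1 + k))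
      (sq_nonneg (cheb n k))]
  calc |cheb (n + 1) k| = |k * cheb n k + (cheb (n + 1) k - k * cheb n k)| := by congr 1; ring
    _ ≤ |k * cheb n k| + |cheb (n + 1) k - k * cheb n k| := abs_add_le _ _
    _ ≤ k * |cheb n k| + 1 := by rw [abs_mul, abs_of_nonneg h0]; linarith

lemma abs_cheb_natCast_le (n : ℕ) {k : ℝ} (h0 : 0 ≤ k) (h1 : k ≤ 1) : |cheb n k| ≤ n := by
  induction n with
  | zero => simp [cheb_zero]
  | succ n ih =>
    have := abs_cheb_add_one n h0 h1
    push_cast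
    nlinarith [abs_nonneg (cheb n k)]

lemma abs_cheb_natAbs (n : ℤ) (k : ℝ) : |cheb n k| = |cheb (n.natAbs : ℤ) k| := by
  rcases Int.natAbs_eq n with h | h
  · rw [← h]
  · rw [h, Int.natAbs_neg, cheb_neg, abs_neg, Int.natAbs_natCast]

lemma abs_cheb_le (n : ℤ) {k : ℝ} (h0 : 0 ≤ k) (h1 : k ≤ 1) : |cheb n k| ≤ n.natAbs := by
  rw [abs_cheb_natAbs]; exact abs_cheb_natCast_le _ h0 h1

/-- One step of the recurrence with factor `k` already gives the gain. Evenness excludes the indices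
±1, where the polynomial has constant modulus 1; off-diagonal entries of `dihedral` have even index.
-/
lemma abs_cheb_le_of_even {n : ℤ} (hn : Even n) {k : ℝ} (h0 : 0 ≤ k) (h1 : k ≤ 1) :
    |cheb n k| ≤ (1 + k) / 2 * n.natAbs := by
  rw [abs_cheb_natAbs]
  have hn' : Even n.natAbs := Int.natAbs_even.2 hn
  set m := n.natAbs
  rcases m with _ | m
  · simp [cheb_zero]
  · have hm : 1 ≤ m := by
      rcases m with _ | m
      · simp at hn'
      · lia
    have hm' : (1 : ℝ) ≤ m := by exact_mod_cast hm
    have h2 := abs_cheb_add_one m h0 h1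
    have h3 := abs_cheb_natCast_le m h0 h1
    push_cast
    nlinarith [mul_le_mul_of_nonneg_left h3 h0, mul_nonneg (sub_nonneg.2 hm') (sub_nonneg.2 h1)]

/-- On `[0, 1]` the entries of `M` are dominated by those at `1`, the off-diagonal ones strictly
away from `1`. -/
def Dominated (M : ℝ → Matrix (Fin 2) (Fin 2) ℝ) : Prop :=
  ∃ (σ : ℝ) (N : Matrix (Fin 2) (Fin 2) ℕ), (σ = 1 ∨ σ = -1) ∧
    (∀ i j, M 1 i j = σ * N i j) ∧ ∀ k, 0 ≤ k → k ≤ 1 →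
      |M k 0 0| ≤ N 0 0 ∧ |M k 1 1| ≤ N 1 1 ∧
      |M k 0 1| ≤ (1 + k) / 2 * N 0 1 ∧ |M k 1 0| ≤ (1 + k) / 2 * N 1 0

/-- An off-diagonal entry of a product contains exactly one off-diagonal factor in each term, so the
gain `(1 + k) / 2` survives. Diagonal entries contain none or two. -/
lemma Dominated.mul {M M' : ℝ → Matrix (Fin 2) (Fin 2) ℝ} (h : Dominated M) (h' : Dominated M') :
    Dominated fun k => M k * M' k := by
  obtain ⟨σ, N, hσ, hN, h⟩ := h
  obtain ⟨σ', N', hσ', hN', h'⟩ := h'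
  refine ⟨σ * σ', N * N', by rcases hσ with rfl | rfl <;> rcases hσ' with rfl | rfl <;> simp,
    fun i j => ?_, fun k h0 h1 => ?_⟩
  · simp only [Matrix.mul_apply, Fin.sum_univ_two, hN, hN']; push_cast; ring
  · obtain ⟨a, b, c, d⟩ := h k h0 h1
    obtain ⟨a', b', c', d'⟩ := h' k h0 h1
    have key : ∀ {x y z w X Y Z W : ℝ}, |x| ≤ X → |y| ≤ Y → |z| ≤ Z → |w| ≤ W →
        |x * y + z * w| ≤ X * Y + Z * W := by
      intro x y z w X Y Z W hx hy hz hw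
      refine (abs_add_le _ _).trans ?_
      rw [abs_mul, abs_mul]
      exact add_le_add (mul_le_mul hx hy (abs_nonneg _) ((abs_nonneg _).trans hx))
        (mul_le_mul hz hw (abs_nonneg _) ((abs_nonneg _).trans hz))
    have hq : (1 + k) / 2 * ((1 + k) / 2) ≤ 1 := by nlinarith
    simp only [Matrix.mul_apply, Fin.sum_univ_two]
    push_cast
    refine ⟨(key a a' c d').trans ?_, ?_, (key a c' c b').trans (le_of_eq (by ring)),
      (key d a' b d').trans (le_of_eq (by ring))⟩
    · have : (0 : ℝ) ≤ N 0 1 * N' 1 0 := by positivity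
      nlinarith
    · refine (key d c' b b').trans ?_
      have : (0 : ℝ) ≤ N 1 0 * N' 0 1 := by positivity
      nlinarith

/-- After the sign change by `genThree` the entries at 1 are among `n - 1`, `n`, `n + 1`, which
never have opposite signs when `n ≠ 0`. Hence domination is compatible with products. -/
lemma dominated_genThree_mul {n : ℤ} (hn : n ≠ 0) :
    Dominated fun k => genThree * dihedral n k := by
  have hentry : ∀ a : ℤ, (0 ≤ n → 0 ≤ a) → (n < 0 → a ≤ 0) →
      (a : ℝ) = (if 0 < n then 1 else -1) * (a.natAbs : ℝ) := by
    intro a h1 h2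
    rw [Nat.cast_natAbs]
    split_ifs with h
    · rw [abs_of_nonneg (h1 h.le)]; simp
    · rw [abs_of_nonpos (h2 (by lia))]; simp
  have hσ : (if 0 < n then (1 : ℝ) else -1) = 1 ∨ (if 0 < n then (1 : ℝ) else -1) = -1 := by
    split_ifs <;> simp
  by_cases he : Even n
  · refine ⟨if 0 < n then 1 else -1, !![(n + 1).natAbs, n.natAbs; n.natAbs, (n - 1).natAbs], hσ,
      ?_, fun k h0 h1 => ?_⟩
    · have e1 := hentry (n + 1) (by lia) (by lia)
      have e2 := hentry n (by lia) (by lia)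
      have e3 := hentry (n - 1) (by lia) (by lia)
      intro i j
      fin_cases i <;> fin_cases j <;>
        simp only [dihedral, he, if_true, genThree, cheb_at_one, Fin.zero_eta, Fin.mk_one,
          Matrix.mul_apply, Fin.sum_univ_two, Matrix.of_apply, Matrix.cons_val',
          Matrix.cons_val_zero, Matrix.cons_val_one, Matrix.cons_val_fin_one]
      · rw [← e1]; ring
      · rw [← e2]; ring
      · rw [← e2]; ring
      · rw [← e3]; ring
    · have b1 := abs_cheb_le (n + 1) h0 h1
      have b2 := abs_cheb_le_of_even he h0 h1
      have b3 := abs_cheb_le (n - 1) h0 h1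
      simp only [dihedral, he, if_true, genThree,
          Matrix.mul_apply, Fin.sum_univ_two, Matrix.of_apply, Matrix.cons_val',
          Matrix.cons_val_zero, Matrix.cons_val_one, Matrix.cons_val_fin_one, one_mul, zero_mul,
          add_zero, zero_add, neg_mul, neg_neg]
      exact ⟨b1, b3, b2, b2⟩
  · refine ⟨if 0 < n then 1 else -1, !![n.natAbs, (n + 1).natAbs; (n - 1).natAbs, n.natAbs], hσ,
      ?_, fun k h0 h1 => ?_⟩
    · have e1 := hentry (n + 1) (by lia) (by lia)
      have e2 := hentry n (by lia) (by lia)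
      have e3 := hentry (n - 1) (by lia) (by lia)
      intro i j
      fin_cases i <;> fin_cases j <;>
        simp only [dihedral, he, if_false, genThree, cheb_at_one, Fin.zero_eta, Fin.mk_one,
          Matrix.mul_apply, Fin.sum_univ_two, Matrix.of_apply, Matrix.cons_val',
          Matrix.cons_val_zero, Matrix.cons_val_one, Matrix.cons_val_fin_one]
      · rw [← e2]; ring
      · rw [← e1]; ring
      · rw [← e3]; ring
      · rw [← e2]; ring
    · have b1 := abs_cheb_le_of_even (n := n + 1) (by simpa [Int.even_add_one] using he) h0 h1
      have b2 := abs_cheb_le n h0 h1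
      have b3 := abs_cheb_le_of_even (n := n - 1) (by simpa [Int.even_sub_one] using he) h0 h1
      simp only [dihedral, he, if_false, genThree,
          Matrix.mul_apply, Fin.sum_univ_two, Matrix.of_apply, Matrix.cons_val',
          Matrix.cons_val_zero, Matrix.cons_val_one, Matrix.cons_val_fin_one, one_mul, zero_mul,
          add_zero, zero_add, neg_mul, neg_neg]
      exact ⟨b2, b2, b1, b3⟩

lemma dominated_listProd {l : List ℤ} (hl : ∀ n ∈ l, n ≠ 0) : Dominated (listProd l) := by
  induction l with
  | nil =>
    refine ⟨1, 1, Or.inl rfl, fun i j => ?_, fun k h0 h1 => ?_⟩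
    · fin_cases i <;> fin_cases j <;> simp [listProd_nil]
    · simp [listProd_nil]
  | cons n l ih =>
    have h := (dominated_genThree_mul (hl n (by simp))).mul (ih fun m hm => hl m (by simp [hm]))
    exact (funext fun k => listProd_cons n l k) ▸ h

/-- If `M` is hyperbolic at `1`, the trace of `M ^ 2` is smaller away from `1`. -/
def TraceDrop (M : ℝ → Matrix (Fin 2) (Fin 2) ℝ) : Prop :=
  2 < (M 1 * M 1).trace → ∃ c : ℝ, 0 < c ∧ ∀ k, 0 ≤ k → k ≤ 1 →
    (M k * M k).trace ≤ (M 1 * M 1).trace - c * (1 - k)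

lemma TraceDrop.congr {M N : ℝ → Matrix (Fin 2) (Fin 2) ℝ} (h : TraceDrop M)
    (hMN : ∀ k, (M k * M k).trace = (N k * N k).trace) : TraceDrop N := by
  simpa only [TraceDrop, hMN] using h

lemma TraceDrop.swap {M N : ℝ → Matrix (Fin 2) (Fin 2) ℝ} (h : TraceDrop fun k => M k * N k) :
    TraceDrop fun k => N k * M k :=
  h.congr fun k => by
    rw [Matrix.mul_assoc, Matrix.trace_mul_comm]
    simp only [Matrix.mul_assoc]

/-- The product of the off-diagonal entries appears in the trace of the square and loses the factor
`((1 + k) / 2)²`, a linear gain in `1 - k`. -/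
lemma Dominated.traceDrop {M : ℝ → Matrix (Fin 2) (Fin 2) ℝ} (h : Dominated M)
    (hdet : |(M 1).det| = 1) : TraceDrop M := by
  obtain ⟨σ, N, hσ, hN, h⟩ := h
  intro hT
  have hσ2 : σ * σ = 1 := by rcases hσ with rfl | rfl <;> norm_num
  have e1 : (M 1 * M 1).trace = (N 0 0 : ℝ) ^ 2 + (N 1 1 : ℝ) ^ 2 + 2 * (N 0 1 * N 1 0) := by
    simp only [Matrix.trace, Matrix.diag, Matrix.mul_apply, Fin.sum_univ_two, hN]
    linear_combination ((N 0 0 : ℝ) ^ 2 + (N 1 1 : ℝ) ^ 2 + 2 * (N 0 1 * N 1 0)) * hσ2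
  -- Otherwise the diagonal entries are natural numbers with product 1, and the trace of the square
  -- is 2.
  have hpos : 0 < N 0 1 * N 1 0 := by
    rw [Nat.pos_iff_ne_zero]
    intro h0
    have h0' : (N 0 1 : ℝ) * N 1 0 = 0 := by exact_mod_cast h0
    have hd : (M 1).det = N 0 0 * N 1 1 := by
      rw [Matrix.det_fin_two, hN, hN, hN, hN]
      linear_combination ((N 0 0 : ℝ) * N 1 1 - N 0 1 * N 1 0) * hσ2 - h0'
    rw [hd, abs_of_nonneg (by positivity)] at hdet
    have hd' : N 0 0 * N 1 1 = 1 := by exact_mod_cast hdet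
    have h1 := Nat.eq_one_of_mul_eq_one_right hd'
    have h2 := Nat.eq_one_of_mul_eq_one_left hd'
    rw [e1, h0', h1, h2] at hT
    norm_num at hT
  have hpos' : (0 : ℝ) < N 0 1 * N 1 0 := by exact_mod_cast hpos
  refine ⟨N 0 1 * N 1 0, hpos', fun k h0 h1 => ?_⟩
  obtain ⟨a, b, c, d⟩ := h k h0 h1
  have e2 : (M k * M k).trace = M k 0 0 ^ 2 + M k 1 1 ^ 2 + 2 * (M k 0 1 * M k 1 0) := by
    simp only [Matrix.trace, Matrix.diag, Matrix.mul_apply, Fin.sum_univ_two]; ring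
  have a' : M k 0 0 ^ 2 ≤ (N 0 0 : ℝ) ^ 2 := sq_le_sq' (neg_le_of_abs_le a) (le_of_abs_le a)
  have b' : M k 1 1 ^ 2 ≤ (N 1 1 : ℝ) ^ 2 := sq_le_sq' (neg_le_of_abs_le b) (le_of_abs_le b)
  have c' : M k 0 1 * M k 1 0 ≤ ((1 + k) / 2 * N 0 1) * ((1 + k) / 2 * N 1 0) := by
    refine (le_abs_self _).trans ?_
    rw [abs_mul]
    exact mul_le_mul c d (abs_nonneg _) ((abs_nonneg _).trans c)
  rw [e1, e2]
  have hk : ((1 + k) / 2) ^ 2 ≤ 1 - (1 - k) / 2 := by nlinarith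
  nlinarith [mul_le_mul_of_nonneg_right hk hpos'.le]

lemma genThree_mul_self : genThree * genThree = 1 := by
  ext i j; fin_cases i <;> fin_cases j <;> simp [genThree]

lemma traceDrop_dihedral (n : ℤ) : TraceDrop (dihedral n) := fun h => by
  rw [trace_dihedral_sq] at h; exact absurd h (lt_irrefl _)

/-- A vanishing index makes two copies of `genThree` adjacent. Rotated to the front they cancel, and
the dihedral factors that become cyclic neighbours merge into one, so the list gets shorter. -/
lemma traceDrop_listProd (l : List ℤ) : TraceDrop (listProd l) := by
  induction hm : l.length using Nat.strong_induction_on generalizing l with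
  | _ m ih =>
  by_cases hl : ∀ n ∈ l, n ≠ 0
  · exact (dominated_listProd hl).traceDrop (abs_det_listProd l)
  push Not at hl
  obtain ⟨n, hn, rfl⟩ := hl
  obtain ⟨l₁, l₂, rfl⟩ := List.append_of_mem hn
  suffices h : TraceDrop (listProd (0 :: (l₂ ++ l₁))) by
    have h' : TraceDrop fun k => listProd (0 :: l₂) k * listProd l₁ k := by
      convert h using 2 with k
      rw [← listProd_append]; rfl
    have h2 := h'.swap
    convert h2 using 2 with k
    rw [← listProd_append]
  have hlen : (l₂ ++ l₁).length + 1 = m := by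
    rw [← hm]; simp only [List.length_append, List.length_cons]; lia
  generalize l₂ ++ l₁ = l at hlen
  rcases l with _ | ⟨a, l⟩
  · intro h
    rw [listProd_cons, listProd_nil, dihedral_zero, Matrix.mul_one, Matrix.mul_one,
      genThree_mul_self] at h
    simp at h
  have e : ∀ k, listProd (0 :: a :: l) k = dihedral a k * listProd l k := fun k => by
    rw [listProd_cons, listProd_cons, dihedral_zero, Matrix.mul_one, ← Matrix.mul_assoc,
      ← Matrix.mul_assoc, genThree_mul_self, Matrix.one_mul]
  rw [show listProd (0 :: a :: l) = fun k => dihedral a k * listProd l k from funext e]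
  rcases List.eq_nil_or_concat l with rfl | ⟨l', b, rfl⟩
  · simpa only [listProd_nil, Matrix.mul_one] using traceDrop_dihedral a
  obtain ⟨c, hc⟩ := exists_dihedral_mul b a
  have h := ih (c :: l').length (by simp at hlen ⊢; lia) (c :: l') rfl
  have h1 : TraceDrop fun k => (genThree * dihedral b k) * (dihedral a k * listProd l' k) := by
    convert h using 2 with k
    rw [listProd_cons, ← hc]; simp only [Matrix.mul_assoc]
  have h2 := h1.swap
  convert h2 using 2 with k
  rw [List.concat_eq_append, listProd_append, listProd_cons, listProd_nil, Matrix.mul_one,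
    Matrix.mul_assoc]

lemma Word.traceDrop {M : ℝ → Matrix (Fin 2) (Fin 2) ℝ} (h : Word M) : TraceDrop M := by
  obtain ⟨σ, n, l, hσ, h⟩ := h.normal_form
  have hσ2 : σ * σ = 1 := by rcases hσ with rfl | rfl <;> norm_num
  suffices h1 : TraceDrop fun k => dihedral n k * listProd l k by
    refine h1.congr fun k => ?_
    rw [h, Matrix.smul_mul, Matrix.mul_smul, smul_smul, hσ2, one_smul]
  rcases List.eq_nil_or_concat l with rfl | ⟨l', b, rfl⟩
  · simpa only [listProd_nil, Matrix.mul_one] using traceDrop_dihedral n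
  obtain ⟨c, hc⟩ := exists_dihedral_mul b n
  have h1 : TraceDrop fun k => (ParabolaSurface.genThree * dihedral b k) * (dihedral n k * listProd l' k) := by
    convert traceDrop_listProd (c :: l') using 2 with k
    rw [listProd_cons, ← hc]; simp only [Matrix.mul_assoc]
  have h2 := h1.swap
  convert h2 using 2 with k
  rw [List.concat_eq_append, listProd_append, listProd_cons, listProd_nil, Matrix.mul_one,
    Matrix.mul_assoc]

end ParabolaSurface

namespace ParabolaSurface

/-! ### Asymptotics of integrals -/

lemma mul_sinc (x : ℝ) : x * Real.sinc x = Real.sin x := by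
  rcases eq_or_ne x 0 with rfl | h
  · simp
  · rw [Real.sinc_of_ne_zero h, mul_div_cancel₀ _ h]

lemma tendsto_sinc_div_sqrt (s : ℝ) :
    Tendsto (fun p : ℕ => Real.sinc (s / √p)) atTop (𝓝 1) := by
  have h : Tendsto (fun p : ℕ => s / √(p : ℝ)) atTop (𝓝 0) :=
    tendsto_const_nhds.div_atTop (Real.tendsto_sqrt_atTop.comp tendsto_natCast_atTop_atTop)
  simpa [Function.comp_def] using (Real.continuous_sinc.tendsto 0).comp h

lemma tendsto_cos_div_sqrt (s : ℝ) :
    Tendsto (fun p : ℕ => Real.cos (s / √p)) atTop (𝓝 1) := by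
  have h : Tendsto (fun p : ℕ => s / √(p : ℝ)) atTop (𝓝 0) :=
    tendsto_const_nhds.div_atTop (Real.tendsto_sqrt_atTop.comp tendsto_natCast_atTop_atTop)
  simpa [Function.comp_def] using (Real.continuous_cos.tendsto 0).comp h

lemma mul_sin_sq_div_sqrt (s : ℝ) {p : ℕ} (hp : p ≠ 0) :
    p * Real.sin (s / √p) ^ 2 = s ^ 2 * Real.sinc (s / √p) ^ 2 := by
  have hp' : (0 : ℝ) < p := by exact_mod_cast Nat.pos_of_ne_zero hp
  rw [← mul_sinc, mul_pow, div_pow, Real.sq_sqrt hp'.le]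
  field_simp

lemma tendsto_mul_sin_sq (s : ℝ) :
    Tendsto (fun p : ℕ => p * Real.sin (s / √p) ^ 2) atTop (𝓝 (s ^ 2)) := by
  have h : Tendsto (fun p : ℕ => s ^ 2 * Real.sinc (s / √p) ^ 2) atTop (𝓝 (s ^ 2 * 1 ^ 2)) :=
    tendsto_const_nhds.mul ((tendsto_sinc_div_sqrt s).pow 2)
  rw [one_pow, mul_one] at h
  refine h.congr' ?_
  filter_upwards [eventually_ne_atTop 0] with p hp
  rw [mul_sin_sq_div_sqrt s hp]

lemma tendsto_mul_one_sub_cos (s : ℝ) :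
    Tendsto (fun p : ℕ => p * (1 - Real.cos (s / √p))) atTop (𝓝 (s ^ 2 / 2)) := by
  have h := (tendsto_mul_sin_sq (s / 2)).const_mul 2
  rw [show 2 * (s / 2) ^ 2 = s ^ 2 / 2 by ring] at h
  refine h.congr fun p => ?_
  have e : Real.cos (s / √p) = 1 - 2 * Real.sin (s / 2 / √p) ^ 2 := by
    rw [show s / √p = 2 * (s / 2 / √p) by ring, Real.cos_two_mul, Real.cos_sq']; ring
  rw [e]; ring

lemma integrable_sq_mul_exp {b : ℝ} (hb : 0 < b) :
    Integrable fun s : ℝ => s ^ 2 * Real.exp (-b * s ^ 2) := by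
  have h := integrable_rpow_mul_exp_neg_mul_sq hb (s := 2) (by norm_num)
  simpa only [Real.rpow_two] using h

lemma integral_sq_mul_exp_pos {b : ℝ} (hb : 0 < b) :
    0 < ∫ s in Set.Ioi (0 : ℝ), s ^ 2 * Real.exp (-b * s ^ 2) := by
  rw [setIntegral_pos_iff_support_of_nonneg_ae
    (Eventually.of_forall fun s => mul_nonneg (sq_nonneg s) (Real.exp_pos _).le)
    (integrable_sq_mul_exp hb).integrableOn]
  have : Function.support (fun s : ℝ => s ^ 2 * Real.exp (-b * s ^ 2)) ∩ Set.Ioi 0 =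
      Set.Ioi 0 := by
    refine Set.inter_eq_right.2 fun s (hs : 0 < s) => ?_
    exact (mul_pos (pow_pos hs 2) (Real.exp_pos _)).ne'
  rw [this]; simp

/-- Laplace's method, for functions with Gaussian decay at scale `1 / √p`. -/
lemma tendsto_laplace {g : ℕ → ℝ → ℝ} {C b α L : ℝ} (hb : 0 < b)
    (hg : ∀ p, Continuous (g p))
    (hbound : ∀ p β, 0 ≤ β → β ≤ Real.pi / 2 → |g p β| ≤ C * Real.exp (-b * (p * β ^ 2)))
    (hlim : ∀ s, 0 < s →
      Tendsto (fun p : ℕ => g p (s / √p)) atTop (𝓝 (L * Real.exp (-α * s ^ 2)))) :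
    Tendsto (fun p : ℕ => (p : ℝ) * √p *
      ∫ β in (0 : ℝ)..(Real.pi / 2), g p β * Real.sin β ^ 2 * Real.cos β) atTop
      (𝓝 (L * ∫ s in Set.Ioi (0 : ℝ), s ^ 2 * Real.exp (-α * s ^ 2))) := by
  have hC : 0 ≤ C := by
    have := (abs_nonneg _).trans (hbound 0 0 le_rfl (by positivity))
    simpa using this
  -- Substitution `β = s / √p`: the factor `√p` is absorbed by the change of variable and `p` by
  -- `sin² β`. Dominated convergence then applies on the half line.
  set G : ℕ → ℝ → ℝ := fun p => Set.indicator (Set.Ioc 0 (√p * (Real.pi / 2)))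
    fun s => g p (s / √p) * (p * Real.sin (s / √p) ^ 2) * Real.cos (s / √p) with hG
  have hint : ∀ p : ℕ, ∫ s, G p s = (p : ℝ) * √p *
      ∫ β in (0 : ℝ)..(Real.pi / 2), g p β * Real.sin β ^ 2 * Real.cos β := by
    intro p
    rcases Nat.eq_zero_or_pos p with rfl | hp
    · simp [hG]
    have hp' : 0 < √(p : ℝ) := Real.sqrt_pos.2 (by exact_mod_cast hp)
    rw [hG, integral_indicator measurableSet_Ioc,
      ← intervalIntegral.integral_of_le (by positivity)]
    have := intervalIntegral.integral_comp_div (a := 0) (b := √p * (Real.pi / 2))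
      (fun β => g p β * (p * Real.sin β ^ 2) * Real.cos β) hp'.ne'
    rw [this, zero_div, mul_div_cancel_left₀ _ hp'.ne', smul_eq_mul, mul_comm (p : ℝ), mul_assoc,
      ← intervalIntegral.integral_const_mul (p : ℝ)]
    congr 2; funext β; ring
  have hlimint : L * ∫ s in Set.Ioi (0 : ℝ), s ^ 2 * Real.exp (-α * s ^ 2) =
      ∫ s, Set.indicator (Set.Ioi 0) (fun s => L * (s ^ 2 * Real.exp (-α * s ^ 2))) s := by
    rw [integral_indicator measurableSet_Ioi, integral_const_mul]
  simp only [← hint]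
  rw [hlimint]
  refine tendsto_integral_of_dominated_convergence
    (fun s => C * (s ^ 2 * Real.exp (-b * s ^ 2))) (fun p => ?_)
    ((integrable_sq_mul_exp hb).const_mul C) (fun p => ?_) ?_
  · have hc : Continuous fun s : ℝ =>
        g p (s / √p) * (p * Real.sin (s / √p) ^ 2) * Real.cos (s / √p) := by
      have h1 : Continuous fun s : ℝ => s / √(p : ℝ) := continuous_id.div_const _
      exact (((hg p).comp h1).mul (continuous_const.mul ((Real.continuous_sin.comp h1).pow 2))).mul
        (Real.continuous_cos.comp h1)
    exact hc.aestronglyMeasurable.indicator measurableSet_Ioc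
  · refine Eventually.of_forall fun s => ?_
    by_cases hs : s ∈ Set.Ioc 0 (√(p : ℝ) * (Real.pi / 2))
    · have hp : p ≠ 0 := by rintro rfl; simp at hs
      have hp0 : (0 : ℝ) < p := by exact_mod_cast Nat.pos_of_ne_zero hp
      have hp' : 0 < √(p : ℝ) := Real.sqrt_pos.2 hp0
      simp only [hG]
      rw [Set.indicator_of_mem hs, Real.norm_eq_abs, abs_mul, abs_mul, mul_sin_sq_div_sqrt s hp]
      have h1 := hbound p (s / √p) (div_nonneg hs.1.le hp'.le)
        (by rw [div_le_iff₀ hp', mul_comm]; exact hs.2)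
      rw [div_pow, Real.sq_sqrt hp0.le, mul_div_cancel₀ _ hp0.ne'] at h1
      have h2 : |s ^ 2 * Real.sinc (s / √p) ^ 2| ≤ s ^ 2 := by
        rw [abs_mul, abs_of_nonneg (sq_nonneg s), abs_pow]
        exact mul_le_of_le_one_right (sq_nonneg s)
          (pow_le_one₀ (abs_nonneg _) (Real.abs_sinc_le_one _))
      have h3 := Real.abs_cos_le_one (s / √p)
      calc _ ≤ (C * Real.exp (-b * s ^ 2)) * s ^ 2 * 1 := by gcongr
        _ = _ := by ring
    · simp only [hG]
      rw [Set.indicator_of_notMem hs, norm_zero]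
      positivity
  · refine Eventually.of_forall fun s => ?_
    by_cases hs : 0 < s
    · rw [Set.indicator_of_mem (show s ∈ Set.Ioi 0 from hs)]
      have h1 := ((hlim s hs).mul (tendsto_mul_sin_sq s)).mul (tendsto_cos_div_sqrt s)
      rw [mul_one, mul_assoc, mul_comm (Real.exp _)] at h1
      refine h1.congr' ?_
      have h2 : Tendsto (fun p : ℕ => √(p : ℝ) * (Real.pi / 2)) atTop atTop :=
        (Real.tendsto_sqrt_atTop.comp tendsto_natCast_atTop_atTop).atTop_mul_const (by positivity)
      filter_upwards [h2.eventually_ge_atTop s] with p hp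
      simp only [hG]
      rw [Set.indicator_of_mem (show s ∈ Set.Ioc 0 (√(p : ℝ) * (Real.pi / 2)) from ⟨hs, hp⟩)]
    · rw [Set.indicator_of_notMem (show s ∉ Set.Ioi 0 from hs)]
      refine tendsto_const_nhds.congr fun p => ?_
      simp only [hG]
      rw [Set.indicator_of_notMem fun h => hs h.1]

/-! ### Linear recurrences of order two -/

lemma recurrence_closed_form {a : ℕ → ℝ} {τ r q : ℝ} (h : ∀ p, a (p + 2) = τ * a (p + 1) - a p)
    (hrq : r * q = 1) (hτ : r + q = τ) (p : ℕ) :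
    a p * (r - q) = r ^ p * (a 1 - q * a 0) - q ^ p * (a 1 - r * a 0) := by
  have key : ∀ p, a p * (r - q) = r ^ p * (a 1 - q * a 0) - q ^ p * (a 1 - r * a 0) ∧
      a (p + 1) * (r - q) = r ^ (p + 1) * (a 1 - q * a 0) - q ^ (p + 1) * (a 1 - r * a 0) := by
    intro p
    induction p with
    | zero =>
      constructor
      · simp; ring
      · rw [pow_succ, pow_succ]; simp; ring
    | succ p ih =>
      refine ⟨ih.2, ?_⟩
      rw [h, sub_mul, mul_assoc, ih.1, ih.2, ← hτ]
      simp only [pow_succ]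
      linear_combination (r ^ p * (a 1 - q * a 0) - q ^ p * (a 1 - r * a 0)) * hrq
  exact (key p).1

/-- The closed form degenerates where the two roots meet, so the bound uses the conserved quadratic
form instead. It makes `|a (p + 1)|` at most `ρ |a p|` plus a constant, and `D` absorbs that
constant, also when there are no real roots. -/
lemma recurrence_bound {a : ℕ → ℝ} {τ ρ D : ℝ} (h : ∀ p, a (p + 2) = τ * a (p + 1) - a p)
    (hρ : 1 < ρ) (hτ : |τ| ≤ ρ + 1 / ρ)
    (hD : √|a 1 ^ 2 - τ * a 1 * a 0 + a 0 ^ 2| ≤ (ρ - 1) * D) (p : ℕ) :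
    |a p| ≤ ρ ^ p * (|a 0| + D) := by
  set V := a 1 ^ 2 - τ * a 1 * a 0 + a 0 ^ 2 with hV
  have hinv : ∀ p, a (p + 1) ^ 2 - τ * a (p + 1) * a p + a p ^ 2 = V := by
    intro p
    induction p with
    | zero => rfl
    | succ p ih => rw [h, ← ih]; ring
  have hD0 : 0 ≤ D := by
    have := (Real.sqrt_nonneg _).trans hD
    exact nonneg_of_mul_nonneg_right this (by linarith)
  have hstep : ∀ p, |a (p + 1)| ≤ ρ * |a p| + √|V| := by
    intro p
    by_contra hcon
    push Not at hcon
    set x := |a (p + 1)| with hx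
    set y := |a p| with hy
    have hy0 : 0 ≤ y := abs_nonneg _
    have hx0 : 0 ≤ x := abs_nonneg _
    have hs0 : 0 ≤ √|V| := Real.sqrt_nonneg _
    have h1 : τ * a (p + 1) * a p ≤ (ρ + 1 / ρ) * (x * y) := by
      refine (le_abs_self _).trans ?_
      rw [abs_mul, abs_mul, mul_assoc]
      exact mul_le_mul_of_nonneg_right hτ (mul_nonneg hx0 hy0)
    have h2 : x ^ 2 - (ρ + 1 / ρ) * (x * y) + y ^ 2 ≤ |V| := by
      have h3 := (le_abs_self _).trans' (hinv p).le
      rw [← sq_abs (a (p + 1)), ← sq_abs (a p)] at h3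
      linarith
    have hρ1 : ρ * (1 / ρ) = 1 := by field_simp
    have h4 : (x - ρ * y) * (x - 1 / ρ * y) ≤ |V| := by
      have e : (x - ρ * y) * (x - 1 / ρ * y) = x ^ 2 - (ρ + 1 / ρ) * (x * y) + y ^ 2 := by
        linear_combination (y ^ 2) * hρ1
      rw [e]; exact h2
    have h5 : 1 / ρ ≤ ρ := by
      rw [div_le_iff₀ (by linarith)]; nlinarith
    have h6 : x - ρ * y ≤ x - 1 / ρ * y := by nlinarith
    have h7 : √|V| < x - ρ * y := by linarith
    have h8 : √|V| ^ 2 < (x - ρ * y) * (x - 1 / ρ * y) := by nlinarith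
    rw [Real.sq_sqrt (abs_nonneg _)] at h8
    linarith
  have hind : ∀ p, |a p| + D ≤ ρ ^ p * (|a 0| + D) := by
    intro p
    induction p with
    | zero => simp
    | succ p ih =>
      have h1 := hstep p
      have h2 := mul_le_mul_of_nonneg_left ih (by linarith : 0 ≤ ρ)
      rw [pow_succ]
      nlinarith
  linarith [hind p]

/-- The larger root of `X ^ 2 - τ X + 1`. -/
noncomputable def bigRoot (τ : ℝ) : ℝ := (τ + √(τ ^ 2 - 4)) / 2

/-- The smaller root of `X ^ 2 - τ X + 1`. -/
noncomputable def smallRoot (τ : ℝ) : ℝ := (τ - √(τ ^ 2 - 4)) / 2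

lemma bigRoot_add_smallRoot (τ : ℝ) : bigRoot τ + smallRoot τ = τ := by
  unfold bigRoot smallRoot; ring

lemma bigRoot_mul_smallRoot {τ : ℝ} (h : 2 ≤ τ) : bigRoot τ * smallRoot τ = 1 := by
  have := Real.sq_sqrt (show 0 ≤ τ ^ 2 - 4 by nlinarith)
  unfold bigRoot smallRoot; nlinarith

lemma one_lt_bigRoot {τ : ℝ} (h : 2 < τ) : 1 < bigRoot τ := by
  have := Real.sqrt_nonneg (τ ^ 2 - 4)
  unfold bigRoot; linarith

lemma smallRoot_eq {τ : ℝ} (h : 2 < τ) : smallRoot τ = (bigRoot τ)⁻¹ :=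
  eq_inv_of_mul_eq_one_right (bigRoot_mul_smallRoot h.le)

lemma smallRoot_lt_bigRoot {τ : ℝ} (h : 2 < τ) : smallRoot τ < bigRoot τ := by
  have h1 := one_lt_bigRoot h
  rw [smallRoot_eq h]
  exact (inv_lt_one_of_one_lt₀ h1).trans h1

/-- The coefficient of the dominant exponential in a solution of the recurrence. -/
noncomputable def leadCoeff (τ a₀ a₁ : ℝ) : ℝ :=
  (a₁ - smallRoot τ * a₀) / (bigRoot τ - smallRoot τ)

lemma continuous_bigRoot : Continuous bigRoot := by unfold bigRoot; fun_prop

lemma continuous_smallRoot : Continuous smallRoot := by unfold smallRoot; fun_prop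

lemma recurrence_div_pow {a : ℕ → ℝ} {τ : ℝ} (h : ∀ p, a (p + 2) = τ * a (p + 1) - a p)
    (hτ : 2 < τ) {r : ℝ} (hr : r ≠ 0) (p : ℕ) : a p / r ^ p =
      ((bigRoot τ / r) ^ p * (a 1 - smallRoot τ * a 0) -
        (smallRoot τ / r) ^ p * (a 1 - bigRoot τ * a 0)) / (bigRoot τ - smallRoot τ) := by
  have h1 := recurrence_closed_form h (bigRoot_mul_smallRoot hτ.le) (bigRoot_add_smallRoot τ) p
  have h2 : bigRoot τ - smallRoot τ ≠ 0 := (sub_pos.2 (smallRoot_lt_bigRoot hτ)).ne'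
  rw [eq_div_iff h2, div_pow, div_pow, div_mul_eq_mul_div, h1]
  ring

/-- Solutions of the recurrence with slowly varying parameter. -/
lemma tendsto_recurrence_div_pow {t : ℝ → ℝ} (ht : Continuous t) (ht1 : 2 < t 1)
    {f : ℕ → ℝ → ℝ} (hf0 : Continuous (f 0)) (hf1 : Continuous (f 1))
    (hrec : ∀ p k, f (p + 2) k = t k * f (p + 1) k - f p k) {k : ℕ → ℝ} {u : ℝ}
    (hk : Tendsto k atTop (𝓝 1))
    (hu : Tendsto (fun p : ℕ => p * (bigRoot (t (k p)) / bigRoot (t 1) - 1)) atTop (𝓝 u)) :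
    Tendsto (fun p => f p (k p) / bigRoot (t 1) ^ p) atTop
      (𝓝 (leadCoeff (t 1) (f 0 1) (f 1 1) * Real.exp u)) := by
  have hr := one_lt_bigRoot ht1
  have hr0 : bigRoot (t 1) ≠ 0 := by positivity
  have htk : Tendsto (fun p => t (k p)) atTop (𝓝 (t 1)) := (ht.tendsto 1).comp hk
  have hR : Tendsto (fun p => bigRoot (t (k p))) atTop (𝓝 (bigRoot (t 1))) :=
    (continuous_bigRoot.tendsto _).comp htk
  have hQ : Tendsto (fun p => smallRoot (t (k p))) atTop (𝓝 (smallRoot (t 1))) :=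
    (continuous_smallRoot.tendsto _).comp htk
  have h0 : Tendsto (fun p => f 0 (k p)) atTop (𝓝 (f 0 1)) := (hf0.tendsto 1).comp hk
  have h1 : Tendsto (fun p => f 1 (k p)) atTop (𝓝 (f 1 1)) := (hf1.tendsto 1).comp hk
  have hev : ∀ᶠ p in atTop, 2 < t (k p) := htk.eventually_const_lt ht1
  have hpow : Tendsto (fun p : ℕ => (bigRoot (t (k p)) / bigRoot (t 1)) ^ p) atTop
      (𝓝 (Real.exp u)) := by
    refine (Real.tendsto_one_add_pow_exp_of_tendsto hu).congr fun p => ?_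
    rw [add_sub_cancel]
  have hpow' : Tendsto (fun p : ℕ => (smallRoot (t (k p)) / bigRoot (t 1)) ^ p) atTop (𝓝 0) := by
    refine squeeze_zero' ?_ ?_ (tendsto_pow_atTop_nhds_zero_of_lt_one
      (inv_nonneg.2 (by linarith : 0 ≤ bigRoot (t 1))) (inv_lt_one_of_one_lt₀ hr))
    · filter_upwards [hev] with p hp
      rw [smallRoot_eq hp]
      have := one_lt_bigRoot hp
      positivity
    · filter_upwards [hev] with p hp
      rw [smallRoot_eq hp]
      have h2 := one_lt_bigRoot hp
      have h3 := inv_le_one_of_one_le₀ h2.le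
      have h4 : (0 : ℝ) ≤ (bigRoot (t (k p)))⁻¹ := by positivity
      have h5 : (0 : ℝ) ≤ (bigRoot (t 1))⁻¹ := by positivity
      rw [div_eq_mul_inv]
      exact pow_le_pow_left₀ (mul_nonneg h4 h5) (mul_le_of_le_one_left h5 h3) p
  have hlim := ((hpow.mul (h1.sub (hQ.mul h0))).sub (hpow'.mul (h1.sub (hR.mul h0)))).div
    (hR.sub hQ) (sub_pos.2 (smallRoot_lt_bigRoot ht1)).ne'
  have e : leadCoeff (t 1) (f 0 1) (f 1 1) * Real.exp u =
      (Real.exp u * (f 1 1 - smallRoot (t 1) * f 0 1) -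
        0 * (f 1 1 - bigRoot (t 1) * f 0 1)) / (bigRoot (t 1) - smallRoot (t 1)) := by
    rw [leadCoeff]; ring
  rw [e]
  refine hlim.congr' ?_
  filter_upwards [hev] with p hp
  exact (recurrence_div_pow (a := fun p' => f p' (k p)) (fun p' => hrec p' (k p)) hp hr0 p).symm

/-- Uniform bound of the solutions of the recurrence. -/
lemma exists_recurrence_bound {t : ℝ → ℝ} (ht : Continuous t) (ht1 : 2 < t 1) {c : ℝ} (hc : 0 < c)
    (htc : ∀ k, 0 ≤ k → k ≤ 1 → -2 ≤ t k ∧ t k ≤ t 1 - c * (1 - k))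
    {f : ℕ → ℝ → ℝ} (hf0 : Continuous (f 0)) (hf1 : Continuous (f 1))
    (hrec : ∀ p k, f (p + 2) k = t k * f (p + 1) k - f p k) :
    ∃ C b : ℝ, 0 < b ∧ ∀ p k, 0 ≤ k → k ≤ 1 →
      |f p k / bigRoot (t 1) ^ p| ≤ C * Real.exp (-b * (p * (1 - k))) := by
  set r := bigRoot (t 1) with hr
  have hr1 : 1 < r := one_lt_bigRoot ht1
  have hr0 : 0 < r := by linarith
  -- The second bound keeps `ρ` uniformly above 1 on the whole interval.
  set c' := min c ((r - 1) / 2) with hc'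
  have hc'0 : 0 < c' := lt_min hc (by linarith)
  have hcc : c' ≤ c := min_le_left _ _
  have hcr : c' ≤ (r - 1) / 2 := min_le_right _ _
  obtain ⟨V, hV⟩ : ∃ V, ∀ k ∈ Set.Icc (0 : ℝ) 1,
      √|f 1 k ^ 2 - t k * f 1 k * f 0 k + f 0 k ^ 2| ≤ V := by
    have hcont : Continuous fun k => √|f 1 k ^ 2 - t k * f 1 k * f 0 k + f 0 k ^ 2| := by fun_prop
    obtain ⟨V, hV⟩ := isCompact_Icc.exists_bound_of_continuousOn
      (hcont.continuousOn (s := Set.Icc (0 : ℝ) 1))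
    exact ⟨V, fun k hk => (le_abs_self _).trans (hV k hk)⟩
  obtain ⟨F, hF⟩ := isCompact_Icc.exists_bound_of_continuousOn
      (hf0.continuousOn (s := Set.Icc (0 : ℝ) 1))
  have hV0 : 0 ≤ V := (Real.sqrt_nonneg _).trans (hV 0 (by simp))
  refine ⟨F + V / ((r - 1) / 2), c' / r, by positivity, fun p k h0 h1 => ?_⟩
  -- As `ρ ≤ r`, the sum `ρ + 1 / ρ` is at least `t 1 - c' (1 - k)`, which dominates `t k`.
  set ρ := r - c' * (1 - k) with hρ
  have hρr : ρ ≤ r := by rw [hρ]; nlinarith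
  have hρ0 : (r - 1) / 2 ≤ ρ - 1 := by rw [hρ]; nlinarith
  have hρ1 : 1 < ρ := by linarith
  have hsum : r + 1 / r = t 1 := by
    rw [one_div, hr, ← smallRoot_eq ht1, bigRoot_add_smallRoot]
  have hτ : |t k| ≤ ρ + 1 / ρ := by
    obtain ⟨h2, h3⟩ := htc k h0 h1
    have h4 : 2 ≤ ρ + 1 / ρ := by
      rw [← sub_nonneg]
      have : ρ + 1 / ρ - 2 = (ρ - 1) ^ 2 / ρ := by field_simp; ring
      rw [this]; positivity
    rw [abs_le]
    refine ⟨by linarith, h3.trans ?_⟩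
    have h5 : 1 / r ≤ 1 / ρ := one_div_le_one_div_of_le (by linarith) hρr
    nlinarith
  have hb := recurrence_bound (a := fun p => f p k) (fun p => hrec p k) hρ1 hτ
    (D := V / ((r - 1) / 2)) ?_ p
  · have hexp : ρ ^ p / r ^ p ≤ Real.exp (-(c' / r) * (p * (1 - k))) := by
      rw [← div_pow, show -(c' / r) * (p * (1 - k)) = p * (-(c' / r) * (1 - k)) by ring,
        Real.exp_nat_mul]
      refine pow_le_pow_left₀ (by positivity) ?_ p
      have h2 := Real.add_one_le_exp (-(c' / r) * (1 - k))
      refine le_trans (le_of_eq ?_) h2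
      rw [hρ]; field_simp; ring
    have hF0 : |f 0 k| ≤ F := hF k ⟨h0, h1⟩
    have hrp : 0 < r ^ p := pow_pos hr0 p
    rw [abs_div, abs_of_pos hrp]
    have hD0 : 0 ≤ V / ((r - 1) / 2) := div_nonneg hV0 (by linarith)
    calc |f p k| / r ^ p ≤ (ρ ^ p * (|f 0 k| + V / ((r - 1) / 2))) / r ^ p := by gcongr
      _ = (|f 0 k| + V / ((r - 1) / 2)) * (ρ ^ p / r ^ p) := by ring
      _ ≤ (F + V / ((r - 1) / 2)) * Real.exp (-(c' / r) * (p * (1 - k))) := by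
        have hF1 := (abs_nonneg _).trans hF0
        gcongr
  · refine (hV k ⟨h0, h1⟩).trans ?_
    have h2 : 0 < (r - 1) / 2 := by linarith
    calc V = (r - 1) / 2 * (V / ((r - 1) / 2)) := (mul_div_cancel₀ _ h2.ne').symm
      _ ≤ (ρ - 1) * (V / ((r - 1) / 2)) := by gcongr

lemma le_deriv_of_drop {t : ℝ → ℝ} {t' c : ℝ} (ht : HasDerivAt t t' 1)
    (htc : ∀ k, 0 ≤ k → k ≤ 1 → t k ≤ t 1 - c * (1 - k)) : c ≤ t' := by
  have h := (hasDerivAt_iff_tendsto_slope.1 ht).mono_left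
    (nhdsWithin_mono 1 (show Set.Iio (1 : ℝ) ⊆ {1}ᶜ from fun x hx => ne_of_lt hx))
  refine ge_of_tendsto h ?_
  filter_upwards [Ioo_mem_nhdsLT (show (0 : ℝ) < 1 by norm_num)] with k hk
  have h1 := htc k hk.1.le hk.2.le
  rw [slope_def_field, le_div_iff_of_neg (by linarith [hk.2])]
  linarith

/-- Asymptotics of the integrals of the solutions of the recurrence. -/
theorem exists_laplace_const {t : ℝ → ℝ} (ht : Continuous t) (htd : DifferentiableAt ℝ t 1)
    (ht1 : 2 < t 1) {c : ℝ} (hc : 0 < c)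
    (htc : ∀ k, 0 ≤ k → k ≤ 1 → -2 ≤ t k ∧ t k ≤ t 1 - c * (1 - k)) :
    ∃ K : ℝ, 0 < K ∧ ∀ f : ℕ → ℝ → ℝ, Continuous (f 0) → Continuous (f 1) →
      (∀ p k, f (p + 2) k = t k * f (p + 1) k - f p k) →
      Tendsto (fun p : ℕ => (p : ℝ) * √p * ∫ β in (0 : ℝ)..(Real.pi / 2),
        f p (Real.cos β) / bigRoot (t 1) ^ p * Real.sin β ^ 2 * Real.cos β) atTop
        (𝓝 (leadCoeff (t 1) (f 0 1) (f 1 1) * K)) := by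
  set r := bigRoot (t 1) with hr
  have hr1 : 1 < r := one_lt_bigRoot ht1
  have hr0 : 0 < r := by linarith
  obtain ⟨t', ht'⟩ : ∃ t', HasDerivAt t t' 1 := ⟨_, htd.hasDerivAt⟩
  have hct' : c ≤ t' := le_deriv_of_drop ht' fun k h0 h1 => (htc k h0 h1).2
  have hS : 0 < t 1 ^ 2 - 4 := by nlinarith
  obtain ⟨R', hR'0, hR'⟩ : ∃ R', 0 < R' ∧ HasDerivAt (fun k => bigRoot (t k)) R' 1 := by
    have h1 : HasDerivAt (fun k => t k ^ 2 - 4) (2 * t 1 * t') 1 := by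
      have := (ht'.pow 2).sub_const 4
      simpa [mul_assoc] using this
    have h2 := (ht'.add (h1.sqrt hS.ne')).div_const 2
    refine ⟨_, ?_, h2⟩
    have : 0 < √(t 1 ^ 2 - 4) := Real.sqrt_pos.2 hS
    have : 0 < t' := hc.trans_le hct'
    have : 0 < t 1 := by linarith
    positivity
  -- The relative decrease of the large root is `R' / r` per unit of `1 - k`, and `1 - cos (s / √p)`
  -- is about `s² / (2 p)`.
  set α := R' / r / 2 with hα
  have hα0 : 0 < α := by positivity
  -- The constant is a Gaussian integral that depends on `t` only and is fixed before the solution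
  -- `f` is chosen.
  refine ⟨_, integral_sq_mul_exp_pos hα0, fun f hf0 hf1 hrec => ?_⟩
  obtain ⟨C, b, hb, hbound⟩ := exists_recurrence_bound ht ht1 hc htc hf0 hf1 hrec
  have hC : 0 ≤ C := by
    have := (abs_nonneg _).trans (hbound 0 1 zero_le_one le_rfl)
    simpa using this
  have hfc : ∀ p, Continuous (f p) ∧ Continuous (f (p + 1)) := by
    intro p
    induction p with
    | zero => exact ⟨hf0, hf1⟩
    | succ p ih =>
      refine ⟨ih.2, ?_⟩
      rw [show f (p + 1 + 1) = fun k => t k * f (p + 1) k - f p k from funext (hrec p)]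
      exact (ht.mul ih.2).sub ih.1
  refine tendsto_laplace (g := fun p β => f p (Real.cos β) / r ^ p) (C := C)
    (b := b * (2 / Real.pi ^ 2)) (by positivity)
    (fun p => ((hfc p).1.comp Real.continuous_cos).div_const _) (fun p β h0 h1 => ?_)
    (fun s hs => ?_)
  · refine (hbound p (Real.cos β) (Real.cos_nonneg_of_mem_Icc ⟨by linarith, h1⟩)
      (Real.cos_le_one β)).trans ?_
    have h2 : Real.cos β ≤ 1 - 2 / Real.pi ^ 2 * β ^ 2 :=
      Real.cos_le_one_sub_mul_cos_sq (by rw [abs_of_nonneg h0]; linarith [Real.pi_pos])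
    have h3 : (p : ℝ) * (2 / Real.pi ^ 2 * β ^ 2) ≤ p * (1 - Real.cos β) := by
      gcongr; linarith
    refine mul_le_mul_of_nonneg_left (Real.exp_le_exp.2 ?_) hC
    nlinarith
  · have hk := tendsto_cos_div_sqrt s
    refine tendsto_recurrence_div_pow ht ht1 hf0 hf1 hrec hk ?_
    have hd : Tendsto (fun p : ℕ => dslope (fun k => bigRoot (t k)) 1 (Real.cos (s / √p))) atTop
        (𝓝 R') := by
      have h1 := (continuousAt_dslope_same.2 hR'.differentiableAt).tendsto.comp hk
      rwa [dslope_same, hR'.deriv] at h1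
    have h2 := ((hd.mul (tendsto_mul_one_sub_cos s)).neg).div_const r
    have e : -α * s ^ 2 = -(R' * (s ^ 2 / 2)) / r := by rw [hα]; ring
    rw [e]
    refine h2.congr fun p => ?_
    have h3 := sub_smul_dslope (fun k => bigRoot (t k)) 1 (Real.cos (s / √p))
    rw [smul_eq_mul] at h3
    have h4 : bigRoot (t (Real.cos (s / √p))) / r - 1 =
        (bigRoot (t (Real.cos (s / √p))) - r) / r := by field_simp
    rw [h4, ← h3]
    ring

end ParabolaSurface

/-! ### Hyperbolic automorphisms and the mixing limit. -/

namespace ParabolaSurface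

lemma Word.differentiable {M : ℝ → Matrix (Fin 2) (Fin 2) ℝ} (h : Word M) (i j : Fin 2) :
    Differentiable ℝ fun k => M k i j := by
  induction h generalizing i j with
  | one => exact differentiable_const _
  | genOne _ ih =>
    have h0 := ih 0 j
    have h1 := ih 1 j
    fin_cases i <;> simp [ParabolaSurface.genOne, Matrix.mul_apply, Fin.sum_univ_two] <;> fun_prop
  | genTwo _ ih =>
    have h0 := ih 0 j
    have h1 := ih 1 j
    fin_cases i <;> simp [ParabolaSurface.genTwo, Matrix.mul_apply, Fin.sum_univ_two] <;> fun_prop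
  | genThree _ ih =>
    have h0 := ih 0 j
    have h1 := ih 1 j
    fin_cases i <;> simp [ParabolaSurface.genThree, Matrix.mul_apply, Fin.sum_univ_two] <;>
      fun_prop
  | neg _ ih => exact (ih i j).neg

lemma mulVec_mulVec_self (N : Matrix (Fin 2) (Fin 2) ℝ) (x : Plane) :
    N.mulVec (N.mulVec x) = N.trace • N.mulVec x - N.det • x := by
  apply plane_ext <;>
  simp [Matrix.mulVec, dotProduct, Matrix.trace, Matrix.det_fin_two, Fin.sum_univ_two] <;> ring

lemma Aff.pow {g : Equiv.Perm S1} {B : Matrix (Fin 2) (Fin 2) ℝ} (hg : Aff g B) (p : ℕ) :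
    Aff (g ^ p) (B ^ p) := by
  induction p with
  | zero => simpa using acts_one.aff
  | succ p ih => rw [pow_succ', pow_succ']; exact hg.comp ih

lemma HasCyl.area_pos {C : Set S1} {v : Plane} (h : HasCyl C v) : 0 < (area C).toReal := by
  refine ENNReal.toReal_pos ?_ h.area_lt_top.ne
  rw [area_eq]
  rcases h.plusPart_nonempty with h1 | h1
  · exact fun h0 => (h.isOpen_plusPart.measure_pos volume h1).ne' (add_eq_zero.1 h0).1
  · exact fun h0 => (h.rot.isOpen_plusPart.measure_pos volume h1).ne' (add_eq_zero.1 h0).2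

lemma HasCyl.area_image {C : Set S1} {v : Plane} (h : HasCyl C v) {g : Equiv.Perm S1}
    {B : Matrix (Fin 2) (Fin 2) ℝ} (hg : Aff g B) (hB : |B.det| = 1) : area (g '' C) = area C := by
  simpa using h.area_image_inter h hg hB

lemma pow_mulVec_of_eigen {B : Matrix (Fin 2) (Fin 2) ℝ} {θ : ℝ} {v : Plane}
    (hv : B.mulVec v = θ • v) (p : ℕ) : (B ^ p).mulVec v = θ ^ p • v := by
  induction p with
  | zero => simp
  | succ p ih => rw [pow_succ', ← Matrix.mulVec_mulVec, ih, Matrix.mulVec_smul, hv, smul_smul,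
      pow_succ]

/-- Holonomies lie in a lattice, hence they are not contracted by affine automorphisms. -/
lemma HasCyl.one_le_abs_of_eigen {C : Set S1} {v : Plane} (h : HasCyl C v) {g : Equiv.Perm S1}
    {B : Matrix (Fin 2) (Fin 2) ℝ} (hg : Aff g B) {θ : ℝ} (hv : B.mulVec v = θ • v) : 1 ≤ |θ| := by
  by_contra hθ
  push Not at hθ
  have h1 : Tendsto (fun p : ℕ => |θ| ^ p * |v 0|) atTop (𝓝 (0 * |v 0|)) :=
    (tendsto_pow_atTop_nhds_zero_of_lt_one (abs_nonneg θ) hθ).mul_const _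
  rw [zero_mul] at h1
  obtain ⟨p, hp⟩ := (h1.eventually_lt_const (show (0 : ℝ) < 1 by norm_num)).exists
  have h2 := h.image (hg.pow p)
  rw [pow_mulVec_of_eigen hv] at h2
  obtain ⟨a, b, ha, -⟩ := h2.mem_periodLattice
  have h3 := h2.apply_zero_ne
  rw [← abs_pow, ← abs_mul] at hp
  rw [Pi.smul_apply, smul_eq_mul] at ha h3
  rw [ha] at hp h3
  have ha0 : a ≠ 0 := by rintro rfl; simp at h3
  have : (1 : ℝ) ≤ |(a : ℝ)| := by exact_mod_cast Int.one_le_abs ha0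
  rw [abs_mul, abs_two] at hp
  linarith

lemma HasCyl.abs_eq_one_of_eigen {C : Set S1} {v : Plane} (h : HasCyl C v) {g : Equiv.Perm S1}
    {B : Matrix (Fin 2) (Fin 2) ℝ} (hg : Aff g B) {θ : ℝ} (hv : B.mulVec v = θ • v) : |θ| = 1 := by
  have h1 := h.one_le_abs_of_eigen hg hv
  have hθ : θ ≠ 0 := by rintro rfl; norm_num at h1
  have hv' : B⁻¹.mulVec v = θ⁻¹ • v := by
    have : B⁻¹.mulVec (B.mulVec v) = v := by
      rw [Matrix.mulVec_mulVec, Matrix.nonsing_inv_mul _ hg.det_ne.isUnit, Matrix.one_mulVec]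
    rw [hv, Matrix.mulVec_smul] at this
    conv_rhs => rw [← this]
    rw [smul_smul, inv_mul_cancel₀ hθ, one_smul]
  have h2 := h.one_le_abs_of_eigen hg.inv hv'
  rw [abs_inv] at h2
  have h3 : |θ| ≤ 1 := by
    rw [one_le_inv₀ (by linarith)] at h2
    exact h2
  linarith

lemma HasCyl.exists_int_wedge {C D : Set S1} {v w : Plane} (h : HasCyl C v) (h' : HasCyl D w) :
    ∃ a : ℤ, wedge v w = a := by
  obtain ⟨a, b, h0, h1⟩ := h.mem_periodLattice
  obtain ⟨a', b', h0', h1'⟩ := h'.mem_periodLattice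
  exact ⟨8 * a * b' - 8 * b * a', by rw [wedge, h0, h1, h0', h1']; push_cast; ring⟩

lemma exists_smul_of_wedge_eq_zero {v w : Plane} (hv : v 0 ≠ 0) (h : wedge v w = 0) :
    w = (w 0 / v 0) • v := by
  rw [wedge] at h
  apply plane_ext
  · simp [hv]
  · simp only [Pi.smul_apply, smul_eq_mul]
    field_simp
    linarith

/-- The data of a hyperbolic affine automorphism. -/
structure HypData (g : Equiv.Perm S1) (A : Matrix (Fin 2) (Fin 2) ℝ)
    (M : ℝ → Matrix (Fin 2) (Fin 2) ℝ) : Prop where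
  aff : Aff g A
  det : |A.det| = 1
  word : Word M
  spec : ∀ (C : Set S1) (v : Plane) (h : HasCyl C v) (k : ℝ),
    (M k).mulVec (specVec (h.image aff).massF k) = specVec h.massF k
  trace_eq : (M 1 * M 1).trace = (A * A).trace
  two_lt_trace : 2 < (M 1 * M 1).trace

section

variable {g : Equiv.Perm S1} {A : Matrix (Fin 2) (Fin 2) ℝ} {M : ℝ → Matrix (Fin 2) (Fin 2) ℝ}

lemma HypData.spec_succ (hH : HypData g A M) {C : Set S1} {v : Plane} (h : HasCyl C v) (q : ℕ)
    (k : ℝ) : (M k).mulVec (specVec (h.image (hH.aff.pow (q + 1))).massF k) =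
      specVec (h.image (hH.aff.pow q)).massF k := by
  have h1 := hH.spec _ _ (h.image (hH.aff.pow q)) k
  refine Eq.trans ?_ h1
  congr 2
  refine HasCyl.massF_congr _ _ ?_ ?_
  · rw [← Set.image_comp, pow_succ']; rfl
  · rw [Matrix.mulVec_mulVec, pow_succ']

/-- The determinant of `M k * M k` is 1 whatever the sign of that of `M k`, so Cayley–Hamilton gives
one recurrence in steps of two. This is why even and odd times are treated separately. -/
lemma HypData.spec_recurrence (hH : HypData g A M) {C : Set S1} {v : Plane} (h : HasCyl C v)
    (q : ℕ) (k : ℝ) : specVec (h.image (hH.aff.pow (q + 4))).massF k =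
      (M k * M k).trace • specVec (h.image (hH.aff.pow (q + 2))).massF k -
        specVec (h.image (hH.aff.pow q)).massF k := by
  have h2 : ∀ q, (M k * M k).mulVec (specVec (h.image (hH.aff.pow (q + 2))).massF k) =
      specVec (h.image (hH.aff.pow q)).massF k := fun q => by
    rw [← Matrix.mulVec_mulVec, hH.spec_succ h (q + 1), hH.spec_succ h q]
  have h3 := mulVec_mulVec_self (M k * M k) (specVec (h.image (hH.aff.pow (q + 4))).massF k)
  obtain ⟨δ, hδ, hd⟩ := hH.word.det
  have hd' : (M k * M k).det = 1 := by
    rw [Matrix.det_mul, hd]; rcases hδ with rfl | rfl <;> norm_num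
  rw [h2 (q + 2), h2 q, hd', one_smul] at h3
  rw [h3]; abel

lemma HypData.spec_at_one (hH : HypData g A M) {C D : Set S1} {v w : Plane} (h : HasCyl C v)
    (h' : HasCyl D w) (q : ℕ) :
    wedge (specVec (h.image (hH.aff.pow q)).massF 1) (specVec h'.massF 1) =
      (area C).toReal * (area D).toReal * wedge w ((A ^ q).mulVec v) := by
  have hdet : |(A ^ q).det| = 1 := by rw [Matrix.det_pow, abs_pow, hH.det, one_pow]
  rw [HasCyl.specVec_one, HasCyl.specVec_one, h.area_image (hH.aff.pow q) hdet]
  simp [wedge, coordMat, Matrix.mulVec, dotProduct, Fin.sum_univ_two]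
  ring

/-- The wedge products of holonomies along the orbit grow at the maximal rate. -/
lemma HypData.leadCoeff_ne_zero (hH : HypData g A M) {C D : Set S1} {v w : Plane}
    (h : HasCyl C v) (h' : HasCyl D w) (e : ℕ) :
    leadCoeff (M 1 * M 1).trace (wedge w ((A ^ e).mulVec v))
      (wedge w ((A ^ (2 + e)).mulVec v)) ≠ 0 := by
  set T := (M 1 * M 1).trace with hT
  have hT2 := hH.two_lt_trace
  rw [← hT] at hT2
  have hlt := smallRoot_lt_bigRoot hT2
  intro h0
  rw [leadCoeff, div_eq_zero_iff] at h0
  replace h0 := h0.resolve_right (sub_pos.2 hlt).ne'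
  set a : ℕ → ℝ := fun p => wedge w ((A ^ (2 * p + e)).mulVec v) with ha
  have hdetA : (A * A).det = 1 := by
    rw [Matrix.det_mul, ← abs_mul_abs_self, hH.det, one_mul]
  have hrec : ∀ p, a (p + 2) = T * a (p + 1) - a p := by
    intro p
    have h1 := mulVec_mulVec_self (A * A) ((A ^ (2 * p + e)).mulVec v)
    have e1 : (A * A).mulVec ((A ^ (2 * p + e)).mulVec v) =
        (A ^ (2 * (p + 1) + e)).mulVec v := by
      rw [Matrix.mulVec_mulVec, ← pow_two, ← pow_add]; congr 2; ring
    have e2 : (A * A).mulVec ((A ^ (2 * (p + 1) + e)).mulVec v) =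
        (A ^ (2 * (p + 2) + e)).mulVec v := by
      rw [Matrix.mulVec_mulVec, ← pow_two, ← pow_add]; congr 2; ring
    rw [e1, e2, hdetA, one_smul, ← hH.trace_eq] at h1
    simp only [ha]
    rw [h1]
    simp only [wedge, Pi.sub_apply, Pi.smul_apply, smul_eq_mul]
    ring
  have h0' : a 1 - smallRoot T * a 0 = 0 := by
    have e1 : a 1 = wedge w ((A ^ (2 + e)).mulVec v) := by simp only [ha, mul_one]
    have e0 : a 0 = wedge w ((A ^ e).mulVec v) := by simp only [ha, mul_zero, zero_add]
    rw [e1, e0]; exact h0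
  have hsol : ∀ p, a p = smallRoot T ^ p * a 0 := by
    intro p
    have h1 := recurrence_closed_form hrec (bigRoot_mul_smallRoot hT2.le)
      (bigRoot_add_smallRoot T) p
    rw [h0', mul_zero, zero_sub] at h1
    apply mul_right_cancel₀ (sub_pos.2 hlt).ne'
    rw [h1]
    linear_combination (-smallRoot T ^ p) * h0'
  have hq0 : 0 < smallRoot T := by
    rw [smallRoot_eq hT2]; have := one_lt_bigRoot hT2; positivity
  have hq1 : smallRoot T < 1 := by
    rw [smallRoot_eq hT2]; exact inv_lt_one_of_one_lt₀ (one_lt_bigRoot hT2)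
  -- The sequence would decay geometrically, but its terms are wedges of lattice vectors and hence
  -- integers.
  have ha0 : a 0 = 0 := by
    have h1 : Tendsto (fun p : ℕ => smallRoot T ^ p * |a 0|) atTop (𝓝 (0 * |a 0|)) :=
      (tendsto_pow_atTop_nhds_zero_of_lt_one hq0.le hq1).mul_const _
    rw [zero_mul] at h1
    obtain ⟨p, hp⟩ := (h1.eventually_lt_const (show (0 : ℝ) < 1 by norm_num)).exists
    obtain ⟨z, hz⟩ := h'.exists_int_wedge (h.image (hH.aff.pow (2 * p + e)))
    have h2 := hsol p
    rw [show a p = z from hz] at h2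
    rw [← abs_of_pos (pow_pos hq0 p), ← abs_mul, ← h2] at hp
    have hz0 : z = 0 := by
      by_contra hne
      have : (1 : ℝ) ≤ |(z : ℝ)| := by exact_mod_cast Int.one_le_abs hne
      linarith
    rw [hz0, Int.cast_zero, eq_comm, mul_eq_zero] at h2
    exact h2.resolve_left (pow_pos hq0 p).ne'
  -- Two terms vanish, so the holonomy `z` and its image under `A * A` are both parallel to `w`, and
  -- `z` is an eigenvector of `A * A`.
  have ha1 : a 1 = 0 := by rw [hsol 1, ha0, mul_zero]
  have hE := h.image (hH.aff.pow e)
  set z := (A ^ e).mulVec v with hz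
  have hw0 := h'.apply_zero_ne
  have hz0 := hE.apply_zero_ne
  have e0 : wedge w z = 0 := by simpa only [ha, mul_zero, zero_add] using ha0
  have e1 : wedge w ((A * A).mulVec z) = 0 := by
    rw [hz, Matrix.mulVec_mulVec, ← pow_two, ← pow_add]
    simpa only [ha, mul_one] using ha1
  have s0 := exists_smul_of_wedge_eq_zero hw0 e0
  have s1 := exists_smul_of_wedge_eq_zero hw0 e1
  obtain ⟨θ, hθ⟩ : ∃ θ : ℝ, (A * A).mulVec z = θ • z := by
    have s2 : w = (z 0 / w 0)⁻¹ • z := (eq_inv_smul_iff₀ (div_ne_zero hz0 hw0)).2 s0.symm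
    exact ⟨((A * A).mulVec z 0 / w 0) * (z 0 / w 0)⁻¹, by rw [mul_smul, ← s2]; exact s1⟩
  have habs := hE.abs_eq_one_of_eigen (hH.aff.comp hH.aff) hθ
  have hCH := mulVec_mulVec_self (A * A) z
  rw [hdetA, hθ, Matrix.mulVec_smul, hθ, ← hH.trace_eq, ← hT] at hCH
  have h5 := congrFun hCH 0
  simp only [Pi.smul_apply, Pi.sub_apply, smul_eq_mul] at h5
  have h6 : θ * θ - T * θ + 1 = 0 := by
    apply mul_right_cancel₀ hz0; linarith
  -- A lattice holonomy has eigenvalue ±1, which would force the trace to be ±2.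
  rcases eq_or_eq_neg_of_abs_eq habs with rfl | rfl <;> linarith

lemma continuous_wedge_specVec (m m' : ℤ →₀ ℝ) :
    Continuous fun k => wedge (specVec m k) (specVec m' k) := by
  have h : ∀ (m : ℤ →₀ ℝ) (i : Fin 2), Continuous fun k => specVec m k i :=
    fun m i => (continuous_apply i).comp (continuous_specVec m)
  exact ((h m 0).mul (h m' 1)).sub ((h m 1).mul (h m' 0))

/-- Mixing along the subsequences of even and of odd times. -/
lemma HypData.exists_const (hH : HypData g A M) : ∃ K : ℝ, 0 < K ∧
    ∀ (C D : Set S1) (v w : Plane), HasCyl C v → HasCyl D w → ∀ e : ℕ,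
      Tendsto (fun p : ℕ => (p : ℝ) * √p * (area ((g ^ (2 * p + e)) '' C ∩ D)).toReal) atTop
        (𝓝 (K * (area C).toReal * (area D).toReal)) := by
  set t : ℝ → ℝ := fun k => (M k * M k).trace with ht
  have hte : t = fun k => M k 0 0 * M k 0 0 + M k 0 1 * M k 1 0 +
      (M k 1 0 * M k 0 1 + M k 1 1 * M k 1 1) := by
    funext k; simp [ht, Matrix.trace, Matrix.mul_apply, Fin.sum_univ_two]
  have htd : Differentiable ℝ t := by
    have h00 := hH.word.differentiable 0 0
    have h01 := hH.word.differentiable 0 1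
    have h10 := hH.word.differentiable 1 0
    have h11 := hH.word.differentiable 1 1
    rw [hte]; fun_prop
  have ht1 : 2 < t 1 := hH.two_lt_trace
  obtain ⟨c, hc, hdrop⟩ := hH.word.traceDrop ht1
  obtain ⟨δ, hδ, hd⟩ := hH.word.det
  have hlow : ∀ k, -2 ≤ t k := by
    intro k
    simp only [ht]
    rw [trace_mul_self, hd]
    rcases hδ with rfl | rfl <;> nlinarith [sq_nonneg (M k).trace]
  obtain ⟨K, hK, hlap⟩ := exists_laplace_const htd.continuous htd.differentiableAt ht1 hc
    fun k h0 h1 => ⟨hlow k, hdrop k h0 h1⟩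
  refine ⟨2 / Real.pi * K, by positivity, fun C D v w h h' e => ?_⟩
  set r := bigRoot (t 1) with hr
  have hr1 : 1 < r := one_lt_bigRoot ht1
  have hC := h.area_pos
  have hD := h'.area_pos
  set f : ℕ → ℝ → ℝ := fun p k =>
    wedge (specVec (h.image (hH.aff.pow (2 * p + e))).massF k) (specVec h'.massF k) with hf
  have hfc : ∀ p, Continuous (f p) := fun p => continuous_wedge_specVec _ _
  have hrec : ∀ p k, f (p + 2) k = t k * f (p + 1) k - f p k := by
    intro p k
    have h1 := hH.spec_recurrence h (2 * p + e) k
    have e1 : specVec (h.image (hH.aff.pow (2 * (p + 2) + e))).massF k =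
        specVec (h.image (hH.aff.pow (2 * p + e + 4))).massF k := by
      rw [show 2 * (p + 2) + e = 2 * p + e + 4 by ring]
    have e2 : specVec (h.image (hH.aff.pow (2 * (p + 1) + e))).massF k =
        specVec (h.image (hH.aff.pow (2 * p + e + 2))).massF k := by
      rw [show 2 * (p + 1) + e = 2 * p + e + 2 by ring]
    simp only [hf]
    rw [e1, e2, h1]
    simp only [wedge, Pi.sub_apply, Pi.smul_apply, smul_eq_mul]
    ring
  have hone : ∀ p, f p 1 = (area C).toReal * (area D).toReal *
      wedge w ((A ^ (2 * p + e)).mulVec v) := fun p => hH.spec_at_one h h' (2 * p + e)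
  set L := leadCoeff (t 1) (f 0 1) (f 1 1) with hL
  have hL0 : L ≠ 0 := by
    have h1 := hH.leadCoeff_ne_zero h h' e
    have h2 : L = (area C).toReal * (area D).toReal * leadCoeff (t 1)
        (wedge w ((A ^ e).mulVec v)) (wedge w ((A ^ (2 + e)).mulVec v)) := by
      rw [hL, hone, hone]
      simp only [leadCoeff, mul_zero, zero_add, mul_one]
      ring
    rw [h2]
    exact mul_ne_zero (mul_pos hC hD).ne' h1
  have hF : Tendsto (fun p => f p 1 / r ^ p) atTop (𝓝 L) := by
    have h1 := tendsto_recurrence_div_pow htd.continuous ht1 (hfc 0) (hfc 1) hrec (u := 0)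
      (k := fun _ => 1) tendsto_const_nhds (by
        rw [div_self (by positivity : bigRoot (t 1) ≠ 0)]; simp)
    rwa [Real.exp_zero, mul_one] at h1
  have hJ := hlap f (hfc 0) (hfc 1) hrec
  -- The intersection area is the spectral integral divided by the wedge of the holonomies, which up
  -- to the two areas is `f p 1`. The unknown coefficient `L` cancels in the quotient of the limits.
  have hlim := ((hJ.const_mul (2 / Real.pi)).mul_const
    ((area C).toReal * (area D).toReal)).div hF hL0
  have e1 : 2 / Real.pi * (L * K) * ((area C).toReal * (area D).toReal) / L =
      2 / Real.pi * K * (area C).toReal * (area D).toReal := by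
    field_simp
  rw [e1] at hlim
  refine hlim.congr' ?_
  filter_upwards [hF.eventually_ne hL0] with p hp
  have hp' : f p 1 ≠ 0 := fun h0 => hp (by rw [h0, zero_div])
  have hrp : r ^ p ≠ 0 := by positivity
  have h1 := (h.image (hH.aff.pow (2 * p + e))).wedge_mul_area_inter h'
  rw [interForm_eq_integral (HasCyl.sum_massF _) (HasCyl.sum_massF _)] at h1
  have h2 : ∫ β in (0 : ℝ)..(Real.pi / 2),
      f p (Real.cos β) / r ^ p * Real.sin β ^ 2 * Real.cos β = (r ^ p)⁻¹ *
      ∫ β in (0 : ℝ)..(Real.pi / 2), f p (Real.cos β) * Real.sin β ^ 2 * Real.cos β := by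
    rw [← intervalIntegral.integral_const_mul]
    congr 1; funext β; ring
  rw [Pi.div_apply, h2, div_eq_iff hp, hone]
  have h3 : (2 / Real.pi) * ∫ β in (0 : ℝ)..(Real.pi / 2),
      f p (Real.cos β) * Real.sin β ^ 2 * Real.cos β =
      wedge w ((A ^ (2 * p + e)).mulVec v) * (area ((g ^ (2 * p + e)) '' C ∩ D)).toReal := h1.symm
  linear_combination ((p : ℝ) * √p * (r ^ p)⁻¹ * ((area C).toReal * (area D).toReal)) * h3

end

lemma tendsto_of_even_odd {u : ℕ → ℝ} {l : ℝ} (h0 : Tendsto (fun p => u (2 * p)) atTop (𝓝 l))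
    (h1 : Tendsto (fun p => u (2 * p + 1)) atTop (𝓝 l)) : Tendsto u atTop (𝓝 l) := by
  rw [Metric.tendsto_atTop] at *
  intro ε hε
  obtain ⟨N0, h0⟩ := h0 ε hε
  obtain ⟨N1, h1⟩ := h1 ε hε
  refine ⟨2 * (N0 + N1), fun n hn => ?_⟩
  rcases Nat.even_or_odd' n with ⟨p, rfl | rfl⟩
  · exact h0 p (by lia)
  · exact h1 p (by lia)

lemma tendsto_rpow_div (e : ℕ) : Tendsto (fun p : ℕ =>
    ((2 * p + e : ℕ) : ℝ) ^ ((3 : ℝ) / 2) / ((p : ℝ) * √p)) atTop (𝓝 ((2 : ℝ) ^ ((3 : ℝ) / 2))) := by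
  have h1 : Tendsto (fun p : ℕ => 2 + (e : ℝ) / p) atTop (𝓝 (2 + 0)) :=
    tendsto_const_nhds.add (tendsto_const_div_atTop_nhds_zero_nat (e : ℝ))
  rw [add_zero] at h1
  have h2 := h1.rpow_const (p := (3 : ℝ) / 2) (Or.inl (by norm_num))
  refine h2.congr' ?_
  filter_upwards [eventually_gt_atTop 0] with p hp
  have hp' : (0 : ℝ) < p := by exact_mod_cast hp
  have h3 : (p : ℝ) * √p = (p : ℝ) ^ ((3 : ℝ) / 2) := by
    rw [Real.sqrt_eq_rpow, show (3 : ℝ) / 2 = 1 + 1 / 2 by norm_num, Real.rpow_add hp',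
      Real.rpow_one]
  rw [h3, ← Real.div_rpow (by positivity) hp'.le]
  congr 1
  push_cast
  field_simp

lemma HypData.exists_mixing_const {g : Equiv.Perm S1} {A : Matrix (Fin 2) (Fin 2) ℝ}
    {M : ℝ → Matrix (Fin 2) (Fin 2) ℝ} (hH : HypData g A M) : ∃ κ : ℝ, 0 < κ ∧
    ∀ (C D : Set S1) (v w : Plane), HasCyl C v → HasCyl D w →
      Tendsto (fun m : ℕ => (m : ℝ) ^ ((3 : ℝ) / 2) * (area ((g ^ m) '' C ∩ D)).toReal) atTop
        (𝓝 (κ * (area C).toReal * (area D).toReal)) := by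
  obtain ⟨K, hK, h⟩ := hH.exists_const
  refine ⟨(2 : ℝ) ^ ((3 : ℝ) / 2) * K, by positivity, fun C D v w hC hD => ?_⟩
  have key : ∀ e : ℕ, Tendsto (fun p : ℕ => ((2 * p + e : ℕ) : ℝ) ^ ((3 : ℝ) / 2) *
      (area ((g ^ (2 * p + e)) '' C ∩ D)).toReal) atTop
      (𝓝 ((2 : ℝ) ^ ((3 : ℝ) / 2) * K * (area C).toReal * (area D).toReal)) := by
    intro e
    have h1 := (tendsto_rpow_div e).mul (h C D v w hC hD e)
    rw [← mul_assoc, ← mul_assoc] at h1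
    refine h1.congr' ?_
    filter_upwards [eventually_gt_atTop 0] with p hp
    have hp' : (0 : ℝ) < p := by exact_mod_cast hp
    have : (p : ℝ) * √p ≠ 0 := by positivity
    rw [← mul_assoc, div_mul_cancel₀ _ this]
  exact tendsto_of_even_odd (by simpa using key 0) (key 1)

lemma det_eq_zero_of_eigenvalue {A : Matrix (Fin 2) (Fin 2) ℝ} {μ : ℝ}
    (h : Module.End.HasEigenvalue (Matrix.toLin' A) μ) : μ ^ 2 - A.trace * μ + A.det = 0 := by
  obtain ⟨x, hx⟩ := h.exists_hasEigenvector
  have h1 : A.mulVec x = μ • x := by simpa using hx.apply_eq_smul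
  have h2 := mulVec_mulVec_self A x
  rw [h1, Matrix.mulVec_smul, h1] at h2
  by_contra hne
  refine hx.2 ?_
  have h3 : (μ ^ 2 - A.trace * μ + A.det) • x = 0 := by
    ext i
    have := congrFun h2 i
    simp only [Pi.smul_apply, Pi.sub_apply, smul_eq_mul, Pi.zero_apply] at this ⊢
    linarith
  exact (smul_eq_zero.1 h3).resolve_left hne

lemma two_lt_of_eigenvalues {A : Matrix (Fin 2) (Fin 2) ℝ} (hdet : |A.det| = 1) {μ ν : ℝ}
    (hν : |ν| < 1) (hμ : 1 < |μ|) (h1 : Module.End.HasEigenvalue (Matrix.toLin' A) μ)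
    (h2 : Module.End.HasEigenvalue (Matrix.toLin' A) ν) : 2 < (A * A).trace := by
  have e1 := det_eq_zero_of_eigenvalue h1
  have e2 := det_eq_zero_of_eigenvalue h2
  have hne : μ - ν ≠ 0 := by
    intro h; rw [sub_eq_zero] at h; rw [h] at hμ; linarith
  have htr : A.trace = μ + ν := by
    apply mul_right_cancel₀ hne; linarith
  have hd : A.det = μ * ν := by rw [htr] at e1; linarith
  rw [trace_mul_self, htr, hd]
  rw [hd, abs_mul] at hdet
  have : (μ + ν) ^ 2 - 2 * (μ * ν) = |μ| ^ 2 + |ν| ^ 2 := by rw [sq_abs, sq_abs]; ring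
  rw [this]
  nlinarith [mul_pos (sub_pos.2 (hν.trans hμ)) (sub_pos.2 (hν.trans hμ))]

/-- The inverse of a matrix of determinant ±1 is ± its adjugate, so its trace changes at most by a
sign; the sign disappears in the square. -/
lemma trace_sq_eq_of_mul_eq_one {N A : Matrix (Fin 2) (Fin 2) ℝ} (hdet : |A.det| = 1)
    (h : N * A = 1) : (N * N).trace = (A * A).trace := by
  have h1 : A.det • N = A.adjugate := by
    have : N * (A * A.adjugate) = A.adjugate := by rw [← Matrix.mul_assoc, h, Matrix.one_mul]
    rwa [Matrix.mul_adjugate, Matrix.mul_smul, Matrix.mul_one] at this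
  have h2 : A.det * N.trace = A.trace := by
    rw [← smul_eq_mul, ← Matrix.trace_smul, h1, Matrix.adjugate_fin_two]
    simp [Matrix.trace, Fin.sum_univ_two]; ring
  have h3 : N.det * A.det = 1 := by rw [← Matrix.det_mul, h, Matrix.det_one]
  have h4 : A.det * A.det = 1 := by rw [← abs_mul_abs_self, hdet, one_mul]
  rw [trace_mul_self, trace_mul_self, ← h2]
  linear_combination (-N.trace ^ 2 + 2 * N.det) * h4 - 2 * A.det * h3

lemma exists_hypData {H : S1 ≃ₜ S1} {A : GL (Fin 2) ℝ} (hH : IsAffineAutomorphism H A)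
    (hA : IsHyperbolic A) : ∃ M, HypData H.toEquiv A M := by
  have hg := aff_of_isAffineAutomorphism hH
  obtain ⟨hdet, M, hM, h1, hspec⟩ := hg.exists_word
  obtain ⟨μ, ν, hν, hμ, e1, e2⟩ := hA
  set B : Matrix (Fin 2) (Fin 2) ℝ := (A : Matrix (Fin 2) (Fin 2) ℝ)
  have hdc : (coordMat * B * coordInv).det = B.det := by
    rw [Matrix.det_mul, Matrix.det_mul]
    simp [coordMat, coordInv]
  have htc : (coordMat * B * coordInv * (coordMat * B * coordInv)).trace = (B * B).trace := by
    rw [trace_mul_self, trace_mul_self, hdc, Matrix.mul_assoc, Matrix.trace_mul_comm,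
      Matrix.mul_assoc, coordInv_mul_coordMat, Matrix.mul_one]
  have ht : (M 1 * M 1).trace = (B * B).trace :=
    (trace_sq_eq_of_mul_eq_one (by rw [hdc]; exact hdet) h1).trans htc
  exact ⟨M, hg, hdet, hM, hspec, ht, by rw [ht]; exact two_lt_of_eigenvalues hdet hν hμ e1 e2⟩

end ParabolaSurface

theorem mainTheorem1 (H : ParabolaSurface.S1 ≃ₜ ParabolaSurface.S1) (A : GL (Fin 2) ℝ)
    (hH : ParabolaSurface.IsAffineAutomorphism H A) (hA : ParabolaSurface.IsHyperbolic A) :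
    ∃ κ : ℝ, 0 < κ ∧ ∀ 𝒜 ℬ : Set ParabolaSurface.S1,
      ParabolaSurface.IsCylinder 𝒜 → ParabolaSurface.IsCylinder ℬ →
        Filter.Tendsto
          (fun m : ℕ => ENNReal.ofReal ((m : ℝ) ^ ((3 : ℝ) / 2)) *
            ParabolaSurface.area ((⇑H)^[m] '' 𝒜 ∩ ℬ))
          Filter.atTop
          (nhds (ENNReal.ofReal κ * ParabolaSurface.area 𝒜 * ParabolaSurface.area ℬ)) := by
  obtain ⟨M, hM⟩ := ParabolaSurface.exists_hypData hH hA
  obtain ⟨κ, hκ, h⟩ := hM.exists_mixing_const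
  refine ⟨κ, hκ, fun 𝒜 ℬ hA hB => ?_⟩
  obtain ⟨v, hv⟩ := ParabolaSurface.exists_hasCyl hA
  obtain ⟨w, hw⟩ := ParabolaSurface.exists_hasCyl hB
  have h1 := ENNReal.tendsto_ofReal (h 𝒜 ℬ v w hv hw)
  rw [ENNReal.ofReal_mul (by positivity), ENNReal.ofReal_mul hκ.le,
    ENNReal.ofReal_toReal hv.area_lt_top.ne, ENNReal.ofReal_toReal hw.area_lt_top.ne] at h1
  refine h1.congr fun m => ?_
  have e : (⇑H)^[m] = ⇑(H.toEquiv ^ m : Equiv.Perm ParabolaSurface.S1) := by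
    rw [← Equiv.Perm.iterate_eq_pow]; rfl
  have hfin : ParabolaSurface.area
      ((H.toEquiv ^ m : Equiv.Perm ParabolaSurface.S1) '' 𝒜 ∩ ℬ) ≠ ⊤ :=
    ((ParabolaSurface.area_mono Set.inter_subset_right).trans_lt hw.area_lt_top).ne
  rw [e, ENNReal.ofReal_mul (by positivity), ENNReal.ofReal_toReal hfin]
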